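/- For real $s,\beta$ let $H^{s}(\ln H)^{-\beta}(\mathbb R^2)$ be the space of all $f\in L^2(\mathbb R^2)$ with $$\int_{\mathbb R^2}\Big(|\xi|^{s}\,(1+|\ln|\xi||)^{-\beta}\,|\hat f(\xi)|\Big)^2\,d\xi<\infty .$$ Let $\beta>1/2$ and $c\in\mathbb R$. For a function $\chi$ on $\mathbb R^2$ consider the Cauchy problem $$\Big(\partial_t+\frac{1+v}{1-v}\,\partial_{x_1}\Big)(\partial_t-\partial_{x_1})u=c\,(\partial_t-\partial_{x_1})u,\qquad v=(\partial_{x_1}-\partial_t)u,\qquad u|_{t=0}=0,\quad \partial_tu|_{t=0}=-\chi .\tag{1}$$ A solution of (1) on $[0,T)\times\mathbb R^2$ is a function $u\in C([0,T);L^2(\mathbb R^2))$ with $u(0)=0$ such that the distribution $v=(\partial_{x_1}-\partial_t)u$ is a bounded function, bounded above by a constant smaller than $1$, and $v$ is the Kruzhkov entropy solution of $$\partial_t v+\partial_{x_1}A(v)=c\,v,\qquad v|_{t=0}=\chi,\qquad A(v)=-v-2\ln(1-v),\quad A'(v)=\frac{1+v}{1-v};$$ that is, for every constant $k<1$ and every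 nonnegative $\zeta\in C_c^\infty((-\infty,T)\times\mathbb R^2)$, $$\int_0^T\!\!\int_{\mathbb R^2}\Big(|v-k|\,\partial_t\zeta+\operatorname{sgn}(v-k)\,(A(v)-A(k))\,\partial_{x_1}\zeta+c\,\operatorname{sgn}(v-k)\,v\,\zeta\Big)\,dx\,dt+\int_{\mathbb R^2}|\chi-k|\,\zeta(0,x)\,dx\;\ge 0 .$$ A function on $[0,\infty)\times\mathbb R^2$ is a global solution if it is a solution on $[0,T)\times\mathbb R^2$ for every $T>0$. **Theorem.** There is a compactly supported $\chi\in H^{7/4}(\ln H)^{-\beta}(\mathbb R^2)$ such that (1) has a global solution, and such that for every $T>0$ every solution $u$ of (1) on $[0,T)\times\mathbb R^2$ satisfies $$u(0)\in H^{11/4}(\ln H)^{-\beta}(\mathbb R^2),\qquad u(t)\notin H^{11/4}(\ln H)^{-\beta}(\mathbb R^2)\quad\text{for all } 0<t<T .$$ -/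

import Mathlib

open MeasureTheory Set Filter Topology
open scoped ContDiff FourierTransform ENNReal

noncomputable section

/-- The plane `ℝ²` with its Euclidean norm; `x 0` is the coordinate `x₁`, `x 1` is `x₂`. -/
abbrev Plane : Type := EuclideanSpace ℝ (Fin 2)

/-- The unit vector of the `x₁`-axis. -/
def e1 : Plane := EuclideanSpace.single 0 1

/-- The Fourier multiplier `|ξ|^s (1 + |ln |ξ||)^(-β)`. -/
def logSobolevWeight (s β : ℝ) (ξ : Plane) : ℝ :=
  ‖ξ‖ ^ s * (1 + |Real.log ‖ξ‖|) ^ (-β)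

/-- `f` belongs to `H^s (ln H)^(-β) (ℝ²)`: it is square integrable and its logarithmic Sobolev
norm, the `L²` norm of `|ξ|^s (1 + |ln |ξ||)^(-β) 𝓕 f (ξ)`, is finite. Here `𝓕` is the Fourier
transform of `L²(ℝ²)` with kernel `exp (-2 π i ⟨x, ξ⟩)`. -/
def MemLogSobolev (s β : ℝ) (f : Plane → ℝ) : Prop :=
  ∃ hf : MemLp (fun x => (f x : ℂ)) 2 (volume : Measure Plane),
    MemLp (fun ξ : Plane =>
      (logSobolevWeight s β ξ : ℂ) * (𝓕 (hf.toLp) : Lp ℂ 2 (volume : Measure Plane)) ξ)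
      2 (volume : Measure Plane)

/-- The flux: the primitive of the characteristic speed `(1 + v) / (1 - v)` that vanishes
at `0`. -/
def flux (v : ℝ) : ℝ := -v - 2 * Real.log (1 - v)

theorem flux_zero : flux 0 = 0 := by simp [flux]

theorem hasDerivAt_flux {v : ℝ} (hv : v < 1) : HasDerivAt flux ((1 + v) / (1 - v)) v := by
  have h1 : (1 : ℝ) - v ≠ 0 := by linarith
  have h := ((hasDerivAt_id v).neg).sub
    ((((hasDerivAt_id v).const_sub 1).log (by simpa using h1)).const_mul 2)
  refine h.congr_deriv ?_
  simp only [id]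
  field_simp
  ring

/-- The time derivative of a function of `(t, x)`. -/
def dt (ζ : ℝ × Plane → ℝ) (p : ℝ × Plane) : ℝ := fderiv ℝ ζ p (1, 0)

/-- The derivative in `x₁` of a function of `(t, x)`. -/
def dx1 (ζ : ℝ × Plane → ℝ) (p : ℝ × Plane) : ℝ := fderiv ℝ ζ p (0, e1)

/-- Smooth test functions with compact support in `(-∞, T) × ℝ²`. They need not vanish at
`t = 0`, so that the weak formulations below contain the initial conditions. -/
structure IsTest (T : ℝ) (ζ : ℝ × Plane → ℝ) : Prop where
  smooth : ContDiff ℝ ∞ ζ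
  compact : HasCompactSupport ζ
  before : tsupport ζ ⊆ Iio T ×ˢ univ

/-- The open time slab `(0, T) × ℝ²`. -/
def slab (T : ℝ) : Set (ℝ × Plane) := Ioo 0 T ×ˢ univ

/-- `v` is the (bounded, Kruzhkov) entropy solution on `[0, T) × ℝ²` of
`∂_t v + ((1 + v) / (1 - v)) ∂_{x₁} v = c v`, that is, of
`∂_t v + ∂_{x₁} (flux v) = c v`, with `v(0) = χ`. The values of `v` stay below, and away from, the
singular value `1`. The entropy inequalities for all constants `k < 1` contain the
weak form of the equation (take `k` below, resp. above, all values of `v`) and the initial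
condition. -/
structure IsEntropySolution (c T : ℝ) (χ : Plane → ℝ) (v : ℝ × Plane → ℝ) : Prop where
  meas : AEStronglyMeasurable v (volume.restrict (slab T))
  bounded : ∃ M m : ℝ, m < 1 ∧ ∀ᵐ p ∂(volume.restrict (slab T)), M ≤ v p ∧ v p ≤ m
  entropy : ∀ k : ℝ, k < 1 → ∀ ζ : ℝ × Plane → ℝ, IsTest T ζ → (∀ p, 0 ≤ ζ p) →
    0 ≤ (∫ p in slab T, (|v p - k| * dt ζ p
            + Real.sign (v p - k) * (flux (v p) - flux k) * dx1 ζ p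
            + c * Real.sign (v p - k) * v p * ζ p))
        + ∫ x, |χ x - k| * ζ (0, x)

/-- `u` is the solution on `[0, T) × ℝ²` of the Cauchy problem
`(∂_t + ((1 + v) / (1 - v)) ∂_{x₁}) (∂_t - ∂_{x₁}) u = c (∂_t - ∂_{x₁}) u`,
`v = (∂_{x₁} - ∂_t) u`, `u(0) = 0`, `∂_t u(0) = -χ`:
`u` is a continuous curve in `L²(ℝ²)` that starts at `0`, the distribution
`v = (∂_{x₁} - ∂_t) u` is a function, and `v` is the entropy solution of the
first-order equation `(∂_t + ((1 + v) / (1 - v)) ∂_{x₁}) v = c v` with `v(0) = χ`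
(as `u(0) = 0`, the condition `∂_t u(0) = -χ` says `v(0) = χ`). -/
structure IsSolution (c T : ℝ) (χ : Plane → ℝ) (u : ℝ → Plane → ℝ) : Prop where
  meas : AEStronglyMeasurable (fun p : ℝ × Plane => u p.1 p.2) (volume.restrict (slab T))
  memLp : ∀ t ∈ Ico 0 T, MemLp (u t) 2 volume
  cont : ∀ t ∈ Ico 0 T,
    Tendsto (fun s => eLpNorm (u s - u t) 2 volume) (𝓝[Ico 0 T] t) (𝓝 0)
  init : u 0 =ᵐ[volume] 0
  eqn : ∃ v : ℝ × Plane → ℝ, IsEntropySolution c T χ v ∧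
    ∀ ζ : ℝ × Plane → ℝ, IsTest T ζ →
      ∫ p in slab T, u p.1 p.2 * (dt ζ p - dx1 ζ p) = ∫ p in slab T, v p * ζ p

end

/-! ### The flux in the amplitude variable `w = exp (-c t) v` -/

/-! The loss of regularity. For `v ≤ 0` the speed `(1 + v) / (1 - v)` lies in `[-1, 1]`, increases
with `v`, and is largest, namely `1`, in the zero state. The variable `x₂` is only a parameter, so
the problem splits into scalar conservation laws on horizontal lines. The datum is minus a sum of
bumps of diameter `2⁻ʲ` and amplitude `2^{-7j/8}` that occupy disjoint strips in `x₂`, so they never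
interact. By scaling, the `j`-th bump contributes `2^{-7j/8} · 2^{-j} · 2^{7j/4} = 2^{-j/8}` to the
`H^{7/4}` norm, which is summable (`memLogSobolev_datum`). Its slope is of order `2^{j/8}`. Hence
after a time of order `2^{-j/8}` the zero state coming from behind, which is faster, has overrun the
decreasing left half of the well and a shock has formed. For every `t > 0` some slice with large `j`
therefore consists at time `t` of the zero state, a shock, and the rarefaction that issues from the
right half of the well (`IsWell.foot_notMem`).

The corner. At time `t` the solution `u` is minus the integral of `v` along lines of speed `-1`
(`travel`). Such lines are transversal to the shock. A line that ends to the right of the shock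
position `X` has stayed in the rarefaction since the wave reached it. A line that ends at distance
`h` to the left of `X` spends at least its last `h / 2` units of time in the zero state, where the
rarefaction would have contributed a value bounded away from `0`. So the slope in `x₁` jumps at `X`
(`IsWell.exists_not_differentiableAt`). On the other hand `11/4 > 2`, so even after the logarithmic
loss `|ξ|` times the Fourier transform is integrable, and elements of `H^{11/4} (ln H)^{-β}` have a
differentiable representative (`MemLogSobolev.exists_differentiable`).

Existence. With `v = exp (c t) w` the amplitude `w` is constant along characteristics and solves a
conservation law with the convex, time-dependent flux `scaledFlux`. A potential of `w` is given by
the Lax-Oleinik formula: minimize over `y` the primitive of the datum at `y` plus the Legendre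
transform, at `x - y`, of the time-integrated flux. At a minimizer the optimal slope is the datum
(`IsProfile.optSlope_eq`), and wherever the potential is differentiable its derivatives are `w` and
minus the flux (`IsProfile.deriv_potential_line`). Feet of characteristics with increasing
amplitudes are ordered, which gives the one-sided Lipschitz bound `IsProfile.amplitude_sub_le`. The
entropy inequality is first tested on mean values over `[x, x + h]`. These fail to solve the
equation only by the nonnegative deficit in Jensen's inequality. The one-sided bound controls the
effect of the deficit from the relevant side, and the deficit vanishes as `h → 0`
(`IsProfile.entropy_inequality_smooth`).

Uniqueness. Kruzhkov's doubling of variables compares an arbitrary entropy solution with the wave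
(`IsDatum.kato_inequality`). The wave is continuous almost everywhere and up to `t = 0`, so a
mollifier that looks into the future suffices. Test functions on backward cones conclude
(`IsDatum.ae_eq_planeWave`). Finally a continuous curve in `L²` is determined by its transversal
derivative (`IsCurve.ae_eq`), hence every solution agrees with `travel`. -/

theorem flux_strongly_convex {R : ℝ} {v v' : ℝ} (hv : v ∈ Icc (-R) 0)
    (hv' : v' ∈ Icc (-R) 0) :
    flux v + (1 + v) / (1 - v) * (v' - v) + (1 / (1 + R) ^ 2) * (v' - v) ^ 2 ≤ flux v' := by
  have hR : 0 ≤ R := by linarith [hv.1, hv.2]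
  set m : ℝ := 1 / (1 + R) ^ 2 with hm
  -- The second derivative of the flux is `2 / (1 - y)²`, at least `2 m` on `[-R, 0]`. So `g` is
  -- convex there and lies above its tangent at `v`.
  set g : ℝ → ℝ := fun y => flux y - m * y ^ 2 with hg
  have hder : ∀ y ∈ Iio (1 : ℝ), HasDerivAt g ((1 + y) / (1 - y) - m * (2 * y)) y := by
    intro y hy
    have h2 : HasDerivAt (fun y : ℝ => m * y ^ 2) (m * (2 * y)) y := by
      simpa using (hasDerivAt_pow 2 y).const_mul m
    exact (hasDerivAt_flux hy).sub h2
  have hmono : MonotoneOn (deriv g) (Icc (-R) 0) := by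
    intro a ha b hb hab
    rw [(hder a (lt_of_le_of_lt ha.2 one_pos)).deriv, (hder b (lt_of_le_of_lt hb.2 one_pos)).deriv]
    have ha1 : 0 < 1 - a := by linarith [ha.2]
    have hb1 : 0 < 1 - b := by linarith [hb.2]
    have key : (1 + b) / (1 - b) - (1 + a) / (1 - a) = 2 / ((1 - a) * (1 - b)) * (b - a) := by
      field_simp; ring
    have h3 : 2 * m ≤ 2 / ((1 - a) * (1 - b)) := by
      rw [hm, ← mul_div_assoc, mul_one]
      apply div_le_div_of_nonneg_left (by norm_num) (by positivity)
      nlinarith [ha.1, hb.1, ha.2, hb.2]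
    nlinarith [mul_le_mul_of_nonneg_right h3 (sub_nonneg.2 hab)]
  have hconv : ConvexOn ℝ (Icc (-R) 0) g := by
    refine MonotoneOn.convexOn_of_deriv (convex_Icc _ _) ?_ ?_ ?_
    · intro y hy
      exact (hder y (lt_of_le_of_lt hy.2 one_pos)).continuousAt.continuousWithinAt
    · intro y hy
      rw [interior_Icc] at hy
      exact (hder y (hy.2.trans one_pos)).differentiableAt.differentiableWithinAt
    · exact hmono.mono interior_subset
  have hd := hder v (lt_of_le_of_lt hv.2 one_pos)
  have key : g v + ((1 + v) / (1 - v) - m * (2 * v)) * (v' - v) ≤ g v' := by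
    rcases lt_trichotomy v v' with h | h | h
    · have := hconv.le_slope_of_hasDerivAt hv hv' h hd
      rw [slope_def_field, le_div_iff₀ (by linarith)] at this
      linarith
    · subst h; simp
    · have := hconv.slope_le_of_hasDerivAt hv' hv h hd
      rw [slope_def_field, div_le_iff₀ (by linarith)] at this
      nlinarith
  simp only [hg] at key
  nlinarith

/-- For nonpositive `v` the characteristic speed lies in `[-1, 1]`. -/
theorem flux_lipschitz {v v' : ℝ} (hv : v ≤ 0) (hv' : v' ≤ 0) : |flux v - flux v'| ≤ |v - v'| := by
  have := Convex.norm_image_sub_le_of_norm_hasDerivWithin_le (f := flux)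
    (f' := fun y => (1 + y) / (1 - y)) (C := 1) (s := Iic 0) (x := v') (y := v)
    (fun y hy => (hasDerivAt_flux (lt_of_le_of_lt hy one_pos)).hasDerivWithinAt) ?_
    (convex_Iic 0) hv' hv
  · simpa using this
  · intro y hy
    have hy : y ≤ 0 := hy
    have h1 : 0 < 1 - y := by linarith
    rw [Real.norm_eq_abs, abs_le]
    constructor
    · rw [le_div_iff₀ h1]; linarith
    · rw [div_le_iff₀ h1]; linarith

/-- The flux as a function of the time and of the amplitude `w = exp (-c s) v`. -/
noncomputable def scaledFlux (c s w : ℝ) : ℝ := Real.exp (-(c * s)) * flux (Real.exp (c * s) * w)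

/-- The characteristic speed as a function of the time and of the amplitude. -/
noncomputable def scaledSpeed (c s w : ℝ) : ℝ :=
  (1 + Real.exp (c * s) * w) / (1 - Real.exp (c * s) * w)

/-- The modulus of convexity of the scaled flux for times in `[0, T]` and amplitudes
in `[-K, 0]`. -/
noncomputable def convexityModulus (c T K : ℝ) : ℝ :=
  Real.exp (-(|c| * T)) / (1 + K * Real.exp (|c| * T)) ^ 2

theorem convexityModulus_pos {c T K : ℝ} (hK : 0 ≤ K) : 0 < convexityModulus c T K := by
  unfold convexityModulus; positivity

theorem exp_mul_le {c s T : ℝ} (hs : 0 ≤ s) (hsT : s ≤ T) : Real.exp (c * s) ≤ Real.exp (|c| * T) := by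
  apply Real.exp_le_exp.2
  calc c * s ≤ |c| * s := by gcongr; exact le_abs_self c
    _ ≤ |c| * T := by gcongr

theorem le_exp_mul {c s T : ℝ} (hs : 0 ≤ s) (hsT : s ≤ T) : Real.exp (-(|c| * T)) ≤ Real.exp (c * s) := by
  apply Real.exp_le_exp.2
  have : (-c) * s ≤ |c| * T := by
    calc (-c) * s ≤ |c| * s := by gcongr; exact neg_le_abs c
      _ ≤ |c| * T := by gcongr
  linarith

theorem scaledFlux_zero (c s : ℝ) : scaledFlux c s 0 = 0 := by simp [scaledFlux, flux_zero]

theorem scaledSpeed_zero (c s : ℝ) : scaledSpeed c s 0 = 1 := by simp [scaledSpeed]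

theorem scaledFlux_lipschitz {c s w w' : ℝ} (hw : w ≤ 0) (hw' : w' ≤ 0) :
    |scaledFlux c s w - scaledFlux c s w'| ≤ |w - w'| := by
  unfold scaledFlux
  rw [← mul_sub, abs_mul, abs_of_pos (Real.exp_pos _)]
  have h := flux_lipschitz (v := Real.exp (c * s) * w) (v' := Real.exp (c * s) * w')
    (mul_nonpos_of_nonneg_of_nonpos (Real.exp_pos _).le hw)
    (mul_nonpos_of_nonneg_of_nonpos (Real.exp_pos _).le hw')
  rw [← mul_sub, abs_mul, abs_of_pos (Real.exp_pos _)] at h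
  calc _ ≤ Real.exp (-(c * s)) * (Real.exp (c * s) * |w - w'|) := by gcongr
    _ = |w - w'| := by rw [← mul_assoc, ← Real.exp_add]; simp

theorem abs_scaledFlux_le {c s w : ℝ} (hw : w ≤ 0) : |scaledFlux c s w| ≤ |w| := by
  simpa [scaledFlux_zero] using scaledFlux_lipschitz (c := c) (s := s) hw le_rfl

theorem abs_scaledSpeed_le {c s w : ℝ} (hw : w ≤ 0) : |scaledSpeed c s w| ≤ 1 := by
  have h0 : Real.exp (c * s) * w ≤ 0 := mul_nonpos_of_nonneg_of_nonpos (Real.exp_pos _).le hw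
  have h1 : 0 < 1 - Real.exp (c * s) * w := by linarith
  unfold scaledSpeed
  rw [abs_le]
  constructor
  · rw [le_div_iff₀ h1]; linarith
  · rw [div_le_iff₀ h1]; linarith

theorem scaledSpeed_sub {c s w w' : ℝ} (hw : w ≤ 0) (hw' : w' ≤ 0) :
    scaledSpeed c s w - scaledSpeed c s w' = 2 * Real.exp (c * s) /
      ((1 - Real.exp (c * s) * w) * (1 - Real.exp (c * s) * w')) * (w - w') := by
  have h0 : Real.exp (c * s) * w ≤ 0 := mul_nonpos_of_nonneg_of_nonpos (Real.exp_pos _).le hw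
  have h0' : Real.exp (c * s) * w' ≤ 0 := mul_nonpos_of_nonneg_of_nonpos (Real.exp_pos _).le hw'
  have h1 : 1 - Real.exp (c * s) * w ≠ 0 := by linarith
  have h1' : 1 - Real.exp (c * s) * w' ≠ 0 := by linarith
  unfold scaledSpeed
  field_simp
  ring

theorem scaledSpeed_lipschitz {c s T w w' : ℝ} (hs : 0 ≤ s) (hsT : s ≤ T) (hw : w ≤ 0)
    (hw' : w' ≤ 0) :
    |scaledSpeed c s w - scaledSpeed c s w'| ≤ 2 * Real.exp (|c| * T) * |w - w'| := by
  have h0 : Real.exp (c * s) * w ≤ 0 := mul_nonpos_of_nonneg_of_nonpos (Real.exp_pos _).le hw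
  have h0' : Real.exp (c * s) * w' ≤ 0 := mul_nonpos_of_nonneg_of_nonpos (Real.exp_pos _).le hw'
  have h2 : 1 ≤ (1 - Real.exp (c * s) * w) * (1 - Real.exp (c * s) * w') := by nlinarith
  rw [scaledSpeed_sub hw hw', abs_mul, abs_of_nonneg (by positivity)]
  gcongr
  calc _ ≤ 2 * Real.exp (c * s) := div_le_self (by positivity) h2
    _ ≤ _ := by gcongr 2 * ?_; exact exp_mul_le hs hsT

/-- The substitution `v = e w` turns the quadratic term of `flux_strongly_convex` into `e⁻¹ e² = e`
times its value in `w`, and `e ≥ exp (-|c| T)`. -/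
theorem scaledFlux_strongly_convex {c s T K w w' : ℝ} (hs : 0 ≤ s) (hsT : s ≤ T)
    (hw : w ∈ Icc (-K) 0) (hw' : w' ∈ Icc (-K) 0) :
    scaledFlux c s w + scaledSpeed c s w * (w' - w) + convexityModulus c T K * (w' - w) ^ 2
      ≤ scaledFlux c s w' := by
  have hK : 0 ≤ K := by linarith [hw.1, hw.2]
  set e := Real.exp (c * s) with he
  have hepos : 0 < e := Real.exp_pos _
  set R := K * Real.exp (|c| * T) with hR
  have hb : ∀ x ∈ Icc (-K) 0, e * x ∈ Icc (-R) 0 := by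
    intro x hx
    have h1 := exp_mul_le (c := c) hs hsT
    constructor
    · nlinarith [hx.1, hx.2]
    · exact mul_nonpos_of_nonneg_of_nonpos hepos.le hx.2
  have h := flux_strongly_convex (hb w hw) (hb w' hw')
  have hinv : Real.exp (-(c * s)) = e⁻¹ := Real.exp_neg _
  unfold scaledFlux scaledSpeed convexityModulus
  rw [hinv, ← he, ← hR]
  have h2 := le_exp_mul (c := c) hs hsT
  have h3 := mul_le_mul_of_nonneg_left h (inv_nonneg.2 hepos.le)
  have h4 : Real.exp (-(|c| * T)) / (1 + R) ^ 2 * (w' - w) ^ 2 ≤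
      e / (1 + R) ^ 2 * (w' - w) ^ 2 := by gcongr
  refine le_trans (add_le_add_right h4 _) (le_trans (le_of_eq ?_) h3)
  field_simp

theorem continuous_scaledFlux {c w : ℝ} (hw : w ≤ 0) : Continuous fun s => scaledFlux c s w := by
  unfold scaledFlux flux
  have : ∀ s, 1 - Real.exp (c * s) * w ≠ 0 := fun s => by
    nlinarith [Real.exp_pos (c * s)]
  fun_prop (disch := assumption)

theorem continuous_scaledSpeed {c w : ℝ} (hw : w ≤ 0) : Continuous fun s => scaledSpeed c s w := by
  unfold scaledSpeed
  have : ∀ s, 1 - Real.exp (c * s) * w ≠ 0 := fun s => by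
    nlinarith [Real.exp_pos (c * s)]
  fun_prop (disch := assumption)

/-- The time integral of the scaled flux. -/
noncomputable def fluxPrimitive (c t w : ℝ) : ℝ := ∫ s in (0 : ℝ)..t, scaledFlux c s w

/-- The displacement along the characteristic with amplitude `w` up to time `t`. -/
noncomputable def displacement (c t w : ℝ) : ℝ := ∫ s in (0 : ℝ)..t, scaledSpeed c s w

theorem fluxPrimitive_zero_right (c t : ℝ) : fluxPrimitive c t 0 = 0 := by
  simp [fluxPrimitive, scaledFlux_zero]

theorem fluxPrimitive_zero_left (c w : ℝ) : fluxPrimitive c 0 w = 0 := by simp [fluxPrimitive]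

theorem displacement_zero_right (c t : ℝ) : displacement c t 0 = t := by
  simp [displacement, scaledSpeed_zero]

theorem displacement_zero_left (c w : ℝ) : displacement c 0 w = 0 := by simp [displacement]

theorem intervalIntegral_le_const {f : ℝ → ℝ} {C a b : ℝ} (h : ∀ s ∈ Set.uIoc a b, |f s| ≤ C) :
    |∫ s in a..b, f s| ≤ C * |b - a| := by
  simpa using intervalIntegral.norm_integral_le_of_norm_le_const (f := f) (C := C) h

theorem abs_displacement_le {c t w : ℝ} (ht : 0 ≤ t) (hw : w ≤ 0) : |displacement c t w| ≤ t := by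
  have := intervalIntegral_le_const (f := fun s => scaledSpeed c s w) (a := 0) (b := t)
    (fun s _ => abs_scaledSpeed_le (c := c) (s := s) hw)
  simpa [displacement, abs_of_nonneg ht] using this

theorem displacement_lipschitz {c t T w w' : ℝ} (ht : 0 ≤ t) (htT : t ≤ T) (hw : w ≤ 0)
    (hw' : w' ≤ 0) :
    |displacement c t w - displacement c t w'| ≤ 2 * Real.exp (|c| * T) * t * |w - w'| := by
  unfold displacement
  rw [← intervalIntegral.integral_sub ((continuous_scaledSpeed hw).intervalIntegrable _ _)
    ((continuous_scaledSpeed hw').intervalIntegrable _ _)]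
  have := intervalIntegral_le_const (f := fun s => scaledSpeed c s w - scaledSpeed c s w') (a := 0)
    (b := t) (C := 2 * Real.exp (|c| * T) * |w - w'|) (fun s hs => by
      rw [uIoc_of_le ht] at hs
      exact scaledSpeed_lipschitz (c := c) hs.1.le (hs.2.trans htT) hw hw')
  rw [sub_zero, abs_of_nonneg ht] at this
  linarith

theorem displacement_time_lipschitz {c t t' w : ℝ} (hw : w ≤ 0) :
    |displacement c t w - displacement c t' w| ≤ |t - t'| := by
  unfold displacement
  rw [intervalIntegral.integral_interval_sub_left
    ((continuous_scaledSpeed hw).intervalIntegrable _ _)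
    ((continuous_scaledSpeed hw).intervalIntegrable _ _)]
  rw [← one_mul |t - t'|]
  exact intervalIntegral_le_const (fun s _ => abs_scaledSpeed_le hw)

/-- Integrating the tangent inequality over `[0, t]` shows that `displacement` is a subgradient of
`fluxPrimitive`, without any differentiation under the integral. The modulus picks up the factor
`t`. -/
theorem fluxPrimitive_strongly_convex {c t T K w w' : ℝ} (ht : 0 ≤ t) (htT : t ≤ T)
    (hw : w ∈ Icc (-K) 0) (hw' : w' ∈ Icc (-K) 0) :
    fluxPrimitive c t w + displacement c t w * (w' - w) + convexityModulus c T K * t * (w' - w) ^ 2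
      ≤ fluxPrimitive c t w' := by
  have h1 := (continuous_scaledFlux (c := c) hw.2).intervalIntegrable (μ := volume) 0 t
  have h2 := ((continuous_scaledSpeed (c := c) hw.2).intervalIntegrable (μ := volume) 0 t).mul_const
    (w' - w)
  have h3 := (continuous_scaledFlux (c := c) hw'.2).intervalIntegrable (μ := volume) 0 t
  have h4 : IntervalIntegrable (fun _ : ℝ => convexityModulus c T K * (w' - w) ^ 2) volume 0 t :=
    intervalIntegrable_const
  have := intervalIntegral.integral_mono_on ht ((h1.add h2).add h4) h3 (fun s hs =>
    scaledFlux_strongly_convex (c := c) hs.1 (hs.2.trans htT) hw hw')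
  rw [intervalIntegral.integral_add (h1.add h2) h4, intervalIntegral.integral_add h1 h2,
    intervalIntegral.integral_mul_const, intervalIntegral.integral_const] at this
  simp only [smul_eq_mul, sub_zero] at this
  unfold fluxPrimitive displacement
  linarith

/-- Add the tangent inequalities at `w` and at `w'` and divide by `w' - w`. -/
theorem displacement_strictMono {c t T K w w' : ℝ} (ht : 0 ≤ t) (htT : t ≤ T)
    (hw : w ∈ Icc (-K) 0) (hw' : w' ∈ Icc (-K) 0) (h : w ≤ w') :
    displacement c t w + 2 * convexityModulus c T K * t * (w' - w) ≤ displacement c t w' := by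
  rcases h.eq_or_lt with rfl | h
  · simp
  have h1 := fluxPrimitive_strongly_convex (c := c) ht htT hw hw'
  have h2 := fluxPrimitive_strongly_convex (c := c) ht htT hw' hw
  have : (displacement c t w + 2 * convexityModulus c T K * t * (w' - w)) * (w' - w) ≤
      displacement c t w' * (w' - w) := by nlinarith
  exact le_of_mul_le_mul_right this (by linarith)

theorem fluxPrimitive_time_sub {c t t' w : ℝ} (hw : w ≤ 0) :
    fluxPrimitive c t w - fluxPrimitive c t' w = ∫ s in t'..t, scaledFlux c s w := by
  unfold fluxPrimitive
  rw [intervalIntegral.integral_interval_sub_left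
    ((continuous_scaledFlux hw).intervalIntegrable _ _)
    ((continuous_scaledFlux hw).intervalIntegrable _ _)]

theorem fluxPrimitive_time_lipschitz {c t t' w : ℝ} (hw : w ≤ 0) :
    |fluxPrimitive c t w - fluxPrimitive c t' w| ≤ |w| * |t - t'| := by
  rw [fluxPrimitive_time_sub hw]
  exact intervalIntegral_le_const (fun s _ => abs_scaledFlux_le hw)

/-- The mixed second difference in time and amplitude is controlled because the flux is
`1`-Lipschitz in the amplitude at each time. This makes errors quadratic when the time and the
optimal slope vary together. -/
theorem fluxPrimitive_time_sub_lipschitz {c t t' w w' : ℝ} (hw : w ≤ 0) (hw' : w' ≤ 0) :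
    |(fluxPrimitive c t w - fluxPrimitive c t' w) - (fluxPrimitive c t w' - fluxPrimitive c t' w')|
      ≤ |w - w'| * |t - t'| := by
  rw [fluxPrimitive_time_sub hw, fluxPrimitive_time_sub hw',
    ← intervalIntegral.integral_sub ((continuous_scaledFlux hw).intervalIntegrable _ _)
    ((continuous_scaledFlux hw').intervalIntegrable _ _)]
  exact intervalIntegral_le_const (fun s _ => scaledFlux_lipschitz hw hw')

theorem fluxPrimitive_lipschitz {c t w w' : ℝ} (hw : w ≤ 0) (hw' : w' ≤ 0) :
    |fluxPrimitive c t w - fluxPrimitive c t w'| ≤ |t| * |w - w'| := by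
  have := fluxPrimitive_time_sub_lipschitz (c := c) (t := t) (t' := 0) hw hw'
  simp only [fluxPrimitive_zero_left, sub_zero] at this
  linarith


/-! ### The Legendre transform of the flux primitive -/

theorem exists_optSlope (c t z : ℝ) {K : ℝ} (hK : 0 ≤ K) :
    ∃ w ∈ Icc (-K) 0, ∀ w' ∈ Icc (-K) 0,
      w' * z - fluxPrimitive c t w' ≤ w * z - fluxPrimitive c t w := by
  have hcont : ContinuousOn (fun w => w * z - fluxPrimitive c t w) (Icc (-K) 0) := by
    refine (continuous_id.mul continuous_const).continuousOn.sub ?_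
    have : LipschitzOnWith (Real.nnabs t) (fluxPrimitive c t) (Icc (-K) 0) :=
      LipschitzOnWith.of_dist_le_mul fun x hx y hy => by
        simpa [Real.dist_eq] using fluxPrimitive_lipschitz (c := c) (t := t) hx.2 hy.2
    exact this.continuousOn
  obtain ⟨w, hw, h⟩ := isCompact_Icc.exists_isMaxOn (nonempty_Icc.2 (by linarith)) hcont
  exact ⟨w, hw, fun w' hw' => h hw'⟩

open Classical in
/-- The amplitude in `[-K, 0]` at which `w z - fluxPrimitive c t w` is maximal. -/
noncomputable def optSlope (c K t z : ℝ) : ℝ :=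
  if h : 0 ≤ K then (exists_optSlope c t z h).choose else 0

/-- The Legendre transform of the flux primitive, restricted to amplitudes in `[-K, 0]`. -/
noncomputable def legendre (c K t z : ℝ) : ℝ :=
  optSlope c K t z * z - fluxPrimitive c t (optSlope c K t z)

section Legendre

variable {c K t z : ℝ}

theorem optSlope_mem (hK : 0 ≤ K) : optSlope c K t z ∈ Icc (-K) 0 := by
  rw [optSlope, dif_pos hK]
  exact (exists_optSlope c t z hK).choose_spec.1

theorem le_legendre {w : ℝ} (hw : w ∈ Icc (-K) 0) :
    w * z - fluxPrimitive c t w ≤ legendre c K t z := by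
  have hK : 0 ≤ K := by linarith [hw.1, hw.2]
  rw [legendre, optSlope, dif_pos hK]
  exact (exists_optSlope c t z hK).choose_spec.2 w hw

/-- Test the supremum with the midpoint of `w` and the maximizer. Strong convexity of the primitive
at the midpoint yields the quadratic gain. -/
theorem legendre_strong {T w : ℝ} (ht : 0 ≤ t) (htT : t ≤ T) (hw : w ∈ Icc (-K) 0) :
    w * z - fluxPrimitive c t w + convexityModulus c T K * t / 2 * (w - optSlope c K t z) ^ 2
      ≤ legendre c K t z := by
  have hK : 0 ≤ K := by linarith [hw.1, hw.2]
  have hs := optSlope_mem (c := c) (t := t) (z := z) hK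
  set s := optSlope c K t z with hsdef
  have hm : (w + s) / 2 ∈ Icc (-K) 0 := ⟨by linarith [hw.1, hs.1], by linarith [hw.2, hs.2]⟩
  have h1 := fluxPrimitive_strongly_convex (c := c) ht htT hm hw
  have h2 := fluxPrimitive_strongly_convex (c := c) ht htT hm hs
  have h3 := le_legendre (c := c) (t := t) (z := z) hm
  have h4 : legendre c K t z = s * z - fluxPrimitive c t s := rfl
  nlinarith

/-- Each maximizer is a competitor in the other problem. Adding the two inequalities leaves the
square of the difference of slopes on the left and one factor of it on the right, which cancels. -/
theorem optSlope_lipschitz {T t' z' : ℝ} (hK : 0 ≤ K) (ht : 0 ≤ t) (htT : t ≤ T) :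
    convexityModulus c T K * t / 2 * |optSlope c K t' z' - optSlope c K t z|
      ≤ |z' - z| + |t' - t| := by
  have hs := optSlope_mem (c := c) (t := t) (z := z) hK
  have hs' := optSlope_mem (c := c) (t := t') (z := z') hK
  have h1 := legendre_strong (c := c) (z := z) ht htT hs'
  have h2 := le_legendre (c := c) (t := t') (z := z') hs
  have h3 : legendre c K t z = optSlope c K t z * z - fluxPrimitive c t (optSlope c K t z) := rfl
  have h4 : legendre c K t' z' = optSlope c K t' z' * z' - fluxPrimitive c t' (optSlope c K t' z') :=
    rfl
  set s := optSlope c K t z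
  set s' := optSlope c K t' z'
  have h5 := (abs_le.1 (fluxPrimitive_time_sub_lipschitz (c := c) (t := t') (t' := t) hs'.2 hs.2)).1
  rcases eq_or_ne s' s with h | h
  · rw [h]; simp; positivity
  have hd : 0 < |s' - s| := abs_pos.2 (sub_ne_zero.2 h)
  refine le_of_mul_le_mul_right ?_ hd
  have h6 : (s' - s) * (z' - z) ≤ |s' - s| * |z' - z| := by
    rw [← abs_mul]; exact le_abs_self _
  have h7 : |s' - s| * |s' - s| = (s' - s) ^ 2 := by rw [← sq, sq_abs]
  have : convexityModulus c T K * t / 2 * |s' - s| * |s' - s| =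
    convexityModulus c T K * t / 2 * (s' - s) ^ 2 := by rw [mul_assoc, h7]
  rw [this]
  nlinarith

/-- The maximizer at `(t', z')` is a competitor at `(t, z)`. This one-sided first-order expansion is
the source of the optimality condition and of all derivatives of the potential. -/
theorem legendre_sub_le {t' z' : ℝ} (hK : 0 ≤ K) :
    legendre c K t' z' - legendre c K t z ≤ optSlope c K t' z' * (z' - z) -
      (fluxPrimitive c t' (optSlope c K t' z') - fluxPrimitive c t (optSlope c K t' z')) := by
  have h2 := le_legendre (c := c) (t := t) (z := z) (optSlope_mem (c := c) (t := t') (z := z') hK)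
  have h4 : legendre c K t' z' = optSlope c K t' z' * z' - fluxPrimitive c t' (optSlope c K t' z') :=
    rfl
  linarith

theorem legendre_sub_le_lipschitz {t' z' : ℝ} (hK : 0 ≤ K) :
    legendre c K t' z' - legendre c K t z ≤ K * (|z' - z| + |t' - t|) := by
  have hs' := optSlope_mem (c := c) (t := t') (z := z') hK
  refine (legendre_sub_le hK).trans ?_
  set s' := optSlope c K t' z'
  have hs : |s'| ≤ K := abs_le.2 ⟨hs'.1, hs'.2.trans hK⟩
  have h5 := (abs_le.1 (fluxPrimitive_time_lipschitz (c := c) (t := t') (t' := t) hs'.2)).1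
  have h6 : s' * (z' - z) ≤ |s'| * |z' - z| := by rw [← abs_mul]; exact le_abs_self _
  nlinarith [mul_le_mul_of_nonneg_right hs (abs_nonneg (z' - z)),
    mul_le_mul_of_nonneg_right hs (abs_nonneg (t' - t))]

theorem legendre_lipschitz {t' z' : ℝ} (hK : 0 ≤ K) :
    |legendre c K t' z' - legendre c K t z| ≤ K * (|z' - z| + |t' - t|) := by
  refine abs_le.2 ⟨?_, legendre_sub_le_lipschitz hK⟩
  have := legendre_sub_le_lipschitz (c := c) (t := t') (z := z') (t' := t) (z' := z) hK
  rw [abs_sub_comm z, abs_sub_comm t] at this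
  linarith

theorem continuous_legendre (hK : 0 ≤ K) : Continuous fun p : ℝ × ℝ => legendre c K p.1 p.2 := by
  rw [Metric.continuous_iff]
  intro p ε hε
  refine ⟨ε / (2 * K + 1), by positivity, fun q hq => ?_⟩
  rw [Real.dist_eq]
  have h1 : |q.2 - p.2| ≤ dist q p := by
    rw [← Real.dist_eq]; exact le_max_right _ _
  have h2 : |q.1 - p.1| ≤ dist q p := by
    rw [← Real.dist_eq]; exact le_max_left _ _
  calc _ ≤ K * (|q.2 - p.2| + |q.1 - p.1|) := legendre_lipschitz hK
    _ ≤ K * (dist q p + dist q p) := by gcongr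
    _ ≤ (2 * K + 1) * dist q p := by nlinarith [dist_nonneg (x := q) (y := p)]
    _ < (2 * K + 1) * (ε / (2 * K + 1)) := by gcongr
    _ = ε := by field_simp

theorem legendre_antitone {z' : ℝ} (hK : 0 ≤ K) (h : z ≤ z') :
    legendre c K t z' ≤ legendre c K t z := by
  have h1 := legendre_sub_le (c := c) (t := t) (z := z) (t' := t) (z' := z') hK
  have hs' := optSlope_mem (c := c) (t := t) (z := z') hK
  nlinarith [hs'.2]

theorem legendre_nonneg (hK : 0 ≤ K) : 0 ≤ legendre c K t z := by
  simpa [fluxPrimitive_zero_right] using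
    le_legendre (c := c) (t := t) (z := z) (K := K) (w := 0) ⟨by linarith, le_rfl⟩

/-- The Legendre transform at `z` in terms of the distance of `z` from the fastest position `t`. -/
theorem legendre_mul_le {T : ℝ} (hK : 0 ≤ K) (ht : 0 ≤ t) (htT : t ≤ T) :
    legendre c K t z ≤ optSlope c K t z * (z - t) -
      convexityModulus c T K * t * optSlope c K t z ^ 2 := by
  have hs := optSlope_mem (c := c) (t := t) (z := z) hK
  have h := fluxPrimitive_strongly_convex (c := c) ht htT (w := 0) ⟨by linarith, le_rfl⟩ hs
  rw [fluxPrimitive_zero_right, displacement_zero_right] at h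
  unfold legendre
  linarith

/-- Beyond the position `t`, reached at the maximal speed `1`, the best slope is `0`. -/
theorem legendre_eq_zero (hK : 0 ≤ K) (ht : 0 ≤ t) (hz : t ≤ z) : legendre c K t z = 0 := by
  refine le_antisymm ?_ (legendre_nonneg hK)
  have h := legendre_mul_le (c := c) (z := z) hK ht le_rfl
  have hs := optSlope_mem (c := c) (t := t) (z := z) hK
  have h2 : 0 ≤ convexityModulus c t K * t * optSlope c K t z ^ 2 :=
    mul_nonneg (mul_nonneg (convexityModulus_pos hK).le ht) (sq_nonneg _)
  nlinarith [mul_nonpos_of_nonpos_of_nonneg hs.2 (sub_nonneg.2 hz)]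

/-- Complete the square in the slope. -/
theorem legendre_le_sq {T : ℝ} (hK : 0 ≤ K) (ht : 0 < t) (htT : t ≤ T) :
    legendre c K t z ≤ (t - z) ^ 2 / (4 * (convexityModulus c T K * t)) := by
  have h := legendre_mul_le (c := c) (z := z) hK ht.le htT
  have hpos : 0 < convexityModulus c T K * t := mul_pos (convexityModulus_pos hK) ht
  refine h.trans ?_
  rw [le_div_iff₀ (by positivity)]
  nlinarith [sq_nonneg ((t - z) + 2 * (convexityModulus c T K * t) * optSlope c K t z)]

/-- No displacement is below `-t`, so at `z = -t` the slope `-K` is already optimal. It then serves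
as a competitor at every `z`. -/
theorem legendre_ge_line (hK : 0 ≤ K) (ht : 0 ≤ t) :
    legendre c K t (-t) + K * (-t - z) ≤ legendre c K t z := by
  have hmem : -K ∈ Icc (-K) 0 := ⟨le_rfl, by linarith⟩
  have h1 := le_legendre (c := c) (t := t) (z := z) hmem
  have hs := optSlope_mem (c := c) (t := t) (z := -t) hK
  have h2 := fluxPrimitive_strongly_convex (c := c) ht le_rfl hmem hs
  have h3 := (abs_le.1 (abs_displacement_le (c := c) ht hmem.2)).1
  have h4 : 0 ≤ convexityModulus c t K * t * (optSlope c K t (-t) - -K) ^ 2 :=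
    mul_nonneg (mul_nonneg (convexityModulus_pos hK).le ht) (sq_nonneg _)
  unfold legendre at h1 ⊢
  nlinarith [hs.1]

/-- One half of the first-order condition. If `z` exceeded the displacement, raising the slope a
little, which is possible because it is negative, would increase the functional. The Lipschitz bound
for the displacement says how little is enough. -/
theorem le_displacement_optSlope (hK : 0 ≤ K) (ht : 0 ≤ t) (h : optSlope c K t z < 0) :
    z ≤ displacement c t (optSlope c K t z) := by
  have hs := optSlope_mem (c := c) (t := t) (z := z) hK
  have hl : legendre c K t z = optSlope c K t z * z - fluxPrimitive c t (optSlope c K t z) := rfl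
  set s := optSlope c K t z
  by_contra! hcon
  set Λ := 2 * Real.exp (|c| * t) * t with hΛ
  have hΛ0 : 0 ≤ Λ := by positivity
  set d := z - displacement c t s
  have hd : 0 < d := by simp only [d]; linarith
  set δ := min (-s) (d / (Λ + 1))
  have hδ : 0 < δ := lt_min (by linarith) (by positivity)
  have hδ1 : δ ≤ -s := min_le_left _ _
  have hδ2 : Λ * δ < d := by
    have : δ ≤ d / (Λ + 1) := min_le_right _ _
    rw [le_div_iff₀ (by positivity)] at this
    nlinarith
  have hmem : s + δ ∈ Icc (-K) 0 := ⟨by linarith [hs.1], by linarith⟩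
  have h1 := le_legendre (c := c) (t := t) (z := z) hmem
  have h2 := fluxPrimitive_strongly_convex (c := c) ht le_rfl hmem hs
  have h3 := (abs_le.1 (displacement_lipschitz (c := c) ht le_rfl hmem.2 hs.2)).2
  have h4 : 0 ≤ convexityModulus c t K * t * (s - (s + δ)) ^ 2 :=
    mul_nonneg (mul_nonneg (convexityModulus_pos hK).le ht) (sq_nonneg _)
  rw [show s + δ - s = δ by ring, abs_of_pos hδ] at h3
  have h5 : displacement c t (s + δ) < z := by simp only [d] at hδ2; linarith
  nlinarith

/-- The mirror image: a slope above `-K` may be lowered. -/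
theorem displacement_optSlope_le (hK : 0 ≤ K) (ht : 0 ≤ t) (h : -K < optSlope c K t z) :
    displacement c t (optSlope c K t z) ≤ z := by
  have hs := optSlope_mem (c := c) (t := t) (z := z) hK
  have hl : legendre c K t z = optSlope c K t z * z - fluxPrimitive c t (optSlope c K t z) := rfl
  set s := optSlope c K t z
  by_contra! hcon
  set Λ := 2 * Real.exp (|c| * t) * t with hΛ
  have hΛ0 : 0 ≤ Λ := by positivity
  set d := displacement c t s - z
  have hd : 0 < d := by simp only [d]; linarith
  set δ := min (s + K) (d / (Λ + 1))
  have hδ : 0 < δ := lt_min (by linarith) (by positivity)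
  have hδ1 : δ ≤ s + K := min_le_left _ _
  have hδ2 : Λ * δ < d := by
    have : δ ≤ d / (Λ + 1) := min_le_right _ _
    rw [le_div_iff₀ (by positivity)] at this
    nlinarith
  have hmem : s - δ ∈ Icc (-K) 0 := ⟨by linarith [hs.1], by linarith [hs.2]⟩
  have h1 := le_legendre (c := c) (t := t) (z := z) hmem
  have h2 := fluxPrimitive_strongly_convex (c := c) ht le_rfl hmem hs
  have h3 := (abs_le.1 (displacement_lipschitz (c := c) ht le_rfl hmem.2 hs.2)).1
  have h4 : 0 ≤ convexityModulus c t K * t * (s - (s - δ)) ^ 2 :=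
    mul_nonneg (mul_nonneg (convexityModulus_pos hK).le ht) (sq_nonneg _)
  rw [show s - δ - s = -δ by ring, abs_neg, abs_of_pos hδ] at h3
  have h5 : z < displacement c t (s - δ) := by simp only [d] at hδ2; linarith
  nlinarith

end Legendre

/-! ### Profiles and the Lax-Oleinik potential -/

/-- Initial data of the one-dimensional problem. -/
structure IsProfile (K C : ℝ) (φ : ℝ → ℝ) : Prop where
  gt : ∀ y, -K < φ y
  nonpos : ∀ y, φ y ≤ 0
  left : ∀ y ≤ 0, φ y = 0
  lip : ∀ y y', |φ y - φ y'| ≤ C * |y - y'|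

/-- The primitive of the initial profile. -/
noncomputable def mass (φ : ℝ → ℝ) (y : ℝ) : ℝ := ∫ r in (0 : ℝ)..y, φ r

/-- `y` minimizes the Lax-Oleinik functional at `(t, x)`. -/
def IsFoot (c K : ℝ) (φ : ℝ → ℝ) (t x y : ℝ) : Prop :=
  ∀ y', mass φ y + legendre c K t (x - y) ≤ mass φ y' + legendre c K t (x - y')

open Classical in
/-- The foot of the characteristic through `(t, x)`. -/
noncomputable def foot (c K : ℝ) (φ : ℝ → ℝ) (t x : ℝ) : ℝ :=
  if h : ∃ y, IsFoot c K φ t x y ∧ x - y = displacement c t (φ y) then h.choose else x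

/-- The Lax-Oleinik potential. -/
noncomputable def potential (c K : ℝ) (φ : ℝ → ℝ) (t x : ℝ) : ℝ :=
  mass φ (foot c K φ t x) + legendre c K t (x - foot c K φ t x)

/-- The Lax-Oleinik solution of the one-dimensional conservation law. -/
noncomputable def wave (c K : ℝ) (φ : ℝ → ℝ) (t x : ℝ) : ℝ :=
  Real.exp (c * t) * φ (foot c K φ t x)

namespace IsProfile

variable {c K C : ℝ} {φ : ℝ → ℝ} (hφ : IsProfile K C φ)
include hφ

theorem K_pos : 0 < K := by linarith [hφ.gt 0, hφ.nonpos 0]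

theorem mem (y : ℝ) : φ y ∈ Icc (-K) 0 := ⟨(hφ.gt y).le, hφ.nonpos y⟩

theorem C_nonneg : 0 ≤ C := by
  have := hφ.lip 0 1
  simp at this
  exact (abs_nonneg _).trans this

theorem continuous : Continuous φ := by
  have : LipschitzWith (Real.toNNReal C) φ := LipschitzWith.of_dist_le_mul fun x y => by
    simpa [Real.dist_eq, hφ.C_nonneg] using hφ.lip x y
  exact this.continuous

theorem mass_sub (y y' : ℝ) : mass φ y - mass φ y' = ∫ r in y'..y, φ r := by
  unfold mass
  rw [intervalIntegral.integral_interval_sub_left (hφ.continuous.intervalIntegrable _ _)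
    (hφ.continuous.intervalIntegrable _ _)]

theorem hasDerivAt_mass (y : ℝ) : HasDerivAt (mass φ) (φ y) y :=
  intervalIntegral.integral_hasDerivAt_right (hφ.continuous.intervalIntegrable _ _)
    (hφ.continuous.stronglyMeasurableAtFilter _ _) hφ.continuous.continuousAt

theorem mass_antitone : Antitone (mass φ) := by
  intro y y' h
  have h1 := hφ.mass_sub y' y
  have h2 := intervalIntegral.integral_nonneg (μ := volume) h fun r _ => neg_nonneg.2 (hφ.nonpos r)
  rw [intervalIntegral.integral_neg] at h2
  linarith

theorem mass_lipschitz (y y' : ℝ) : |mass φ y - mass φ y'| ≤ K * |y - y'| := by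
  rw [hφ.mass_sub]
  exact intervalIntegral_le_const fun s _ =>
    abs_le.2 ⟨(hφ.gt s).le, (hφ.nonpos s).trans hφ.K_pos.le⟩

theorem mass_of_nonpos {y : ℝ} (hy : y ≤ 0) : mass φ y = 0 := by
  unfold mass
  rw [intervalIntegral.integral_symm, neg_eq_zero]
  refine (intervalIntegral.integral_congr (g := fun _ => (0 : ℝ)) fun r hr => ?_).trans (by simp)
  rw [uIcc_of_le hy] at hr
  exact hφ.left r hr.2

theorem mass_nonpos (y : ℝ) : mass φ y ≤ 0 := by
  rcases le_total y 0 with h | h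
  · exact (hφ.mass_of_nonpos h).le
  · simpa [hφ.mass_of_nonpos le_rfl] using hφ.mass_antitone h

/-- The optimality condition. -/
theorem optSlope_eq {t x y : ℝ} (ht : 0 < t) (h : IsFoot c K φ t x y) :
    optSlope c K t (x - y) = φ y := by
  have hK := hφ.K_pos.le
  -- Minimality of `y` and the expansion of the Legendre transform bound the difference quotients of
  -- `mass φ` at `y` by the slopes at nearby points. As `y' → y` from either side this pins the
  -- slope to the derivative `φ y`.
  have key : ∀ y', optSlope c K t (x - y') * (y' - y) ≤ mass φ y' - mass φ y := by
    intro y'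
    have h1 := legendre_sub_le (c := c) (t := t) (z := x - y) (t' := t) (z' := x - y') hK
    have h2 := h y'
    nlinarith
  set w := optSlope c K t (x - y) with hw
  have hcont : ContinuousAt (fun y' => optSlope c K t (x - y')) y := by
    set m := convexityModulus c t K * t / 2 with hm
    have hmpos : 0 < m := by have := convexityModulus_pos (c := c) (T := t) hK; positivity
    rw [Metric.continuousAt_iff]
    intro ε hε
    refine ⟨m * ε, by positivity, fun y' hy' => ?_⟩
    have := optSlope_lipschitz (c := c) (z := x - y) (t' := t) (z' := x - y') hK ht.le le_rfl
    rw [sub_self, abs_zero, add_zero, ← hm] at this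
    rw [Real.dist_eq] at hy' ⊢
    rw [show x - y' - (x - y) = -(y' - y) by ring, abs_neg] at this
    exact lt_of_mul_lt_mul_left (this.trans_lt hy') hmpos.le
  have hder := (hasDerivAt_iff_tendsto_slope.1 (hφ.hasDerivAt_mass y))
  apply le_antisymm
  · refine le_of_tendsto_of_tendsto (hcont.tendsto.mono_left (nhdsWithin_le_nhds (s := Ioi y)))
      (hder.mono_left (nhdsWithin_mono (s := Ioi y) _ fun a ha => ne_of_gt ha)) ?_
    filter_upwards [self_mem_nhdsWithin] with a ha
    rw [slope_def_field, le_div_iff₀ (sub_pos.2 ha)]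
    exact key a
  · refine le_of_tendsto_of_tendsto (hder.mono_left (nhdsWithin_mono (s := Iio y) _ fun a ha => ne_of_lt ha))
      (hcont.tendsto.mono_left (nhdsWithin_le_nhds (s := Iio y))) ?_
    filter_upwards [self_mem_nhdsWithin] with a ha
    have ha' : a < y := ha
    rw [slope_def_field, div_le_iff_of_neg (by linarith)]
    exact key a

/-- It suffices to minimize over `|x - y| ≤ t`. To the left the Legendre transform vanishes and the
mass decreases towards `x - t`; to the right the Legendre transform grows at rate `K`, at least as
fast as the mass can fall. The strict inequality `-K < φ` makes the lower constraint on the slope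
inactive, so the foot lies on a genuine characteristic; for amplitude `0` the missing half of the
condition comes from `y ≥ x - t`. -/
theorem exists_foot {t x : ℝ} (ht : 0 ≤ t) :
    ∃ y, IsFoot c K φ t x y ∧ x - y = displacement c t (φ y) := by
  have hK := hφ.K_pos.le
  have hcont : ContinuousOn (fun y => mass φ y + legendre c K t (x - y)) (Icc (x - t) (x + t)) := by
    apply Continuous.continuousOn
    have h1 : Continuous (mass φ) :=
      continuous_iff_continuousAt.2 fun y => (hφ.hasDerivAt_mass y).continuousAt
    exact h1.add ((continuous_legendre (c := c) hK).comp
      (continuous_const.prodMk (continuous_const.sub continuous_id)))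
  obtain ⟨y, hy, hmin⟩ := isCompact_Icc.exists_isMinOn (nonempty_Icc.2 (by linarith)) hcont
  have hfoot : IsFoot c K φ t x y := by
    intro y'
    rcases lt_or_ge y' (x - t) with h | h
    · refine (hmin (left_mem_Icc.2 (by linarith))).trans ?_
      simp only [sub_sub_cancel]
      rw [legendre_eq_zero hK ht le_rfl, legendre_eq_zero hK ht (by linarith)]
      linarith [hφ.mass_antitone h.le]
    rcases lt_or_ge (x + t) y' with h' | h'
    · refine (hmin (right_mem_Icc.2 (by linarith))).trans ?_
      have h1 := legendre_ge_line (c := c) (t := t) (z := x - y') hK ht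
      have h2 := (abs_le.1 (hφ.mass_lipschitz y' (x + t))).1
      rw [abs_of_pos (by linarith)] at h2
      simp only [show x - (x + t) = -t by ring]
      nlinarith
    · exact hmin ⟨h, h'⟩
  refine ⟨y, hfoot, ?_⟩
  rcases ht.eq_or_lt with rfl | ht
  · rw [displacement_zero_left]
    linarith [hy.1, hy.2]
  have hs := hφ.optSlope_eq ht hfoot
  have h1 : displacement c t (φ y) ≤ x - y := by
    rw [← hs]; exact displacement_optSlope_le hK ht.le (by rw [hs]; exact hφ.gt y)
  refine le_antisymm ?_ h1
  rcases (hφ.nonpos y).lt_or_eq with h | h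
  · rw [← hs]; exact le_displacement_optSlope hK ht.le (by rwa [hs])
  · rw [h, displacement_zero_right]; linarith [hy.1]

theorem isFoot_foot {t x : ℝ} (ht : 0 ≤ t) : IsFoot c K φ t x (foot c K φ t x) := by
  have h := hφ.exists_foot (c := c) (x := x) ht
  rw [foot, dif_pos h]; exact h.choose_spec.1

theorem sub_foot {t x : ℝ} (ht : 0 ≤ t) :
    x - foot c K φ t x = displacement c t (φ (foot c K φ t x)) := by
  have h := hφ.exists_foot (c := c) (x := x) ht
  rw [foot, dif_pos h]; exact h.choose_spec.2

theorem abs_sub_foot_le {t x : ℝ} (ht : 0 ≤ t) : |x - foot c K φ t x| ≤ t := by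
  rw [hφ.sub_foot ht]; exact abs_displacement_le ht (hφ.nonpos _)

theorem potential_le {t x : ℝ} (ht : 0 ≤ t) (y : ℝ) :
    potential c K φ t x ≤ mass φ y + legendre c K t (x - y) := hφ.isFoot_foot ht y

theorem potential_eq {t x y : ℝ} (ht : 0 ≤ t) (h : IsFoot c K φ t x y) :
    potential c K φ t x = mass φ y + legendre c K t (x - y) :=
  le_antisymm (hφ.potential_le ht y) (h _)

theorem foot_zero (x : ℝ) : foot c K φ 0 x = x := by
  have := hφ.sub_foot (c := c) (x := x) le_rfl
  rw [displacement_zero_left] at this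
  linarith

theorem wave_zero (x : ℝ) : wave c K φ 0 x = φ x := by simp [wave, hφ.foot_zero]

theorem potential_zero (x : ℝ) : potential c K φ 0 x = mass φ x := by
  unfold potential
  rw [hφ.foot_zero, sub_self, legendre_eq_zero hφ.K_pos.le le_rfl le_rfl, add_zero]

theorem potential_nonpos {t : ℝ} (ht : 0 ≤ t) (x : ℝ) : potential c K φ t x ≤ 0 := by
  refine (hφ.potential_le ht (x - t)).trans ?_
  rw [sub_sub_cancel, legendre_eq_zero hφ.K_pos.le ht le_rfl, add_zero]
  exact hφ.mass_nonpos _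

/-- A minimizer at `(t, x)` is kept as a competitor at `(t', x')`. -/
theorem potential_sub_le {t t' x x' y : ℝ} (ht : 0 ≤ t) (ht' : 0 ≤ t') (h : IsFoot c K φ t x y) :
    potential c K φ t' x' - potential c K φ t x ≤
      optSlope c K t' (x' - y) * (x' - x) -
      (fluxPrimitive c t' (optSlope c K t' (x' - y)) -
        fluxPrimitive c t (optSlope c K t' (x' - y))) := by
  have h1 := hφ.potential_le (c := c) (x := x') ht' y
  have h2 := hφ.potential_eq ht h
  have h3 := legendre_sub_le (c := c) (t := t) (z := x - y) (t' := t') (z' := x' - y) hφ.K_pos.le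
  rw [show x' - y - (x - y) = x' - x by ring] at h3
  linarith

theorem potential_lipschitz {t t' x x' : ℝ} (ht : 0 ≤ t) (ht' : 0 ≤ t') :
    |potential c K φ t' x' - potential c K φ t x| ≤ K * (|x' - x| + |t' - t|) := by
  have key : ∀ {t t' x x' : ℝ}, 0 ≤ t → 0 ≤ t' →
      potential c K φ t' x' - potential c K φ t x ≤ K * (|x' - x| + |t' - t|) := by
    intro t t' x x' ht ht'
    have h1 := hφ.potential_le (c := c) (x := x') ht' (foot c K φ t x)
    have h2 := legendre_sub_le_lipschitz (c := c) (t := t) (z := x - foot c K φ t x) (t' := t')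
      (z' := x' - foot c K φ t x) hφ.K_pos.le
    rw [show x' - foot c K φ t x - (x - foot c K φ t x) = x' - x by ring] at h2
    have h3 : potential c K φ t x = mass φ (foot c K φ t x) +
      legendre c K t (x - foot c K φ t x) := rfl
    linarith
  refine abs_le.2 ⟨?_, key ht ht'⟩
  have := key (x := x') (x' := x) ht' ht
  rw [abs_sub_comm x, abs_sub_comm t] at this
  linarith

theorem potential_antitone {t : ℝ} (ht : 0 ≤ t) : Antitone (potential c K φ t) := by
  intro x x' hx
  refine (hφ.potential_le ht (foot c K φ t x)).trans ?_
  unfold potential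
  gcongr
  exact legendre_antitone hφ.K_pos.le (by linarith)

/-- Minimizers with increasing amplitudes are ordered. -/
theorem foot_le_of_lt {t x x' y y' : ℝ} (ht : 0 < t) (hx : x < x') (h : IsFoot c K φ t x y)
    (h' : IsFoot c K φ t x' y') (hlt : φ y < φ y') : y ≤ y' := by
  have hK := hφ.K_pos.le
  by_contra! hcon
  have hm : 0 < convexityModulus c t K * t / 2 := by
    have := convexityModulus_pos (c := c) (T := t) hK; positivity
  have e1 := hφ.optSlope_eq ht h
  have e2 := hφ.optSlope_eq ht h'
  have m1 := optSlope_mem (c := c) (t := t) (z := x - y') hK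
  have m2 := optSlope_mem (c := c) (t := t) (z := x' - y) hK
  have l1 : legendre c K t (x - y') = optSlope c K t (x - y') * (x - y') -
    fluxPrimitive c t (optSlope c K t (x - y')) := rfl
  have l2 : legendre c K t (x' - y) = optSlope c K t (x' - y) * (x' - y) -
    fluxPrimitive c t (optSlope c K t (x' - y)) := rfl
  -- Exchanging the feet cancels the masses and leaves a four-point inequality for the Legendre
  -- transform. Strong convexity contradicts it when the feet are in the wrong order.
  have hsum := add_le_add (h y') (h' y)
  have a1 := legendre_strong (c := c) (z := x - y) ht.le le_rfl m1
  have a2 := legendre_strong (c := c) (z := x' - y') ht.le le_rfl m2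
  have b1 := legendre_strong (c := c) (z := x - y) ht.le le_rfl m2
  have b2 := legendre_strong (c := c) (z := x' - y') ht.le le_rfl m1
  rw [e1] at a1 b1
  rw [e2] at a2 b2
  generalize optSlope c K t (x - y') = w1 at *
  generalize optSlope c K t (x' - y) = w2 at *
  generalize convexityModulus c t K * t / 2 = m at *
  have sq_aux : ∀ {a b p : ℝ}, 0 ≤ p → m * a ^ 2 + m * b ^ 2 + p ≤ 0 → a = 0 ∧ b = 0 := by
    intro a b p hp hab
    have ha := mul_nonneg hm.le (sq_nonneg a)
    have hb := mul_nonneg hm.le (sq_nonneg b)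
    have ha' : m * a ^ 2 = 0 := by linarith
    have hb' : m * b ^ 2 = 0 := by linarith
    simpa [hm.ne'] using And.intro ha' hb'
  have hd : 0 < φ y' - φ y := by linarith
  rcases le_total w1 w2 with hw | hw
  · have h1 : m * (w1 - φ y) ^ 2 + m * (w2 - φ y') ^ 2 + (w2 - w1) * (y - y') ≤ 0 := by
      linarith
    obtain ⟨z1, z2⟩ := sq_aux (mul_nonneg (by linarith) (by linarith)) h1
    rw [z1, z2, show w2 - w1 = φ y' - φ y by linarith] at h1
    linarith [mul_pos hd (sub_pos.2 hcon)]
  · have h1 : m * (w2 - φ y) ^ 2 + m * (w1 - φ y') ^ 2 + (w1 - w2) * (x' - x) ≤ 0 := by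
      linarith
    obtain ⟨z1, z2⟩ := sq_aux (mul_nonneg (by linarith) (by linarith)) h1
    rw [z1, z2, show w1 - w2 = φ y' - φ y by linarith] at h1
    linarith [mul_pos hd (sub_pos.2 hx)]

/-- The one-sided Lipschitz bound. -/
theorem amplitude_sub_le {t x x' y y' : ℝ} (ht : 0 < t) (hx : x < x') (h : IsFoot c K φ t x y)
    (h' : IsFoot c K φ t x' y') : φ y' - φ y ≤ C * (x' - x) := by
  have hK := hφ.K_pos.le
  rcases le_or_gt (φ y') (φ y) with hle | hlt
  · have := mul_nonneg hφ.C_nonneg (sub_nonneg.2 hx.le); linarith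
  have hyy := hφ.foot_le_of_lt ht hx h h' hlt
  have hs := hφ.optSlope_eq ht h
  have hs' := hφ.optSlope_eq ht h'
  -- The larger amplitude travels faster, so the two characteristics diverge and `y' - y ≤ x' - x`.
  -- The Lipschitz bound of the datum then gives the claim.
  have h1 : x - y ≤ displacement c t (φ y) := by
    rw [← hs]; exact le_displacement_optSlope hK ht.le (by rw [hs]; linarith [hφ.nonpos y'])
  have h2 : displacement c t (φ y') ≤ x' - y' := by
    rw [← hs']; exact displacement_optSlope_le hK ht.le (by rw [hs']; exact hφ.gt y')
  have h3 := displacement_strictMono (c := c) ht.le le_rfl (hφ.mem y) (hφ.mem y') hlt.le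
  have h4 : 0 ≤ 2 * convexityModulus c t K * t * (φ y' - φ y) :=
    mul_nonneg (mul_nonneg (mul_nonneg two_pos.le (convexityModulus_pos hK).le) ht.le)
      (by linarith)
  have h5 := (le_abs_self _).trans (hφ.lip y' y)
  rw [abs_of_nonneg (by linarith)] at h5
  refine h5.trans (mul_le_mul_of_nonneg_left (by linarith) hφ.C_nonneg)

end IsProfile


/-! ### Differentiability of the potential and uniqueness of slopes -/

/-- A one-sided estimate, used on both sides of `0`, determines the derivative. It applies to the
potential because an infimum of smooth functions is touched from above by the one belonging to the
foot. -/
theorem eq_zero_of_hasDerivAt_of_le {F ε : ℝ → ℝ} {d : ℝ} (hF : HasDerivAt F d 0) (h0 : F 0 = 0)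
    (hε : Tendsto ε (𝓝 0) (𝓝 0)) (h : ∀ᶠ s in 𝓝 0, F s ≤ ε s * |s|) : d = 0 := by
  have hs := hasDerivAt_iff_tendsto_slope.1 hF
  have hl : ∀ s : ℝ, slope F 0 s = F s / s := fun s => by rw [slope_def_field, h0]; simp
  apply le_antisymm
  · refine le_of_tendsto_of_tendsto
      (hs.mono_left (nhdsWithin_mono (s := Ioi 0) _ fun a ha => ne_of_gt ha))
      (hε.mono_left (nhdsWithin_le_nhds (s := Ioi 0))) ?_
    filter_upwards [self_mem_nhdsWithin, nhdsWithin_le_nhds h] with s hs hF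
    have hs : 0 < s := hs
    rw [abs_of_pos hs] at hF
    rw [hl, div_le_iff₀ hs]; exact hF
  · have hε' : Tendsto (fun s => -ε s) (𝓝[<] 0) (𝓝 0) := by
      simpa using (hε.mono_left (nhdsWithin_le_nhds (s := Iio 0))).neg
    refine le_of_tendsto_of_tendsto hε'
      (hs.mono_left (nhdsWithin_mono (s := Iio 0) _ fun a ha => ne_of_lt ha)) ?_
    filter_upwards [self_mem_nhdsWithin, nhdsWithin_le_nhds h] with s hs hF
    have hs : s < 0 := hs
    rw [abs_of_neg hs] at hF
    rw [hl, le_div_iff_of_neg hs]; linarith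

theorem hasDerivAt_fluxPrimitive {c t w : ℝ} (hw : w ≤ 0) :
    HasDerivAt (fun s => fluxPrimitive c s w) (scaledFlux c t w) t :=
  intervalIntegral.integral_hasDerivAt_right ((continuous_scaledFlux hw).intervalIntegrable _ _)
    ((continuous_scaledFlux hw).stronglyMeasurableAtFilter _ _) (continuous_scaledFlux hw).continuousAt

namespace IsProfile

variable {c K C : ℝ} {φ : ℝ → ℝ} (hφ : IsProfile K C φ)
include hφ

theorem tendsto_optSlope {t x y a b : ℝ} (ht : 0 < t) (h : IsFoot c K φ t x y) :
    Tendsto (fun s : ℝ => optSlope c K (t + s * a) (x + s * b - y)) (𝓝 0) (𝓝 (φ y)) := by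
  have hK := hφ.K_pos.le
  set m := convexityModulus c t K * t / 2 with hm
  have hmpos : 0 < m := by have := convexityModulus_pos (c := c) (T := t) hK; positivity
  rw [tendsto_iff_dist_tendsto_zero]
  have hlim : Tendsto (fun s : ℝ => (|s * b| + |s * a|) / m) (𝓝 0) (𝓝 0) := by
    have : Continuous fun s : ℝ => (|s * b| + |s * a|) / m := by fun_prop
    simpa using this.tendsto 0
  refine squeeze_zero (fun _ => dist_nonneg) (fun s => ?_) hlim
  have := optSlope_lipschitz (c := c) (z := x - y) (t' := t + s * a) (z' := x + s * b - y) hK ht.le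
    le_rfl
  rw [hφ.optSlope_eq ht h, ← hm, show x + s * b - y - (x - y) = s * b by ring,
    show t + s * a - t = s * a by ring] at this
  rw [Real.dist_eq, le_div_iff₀ hmpos]
  linarith

/-- The directional derivatives of the potential. -/
theorem deriv_potential_line {t x y a b d : ℝ} (ht : 0 < t) (h : IsFoot c K φ t x y)
    (hd : HasDerivAt (fun s : ℝ => potential c K φ (t + s * a) (x + s * b)) d 0) :
    d = b * φ y - a * scaledFlux c t (φ y) := by
  have hK := hφ.K_pos.le
  have hw := hφ.nonpos y
  set w := φ y with hwdef
  -- The expected first-order expansion with the amplitude frozen at `w`. The potential exceeds it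
  -- by at most `o(s)`, because the optimal slope at the moved point tends to `w`.
  have hg : HasDerivAt (fun s : ℝ => w * (s * b) - (fluxPrimitive c (t + s * a) w -
      fluxPrimitive c t w)) (w * b - scaledFlux c t w * a) 0 := by
    have h1 : HasDerivAt (fun s : ℝ => w * (s * b)) (w * b) 0 := by
      simpa using ((hasDerivAt_id (0 : ℝ)).mul_const b).const_mul w
    have h2 : HasDerivAt (fun s : ℝ => t + s * a) a 0 := by
      simpa using ((hasDerivAt_id (0 : ℝ)).mul_const a).const_add t
    have h3 : HasDerivAt (fun s => fluxPrimitive c s w) (scaledFlux c t w) (t + 0 * a) := by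
      simpa using hasDerivAt_fluxPrimitive (c := c) (t := t) hw
    exact h1.sub ((h3.comp (0 : ℝ) h2).sub_const _)
  have hF := (hd.sub hg).sub_const (potential c K φ t x)
  have hε : Tendsto (fun s : ℝ => |optSlope c K (t + s * a) (x + s * b - y) - w| * (|b| + |a|))
      (𝓝 0) (𝓝 0) := by
    have h1 := ((hφ.tendsto_optSlope (a := a) (b := b) ht h).sub_const w).abs.mul_const (|b| + |a|)
    rwa [sub_self, abs_zero, zero_mul] at h1
  have := eq_zero_of_hasDerivAt_of_le hF (by simp) hε ?_
  · linarith
  have hpos : ∀ᶠ s : ℝ in 𝓝 0, 0 ≤ t + s * a := by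
    have hc : Continuous fun s : ℝ => t + s * a := by fun_prop
    have := hc.tendsto 0
    simp only [zero_mul, add_zero] at this
    exact (this.eventually (lt_mem_nhds ht)).mono fun _ h => h.le
  filter_upwards [hpos] with s hs
  have h1 := hφ.potential_sub_le (x' := x + s * b) ht.le hs h
  have hmem := optSlope_mem (c := c) (t := t + s * a) (z := x + s * b - y) hK
  set w' := optSlope c K (t + s * a) (x + s * b - y)
  have h2 := (abs_le.1 (fluxPrimitive_time_sub_lipschitz (c := c) (t := t + s * a) (t' := t)
    hmem.2 hw)).1
  rw [show t + s * a - t = s * a by ring, abs_mul] at h2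
  have h3 : (w' - w) * (s * b) ≤ |w' - w| * (|s| * |b|) := by
    rw [← abs_mul, ← abs_mul]; exact le_abs_self _
  simp only [Pi.sub_apply]
  rw [show x + s * b - x = s * b by ring] at h1
  nlinarith

theorem deriv_potential_space {t x y d : ℝ} (ht : 0 < t) (h : IsFoot c K φ t x y)
    (hd : HasDerivAt (potential c K φ t) d x) : d = φ y := by
  have := hφ.deriv_potential_line (a := 0) (b := 1) (d := d) ht h ?_
  · simpa using this
  have h1 : HasDerivAt (fun s : ℝ => x + s * 1) 1 0 := by
    simpa using (hasDerivAt_id (0 : ℝ)).const_add x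
  have h2 : HasDerivAt (potential c K φ t) d (x + 0 * 1) := by simpa using hd
  simpa [Function.comp_def] using h2.comp (0 : ℝ) h1

theorem deriv_potential_time {t x y d : ℝ} (ht : 0 < t) (h : IsFoot c K φ t x y)
    (hd : HasDerivAt (fun s => potential c K φ s x) d t) : d = -scaledFlux c t (φ y) := by
  have := hφ.deriv_potential_line (a := 1) (b := 0) (d := d) ht h ?_
  · simpa using this
  have h1 : HasDerivAt (fun s : ℝ => t + s * 1) 1 0 := by
    simpa using (hasDerivAt_id (0 : ℝ)).const_add t
  have h2 : HasDerivAt (fun s => potential c K φ s x) d (t + 0 * 1) := by simpa using hd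
  simpa [Function.comp_def] using h2.comp (0 : ℝ) h1

theorem deriv_potential_transversal {t z y d : ℝ} (ht : 0 < t) (h : IsFoot c K φ t (z - t) y)
    (hd : HasDerivAt (fun s => potential c K φ s (z - s)) d t) :
    d = -φ y - scaledFlux c t (φ y) := by
  have := hφ.deriv_potential_line (a := 1) (b := -1) (d := d) ht h ?_
  · simpa using this
  have h1 : HasDerivAt (fun s : ℝ => t + s * 1) 1 0 := by
    simpa using (hasDerivAt_id (0 : ℝ)).const_add t
  have h2 : HasDerivAt (fun s => potential c K φ s (z - s)) d (t + 0 * 1) := by simpa using hd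
  have h3 := h2.comp (0 : ℝ) h1
  rw [mul_one] at h3
  refine h3.congr_of_eventuallyEq (Eventually.of_forall fun s => ?_)
  simp only [mul_one, Function.comp]
  congr 1; ring

theorem ae_hasDerivAt_space {t : ℝ} (ht : 0 < t) :
    ∀ᵐ x, HasDerivAt (potential c K φ t) (φ (foot c K φ t x)) x := by
  have hl : LipschitzWith (Real.toNNReal K) (potential c K φ t) :=
    LipschitzWith.of_dist_le_mul fun x y => by
      simpa [Real.dist_eq, hφ.K_pos.le] using
        hφ.potential_lipschitz (c := c) (t := t) (t' := t) (x := y) (x' := x) ht.le ht.le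
  filter_upwards [hl.ae_differentiableAt] with x hx
  rw [← hφ.deriv_potential_space ht (hφ.isFoot_foot ht.le) hx.hasDerivAt]
  exact hx.hasDerivAt

theorem ae_hasDerivAt_time (x : ℝ) : ∀ᵐ t, 0 < t →
    HasDerivAt (fun s => potential c K φ s x) (-scaledFlux c t (φ (foot c K φ t x))) t := by
  have hl : LipschitzOnWith (Real.toNNReal K) (fun s => potential c K φ s x) (Ici 0) :=
    LipschitzOnWith.of_dist_le_mul fun s hs r hr => by
      simpa [Real.dist_eq, hφ.K_pos.le] using
        hφ.potential_lipschitz (c := c) (t := r) (t' := s) (x := x) (x' := x) hr hs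
  filter_upwards [hl.ae_differentiableWithinAt_of_mem] with t h ht
  have hd := ((h ht.le).differentiableAt (Ici_mem_nhds ht)).hasDerivAt
  rw [← hφ.deriv_potential_time ht (hφ.isFoot_foot ht.le) hd]
  exact hd

/-- For almost every position all minimizers carry the same amplitude. -/
theorem ae_unique_space {t : ℝ} (ht : 0 < t) :
    ∀ᵐ x, ∀ y, IsFoot c K φ t x y → φ y = φ (foot c K φ t x) := by
  filter_upwards [hφ.ae_hasDerivAt_space (c := c) ht] with x hx y hy
  exact (hφ.deriv_potential_space ht hy hx).symm

theorem ae_differentiableAt_transversal (z : ℝ) :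
    ∀ᵐ t, 0 < t → DifferentiableAt ℝ (fun s => potential c K φ s (z - s)) t := by
  have hl : LipschitzOnWith (Real.toNNReal (2 * K)) (fun s => potential c K φ s (z - s)) (Ici 0) :=
    LipschitzOnWith.of_dist_le_mul fun s hs r hr => by
      have := hφ.potential_lipschitz (c := c) (t := r) (t' := s) (x := z - r) (x' := z - s) hr hs
      rw [show z - s - (z - r) = -(s - r) by ring, abs_neg] at this
      rw [Real.dist_eq, Real.dist_eq, Real.coe_toNNReal _ (by linarith [hφ.K_pos])]
      linarith
  filter_upwards [hl.ae_differentiableWithinAt_of_mem] with t h ht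
  exact (h ht.le).differentiableAt (Ici_mem_nhds ht)

/-- The derivative along the line is `-(w + scaledFlux c t w)` for every amplitude `w` of a
minimizer. This expression is strictly monotone in `w`, since the speed is at least `-1` and the
flux is strictly convex. -/
theorem ae_unique_transversal (z : ℝ) :
    ∀ᵐ t, 0 < t → ∀ y, IsFoot c K φ t (z - t) y → φ y = φ (foot c K φ t (z - t)) := by
  filter_upwards [hφ.ae_differentiableAt_transversal (c := c) z] with t h ht y hy
  have h1 := hφ.deriv_potential_transversal ht hy (h ht).hasDerivAt
  have h2 := hφ.deriv_potential_transversal ht (hφ.isFoot_foot ht.le) (h ht).hasDerivAt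
  have key : ∀ {w w' : ℝ}, w ∈ Icc (-K) 0 → w' ∈ Icc (-K) 0 → w < w' →
      w + scaledFlux c t w < w' + scaledFlux c t w' := by
    intro w w' hw hw' hlt
    have := scaledFlux_strongly_convex (c := c) ht.le le_rfl hw hw'
    have h3 := (abs_le.1 (abs_scaledSpeed_le (c := c) (s := t) hw.2)).1
    have h4 := mul_pos (convexityModulus_pos (c := c) (T := t) hφ.K_pos.le)
      (pow_pos (sub_pos.2 hlt) 2)
    nlinarith
  rcases lt_trichotomy (φ y) (φ (foot c K φ t (z - t))) with hlt | heq | hlt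
  · have := key (hφ.mem _) (hφ.mem _) hlt; linarith
  · exact heq
  · have := key (hφ.mem _) (hφ.mem _) hlt; linarith

end IsProfile

/-! ### The planar solution -/

instance isAddHaarMeasure_spacetime : (volume : Measure (ℝ × Plane)).IsAddHaarMeasure :=
  inferInstanceAs ((volume : Measure ℝ).prod (volume : Measure Plane)).IsAddHaarMeasure

/-- The restriction of a function on the plane to a horizontal line. -/
def slice (χ : Plane → ℝ) (b y : ℝ) : ℝ := χ !₂[y, b]

/-- Initial data of the planar problem: nonpositive, and Lipschitz along horizontal lines. -/
structure IsDatum (K : ℝ) (χ : Plane → ℝ) : Prop where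
  cont : Continuous χ
  profile : ∀ b, ∃ C, IsProfile K C (slice χ b)

/-- The solution operator of the planar conservation law. -/
noncomputable def planeWave (c K : ℝ) (χ : Plane → ℝ) (p : ℝ × Plane) : ℝ :=
  wave c K (slice χ (p.2 1)) p.1 (p.2 0)

theorem continuous_slice {χ : Plane → ℝ} (hχ : Continuous χ) :
    Continuous fun q : ℝ × ℝ => slice χ q.1 q.2 := by
  unfold slice
  refine hχ.comp ((PiLp.continuous_toLp 2 _).comp (continuous_pi fun i => ?_))
  fin_cases i
  · exact continuous_snd
  · exact continuous_fst

theorem continuous_mass_slice {χ : Plane → ℝ} (hχ : Continuous χ) :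
    Continuous fun q : ℝ × ℝ => mass (slice χ q.1) q.2 := by
  have h2 : Continuous (Function.uncurry fun (q : ℝ × ℝ) (r : ℝ) => slice χ q.1 r) :=
    (continuous_slice hχ).comp ((continuous_fst.comp continuous_fst).prodMk continuous_snd)
  exact intervalIntegral.continuous_parametric_intervalIntegral_of_continuous h2 continuous_snd

namespace IsDatum

variable {c K : ℝ} {χ : Plane → ℝ} (hχ : IsDatum K χ)
include hχ

theorem K_pos : 0 < K := (hχ.profile 0).choose_spec.K_pos

/-- Feet of nearby points are bounded, so they converge along an ultrafilter, and the limit is again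
a minimizer by continuity of the functional. If all minimizers at `p` carry the same amplitude, the
wave converges to its value at `p`, although the foot itself need not converge. -/
theorem continuousWithinAt_planeWave {p : ℝ × Plane}
    (hu : ∀ y, IsFoot c K (slice χ (p.2 1)) p.1 (p.2 0) y → |p.2 0 - y| ≤ p.1 →
      slice χ (p.2 1) y = slice χ (p.2 1) (foot c K (slice χ (p.2 1)) p.1 (p.2 0))) :
    ContinuousWithinAt (planeWave c K χ) {q | 0 ≤ q.1} p := by
  unfold ContinuousWithinAt
  rw [tendsto_iff_ultrafilter]
  intro g hg
  have hgp : Tendsto id (g : Filter (ℝ × Plane)) (𝓝 p) := hg.trans nhdsWithin_le_nhds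
  have hgs : ∀ᶠ q in (g : Filter (ℝ × Plane)), 0 ≤ q.1 := hg self_mem_nhdsWithin
  have c0 : Continuous fun q : ℝ × Plane => q.2 0 := by fun_prop
  have c1 : Continuous fun q : ℝ × Plane => q.2 1 := by fun_prop
  have t0 : Tendsto (fun q : ℝ × Plane => q.2 0) g (𝓝 (p.2 0)) := (c0.tendsto p).comp hgp
  have t1 : Tendsto (fun q : ℝ × Plane => q.2 1) g (𝓝 (p.2 1)) := (c1.tendsto p).comp hgp
  have tt : Tendsto (fun q : ℝ × Plane => q.1) g (𝓝 p.1) := (continuous_fst.tendsto p).comp hgp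
  set Y : ℝ × Plane → ℝ := fun q => foot c K (slice χ (q.2 1)) q.1 (q.2 0) with hY
  have hYb : ∀ᶠ q in (g : Filter (ℝ × Plane)), |q.2 0 - Y q| ≤ q.1 := by
    filter_upwards [hgs] with q hq
    obtain ⟨C, hC⟩ := hχ.profile (q.2 1)
    exact hC.abs_sub_foot_le hq
  have hYc : ∀ᶠ q in (g : Filter (ℝ × Plane)), Y q ∈ Icc (p.2 0 - p.1 - 2) (p.2 0 + p.1 + 2) := by
    filter_upwards [hYb, t0.eventually (Metric.ball_mem_nhds _ one_pos),
      tt.eventually (Metric.ball_mem_nhds _ one_pos)] with q h1 h2 h3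
    rw [Real.dist_eq] at h2 h3
    have a1 := abs_le.1 h1
    have a2 := abs_lt.1 h2
    have a3 := abs_lt.1 h3
    exact ⟨by linarith [a1.1, a1.2], by linarith [a1.1, a1.2]⟩
  obtain ⟨y, -, hy⟩ := isCompact_Icc.ultrafilter_le_nhds (g.map Y) (by
    rw [le_principal_iff]; exact hYc)
  have ty : Tendsto Y g (𝓝 y) := hy
  have hfoot : IsFoot c K (slice χ (p.2 1)) p.1 (p.2 0) y := by
    intro y'
    have L := continuous_legendre (c := c) hχ.K_pos.le
    have M := continuous_mass_slice hχ.cont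
    have key : ∀ {Z : ℝ × Plane → ℝ} {z : ℝ}, Tendsto Z g (𝓝 z) →
        Tendsto (fun q => mass (slice χ (q.2 1)) (Z q) + legendre c K q.1 (q.2 0 - Z q)) g
        (𝓝 (mass (slice χ (p.2 1)) z + legendre c K p.1 (p.2 0 - z))) := by
      intro Z z hZ
      have e1 : Tendsto (fun q => (q.2 1, Z q)) (g : Filter (ℝ × Plane)) (𝓝 (p.2 1, z)) :=
        t1.prodMk_nhds hZ
      have e2 : Tendsto (fun q => (q.1, q.2 0 - Z q)) (g : Filter (ℝ × Plane))
        (𝓝 (p.1, p.2 0 - z)) := tt.prodMk_nhds (t0.sub hZ)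
      have m1 := (M.tendsto (p.2 1, z)).comp e1
      have m2 := (L.tendsto (p.1, p.2 0 - z)).comp e2
      exact m1.add m2
    have l1 := key ty
    have l2 := key (Z := fun _ => y') tendsto_const_nhds
    have hle : ∀ᶠ q in (g : Filter (ℝ × Plane)),
        mass (slice χ (q.2 1)) (Y q) + legendre c K q.1 (q.2 0 - Y q) ≤
        mass (slice χ (q.2 1)) y' + legendre c K q.1 (q.2 0 - y') := by
      filter_upwards [hgs] with q hq
      obtain ⟨C, hC⟩ := hχ.profile (q.2 1)
      exact hC.isFoot_foot hq y'
    exact le_of_tendsto_of_tendsto l1 l2 hle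
  have hbound : |p.2 0 - y| ≤ p.1 := le_of_tendsto_of_tendsto ((t0.sub ty).abs) tt hYb
  have e := hu y hfoot hbound
  have hlim : planeWave c K χ p = Real.exp (c * p.1) * slice χ (p.2 1) y := by
    rw [e]; rfl
  rw [hlim]
  have E : Tendsto (fun q : ℝ × Plane => Real.exp (c * q.1)) g (𝓝 (Real.exp (c * p.1))) :=
    ((Real.continuous_exp.comp (continuous_const.mul continuous_id)).tendsto p.1).comp tt
  have e1 : Tendsto (fun q => (q.2 1, Y q)) (g : Filter (ℝ × Plane)) (𝓝 (p.2 1, y)) :=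
    t1.prodMk_nhds ty
  have e2 := ((continuous_slice hχ.cont).tendsto (p.2 1, y)).comp e1
  exact E.mul e2

theorem continuousAt_planeWave {p : ℝ × Plane} (hp : 0 < p.1)
    (hu : ∀ y, IsFoot c K (slice χ (p.2 1)) p.1 (p.2 0) y →
      slice χ (p.2 1) y = slice χ (p.2 1) (foot c K (slice χ (p.2 1)) p.1 (p.2 0))) :
    ContinuousAt (planeWave c K χ) p :=
  (hχ.continuousWithinAt_planeWave fun y hy _ => hu y hy).continuousAt
    (continuous_fst.continuousAt.eventually (Ici_mem_nhds hp))

/-- At time `0` the bound `|x - y| ≤ t` leaves only one possible limit of feet. -/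
theorem continuousWithinAt_planeWave_zero {p : ℝ × Plane} (hp : p.1 = 0) :
    ContinuousWithinAt (planeWave c K χ) {q | 0 ≤ q.1} p := by
  refine hχ.continuousWithinAt_planeWave fun y _ hy => ?_
  obtain ⟨C, hC⟩ := hχ.profile (p.2 1)
  rw [hp] at hy ⊢
  rw [hC.foot_zero]
  congr 1
  linarith [abs_nonpos_iff.1 hy]

theorem planeWave_zero (x : Plane) : planeWave c K χ (0, x) = χ x := by
  obtain ⟨C, hC⟩ := hχ.profile (x 1)
  simp only [planeWave, hC.wave_zero, slice]
  congr 1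
  ext i
  fin_cases i <;> rfl

/-- On every horizontal line almost every point has a unique amplitude. The continuity points form a
measurable (`Gδ`) set, so Fubini in the direction `e1` turns this into a statement in space-time. -/
theorem ae_continuousAt_planeWave :
    ∀ᵐ p : ℝ × Plane, 0 < p.1 → ContinuousAt (planeWave c K χ) p := by
  have hm : MeasurableSet ({p | ContinuousAt (planeWave c K χ) p} ∪ {p : ℝ × Plane | p.1 ≤ 0}) :=
    (IsGδ.setOfPred_continuousAt _).measurableSet.union
      (measurableSet_le measurable_fst measurable_const)
  let L : ℝ →L[ℝ] ℝ × Plane := ContinuousLinearMap.toSpanSingleton ℝ (0, e1)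
  have key := ae_mem_of_ae_add_linearMap_mem (F := ℝ × Plane) L.toLinearMap
    (volume : Measure ℝ) (volume : Measure (ℝ × Plane)) hm ?_
  · filter_upwards [key] with p hp h0
    rcases hp with hp | hp
    · exact hp
    · exact absurd hp (not_le.2 h0)
  intro p
  rcases le_or_gt p.1 0 with h0 | h0
  · refine Eventually.of_forall fun r => Or.inr ?_
    simpa [L] using h0
  obtain ⟨C, hC⟩ := hχ.profile (p.2 1)
  have h1 := hC.ae_unique_space (c := c) h0
  have h2 := (measurePreserving_add_left volume (p.2 0)).quasiMeasurePreserving.ae h1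
  filter_upwards [h2] with r hr
  refine Or.inl (hχ.continuousAt_planeWave ?_ ?_)
  · simpa [L] using h0
  · simpa [L, e1] using hr

/-- The foot is obtained by choice, so measurability is read off from continuity almost everywhere.
-/
theorem aestronglyMeasurable_planeWave (T : ℝ) :
    AEStronglyMeasurable (planeWave c K χ) (volume.restrict (slab T)) := by
  set G := {p | ContinuousAt (planeWave c K χ) p}
  have hG : MeasurableSet G := (IsGδ.setOfPred_continuousAt _).measurableSet
  have h1 : AEStronglyMeasurable (planeWave c K χ) (volume.restrict G) :=
    ContinuousOn.aestronglyMeasurable (fun p hp => ContinuousAt.continuousWithinAt hp) hG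
  refine h1.mono_ac ?_
  have hs : slab T ≤ᵐ[volume] G := by
    filter_upwards [hχ.ae_continuousAt_planeWave (c := c)] with p hp hps
    exact hp hps.1.1
  exact (Measure.restrict_mono_ae hs).absolutelyContinuous

end IsDatum


/-! ### Absolutely continuous functions -/

theorem AbsolutelyContinuousOnInterval.lipschitz_comp {f G : ℝ → ℝ} {a b : ℝ} {L : NNReal}
    {s : Set ℝ} (hf : AbsolutelyContinuousOnInterval f a b) (hG : LipschitzOnWith L G s)
    (hs : ∀ x ∈ uIcc a b, f x ∈ s) : AbsolutelyContinuousOnInterval (fun x => G (f x)) a b := by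
  unfold AbsolutelyContinuousOnInterval at hf ⊢
  have h2 := hf.const_mul (L : ℝ)
  rw [mul_zero] at h2
  refine squeeze_zero' (Eventually.of_forall fun E => Finset.sum_nonneg fun _ _ => dist_nonneg) ?_ h2
  refine Filter.Eventually.filter_mono inf_le_right ?_
  filter_upwards [mem_principal_self (disjWithin a b)] with E hE
  rw [Finset.mul_sum]
  exact Finset.sum_le_sum fun i hi =>
    hG.dist_le_mul _ (hs _ (hE.1 i hi).1) _ (hs _ (hE.1 i hi).2)

theorem AbsolutelyContinuousOnInterval.integral_eq_sub {F F' : ℝ → ℝ} {a b : ℝ}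
    (hF : AbsolutelyContinuousOnInterval F a b)
    (h : ∀ᵐ x, x ∈ Set.uIoc a b → HasDerivAt F (F' x) x) :
    IntervalIntegrable F' volume a b ∧ ∫ x in a..b, F' x = F b - F a := by
  have hae : ∀ᵐ x, x ∈ Set.uIoc a b → deriv F x = F' x := by
    filter_upwards [h] with x hx hxm
    exact (hx hxm).deriv
  refine ⟨hF.intervalIntegrable_deriv.congr_ae ?_, ?_⟩
  · rw [Filter.EventuallyEq, ae_restrict_iff' measurableSet_uIoc]; exact hae
  · rw [← hF.integral_deriv_eq_sub]
    exact (intervalIntegral.integral_congr_ae hae).symm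

theorem exists_lipschitzOnWith_Icc {G G' : ℝ → ℝ} {a b : ℝ}
    (hG : ∀ y ∈ Icc a b, HasDerivAt G (G' y) y) (hc : ContinuousOn G' (Icc a b)) :
    ∃ L, LipschitzOnWith L G (Icc a b) := by
  obtain ⟨M, hM⟩ := isCompact_Icc.exists_bound_of_continuousOn hc
  refine ⟨Real.toNNReal M, (convex_Icc a b).lipschitzOnWith_of_nnnorm_hasDerivWithin_le
    (fun x hx => (hG x hx).hasDerivWithinAt) fun x hx => ?_⟩
  rw [← NNReal.coe_le_coe, Real.coe_toNNReal _ ((norm_nonneg _).trans (hM x hx))]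
  exact hM x hx

/-- A `C²` convex entropy for the flux, with its derivatives and its entropy flux. -/
structure EntropyPair (η η' η'' q : ℝ → ℝ) : Prop where
  deriv : ∀ v, HasDerivAt η (η' v) v
  deriv' : ∀ v, HasDerivAt η' (η'' v) v
  cont : Continuous η''
  nonneg : ∀ v, 0 ≤ η'' v
  flux : ∀ v : ℝ, v < 1 → HasDerivAt q (η' v * ((1 + v) / (1 - v))) v

namespace EntropyPair

variable {η η' η'' q : ℝ → ℝ} (he : EntropyPair η η' η'' q)
include he

theorem continuous_deriv : Continuous η' :=
  continuous_iff_continuousAt.2 fun v => (he.deriv' v).continuousAt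

theorem continuous : Continuous η :=
  continuous_iff_continuousAt.2 fun v => (he.deriv v).continuousAt

theorem continuousOn_flux : ContinuousOn q (Iio 1) := fun _ hv =>
  (he.flux _ hv).continuousAt.continuousWithinAt

end EntropyPair

theorem continuousOn_speed : ContinuousOn (fun v : ℝ => (1 + v) / (1 - v)) (Iio 1) := by
  refine ContinuousOn.div (by fun_prop) (by fun_prop) fun v hv => ?_
  have : v < 1 := hv
  linarith

theorem continuousOn_flux : ContinuousOn flux (Iio 1) := fun _ hv =>
  (hasDerivAt_flux hv).continuousAt.continuousWithinAt

/-- Entropy balance on a line, for a function `a` that dominates the flux of `V`. -/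
theorem entropy_balance_line {η η' η'' q : ℝ → ℝ} (he : EntropyPair η η' η'' q)
    {R M B : ℝ} {V a DV Da g g' : ℝ → ℝ} (hR : 0 < R)
    (hV : AbsolutelyContinuousOnInterval V (-R) R) (hVm : ∀ x, V x ∈ Icc (-M) 0)
    (ha : AbsolutelyContinuousOnInterval a (-R) R)
    (hDV : ∀ᵐ x, HasDerivAt V (DV x) x) (hDa : ∀ᵐ x, HasDerivAt a (Da x) x)
    (hg : ∀ x, HasDerivAt g (g' x) x) (hg' : Continuous g') (hgR : g R = 0) (hgR' : g (-R) = 0)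
    (hflux : ∀ x, flux (V x) ≤ a x)
    (hB : ∀ᵐ x, x ∈ Icc (-R) R → η'' (V x) * DV x * g x + η' (V x) * g' x ≤ B)
    (hint : IntervalIntegrable (fun x => η' (V x) * g x * Da x + q (V x) * g' x) volume (-R) R) :
    -(B * ∫ x in (-R)..R, (a x - flux (V x))) ≤
      ∫ x in (-R)..R, (η' (V x) * g x * Da x + q (V x) * g' x) := by
  have hsub : Icc (-M) 0 ⊆ Iio (1 : ℝ) := fun x hx => lt_of_le_of_lt hx.2 one_pos
  obtain ⟨L1, hL1⟩ := exists_lipschitzOnWith_Icc (a := -M) (b := 0) (fun y _ => he.deriv' y)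
    he.cont.continuousOn
  obtain ⟨L2, hL2⟩ := exists_lipschitzOnWith_Icc (a := -M) (b := 0)
    (fun y hy => hasDerivAt_flux (hsub hy)) (continuousOn_speed.mono hsub)
  obtain ⟨L3, hL3⟩ := exists_lipschitzOnWith_Icc (a := -M) (b := 0)
    (fun y hy => he.flux y (hsub hy))
    (he.continuous_deriv.continuousOn.mul (continuousOn_speed.mono hsub))
  have acg : AbsolutelyContinuousOnInterval g (-R) R := by
    obtain ⟨L, hL⟩ := exists_lipschitzOnWith_Icc (a := -R) (b := R) (fun y _ => hg y)
      hg'.continuousOn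
    rw [← uIcc_of_le (by linarith : -R ≤ R)] at hL
    exact hL.absolutelyContinuousOnInterval
  have acF := (hV.lipschitz_comp hL1 fun x _ => hVm x).mul acg
  have acA := hV.lipschitz_comp hL2 fun x _ => hVm x
  have acq := (hV.lipschitz_comp hL3 fun x _ => hVm x).mul acg
  -- This function vanishes at `±R`. Its derivative is the integrand of the claim plus the deficit
  -- `a - flux V` times the quantity bounded by `B`. The deficit is nonnegative, so an upper bound
  -- on that quantity is all that is needed.
  have acG := ((ha.sub acA).mul acF).add acq
  have key := acG.integral_eq_sub (F' := fun x => (η' (V x) * g x * Da x + q (V x) * g' x) +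
    (a x - flux (V x)) * (η'' (V x) * DV x * g x + η' (V x) * g' x)) ?_
  · obtain ⟨k1, k2⟩ := key
    have k3 : ∫ x in (-R)..R, ((η' (V x) * g x * Da x + q (V x) * g' x) +
        (a x - flux (V x)) * (η'' (V x) * DV x * g x + η' (V x) * g' x)) = 0 := by
      rw [k2]; simp [hgR, hgR']
    have hr : IntervalIntegrable (fun x => a x - flux (V x)) volume (-R) R :=
      (ha.sub acA).continuousOn.intervalIntegrable
    have hm := intervalIntegral.integral_mono_ae_restrict (μ := volume) (by linarith : -R ≤ R)
      (k1.sub (hr.const_mul B)) hint ?_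
    · have e1 := intervalIntegral.integral_sub k1 (hr.const_mul B)
      rw [k3, intervalIntegral.integral_const_mul] at e1
      linarith [hm, e1]
    rw [Filter.EventuallyLE, ae_restrict_iff' measurableSet_Icc]
    filter_upwards [hB] with x hx hxm
    have := mul_le_mul_of_nonneg_left (hx hxm) (sub_nonneg.2 (hflux x))
    linarith
  · filter_upwards [hDV, hDa] with x h1 h2 _
    have hV1 : V x < 1 := hsub (hVm x)
    have d1 : HasDerivAt (fun x => η' (V x)) (η'' (V x) * DV x) x := (he.deriv' (V x)).comp x h1
    have d2 : HasDerivAt (fun x => flux (V x)) ((1 + V x) / (1 - V x) * DV x) x :=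
      (hasDerivAt_flux hV1).comp x h1
    have d3 : HasDerivAt (fun x => q (V x)) (η' (V x) * ((1 + V x) / (1 - V x)) * DV x) x :=
      (he.flux _ hV1).comp x h1
    have d4 := ((h2.sub d2).mul (d1.mul (hg x))).add (d3.mul (hg x))
    refine d4.congr_deriv ?_
    simp only [Pi.sub_apply, Pi.mul_apply]
    ring

theorem exp_mul_scaledFlux (c t w : ℝ) :
    Real.exp (c * t) * scaledFlux c t w = flux (Real.exp (c * t) * w) := by
  unfold scaledFlux
  rw [← mul_assoc, ← Real.exp_add]
  simp

/-! ### Measurable versions of the slope and of the wave -/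

/-- The potential, extended to negative times by its initial value. -/
noncomputable def potentialExt (c K : ℝ) (φ : ℝ → ℝ) (t x : ℝ) : ℝ := potential c K φ (max t 0) x

/-- The derivative of the potential, times the amplification factor. -/
noncomputable def waveExt (c K : ℝ) (φ : ℝ → ℝ) (t x : ℝ) : ℝ :=
  Real.exp (c * t) * deriv (potentialExt c K φ t) x

/-- The mean value of the wave over `[x, x + h]`. -/
noncomputable def waveMean (c K : ℝ) (φ : ℝ → ℝ) (h t x : ℝ) : ℝ :=
  Real.exp (c * t) * ((potentialExt c K φ t (x + h) - potentialExt c K φ t x) / h)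

namespace IsProfile

variable {c K C : ℝ} {φ : ℝ → ℝ} (hφ : IsProfile K C φ)
include hφ

theorem potentialExt_lipschitz (t t' x x' : ℝ) :
    |potentialExt c K φ t' x' - potentialExt c K φ t x| ≤ K * (|x' - x| + |t' - t|) := by
  refine (hφ.potential_lipschitz (le_max_right t 0) (le_max_right t' 0)).trans ?_
  exact mul_le_mul_of_nonneg_left (add_le_add le_rfl (abs_max_sub_max_le_abs t' t 0)) hφ.K_pos.le

theorem continuous_potentialExt : Continuous (Function.uncurry (potentialExt c K φ)) := by
  rw [Metric.continuous_iff]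
  intro p ε hε
  have hK := hφ.K_pos
  refine ⟨ε / (2 * K + 1), by positivity, fun q hq => ?_⟩
  rw [Real.dist_eq]
  have h1 : |q.2 - p.2| ≤ dist q p := by
    rw [← Real.dist_eq]; exact le_max_right _ _
  have h2 : |q.1 - p.1| ≤ dist q p := by
    rw [← Real.dist_eq]; exact le_max_left _ _
  calc _ ≤ K * (|q.2 - p.2| + |q.1 - p.1|) := hφ.potentialExt_lipschitz _ _ _ _
    _ ≤ K * (dist q p + dist q p) := by gcongr
    _ ≤ (2 * K + 1) * dist q p := by nlinarith [dist_nonneg (x := q) (y := p)]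
    _ < (2 * K + 1) * (ε / (2 * K + 1)) := by gcongr
    _ = ε := by field_simp

theorem lipschitzWith_potentialExt (t : ℝ) :
    LipschitzWith (Real.toNNReal K) (potentialExt c K φ t) :=
  LipschitzWith.of_dist_le_mul fun x y => by
    simpa [Real.dist_eq, hφ.K_pos.le] using hφ.potentialExt_lipschitz (c := c) t t y x

theorem deriv_potentialExt_mem (t x : ℝ) : deriv (potentialExt c K φ t) x ∈ Icc (-K) 0 := by
  have h1 := norm_deriv_le_of_lipschitz (x₀ := x) (hφ.lipschitzWith_potentialExt (c := c) t)
  rw [Real.norm_eq_abs, Real.coe_toNNReal _ hφ.K_pos.le] at h1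
  refine ⟨(abs_le.1 h1).1, ?_⟩
  rw [← derivWithin_univ]
  exact ((hφ.potential_antitone (c := c) (le_max_right t 0)).antitoneOn univ).derivWithin_nonpos

/-- The derivative of a jointly continuous function in one variable is jointly measurable. This
gives a measurable version of the wave, whose own definition involves a choice of feet. -/
theorem measurable_waveExt : Measurable fun p : ℝ × ℝ => waveExt c K φ p.1 p.2 := by
  have h := measurable_deriv_with_param (hφ.continuous_potentialExt (c := c))
  unfold waveExt
  exact (by fun_prop : Measurable fun p : ℝ × ℝ => Real.exp (c * p.1)).mul h

theorem ae_differentiableAt_potentialExt :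
    ∀ᵐ p : ℝ × ℝ, DifferentiableAt ℝ (potentialExt c K φ p.1) p.2 := by
  have h := measurableSet_of_differentiableAt_with_param ℝ (hφ.continuous_potentialExt (c := c))
  exact (Measure.ae_prod_mem_iff_ae_ae_mem h).2
    (Eventually.of_forall fun t => (hφ.lipschitzWith_potentialExt t).ae_differentiableAt)

theorem waveExt_eq {t x : ℝ} (ht : 0 < t) (h : DifferentiableAt ℝ (potentialExt c K φ t) x) :
    waveExt c K φ t x = wave c K φ t x := by
  have hd := h.hasDerivAt
  have e : potentialExt c K φ t = potential c K φ t := by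
    funext y; rw [potentialExt, max_eq_left ht.le]
  unfold waveExt wave
  rw [e] at hd ⊢
  rw [hφ.deriv_potential_space ht (hφ.isFoot_foot ht.le) hd]

theorem ae_waveExt_eq : ∀ᵐ p : ℝ × ℝ, 0 < p.1 → waveExt c K φ p.1 p.2 = wave c K φ p.1 p.2 := by
  filter_upwards [hφ.ae_differentiableAt_potentialExt (c := c)] with p hp ht
  exact hφ.waveExt_eq ht hp

theorem wave_mem {T t : ℝ} (ht : 0 ≤ t) (htT : t ≤ T) (x : ℝ) :
    wave c K φ t x ∈ Icc (-(K * Real.exp (|c| * T))) 0 := by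
  have h1 := hφ.mem (foot c K φ t x)
  have h2 := exp_mul_le (c := c) ht htT
  have h3 := Real.exp_pos (c * t)
  unfold wave
  constructor
  · nlinarith [h1.1, h1.2, hφ.K_pos]
  · exact mul_nonpos_of_nonneg_of_nonpos h3.le h1.2

theorem waveExt_mem {T t : ℝ} (ht : 0 ≤ t) (htT : t ≤ T) (x : ℝ) :
    waveExt c K φ t x ∈ Icc (-(K * Real.exp (|c| * T))) 0 := by
  have h1 := hφ.deriv_potentialExt_mem (c := c) t x
  have h2 := exp_mul_le (c := c) ht htT
  have h3 := Real.exp_pos (c * t)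
  unfold waveExt
  constructor
  · nlinarith [h1.1, h1.2, hφ.K_pos]
  · exact mul_nonpos_of_nonneg_of_nonpos h3.le h1.2

theorem waveMean_mem {T t h : ℝ} (hh : 0 < h) (ht : 0 ≤ t) (htT : t ≤ T) (x : ℝ) :
    waveMean c K φ h t x ∈ Icc (-(K * Real.exp (|c| * T))) 0 := by
  have h0 : (potentialExt c K φ t (x + h) - potentialExt c K φ t x) / h ∈ Icc (-K) 0 := by
    have a1 := (abs_le.1 (hφ.potentialExt_lipschitz (c := c) t t x (x + h))).1
    have a2 := hφ.potential_antitone (c := c) (le_max_right t 0) (by linarith : x ≤ x + h)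
    simp only [add_sub_cancel_left, sub_self, abs_zero, add_zero, abs_of_pos hh] at a1
    constructor
    · rw [le_div_iff₀ hh]; linarith
    · rw [div_le_iff₀ hh]; unfold potentialExt; linarith
  have h2 := exp_mul_le (c := c) ht htT
  have h3 := Real.exp_pos (c * t)
  unfold waveMean
  constructor
  · nlinarith [h0.1, h0.2, hφ.K_pos]
  · exact mul_nonpos_of_nonneg_of_nonpos h3.le h0.2

theorem continuous_waveMean (h : ℝ) : Continuous fun p : ℝ × ℝ => waveMean c K φ h p.1 p.2 := by
  have h1 := hφ.continuous_potentialExt (c := c)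
  have h0 : Continuous fun p : ℝ × ℝ => (p.1, p.2 + h) := by fun_prop
  have h2 := h1.comp h0
  have h3 : Continuous fun p : ℝ × ℝ => potentialExt c K φ p.1 p.2 := h1
  unfold waveMean
  have h4 : Continuous fun p : ℝ × ℝ => Real.exp (c * p.1) := by fun_prop
  exact h4.mul ((h2.sub h3).div_const h)

theorem waveMean_zero {h x : ℝ} : waveMean c K φ h 0 x = (mass φ (x + h) - mass φ x) / h := by
  unfold waveMean potentialExt
  simp [hφ.potential_zero]

/-- This is `amplitude_sub_le` for the difference quotients. The constant does not depend on `h`. -/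
theorem ae_waveExt_sub_le {t h : ℝ} (ht : 0 < t) (hh : 0 < h) :
    ∀ᵐ x, (waveExt c K φ t (x + h) - waveExt c K φ t x) / h ≤ Real.exp (c * t) * C := by
  have h1 := (hφ.lipschitzWith_potentialExt (c := c) t).ae_differentiableAt (μ := volume)
  have h2 := (measurePreserving_add_right (volume : Measure ℝ) h).quasiMeasurePreserving.ae h1
  filter_upwards [h1, h2] with x e1 e2
  rw [hφ.waveExt_eq ht e1, hφ.waveExt_eq ht e2, div_le_iff₀ hh]
  unfold wave
  have := hφ.amplitude_sub_le (c := c) ht (by linarith : x < x + h) (hφ.isFoot_foot ht.le)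
    (hφ.isFoot_foot ht.le)
  rw [add_sub_cancel_left] at this
  rw [← mul_sub, mul_assoc]
  exact mul_le_mul_of_nonneg_left this (Real.exp_pos _).le

/-- The time derivative of the mean values. -/
theorem ae_hasDerivAt_waveMean (h x : ℝ) : ∀ᵐ t, 0 < t →
    HasDerivAt (fun s => waveMean c K φ h s x) (c * waveMean c K φ h t x -
      (flux (wave c K φ t (x + h)) - flux (wave c K φ t x)) / h) t := by
  filter_upwards [hφ.ae_hasDerivAt_time (c := c) x, hφ.ae_hasDerivAt_time (c := c) (x + h)]
    with t h1 h2 ht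
  have e : ∀ y, (fun s => potential c K φ s y) =ᶠ[𝓝 t] fun s => potentialExt c K φ s y := by
    intro y
    filter_upwards [lt_mem_nhds ht] with s hs
    rw [potentialExt, max_eq_left hs.le]
  have d1 := (h1 ht).congr_of_eventuallyEq (e x).symm
  have d2 := (h2 ht).congr_of_eventuallyEq (e (x + h)).symm
  have d3 : HasDerivAt (fun s : ℝ => Real.exp (c * s)) (Real.exp (c * t) * c) t := by
    simpa using ((hasDerivAt_id t).const_mul c).exp
  refine (d3.mul ((d2.sub d1).div_const h)).congr_deriv ?_
  unfold wave waveMean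
  rw [← exp_mul_scaledFlux, ← exp_mul_scaledFlux]
  simp only [Pi.sub_apply]
  ring

theorem absolutelyContinuous_waveMean_time {T : ℝ} (h x : ℝ) :
    AbsolutelyContinuousOnInterval (fun s => waveMean c K φ h s x) 0 T := by
  have hl : ∀ y, AbsolutelyContinuousOnInterval (fun s => potentialExt c K φ s y) 0 T := by
    intro y
    have : LipschitzWith (Real.toNNReal K) (fun s => potentialExt c K φ s y) :=
      LipschitzWith.of_dist_le_mul fun s r => by
        simpa [Real.dist_eq, hφ.K_pos.le] using hφ.potentialExt_lipschitz (c := c) r s y y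
    exact (this.lipschitzOnWith).absolutelyContinuousOnInterval
  have he : AbsolutelyContinuousOnInterval (fun s : ℝ => Real.exp (c * s)) 0 T :=
    ContDiffOn.absolutelyContinuousOnInterval (by fun_prop)
  have := he.mul (((hl (x + h)).sub (hl x)).const_mul h⁻¹)
  convert this using 2
  simp only [Pi.mul_apply, Pi.sub_apply, waveMean]
  ring


theorem waveExt_nonpos (t x : ℝ) : waveExt c K φ t x ≤ 0 :=
  mul_nonpos_of_nonneg_of_nonpos (Real.exp_pos _).le (hφ.deriv_potentialExt_mem t x).2

theorem waveMean_nonpos {h : ℝ} (hh : 0 < h) (t x : ℝ) : waveMean c K φ h t x ≤ 0 := by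
  have a2 := hφ.potential_antitone (c := c) (le_max_right t 0) (by linarith : x ≤ x + h)
  refine mul_nonpos_of_nonneg_of_nonpos (Real.exp_pos _).le ?_
  rw [div_le_iff₀ hh]; unfold potentialExt; linarith

/-- Fubini replaces the wave by its measurable version for almost every `x` and then almost every
`t`. -/
theorem ae_waveMean_deriv_time (h : ℝ) : ∀ᵐ x, ∀ᵐ t, 0 < t →
    HasDerivAt (fun s => waveMean c K φ h s x) (c * waveMean c K φ h t x -
      (flux (waveExt c K φ t (x + h)) - flux (waveExt c K φ t x)) / h) t := by
  have h1 : ∀ᵐ x, ∀ᵐ t, 0 < t → waveExt c K φ t x = wave c K φ t x :=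
    Measure.ae_ae_of_ae_prod ((Measure.measurePreserving_swap (μ := (volume : Measure ℝ))
      (ν := (volume : Measure ℝ))).quasiMeasurePreserving.ae (hφ.ae_waveExt_eq (c := c)))
  have h2 := (measurePreserving_add_right (volume : Measure ℝ) h).quasiMeasurePreserving.ae h1
  filter_upwards [h1, h2] with x e1 e2
  filter_upwards [e1, e2, hφ.ae_hasDerivAt_waveMean (c := c) h x] with t d1 d2 d3 ht
  rw [d1 ht, d2 ht]
  exact d3 ht

/-- Entropy balance in time at a fixed point of the line. -/
theorem ae_entropy_balance_time {η η' η'' q : ℝ → ℝ} (he : EntropyPair η η' η'' q) {T h : ℝ}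
    (hT : 0 ≤ T) (hh : 0 < h) {g gt : ℝ × ℝ → ℝ}
    (hg : ∀ t x, HasDerivAt (fun s => g (s, x)) (gt (t, x)) t) (hgt : Continuous gt)
    (hgT : ∀ x, g (T, x) = 0) :
    ∀ᵐ x, ∫ t in (0)..T, (η (waveMean c K φ h t x) * gt (t, x)
      + c * η' (waveMean c K φ h t x) * waveMean c K φ h t x * g (t, x)
      - η' (waveMean c K φ h t x) * g (t, x) *
        ((flux (waveExt c K φ t (x + h)) - flux (waveExt c K φ t x)) / h))
      = -(η (waveMean c K φ h 0 x) * g (0, x)) := by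
  filter_upwards [hφ.ae_waveMean_deriv_time (c := c) h] with x hx
  obtain ⟨L1, hL1⟩ := exists_lipschitzOnWith_Icc (a := -(K * Real.exp (|c| * T))) (b := 0)
    (fun y _ => he.deriv y) he.continuous_deriv.continuousOn
  have ac1 := (hφ.absolutelyContinuous_waveMean_time (c := c) (T := T) h x).lipschitz_comp hL1
    (fun t ht => by
      rw [uIcc_of_le hT] at ht
      exact hφ.waveMean_mem hh ht.1 ht.2 x)
  have ac2 : AbsolutelyContinuousOnInterval (fun s => g (s, x)) 0 T := by
    obtain ⟨L, hL⟩ := exists_lipschitzOnWith_Icc (a := 0) (b := T) (fun y _ => hg y x)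
      (by fun_prop)
    rw [← uIcc_of_le hT] at hL
    exact hL.absolutelyContinuousOnInterval
  have key := (ac1.mul ac2).integral_eq_sub (F' := fun t => η (waveMean c K φ h t x) * gt (t, x)
      + c * η' (waveMean c K φ h t x) * waveMean c K φ h t x * g (t, x)
      - η' (waveMean c K φ h t x) * g (t, x) *
        ((flux (waveExt c K φ t (x + h)) - flux (waveExt c K φ t x)) / h)) ?_
  · rw [key.2]; simp [hgT]
  · filter_upwards [hx] with t ht htm
    rw [uIoc_of_le hT] at htm
    have d1 : HasDerivAt (fun s => η (waveMean c K φ h s x)) _ t :=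
      (he.deriv (waveMean c K φ h t x)).comp t (ht htm.1)
    refine (d1.mul (hg t x)).congr_deriv ?_
    ring

/-- The mean value of the flux. -/
theorem flux_waveMean_le {t h : ℝ} (hh : 0 < h) (ht : 0 ≤ t) (x : ℝ) :
    flux (waveMean c K φ h t x) ≤ (∫ y in x..(x + h), flux (waveExt c K φ t y)) / h := by
  have hm : Measurable fun y => waveExt c K φ t y :=
    (hφ.measurable_waveExt (c := c)).comp (by fun_prop : Measurable fun y : ℝ => (t, y))
  have hflux : Measurable flux := by unfold flux; fun_prop
  set M := K * Real.exp (|c| * t)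
  have hi1 : IntervalIntegrable (fun y => waveExt c K φ t y) volume x (x + h) := by
    rw [intervalIntegrable_iff]
    refine Measure.integrableOn_of_bounded (M := M) (by simp) hm.aestronglyMeasurable ?_
    filter_upwards with y
    have := hφ.waveExt_mem (c := c) ht le_rfl y
    exact abs_le.2 ⟨this.1, by linarith [this.2, this.1]⟩
  have hi2 : IntervalIntegrable (fun y => flux (waveExt c K φ t y)) volume x (x + h) := by
    rw [intervalIntegrable_iff]
    obtain ⟨B, hB⟩ := isCompact_Icc.exists_bound_of_continuousOn
      (continuousOn_flux.mono (fun y hy => lt_of_le_of_lt hy.2 one_pos) :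
        ContinuousOn flux (Icc (-M) 0))
    refine Measure.integrableOn_of_bounded (M := B) (by simp)
      (hflux.comp hm).aestronglyMeasurable ?_
    filter_upwards with y
    exact hB _ (hφ.waveExt_mem (c := c) ht le_rfl y)
  have hac : AbsolutelyContinuousOnInterval (potentialExt c K φ t) x (x + h) :=
    ((hφ.lipschitzWith_potentialExt (c := c) t).lipschitzOnWith).absolutelyContinuousOnInterval
  have hW : ∫ y in x..(x + h), waveExt c K φ t y = h * waveMean c K φ h t x := by
    unfold waveExt waveMean
    rw [intervalIntegral.integral_const_mul, hac.integral_deriv_eq_sub]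
    field_simp
  set w := waveMean c K φ h t x
  have hw : w ≤ 0 := hφ.waveMean_nonpos hh t x
  rw [le_div_iff₀ hh]
  -- Jensen's inequality: integrate the tangent inequality for the flux at the mean value `w`; the
  -- linear term integrates to zero.
  have hmono := intervalIntegral.integral_mono (by linarith : x ≤ x + h)
    ((intervalIntegrable_const (c := flux w)).add
      ((hi1.sub (intervalIntegrable_const (c := w))).const_mul ((1 + w) / (1 - w)))) hi2
    (fun y => by
      have hE := hφ.waveExt_nonpos (c := c) t y
      have h1 : min w (waveExt c K φ t y) ≤ w := min_le_left _ _
      have h2 : min w (waveExt c K φ t y) ≤ waveExt c K φ t y := min_le_right _ _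
      have := flux_strongly_convex (R := -min w (waveExt c K φ t y)) (v := w)
        (v' := waveExt c K φ t y) ⟨by linarith, hw⟩ ⟨by linarith, hE⟩
      have h3 : 0 ≤ 1 / (1 + -min w (waveExt c K φ t y)) ^ 2 * (waveExt c K φ t y - w) ^ 2 := by
        positivity
      linarith)
  rw [intervalIntegral.integral_add intervalIntegrable_const
      ((hi1.sub (intervalIntegrable_const (c := w))).const_mul ((1 + w) / (1 - w))),
    intervalIntegral.integral_const_mul, intervalIntegral.integral_sub hi1
      intervalIntegrable_const, hW] at hmono
  simp only [intervalIntegral.integral_const, add_sub_cancel_left, smul_eq_mul, sub_self,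
    mul_zero, add_zero] at hmono
  linarith

end IsProfile


/-! ### Mean values over short intervals and the smooth entropy inequality -/

theorem HasDerivAt.tendsto_slope_seq {F : ℝ → ℝ} {F' x : ℝ} (hF : HasDerivAt F F' x) {r : ℕ → ℝ}
    (hr : Tendsto r atTop (𝓝[≠] 0)) :
    Tendsto (fun n => (F (x + r n) - F x) / r n) atTop (𝓝 F') := by
  refine ((hasDerivAt_iff_tendsto_slope_zero.1 hF).comp hr).congr fun n => ?_
  simp [div_eq_inv_mul]

theorem abs_flux_le {v : ℝ} (hv : v ≤ 0) : |flux v| ≤ |v| := by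
  simpa [flux_zero] using flux_lipschitz hv (le_refl (0 : ℝ))

theorem measurable_flux : Measurable flux := by unfold flux; fun_prop

/-- The mean value over `[x, x + h]` of the flux of the wave. -/
noncomputable def fluxMean (c K : ℝ) (φ : ℝ → ℝ) (h t x : ℝ) : ℝ :=
  (∫ y in x..(x + h), flux (waveExt c K φ t y)) / h

/-- The difference quotient of the flux of the wave. -/
noncomputable def fluxQuot (c K : ℝ) (φ : ℝ → ℝ) (h t x : ℝ) : ℝ :=
  (flux (waveExt c K φ t (x + h)) - flux (waveExt c K φ t x)) / h

theorem tendsto_waveMean {c K : ℝ} {φ : ℝ → ℝ} {t x : ℝ} (h : DifferentiableAt ℝ (potentialExt c K φ t) x) {r : ℕ → ℝ}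
    (hr : Tendsto r atTop (𝓝[≠] 0)) :
    Tendsto (fun n => waveMean c K φ (r n) t x) atTop (𝓝 (waveExt c K φ t x)) :=
  (h.hasDerivAt.tendsto_slope_seq hr).const_mul _

namespace IsProfile

variable {c K C : ℝ} {φ : ℝ → ℝ} (hφ : IsProfile K C φ)
include hφ

theorem abs_waveExt_le {T t : ℝ} (ht : 0 ≤ t) (htT : t ≤ T) (x : ℝ) :
    |waveExt c K φ t x| ≤ K * Real.exp (|c| * T) := by
  have := hφ.waveExt_mem (c := c) ht htT x
  exact abs_le.2 ⟨this.1, by linarith [this.2, this.1]⟩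

theorem abs_flux_waveExt_le {T t : ℝ} (ht : 0 ≤ t) (htT : t ≤ T) (x : ℝ) :
    |flux (waveExt c K φ t x)| ≤ K * Real.exp (|c| * T) :=
  (abs_flux_le (hφ.waveExt_nonpos t x)).trans (hφ.abs_waveExt_le ht htT x)

theorem abs_fluxQuot_le {T t h : ℝ} (hh : 0 < h) (ht : 0 ≤ t) (htT : t ≤ T) (x : ℝ) :
    |fluxQuot c K φ h t x| ≤ 2 * (K * Real.exp (|c| * T)) / h := by
  unfold fluxQuot
  rw [abs_div, abs_of_pos hh]
  gcongr
  have h1 := hφ.abs_flux_waveExt_le (c := c) ht htT (x + h)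
  have h2 := hφ.abs_flux_waveExt_le (c := c) ht htT x
  linarith [abs_sub (flux (waveExt c K φ t (x + h))) (flux (waveExt c K φ t x))]

theorem measurable_fluxQuot (h : ℝ) : Measurable fun p : ℝ × ℝ => fluxQuot c K φ h p.1 p.2 := by
  have h1 := measurable_flux.comp (hφ.measurable_waveExt (c := c))
  have h0 : Measurable fun p : ℝ × ℝ => (p.1, p.2 + h) := by fun_prop
  exact ((h1.comp h0).sub h1).div_const h

theorem measurable_flux_waveExt (t : ℝ) : Measurable fun y => flux (waveExt c K φ t y) :=
  measurable_flux.comp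
    ((hφ.measurable_waveExt (c := c)).comp (by fun_prop : Measurable fun y : ℝ => (t, y)))

theorem intervalIntegrable_flux_waveExt {t : ℝ} (ht : 0 ≤ t) (a b : ℝ) :
    IntervalIntegrable (fun y => flux (waveExt c K φ t y)) volume a b := by
  rw [intervalIntegrable_iff]
  refine Measure.integrableOn_of_bounded (M := K * Real.exp (|c| * t)) (by simp)
    (hφ.measurable_flux_waveExt t).aestronglyMeasurable ?_
  filter_upwards with y
  exact hφ.abs_flux_waveExt_le ht le_rfl y

theorem ae_hasDerivAt_integral_flux {t : ℝ} (ht : 0 ≤ t) : ∀ᵐ x,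
    HasDerivAt (fun x => ∫ y in (0)..x, flux (waveExt c K φ t y)) (flux (waveExt c K φ t x)) x := by
  have : LocallyIntegrable (fun y => flux (waveExt c K φ t y)) volume := by
    intro x
    refine ⟨Ioc (x - 1) (x + 1), Ioc_mem_nhds (by linarith) (by linarith), ?_⟩
    exact (intervalIntegrable_iff_integrableOn_Ioc_of_le (by linarith)).1
      (hφ.intervalIntegrable_flux_waveExt ht _ _)
  filter_upwards [LocallyIntegrable.ae_hasDerivAt_integral this] with x hx
  exact hx 0

theorem fluxMean_eq {t h : ℝ} (ht : 0 ≤ t) (x : ℝ) : fluxMean c K φ h t x =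
    ((∫ y in (0)..(x + h), flux (waveExt c K φ t y)) -
      ∫ y in (0)..x, flux (waveExt c K φ t y)) / h := by
  unfold fluxMean
  rw [intervalIntegral.integral_interval_sub_left] <;>
    exact hφ.intervalIntegrable_flux_waveExt ht _ _

theorem ae_hasDerivAt_fluxMean {t : ℝ} (h : ℝ) (ht : 0 ≤ t) : ∀ᵐ x,
    HasDerivAt (fluxMean c K φ h t) (fluxQuot c K φ h t x) x := by
  have h1 := hφ.ae_hasDerivAt_integral_flux (c := c) ht
  have h2 := (measurePreserving_add_right (volume : Measure ℝ) h).quasiMeasurePreserving.ae h1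
  filter_upwards [h1, h2] with x e1 e2
  have e3 := (((e2.comp_add_const x h).sub e1).div_const h)
  refine e3.congr_of_eventuallyEq (Eventually.of_forall fun y => ?_)
  exact hφ.fluxMean_eq ht y

theorem absolutelyContinuous_fluxMean {t : ℝ} (h a b : ℝ) (ht : 0 ≤ t) :
    AbsolutelyContinuousOnInterval (fluxMean c K φ h t) a b := by
  have hl : LipschitzWith (Real.toNNReal (K * Real.exp (|c| * t)))
      fun x => ∫ y in (0)..x, flux (waveExt c K φ t y) := by
    refine LipschitzWith.of_dist_le_mul fun x y => ?_
    have hK := hφ.K_pos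
    rw [Real.dist_eq, Real.dist_eq, Real.coe_toNNReal _ (by positivity),
      intervalIntegral.integral_interval_sub_left]
    · exact intervalIntegral.norm_integral_le_of_norm_le_const (C := K * Real.exp (|c| * t))
        (f := fun y => flux (waveExt c K φ t y)) fun z _ => hφ.abs_flux_waveExt_le ht le_rfl z
    all_goals exact hφ.intervalIntegrable_flux_waveExt ht _ _
  have h1 : AbsolutelyContinuousOnInterval
      (fun x => ∫ y in (0)..x, flux (waveExt c K φ t y)) a b :=
    hl.lipschitzOnWith.absolutelyContinuousOnInterval
  have h2 : AbsolutelyContinuousOnInterval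
      (fun x => ∫ y in (0)..(x + h), flux (waveExt c K φ t y)) a b :=
    (LipschitzWith.comp hl
      (Isometry.lipschitz (isometry_add_right h))).lipschitzOnWith.absolutelyContinuousOnInterval
  have := (h2.sub h1).const_mul h⁻¹
  convert this using 2 with x
  simp only [Pi.sub_apply]
  rw [hφ.fluxMean_eq ht x, div_eq_inv_mul]

theorem abs_fluxMean_le {T t h : ℝ} (hh : 0 < h) (ht : 0 ≤ t) (htT : t ≤ T) (x : ℝ) :
    |fluxMean c K φ h t x| ≤ K * Real.exp (|c| * T) := by
  unfold fluxMean
  rw [abs_div, abs_of_pos hh, div_le_iff₀ hh]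
  have := intervalIntegral.norm_integral_le_of_norm_le_const (a := x) (b := x + h)
    (f := fun y => flux (waveExt c K φ t y)) fun z _ =>
        hφ.abs_flux_waveExt_le (c := c) ht htT z
  simpa [abs_of_pos hh] using this

theorem ae_hasDerivAt_waveMean_space {t : ℝ} (h : ℝ) :
    ∀ᵐ x, HasDerivAt (waveMean c K φ h t) ((waveExt c K φ t (x + h) - waveExt c K φ t x) / h) x := by
  have h1 := (hφ.lipschitzWith_potentialExt (c := c) t).ae_differentiableAt (μ := volume)
  have h2 := (measurePreserving_add_right (volume : Measure ℝ) h).quasiMeasurePreserving.ae h1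
  filter_upwards [h1, h2] with x e1 e2
  have e3 := (((e2.hasDerivAt.comp_add_const x h).sub e1.hasDerivAt).div_const h).const_mul
    (Real.exp (c * t))
  refine e3.congr_deriv ?_
  unfold waveExt
  ring

theorem absolutelyContinuous_waveMean_space (h t a b : ℝ) :
    AbsolutelyContinuousOnInterval (waveMean c K φ h t) a b := by
  have hl := hφ.lipschitzWith_potentialExt (c := c) t
  have h1 : AbsolutelyContinuousOnInterval (potentialExt c K φ t) a b :=
    hl.lipschitzOnWith.absolutelyContinuousOnInterval
  have h2 : AbsolutelyContinuousOnInterval (fun x => potentialExt c K φ t (x + h)) a b :=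
    (LipschitzWith.comp hl
      (Isometry.lipschitz (isometry_add_right h))).lipschitzOnWith.absolutelyContinuousOnInterval
  have := (h2.sub h1).const_mul (Real.exp (c * t) * h⁻¹)
  convert this using 2 with x
  simp only [Pi.sub_apply, waveMean]
  ring

theorem ae_tendsto_fluxMean {t : ℝ} (ht : 0 ≤ t) {r : ℕ → ℝ} (hr : Tendsto r atTop (𝓝[≠] 0)) :
    ∀ᵐ x, Tendsto (fun n => fluxMean c K φ (r n) t x) atTop (𝓝 (flux (waveExt c K φ t x))) := by
  filter_upwards [hφ.ae_hasDerivAt_integral_flux (c := c) ht] with x e2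
  simp only [hφ.fluxMean_eq ht]
  exact e2.tendsto_slope_seq hr

/-- Entropy balance in space at a fixed time. -/
theorem entropy_balance_space {η η' η'' q : ℝ → ℝ} (he : EntropyPair η η' η'' q) {R h t B : ℝ}
    (hR : 0 < R) (hh : 0 < h) (ht : 0 < t) {g g' : ℝ → ℝ}
    (hg : ∀ x, HasDerivAt g (g' x) x) (hg' : Continuous g') (hgR : g R = 0) (hgR' : g (-R) = 0)
    (hB : ∀ x ∈ Icc (-R) R, ∀ d ≤ Real.exp (c * t) * C,
      η'' (waveMean c K φ h t x) * d * g x + η' (waveMean c K φ h t x) * g' x ≤ B) :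
    -(B * ∫ x in (-R)..R, (fluxMean c K φ h t x - flux (waveMean c K φ h t x))) ≤
      ∫ x in (-R)..R, (η' (waveMean c K φ h t x) * g x * fluxQuot c K φ h t x +
        q (waveMean c K φ h t x) * g' x) := by
  have hW : Continuous (waveMean c K φ h t) :=
    (hφ.continuous_waveMean (c := c) h).comp (by fun_prop : Continuous fun y : ℝ => (t, y))
  have hgc : Continuous g := continuous_iff_continuousAt.2 fun x => (hg x).continuousAt
  have hqc : Continuous fun x => q (waveMean c K φ h t x) :=
    he.continuousOn_flux.comp_continuous hW
      fun x => lt_of_le_of_lt (hφ.waveMean_nonpos hh t x) one_pos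
  refine entropy_balance_line he hR (hφ.absolutelyContinuous_waveMean_space h t _ _)
    (fun x => hφ.waveMean_mem hh ht.le le_rfl x)
    (hφ.absolutelyContinuous_fluxMean h _ _ ht.le) (hφ.ae_hasDerivAt_waveMean_space h)
    (hφ.ae_hasDerivAt_fluxMean h ht.le) hg hg' hgR hgR' (fun x => hφ.flux_waveMean_le hh ht.le x)
    ?_ ?_
  · filter_upwards [hφ.ae_waveExt_sub_le (c := c) ht hh] with x hx hxm
    exact hB x hxm _ hx
  · refine IntervalIntegrable.add ?_ ((hqc.mul hg').intervalIntegrable _ _)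
    have h1 : IntervalIntegrable (fluxQuot c K φ h t) volume (-R) R := by
      rw [intervalIntegrable_iff]
      refine Measure.integrableOn_of_bounded (M := 2 * (K * Real.exp (|c| * t)) / h) (by simp)
        ((hφ.measurable_fluxQuot h).comp
          (by fun_prop : Measurable fun y : ℝ => (t, y))).aestronglyMeasurable ?_
      filter_upwards with y
      exact hφ.abs_fluxQuot_le hh ht.le le_rfl y
    exact h1.continuousOn_mul ((he.continuous_deriv.comp hW).mul hgc).continuousOn

/-- The deficit in Jensen's inequality tends to zero. -/
theorem tendsto_integral_deficit {t R : ℝ} (ht : 0 ≤ t) {r : ℕ → ℝ} (hr0 : ∀ n, 0 < r n)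
    (hr : Tendsto r atTop (𝓝[≠] 0)) :
    Tendsto (fun n => ∫ x in (-R)..R, (fluxMean c K φ (r n) t x - flux (waveMean c K φ (r n) t x)))
      atTop (𝓝 0) := by
  have h0 : (0 : ℝ) = ∫ x in (-R)..R, (0 : ℝ) := by simp
  rw [h0]
  have hW : ∀ h, Continuous (waveMean c K φ h t) := fun h =>
    (hφ.continuous_waveMean (c := c) h).comp (by fun_prop : Continuous fun y : ℝ => (t, y))
  have hF : ∀ h, Continuous (fluxMean c K φ h t) := fun h => by
    rw [← continuousOn_univ]
    intro x _
    have := (hφ.absolutelyContinuous_fluxMean (c := c) h (x - 1) (x + 1) ht).continuousOn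
    rw [uIcc_of_le (by linarith)] at this
    exact (this.continuousAt (Icc_mem_nhds (by linarith) (by linarith))).continuousWithinAt
  refine intervalIntegral.tendsto_integral_filter_of_dominated_convergence
    (fun _ => 2 * (K * Real.exp (|c| * t))) ?_ ?_ (by simp) ?_
  · refine Eventually.of_forall fun n => ?_
    exact ((hF _).measurable.sub (measurable_flux.comp (hW _).measurable)).aestronglyMeasurable
  · refine Eventually.of_forall fun n => Eventually.of_forall fun x _ => ?_
    have h1 := hφ.abs_fluxMean_le (c := c) (hr0 n) ht le_rfl x
    have h2 := (abs_flux_le (hφ.waveMean_nonpos (c := c) (hr0 n) t x))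
    have h3 := hφ.waveMean_mem (c := c) (hr0 n) ht le_rfl x
    rw [abs_of_nonpos h3.2] at h2
    rw [Real.norm_eq_abs]
    linarith [abs_sub (fluxMean c K φ (r n) t x) (flux (waveMean c K φ (r n) t x)), h3.1]
  · filter_upwards [(hφ.lipschitzWith_potentialExt (c := c) t).ae_differentiableAt (μ := volume),
      hφ.ae_tendsto_fluxMean (c := c) ht hr] with x e1 e2 _
    have e3 := ((hasDerivAt_flux (lt_of_le_of_lt (hφ.waveExt_nonpos (c := c) t x)
      one_pos)).continuousAt.tendsto).comp (tendsto_waveMean e1 hr)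
    simpa using e2.sub e3

/-- The entropy inequality on a rectangle for a smooth entropy. -/
theorem entropy_inequality_smooth {η η' η'' q : ℝ → ℝ} (he : EntropyPair η η' η'' q) {T R : ℝ}
    (hT : 0 < T) (hR : 0 < R) {g gt gx : ℝ × ℝ → ℝ}
    (hgt : ∀ t x, HasDerivAt (fun s => g (s, x)) (gt (t, x)) t)
    (hgx : ∀ t x, HasDerivAt (fun y => g (t, y)) (gx (t, x)) x)
    (cg : Continuous g) (cgt : Continuous gt) (cgx : Continuous gx) (hg0 : ∀ p, 0 ≤ g p)
    (hgT : ∀ x, g (T, x) = 0) (hgR : ∀ t, g (t, R) = 0) (hgR' : ∀ t, g (t, -R) = 0) :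
    0 ≤ (∫ p in Ioc 0 T ×ˢ Ioc (-R) R, (η (waveExt c K φ p.1 p.2) * gt p
        + q (waveExt c K φ p.1 p.2) * gx p
        + c * η' (waveExt c K φ p.1 p.2) * waveExt c K φ p.1 p.2 * g p))
      + ∫ x in Ioc (-R) R, η (φ x) * g (0, x) := by
  set M := K * Real.exp (|c| * T) with hM
  set S : Set (ℝ × ℝ) := Ioc 0 T ×ˢ Ioc (-R) R with hS
  have hSm : MeasurableSet S := measurableSet_Ioc.prod measurableSet_Ioc
  have hμ : (volume.restrict S : Measure (ℝ × ℝ)) =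
      (volume.restrict (Ioc 0 T)).prod (volume.restrict (Ioc (-R) R)) := by
    rw [Measure.prod_restrict, Measure.volume_eq_prod]
  have hSK : S ⊆ Icc 0 T ×ˢ Icc (-R) R := prod_mono Ioc_subset_Icc_self Ioc_subset_Icc_self
  have hKc : IsCompact (Icc 0 T ×ˢ Icc (-R) R) := isCompact_Icc.prod isCompact_Icc
  have hci : ∀ {f : ℝ × ℝ → ℝ}, Continuous f → IntegrableOn f S := fun hf =>
    (hf.continuousOn.integrableOn_compact hKc).mono_set hSK
  have hfin : volume S < ⊤ := lt_of_le_of_lt (measure_mono hSK) hKc.measure_lt_top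
  let r : ℕ → ℝ := fun n => 1 / ((n : ℝ) + 1)
  have hr0 : ∀ n, 0 < r n := fun n => Nat.one_div_pos_of_nat
  have hr : Tendsto r atTop (𝓝[≠] 0) := tendsto_nhdsWithin_iff.2
    ⟨tendsto_one_div_add_atTop_nhds_zero_nat, Eventually.of_forall fun n => (hr0 n).ne'⟩
  have cW : ∀ n, Continuous fun p : ℝ × ℝ => waveMean c K φ (r n) p.1 p.2 := fun n =>
    hφ.continuous_waveMean (r n)
  have cη := he.continuous
  have cη' := he.continuous_deriv
  have cη'' := he.cont
  have cqW : ∀ n, Continuous fun p : ℝ × ℝ => q (waveMean c K φ (r n) p.1 p.2) := fun n =>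
    he.continuousOn_flux.comp_continuous (cW n)
      fun p => lt_of_le_of_lt (hφ.waveMean_nonpos (hr0 n) _ _) one_pos
  -- a bound for the one-sided derivatives
  obtain ⟨B, hB0, hB⟩ : ∃ B, 0 ≤ B ∧ ∀ p ∈ Icc 0 T ×ˢ Icc (-R) R, ∀ w ∈ Icc (-M) 0,
      η'' w * (Real.exp (|c| * T) * C) * g p + η' w * gx p ≤ B := by
    obtain ⟨B, hB⟩ := (hKc.prod (isCompact_Icc (a := -M) (b := 0))).exists_bound_of_continuousOn
      (f := fun z : (ℝ × ℝ) × ℝ =>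
        η'' z.2 * (Real.exp (|c| * T) * C) * g z.1 + η' z.2 * gx z.1)
      (by fun_prop)
    exact ⟨max B 0, le_max_right _ _, fun p hp w hw =>
      (le_abs_self _).trans ((hB (p, w) ⟨hp, hw⟩).trans (le_max_left _ _))⟩
  let X : ℕ → ℝ → ℝ := fun n t => ∫ x in Ioc (-R) R,
    (η' (waveMean c K φ (r n) t x) * g (t, x) * fluxQuot c K φ (r n) t x +
        q (waveMean c K φ (r n) t x) * gx (t, x))
  let ε : ℕ → ℝ → ℝ := fun n t => ∫ x in (-R)..R,
    (fluxMean c K φ (r n) t x - flux (waveMean c K φ (r n) t x))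
  have hX : ∀ n, ∀ t ∈ Ioc 0 T, -(B * ε n t) ≤ X n t := by
    intro n t ht
    have := hφ.entropy_balance_space (c := c) he (B := B) hR (hr0 n) ht.1 (g := fun x => g (t, x))
      (g' := fun x => gx (t, x)) (hgx t) (by fun_prop) (hgR t) (hgR' t) ?_
    · rwa [intervalIntegral.integral_of_le (a := -R) (b := R) (f := fun x =>
        η' (waveMean c K φ (r n) t x) * g (t, x) * fluxQuot c K φ (r n) t x +
        q (waveMean c K φ (r n) t x) * gx (t, x)) (by linarith)] at this
    · intro x hx d hd
      refine le_trans ?_ (hB (t, x) ⟨⟨ht.1.le, ht.2⟩, hx⟩ _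
        (hφ.waveMean_mem (hr0 n) ht.1.le ht.2 x))
      have h1 : d ≤ Real.exp (|c| * T) * C :=
        hd.trans (mul_le_mul_of_nonneg_right (exp_mul_le ht.1.le ht.2) hφ.C_nonneg)
      have h2 := he.nonneg (waveMean c K φ (r n) t x)
      have h3 := hg0 (t, x)
      gcongr
  have hε : ∀ n, ∀ t ∈ Ioc 0 T, 0 ≤ ε n t ∧ ε n t ≤ 2 * M * (2 * R) := by
    intro n t ht
    have hb : ∀ x, fluxMean c K φ (r n) t x - flux (waveMean c K φ (r n) t x) ≤ 2 * M := fun x => by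
      have h1 := hφ.abs_fluxMean_le (c := c) (hr0 n) ht.1.le ht.2 x
      have h2 := (abs_flux_le (hφ.waveMean_nonpos (c := c) (hr0 n) t x))
      have h3 := hφ.waveMean_mem (c := c) (hr0 n) ht.1.le ht.2 x
      rw [abs_of_nonpos h3.2] at h2
      linarith [le_abs_self (fluxMean c K φ (r n) t x),
        neg_abs_le (flux (waveMean c K φ (r n) t x)), h3.1]
    have h0 : ∀ x, 0 ≤ fluxMean c K φ (r n) t x - flux (waveMean c K φ (r n) t x) := fun x =>
      sub_nonneg.2 (hφ.flux_waveMean_le (hr0 n) ht.1.le x)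
    refine ⟨intervalIntegral.integral_nonneg (by linarith) fun x _ => h0 x, ?_⟩
    have := intervalIntegral.norm_integral_le_of_norm_le_const (a := -R) (b := R) (C := 2 * M)
      (f := fun x => fluxMean c K φ (r n) t x - flux (waveMean c K φ (r n) t x))
      fun x _ => by rw [Real.norm_eq_abs, abs_of_nonneg (h0 x)]; exact hb x
    have h2 : R - -R = 2 * R := by ring
    rw [h2, abs_of_pos (by linarith : 0 < 2 * R)] at this
    exact (le_abs_self _).trans this
  -- integrability
  have i3 : ∀ n, Integrable (fun p : ℝ × ℝ => η' (waveMean c K φ (r n) p.1 p.2) * g p *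
      fluxQuot c K φ (r n) p.1 p.2) (volume.restrict S) := by
    intro n
    refine Integrable.mul_bdd (c := 2 * M / r n) (hci (by fun_prop))
      (hφ.measurable_fluxQuot (r n)).aestronglyMeasurable ?_
    rw [ae_restrict_iff' hSm]
    exact Eventually.of_forall fun p hp => hφ.abs_fluxQuot_le (hr0 n) hp.1.1.le hp.1.2 p.2
  have i1 : ∀ n, Integrable (fun p : ℝ × ℝ => η (waveMean c K φ (r n) p.1 p.2) * gt p +
      c * η' (waveMean c K φ (r n) p.1 p.2) * waveMean c K φ (r n) p.1 p.2 * g p)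
      (volume.restrict S) := fun n => hci (by fun_prop)
  have i2 : ∀ n, Integrable (fun p : ℝ × ℝ => q (waveMean c K φ (r n) p.1 p.2) * gx p)
      (volume.restrict S) := fun n => hci ((cqW n).mul cgx)
  let I : ℕ → ℝ := fun n => (∫ p in S, (η (waveMean c K φ (r n) p.1 p.2) * gt p
        + q (waveMean c K φ (r n) p.1 p.2) * gx p
        + c * η' (waveMean c K φ (r n) p.1 p.2) * waveMean c K φ (r n) p.1 p.2 * g p))
      + ∫ x in Ioc (-R) R, η (waveMean c K φ (r n) 0 x) * g (0, x)
  have i32 := fun n => (i3 n).add (i2 n)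
  -- Fubini in both orders: the balance in time holds for fixed `x`, the one in space for fixed `t`.
  -- The two copies of the term with the flux quotient cancel.
  have hI : ∀ n, I n = ∫ t in Ioc 0 T, X n t := by
    intro n
    have e1 : ∫ p in S, ((η (waveMean c K φ (r n) p.1 p.2) * gt p +
        c * η' (waveMean c K φ (r n) p.1 p.2) * waveMean c K φ (r n) p.1 p.2 * g p) -
        η' (waveMean c K φ (r n) p.1 p.2) * g p * fluxQuot c K φ (r n) p.1 p.2)
        = - ∫ x in Ioc (-R) R, η (waveMean c K φ (r n) 0 x) * g (0, x) := by
      have ii := (i1 n).sub (i3 n)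
      rw [hμ] at ii ⊢
      refine (integral_prod_symm _ ii).trans ?_
      rw [← integral_neg]
      refine integral_congr_ae (ae_restrict_of_ae ?_)
      filter_upwards [hφ.ae_entropy_balance_time (c := c) he hT.le (hr0 n) hgt cgt hgT] with x hx
      rw [intervalIntegral.integral_of_le hT.le] at hx
      exact hx
    have e2 : ∫ t in Ioc 0 T, X n t = ∫ p in S, (η' (waveMean c K φ (r n) p.1 p.2) * g p *
        fluxQuot c K φ (r n) p.1 p.2 + q (waveMean c K φ (r n) p.1 p.2) * gx p) := by
      have ii := i32 n
      rw [hμ] at ii ⊢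
      exact (integral_prod _ ii).symm
    rw [e2]
    have e3 := integral_add ((i1 n).sub (i3 n)) (i32 n)
    simp only [Pi.sub_apply, Pi.add_apply] at e3
    rw [e1] at e3
    have e4 : (∫ p in S, (η (waveMean c K φ (r n) p.1 p.2) * gt p
        + q (waveMean c K φ (r n) p.1 p.2) * gx p
        + c * η' (waveMean c K φ (r n) p.1 p.2) * waveMean c K φ (r n) p.1 p.2 * g p)) = _ :=
      (integral_congr_ae (Eventually.of_forall fun p => by ring)).trans e3
    simp only [I]
    rw [e4]
    ring
  have iX : ∀ n, Integrable (X n) (volume.restrict (Ioc 0 T)) := by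
    intro n
    have ii := i32 n
    rw [hμ] at ii
    exact ii.integral_prod_left
  -- Only the negative part of `X n` is under control: it is at most `B` times the deficit, which
  -- tends to zero boundedly.
  have hmin : Tendsto (fun n => ∫ t in Ioc 0 T, min (X n t) 0) atTop (𝓝 0) := by
    have h0 : 𝓝 (0 : ℝ) = 𝓝 (∫ t in Ioc 0 T, (0 : ℝ)) := by simp
    rw [h0]
    have hlow : ∀ n, ∀ t ∈ Ioc 0 T, |min (X n t) 0| ≤ B * ε n t := by
      intro n t ht
      rw [abs_of_nonpos (min_le_right _ _)]
      have := mul_nonneg hB0 (hε n t ht).1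
      rcases min_cases (X n t) 0 with h | h <;> rw [h.1] <;> linarith [hX n t ht]
    refine tendsto_integral_of_dominated_convergence (fun _ => B * (2 * M * (2 * R)))
      (fun n => ((iX n).aestronglyMeasurable.aemeasurable.min
        aemeasurable_const).aestronglyMeasurable) (integrable_const _) ?_ ?_
    · intro n
      rw [ae_restrict_iff' measurableSet_Ioc]
      exact Eventually.of_forall fun t ht =>
        (hlow n t ht).trans (mul_le_mul_of_nonneg_left (hε n t ht).2 hB0)
    · rw [ae_restrict_iff' measurableSet_Ioc]
      refine Eventually.of_forall fun t ht => ?_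
      refine squeeze_zero_norm (fun n => hlow n t ht) ?_
      simpa using (hφ.tendsto_integral_deficit (c := c) (R := R) ht.1.le hr0 hr).const_mul B
  have hlim : Tendsto I atTop (𝓝 ((∫ p in S, (η (waveExt c K φ p.1 p.2) * gt p
        + q (waveExt c K φ p.1 p.2) * gx p
        + c * η' (waveExt c K φ p.1 p.2) * waveExt c K φ p.1 p.2 * g p))
      + ∫ x in Ioc (-R) R, η (φ x) * g (0, x))) := by
    refine Tendsto.add ?_ ?_
    · obtain ⟨D, hD⟩ := (hKc.prod (isCompact_Icc (a := -M) (b := 0))).exists_bound_of_continuousOn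
        (f := fun z : (ℝ × ℝ) × ℝ =>
          η z.2 * gt z.1 + q z.2 * gx z.1 + c * η' z.2 * z.2 * g z.1) (by
          have : ContinuousOn (fun z : (ℝ × ℝ) × ℝ => q z.2)
              ((Icc 0 T ×ˢ Icc (-R) R) ×ˢ Icc (-M) 0) :=
            he.continuousOn_flux.comp (by fun_prop)
              (fun z hz => lt_of_le_of_lt hz.2.2 one_pos)
          exact (((by fun_prop : Continuous fun z : (ℝ × ℝ) × ℝ => η z.2 * gt z.1).continuousOn).add
            (this.mul (by fun_prop : Continuous fun z : (ℝ × ℝ) × ℝ => gx z.1).continuousOn)).add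
            (by fun_prop : Continuous fun z : (ℝ × ℝ) × ℝ =>
              c * η' z.2 * z.2 * g z.1).continuousOn)
      refine tendsto_integral_of_dominated_convergence (fun _ => D) (fun n => ?_)
        (integrableOn_const hfin.ne) (fun n => ?_) ?_
      · exact (((((cη.comp (cW n)).mul cgt).add ((cqW n).mul cgx))).add
          (by fun_prop)).aestronglyMeasurable
      · rw [ae_restrict_iff' hSm]
        exact Eventually.of_forall fun p hp => hD (p, _) ⟨hSK hp,
          hφ.waveMean_mem (hr0 n) hp.1.1.le hp.1.2 p.2⟩
      · refine ae_restrict_of_ae ?_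
        filter_upwards [hφ.ae_differentiableAt_potentialExt (c := c)] with p hp
        have h1 := tendsto_waveMean hp hr
        have h2 := ((he.flux _ (lt_of_le_of_lt (hφ.waveExt_nonpos (c := c) p.1 p.2)
          one_pos)).continuousAt.tendsto).comp h1
        have h3 := (cη.tendsto _).comp h1
        have h4 := (cη'.tendsto _).comp h1
        exact ((h3.mul_const _).add (h2.mul_const _)).add
          (((h4.const_mul c).mul h1).mul_const _)
    · obtain ⟨D, hD⟩ := ((isCompact_Icc (a := -R) (b := R)).prod
        (isCompact_Icc (a := -M) (b := 0))).exists_bound_of_continuousOn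
        (f := fun z : ℝ × ℝ => η z.2 * g (0, z.1)) (by fun_prop)
      refine tendsto_integral_of_dominated_convergence (fun _ => D) (fun n => ?_)
        (by simp) (fun n => ?_) ?_
      · have : Continuous fun x => waveMean c K φ (r n) 0 x :=
          (cW n).comp (by fun_prop : Continuous fun y : ℝ => ((0 : ℝ), y))
        exact (by fun_prop : Continuous fun x =>
          η (waveMean c K φ (r n) 0 x) * g (0, x)).aestronglyMeasurable
      · rw [ae_restrict_iff' measurableSet_Ioc]
        exact Eventually.of_forall fun x hx => hD (x, _) ⟨Ioc_subset_Icc_self hx,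
          hφ.waveMean_mem (hr0 n) le_rfl hT.le x⟩
      · refine Eventually.of_forall fun x => ?_
        have h1 := (hφ.hasDerivAt_mass x).tendsto_slope_seq hr
        simp only [hφ.waveMean_zero]
        exact ((cη.tendsto _).comp h1).mul_const _
  refine le_of_tendsto_of_tendsto' hmin hlim fun n => ?_
  rw [hI]
  exact integral_mono (f := fun t => min (X n t) 0) ((iX n).inf (integrable_zero _ _ _)) (iX n)
    fun t => min_le_left _ _

end IsProfile


/-! ### Kruzhkov entropies -/

/-- The derivative of the regularized modulus `√((v - k)² + ε²)`. -/
noncomputable def smoothSign (ε k v : ℝ) : ℝ := (v - k) / √((v - k) ^ 2 + ε ^ 2)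

/-- The entropy flux of the regularized modulus. -/
noncomputable def smoothFlux (ε k v : ℝ) : ℝ :=
  ∫ y in k..v, smoothSign ε k y * ((1 + y) / (1 - y))

theorem continuous_smoothSign {ε : ℝ} (hε : ε ≠ 0) (k : ℝ) : Continuous (smoothSign ε k) := by
  unfold smoothSign
  refine Continuous.div (by fun_prop) (by fun_prop) fun v => ?_
  positivity

theorem abs_smoothSign_le (ε k v : ℝ) : |smoothSign ε k v| ≤ 1 := by
  unfold smoothSign
  rw [abs_div, abs_of_nonneg (Real.sqrt_nonneg _)]
  refine div_le_one_of_le₀ (Real.abs_le_sqrt ?_) (Real.sqrt_nonneg _)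
  nlinarith [sq_nonneg ε]

theorem uIcc_subset_Iio_one {k v : ℝ} (hk : k < 1) (hv : v < 1) : uIcc k v ⊆ Iio 1 := fun _ hy =>
  lt_of_le_of_lt hy.2 (max_lt hk hv)

theorem entropyPair_smooth {ε k : ℝ} (hε : ε ≠ 0) (hk : k < 1) :
    EntropyPair (fun v => √((v - k) ^ 2 + ε ^ 2)) (smoothSign ε k)
      (fun v => ε ^ 2 / (√((v - k) ^ 2 + ε ^ 2) * ((v - k) ^ 2 + ε ^ 2))) (smoothFlux ε k) := by
  have hpos : ∀ v : ℝ, 0 < (v - k) ^ 2 + ε ^ 2 := fun v => by positivity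
  have hd : ∀ v, HasDerivAt (fun v => √((v - k) ^ 2 + ε ^ 2)) (smoothSign ε k v) v := by
    intro v
    have h1 : HasDerivAt (fun v : ℝ => (v - k) ^ 2 + ε ^ 2) (2 * (v - k)) v := by
      have := (((hasDerivAt_id v).sub_const k).pow 2).add_const (ε ^ 2)
      simpa using this
    refine (h1.sqrt (hpos v).ne').congr_deriv ?_
    unfold smoothSign
    rw [mul_div_mul_left _ _ two_ne_zero]
  refine ⟨hd, fun v => ?_, ?_, fun v => by positivity, fun v hv => ?_⟩
  · have h2 := ((hasDerivAt_id v).sub_const k).div (hd v) (Real.sqrt_pos.2 (hpos v)).ne'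
    refine h2.congr_deriv ?_
    have h3 := Real.sq_sqrt (hpos v).le
    have h4 := Real.sqrt_pos.2 (hpos v)
    unfold smoothSign
    simp only [id]
    have h5 := hpos v
    field_simp
    rw [h3]
    ring
  · refine Continuous.div (by fun_prop) (by fun_prop) fun v => ?_
    have := hpos v
    positivity
  · have hc : ContinuousOn (fun y => smoothSign ε k y * ((1 + y) / (1 - y))) (Iio 1) :=
      (continuous_smoothSign hε k).continuousOn.mul continuousOn_speed
    exact intervalIntegral.integral_hasDerivAt_right
      (hc.mono (uIcc_subset_Iio_one hk hv)).intervalIntegrable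
      (hc.stronglyMeasurableAtFilter isOpen_Iio v hv) (hc.continuousAt (Iio_mem_nhds hv))

theorem tendsto_smoothSign {r : ℕ → ℝ} (hr : Tendsto r atTop (𝓝 0)) (k v : ℝ) :
    Tendsto (fun n => smoothSign (r n) k v) atTop (𝓝 (Real.sign (v - k))) := by
  rcases eq_or_ne v k with rfl | h
  · simp [smoothSign]
  · have h0 : v - k ≠ 0 := sub_ne_zero.2 h
    have h1 : Tendsto (fun n => √((v - k) ^ 2 + r n ^ 2)) atTop (𝓝 |v - k|) := by
      have : Tendsto (fun n => (v - k) ^ 2 + r n ^ 2) atTop (𝓝 ((v - k) ^ 2 + 0 ^ 2)) :=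
        (hr.pow 2).const_add _
      rw [← Real.sqrt_sq_eq_abs]
      simpa using this.sqrt
    have h2 := (tendsto_const_nhds (x := v - k)).div h1 (abs_pos.2 h0).ne'
    have h3 : (v - k) / |v - k| = Real.sign (v - k) := by
      rcases lt_or_gt_of_ne h0 with hn | hp
      · rw [Real.sign_of_neg hn, abs_of_neg hn, div_neg, div_self h0]
      · rw [Real.sign_of_pos hp, abs_of_pos hp, div_self h0]
    rw [← h3]
    exact h2

theorem tendsto_smoothFlux {r : ℕ → ℝ} (hr : Tendsto r atTop (𝓝 0)) {k v : ℝ} (hk : k < 1)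
    (hv : v < 1) (hr0 : ∀ n, r n ≠ 0) :
    Tendsto (fun n => smoothFlux (r n) k v) atTop
      (𝓝 (Real.sign (v - k) * (flux v - flux k))) := by
  have hc := continuousOn_speed.mono (uIcc_subset_Iio_one hk hv)
  have h1 : ∫ y in k..v, Real.sign (v - k) * ((1 + y) / (1 - y)) =
      Real.sign (v - k) * (flux v - flux k) := by
    rw [intervalIntegral.integral_const_mul]
    rw [intervalIntegral.integral_eq_sub_of_hasDerivAt
      (fun y hy => hasDerivAt_flux (uIcc_subset_Iio_one hk hv hy)) hc.intervalIntegrable]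
  rw [← h1]
  refine intervalIntegral.tendsto_integral_filter_of_dominated_convergence
    (fun y => |(1 + y) / (1 - y)|) (Eventually.of_forall fun n => ?_)
    (Eventually.of_forall fun n => Eventually.of_forall fun y _ => ?_)
    hc.intervalIntegrable.abs ?_
  · refine (ContinuousOn.aestronglyMeasurable ?_ measurableSet_uIoc)
    exact ((continuous_smoothSign (hr0 n) k).continuousOn.mul hc).mono uIoc_subset_uIcc
  · rw [norm_mul]
    exact mul_le_of_le_one_left (norm_nonneg _) (abs_smoothSign_le _ _ _)
  -- Between `k` and `v` the sign of `y - k` is constant except at `k` itself.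
  · have hne : ∀ᵐ y : ℝ, y ≠ k := compl_mem_ae_iff.2 (measure_singleton k)
    filter_upwards [hne] with y hy hyv
    have h3 : Real.sign (y - k) = Real.sign (v - k) := by
      rcases le_total k v with hkv | hkv
      · rw [uIoc_of_le hkv] at hyv
        rw [Real.sign_of_pos (by linarith [hyv.1]), Real.sign_of_pos (by linarith [hyv.1, hyv.2])]
      · rw [uIoc_of_ge hkv] at hyv
        have : y < k := lt_of_le_of_ne hyv.2 hy
        rw [Real.sign_of_neg (by linarith), Real.sign_of_neg (by linarith [hyv.1])]
    rw [← h3]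
    exact (tendsto_smoothSign hr k y).mul_const _

theorem exists_abs_smoothFlux_le {k : ℝ} (hk : k < 1) (M : ℝ) :
    ∃ P, ∀ ε, ∀ v ∈ Icc (-M) 0, |smoothFlux ε k v| ≤ P := by
  obtain ⟨P, hP⟩ := (isCompact_Icc (a := min k (-M)) (b := max k 0)).exists_bound_of_continuousOn
    (continuousOn_speed.mono fun y hy => lt_of_le_of_lt hy.2 (max_lt hk one_pos))
  refine ⟨P * (M + |k|), fun ε v hv => ?_⟩
  have h1 := intervalIntegral.norm_integral_le_of_norm_le_const (a := k) (b := v) (C := P)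
    (f := fun y => smoothSign ε k y * ((1 + y) / (1 - y))) fun y hy => ?_
  · refine h1.trans ?_
    have hP0 : 0 ≤ P := (norm_nonneg _).trans (hP (max k 0) ⟨(min_le_left _ _).trans
      (le_max_left _ _), le_rfl⟩)
    refine mul_le_mul_of_nonneg_left ?_ hP0
    refine (abs_sub _ _).trans ?_
    have : |v| ≤ M := abs_le.2 ⟨hv.1, by linarith [hv.1, hv.2]⟩
    linarith
  · rw [norm_mul]
    refine (mul_le_of_le_one_left (norm_nonneg _) (abs_smoothSign_le _ _ _)).trans (hP y ?_)
    have := uIoc_subset_uIcc hy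
    exact ⟨(min_le_min_left k hv.1).trans this.1, this.2.trans (max_le_max_left k hv.2)⟩

theorem measurable_sign : Measurable Real.sign := by
  unfold Real.sign
  exact Measurable.ite measurableSet_Iio measurable_const
    (Measurable.ite measurableSet_Ioi measurable_const measurable_const)

/-- Kruzhkov's entropy inequality on a rectangle. -/
theorem IsProfile.kruzhkov_inequality {c K C : ℝ} {φ : ℝ → ℝ} (hφ : IsProfile K C φ) {k T R : ℝ}
    (hk : k < 1) (hT : 0 < T) (hR : 0 < R) {g gt gx : ℝ × ℝ → ℝ}
    (hgt : ∀ t x, HasDerivAt (fun s => g (s, x)) (gt (t, x)) t)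
    (hgx : ∀ t x, HasDerivAt (fun y => g (t, y)) (gx (t, x)) x)
    (cg : Continuous g) (cgt : Continuous gt) (cgx : Continuous gx) (hg0 : ∀ p, 0 ≤ g p)
    (hgT : ∀ x, g (T, x) = 0) (hgR : ∀ t, g (t, R) = 0) (hgR' : ∀ t, g (t, -R) = 0) :
    0 ≤ (∫ p in Ioc 0 T ×ˢ Ioc (-R) R, (|wave c K φ p.1 p.2 - k| * gt p
        + Real.sign (wave c K φ p.1 p.2 - k) * (flux (wave c K φ p.1 p.2) - flux k) * gx p
        + c * Real.sign (wave c K φ p.1 p.2 - k) * wave c K φ p.1 p.2 * g p))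
      + ∫ x in Ioc (-R) R, |φ x - k| * g (0, x) := by
  set M := K * Real.exp (|c| * T) with hM
  set S : Set (ℝ × ℝ) := Ioc 0 T ×ˢ Ioc (-R) R with hS
  have hSm : MeasurableSet S := measurableSet_Ioc.prod measurableSet_Ioc
  have hSK : S ⊆ Icc 0 T ×ˢ Icc (-R) R := prod_mono Ioc_subset_Icc_self Ioc_subset_Icc_self
  have hKc : IsCompact (Icc 0 T ×ˢ Icc (-R) R) := isCompact_Icc.prod isCompact_Icc
  have hci : ∀ {f : ℝ × ℝ → ℝ}, Continuous f → IntegrableOn f S := fun hf =>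
    (hf.continuousOn.integrableOn_compact hKc).mono_set hSK
  let r : ℕ → ℝ := fun n => 1 / ((n : ℝ) + 1)
  have hr0 : ∀ n, 0 < r n := fun n => Nat.one_div_pos_of_nat
  have hr1 : ∀ n, r n ≤ 1 := fun n => by
    simp only [r]
    rw [div_le_one (by positivity)]
    linarith [(Nat.cast_nonneg n : (0 : ℝ) ≤ n)]
  have hr : Tendsto r atTop (𝓝 0) := tendsto_one_div_add_atTop_nhds_zero_nat
  obtain ⟨P, hP⟩ := exists_abs_smoothFlux_le hk M
  have hηlim : ∀ v, Tendsto (fun n => √((v - k) ^ 2 + r n ^ 2)) atTop (𝓝 |v - k|) := fun v => by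
    have : Tendsto (fun n => (v - k) ^ 2 + r n ^ 2) atTop (𝓝 ((v - k) ^ 2 + 0 ^ 2)) :=
      (hr.pow 2).const_add _
    rw [← Real.sqrt_sq_eq_abs]
    simpa using this.sqrt
  have hηb : ∀ n, ∀ v ∈ Icc (-M) 0, |√((v - k) ^ 2 + r n ^ 2)| ≤ M + |k| + 1 := fun n v hv => by
    rw [abs_of_nonneg (Real.sqrt_nonneg _)]
    have h0 : 0 ≤ M := by linarith [hv.1, hv.2]
    refine Real.sqrt_le_iff.2 ⟨by positivity, ?_⟩
    have h1 : |v - k| ≤ M + |k| := (abs_sub _ _).trans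
      (add_le_add (abs_le.2 ⟨hv.1, by linarith [hv.2]⟩) le_rfl)
    have h2 : (v - k) ^ 2 ≤ (M + |k|) ^ 2 := sq_le_sq' (by linarith [neg_abs_le (v - k)])
      ((le_abs_self _).trans h1)
    nlinarith [hr0 n, hr1 n, abs_nonneg k]
  have hE := hφ.measurable_waveExt (c := c)
  have hmem : ∀ p ∈ S, waveExt c K φ p.1 p.2 ∈ Icc (-M) 0 := fun p hp =>
    hφ.waveExt_mem hp.1.1.le hp.1.2 p.2
  have key := fun n => hφ.entropy_inequality_smooth (c := c) (entropyPair_smooth (hr0 n).ne' hk)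
    hT hR hgt hgx cg cgt cgx hg0 hgT hgR hgR'
  have hlim := tendsto_integral_of_dominated_convergence (μ := volume.restrict S)
    (F := fun n p => √((waveExt c K φ p.1 p.2 - k) ^ 2 + r n ^ 2) * gt p
        + smoothFlux (r n) k (waveExt c K φ p.1 p.2) * gx p
        + c * smoothSign (r n) k (waveExt c K φ p.1 p.2) * waveExt c K φ p.1 p.2 * g p)
    (f := fun p => |waveExt c K φ p.1 p.2 - k| * gt p
        + Real.sign (waveExt c K φ p.1 p.2 - k) * (flux (waveExt c K φ p.1 p.2) - flux k) * gx p
        + c * Real.sign (waveExt c K φ p.1 p.2 - k) * waveExt c K φ p.1 p.2 * g p)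
    (fun p => (M + |k| + 1) * |gt p| + P * |gx p| + |c| * 1 * M * |g p|) ?_ (hci (by fun_prop)) ?_ ?_
  · have hlim2 := tendsto_integral_of_dominated_convergence (μ := volume.restrict (Ioc (-R) R))
      (F := fun n x => √((φ x - k) ^ 2 + r n ^ 2) * g (0, x))
      (f := fun x => |φ x - k| * g (0, x))
      (fun x => (M + |k| + 1) * |g (0, x)|) ?_
      (((by fun_prop : Continuous fun x => (M + |k| + 1) * |g (0, x)|).continuousOn
        |>.integrableOn_compact isCompact_Icc).mono_set Ioc_subset_Icc_self) ?_ ?_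
    · have h1 := ge_of_tendsto' (hlim.add hlim2) key
      refine h1.trans (le_of_eq ?_)
      congr 1
      refine integral_congr_ae ?_
      rw [Filter.EventuallyEq, ae_restrict_iff' hSm]
      filter_upwards [hφ.ae_waveExt_eq (c := c)] with p hp hpS
      rw [hp hpS.1.1]
    · intro n
      have := hφ.continuous
      exact (by fun_prop : Continuous _).aestronglyMeasurable
    · intro n
      refine Eventually.of_forall fun x => ?_
      rw [norm_mul]
      have h1 : φ x ∈ Icc (-M) 0 := by
        have := hφ.wave_mem (c := c) (T := T) le_rfl hT.le x
        simpa [hφ.wave_zero] using this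
      exact mul_le_mul_of_nonneg_right (hηb n _ h1) (norm_nonneg _)
    · exact Eventually.of_forall fun x => (hηlim _).mul_const _
  · intro n
    have m1 : Measurable fun p : ℝ × ℝ => smoothSign (r n) k (waveExt c K φ p.1 p.2) :=
      (continuous_smoothSign (hr0 n).ne' k).measurable.comp hE
    have m2 : Measurable fun p : ℝ × ℝ => smoothFlux (r n) k (waveExt c K φ p.1 p.2) := by
      -- The entropy flux is only known to be continuous below `1`. Truncation at `0` changes
      -- nothing, because the wave is nonpositive.
      have hc : Continuous fun v => smoothFlux (r n) k (min v 0) :=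
        (entropyPair_smooth (hr0 n).ne' hk).continuousOn_flux.comp_continuous (by fun_prop)
          fun v => lt_of_le_of_lt (min_le_right v 0) one_pos
      have h1 := hc.measurable.comp hE
      simp only [Function.comp_def, min_eq_left (hφ.waveExt_nonpos _ _)] at h1
      exact h1
    have m3 := cg.measurable
    have m4 := cgt.measurable
    have m5 := cgx.measurable
    exact Measurable.aestronglyMeasurable (by fun_prop)
  · intro n
    rw [ae_restrict_iff' hSm]
    refine Eventually.of_forall fun p hp => ?_
    have h1 := hmem p hp
    have h2 : |waveExt c K φ p.1 p.2| ≤ M := abs_le.2 ⟨h1.1, by linarith [h1.1, h1.2]⟩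
    refine (norm_add₃_le).trans ?_
    simp only [norm_mul, Real.norm_eq_abs]
    refine add_le_add (add_le_add ?_ ?_) ?_
    · exact mul_le_mul_of_nonneg_right (hηb n _ h1) (abs_nonneg _)
    · exact mul_le_mul_of_nonneg_right (hP _ _ h1) (abs_nonneg _)
    · have := abs_smoothSign_le (r n) k (waveExt c K φ p.1 p.2)
      gcongr
  · rw [ae_restrict_iff' hSm]
    refine Eventually.of_forall fun p hp => ?_
    have h1 : waveExt c K φ p.1 p.2 < 1 := lt_of_le_of_lt (hφ.waveExt_nonpos _ _) one_pos
    exact (((hηlim _).mul_const _).add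
      ((tendsto_smoothFlux hr hk h1 fun n => (hr0 n).ne').mul_const _)).add
      ((((tendsto_smoothSign hr k _).const_mul c).mul_const _).mul_const _)


/-! ### Slicing the plane -/

/-- The plane as a product of its axes. -/
noncomputable def planeEquiv : ℝ × ℝ ≃ᵐ Plane :=
  MeasurableEquiv.finTwoArrow.symm.trans (MeasurableEquiv.toLp 2 (Fin 2 → ℝ))

theorem planeEquiv_apply (p : ℝ × ℝ) : planeEquiv p = !₂[p.1, p.2] := by
  ext i; fin_cases i <;> rfl

theorem measurePreserving_planeEquiv : MeasurePreserving planeEquiv :=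
  (PiLp.volume_preserving_toLp (Fin 2)).comp (volume_preserving_finTwoArrow ℝ).symm

/-- Space-time as a product of the axis of the parameter `x₂` with the half plane of `(t, x₁)`. -/
noncomputable def spacetimeEquiv : ℝ × (ℝ × ℝ) ≃ᵐ ℝ × Plane :=
  (MeasurableEquiv.prodComm.trans MeasurableEquiv.prodAssoc).trans
    ((MeasurableEquiv.refl ℝ).prodCongr planeEquiv)

theorem spacetimeEquiv_apply (z : ℝ × (ℝ × ℝ)) : spacetimeEquiv z = (z.2.1, !₂[z.2.2, z.1]) := by
  rw [← planeEquiv_apply (z.2.2, z.1)]; rfl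

theorem measurePreserving_spacetimeEquiv : MeasurePreserving spacetimeEquiv := by
  refine MeasurePreserving.comp (g := (MeasurableEquiv.refl ℝ).prodCongr planeEquiv)
    (μb := volume) ?_ ?_
  · exact (MeasurePreserving.id volume).prod measurePreserving_planeEquiv
  · exact (volume_preserving_prodAssoc (α₁ := ℝ) (β₁ := ℝ) (γ₁ := ℝ)).comp
      (Measure.measurePreserving_swap (μ := (volume : Measure ℝ))
        (ν := (volume : Measure (ℝ × ℝ))))

theorem integral_plane (f : Plane → ℝ) : ∫ x, f x = ∫ p : ℝ × ℝ, f !₂[p.1, p.2] := by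
  rw [← measurePreserving_planeEquiv.integral_comp planeEquiv.measurableEmbedding f]
  simp only [planeEquiv_apply]

theorem integral_spacetime (f : ℝ × Plane → ℝ) :
    ∫ p, f p = ∫ z : ℝ × (ℝ × ℝ), f (z.2.1, !₂[z.2.2, z.1]) := by
  rw [← measurePreserving_spacetimeEquiv.integral_comp spacetimeEquiv.measurableEmbedding f]
  simp only [spacetimeEquiv_apply]

theorem integrable_spacetime {f : ℝ × Plane → ℝ} :
    Integrable (fun z : ℝ × (ℝ × ℝ) => f (z.2.1, !₂[z.2.2, z.1])) ↔ Integrable f := by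
  rw [← measurePreserving_spacetimeEquiv.integrable_comp_emb spacetimeEquiv.measurableEmbedding]
  simp only [Function.comp_def, spacetimeEquiv_apply]

theorem integrable_plane {f : Plane → ℝ} :
    Integrable (fun z : ℝ × ℝ => f !₂[z.1, z.2]) ↔ Integrable f := by
  rw [← measurePreserving_planeEquiv.integrable_comp_emb planeEquiv.measurableEmbedding]
  simp only [Function.comp_def, planeEquiv_apply]

theorem integral_plane_slices {f : Plane → ℝ} (hf : Integrable f) :
    ∫ x, f x = ∫ b : ℝ, ∫ x : ℝ, f !₂[x, b] := by
  rw [integral_plane]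
  exact integral_prod_symm _ (integrable_plane.2 hf)

theorem integral_spacetime_slices {f : ℝ × Plane → ℝ} (hf : Integrable f) :
    ∫ p, f p = ∫ b : ℝ, ∫ z : ℝ × ℝ, f (z.1, !₂[z.2, b]) := by
  rw [integral_spacetime]
  exact integral_prod _ (integrable_spacetime.2 hf)

theorem measurableSet_slab (T : ℝ) : MeasurableSet (slab T) := measurableSet_Ioo.prod MeasurableSet.univ

/-! ### Test functions -/

theorem derivs_eq_zero_of_notMem_tsupport {ζ : ℝ × Plane → ℝ} {p : ℝ × Plane} (hp : p ∉ tsupport ζ) :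
    ζ p = 0 ∧ dt ζ p = 0 ∧ dx1 ζ p = 0 := by
  have h1 : fderiv ℝ ζ p = 0 :=
    image_eq_zero_of_notMem_tsupport fun h => hp (tsupport_fderiv_subset ℝ h)
  exact ⟨image_eq_zero_of_notMem_tsupport hp, by simp [dt, h1], by simp [dx1, h1]⟩

namespace IsTest

variable {T : ℝ} {ζ : ℝ × Plane → ℝ} (hζ : IsTest T ζ)
include hζ

theorem continuous : Continuous ζ := hζ.smooth.continuous

theorem differentiable : Differentiable ℝ ζ := hζ.smooth.differentiable (by simp)

theorem continuous_fderiv : Continuous (fderiv ℝ ζ) := hζ.smooth.continuous_fderiv (by simp)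

theorem continuous_dt : Continuous (dt ζ) := hζ.continuous_fderiv.clm_apply continuous_const

theorem continuous_dx1 : Continuous (dx1 ζ) := hζ.continuous_fderiv.clm_apply continuous_const

theorem compact_dt : HasCompactSupport (dt ζ) := hζ.compact.fderiv_apply ℝ _

theorem compact_dx1 : HasCompactSupport (dx1 ζ) := hζ.compact.fderiv_apply ℝ _

theorem eq_zero {p : ℝ × Plane} (hp : T ≤ p.1) : ζ p = 0 ∧ dt ζ p = 0 ∧ dx1 ζ p = 0 :=
  derivs_eq_zero_of_notMem_tsupport fun h => absurd (hζ.before h).1 (not_lt.2 hp)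

theorem hasDerivAt_time (t : ℝ) (x : Plane) :
    HasDerivAt (fun s => ζ (s, x)) (dt ζ (t, x)) t := by
  have h := (hζ.differentiable (t, x)).hasFDerivAt
  have h2 : HasDerivAt (fun s : ℝ => (s, x)) ((1 : ℝ), (0 : Plane)) t :=
    (hasDerivAt_id t).prodMk (hasDerivAt_const t x)
  exact h.comp_hasDerivAt t h2

theorem hasDerivAt_space (t x b : ℝ) :
    HasDerivAt (fun y => ζ (t, !₂[y, b])) (dx1 ζ (t, !₂[x, b])) x := by
  have h := (hζ.differentiable (t, !₂[x, b])).hasFDerivAt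
  have h2 : HasDerivAt (fun y : ℝ => (t, (!₂[y, b] : Plane))) ((0 : ℝ), e1) x := by
    refine (hasDerivAt_const x t).prodMk ?_
    have : (fun y : ℝ => (!₂[y, b] : Plane)) = fun y => y • e1 + !₂[0, b] := by
      funext y
      ext i
      fin_cases i <;> simp [e1]
    rw [this]
    simpa using ((hasDerivAt_id x).smul_const e1).add_const (!₂[0, b] : Plane)
  exact h.comp_hasDerivAt x h2

/-- All data of a test function vanish outside a cube. -/
theorem exists_cube : ∃ R > 0, ∀ t x b, R ≤ |t| ∨ R ≤ |x| ∨ R ≤ |b| →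
    ζ (t, !₂[x, b]) = 0 ∧ dt ζ (t, !₂[x, b]) = 0 ∧ dx1 ζ (t, !₂[x, b]) = 0 := by
  obtain ⟨r, hr⟩ := hζ.compact.isCompact.isBounded.subset_closedBall 0
  refine ⟨max r 0 + 1, by positivity, fun t x b h => ?_⟩
  have h0 : ((t, !₂[x, b]) : ℝ × Plane) ∉ tsupport ζ := by
    intro hmem
    have h1 := hr hmem
    rw [mem_closedBall_zero_iff] at h1
    have h2 : |t| ≤ r := (norm_fst_le ((t, !₂[x, b]) : ℝ × Plane)).trans h1
    have h3 : ‖(!₂[x, b] : Plane)‖ ≤ r := (norm_snd_le ((t, !₂[x, b]) : ℝ × Plane)).trans h1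
    have h4 : |x| ≤ r := (PiLp.norm_apply_le (!₂[x, b] : Plane) 0).trans h3
    have h5 : |b| ≤ r := (PiLp.norm_apply_le (!₂[x, b] : Plane) 1).trans h3
    have := le_max_left r 0
    rcases h with h | h | h <;> linarith
  exact derivs_eq_zero_of_notMem_tsupport h0

end IsTest

theorem continuous_plane_mk : Continuous fun p : ℝ × ℝ => (!₂[p.1, p.2] : Plane) := by
  refine (PiLp.continuous_toLp 2 _).comp (continuous_pi fun i => ?_)
  fin_cases i
  · exact continuous_fst
  · exact continuous_snd

/-! ### The entropy solution -/

/-- The integrand of Kruzhkov's entropy inequality. -/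
noncomputable def kruzhkovIntegrand (c k : ℝ) (v ζ : ℝ × Plane → ℝ) (p : ℝ × Plane) : ℝ :=
  |v p - k| * dt ζ p + Real.sign (v p - k) * (flux (v p) - flux k) * dx1 ζ p
    + c * Real.sign (v p - k) * v p * ζ p

theorem abs_sign_le (x : ℝ) : |Real.sign x| ≤ 1 := by
  rcases Real.sign_apply_eq x with h | h | h <;> simp [h]

theorem exists_abs_flux_sub_le (k M m : ℝ) (hm : m < 1) :
    ∃ D, ∀ v ∈ Icc M m, |flux v - flux k| ≤ D := by
  obtain ⟨D, hD⟩ := (isCompact_Icc (a := M) (b := m)).exists_bound_of_continuousOn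
    ((continuousOn_flux.mono fun y hy => lt_of_le_of_lt hy.2 hm).sub
      (continuousOn_const (c := flux k)))
  exact ⟨D, hD⟩

/-- The integrand of Kruzhkov's inequality is integrable. -/
theorem integrableOn_kruzhkovIntegrand {c k T : ℝ} {v ζ : ℝ × Plane → ℝ}
    (hv : AEStronglyMeasurable v (volume.restrict (slab T))) {M m : ℝ} (hm : m < 1)
    (hb : ∀ᵐ p ∂(volume.restrict (slab T)), M ≤ v p ∧ v p ≤ m) (hζ : IsTest T ζ) :
    IntegrableOn (kruzhkovIntegrand c k v ζ) (slab T) := by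
  obtain ⟨D, hD⟩ := exists_abs_flux_sub_le k M m hm
  have hs : AEStronglyMeasurable (fun p => Real.sign (v p - k)) (volume.restrict (slab T)) :=
    (measurable_sign.comp_aemeasurable (hv.aemeasurable.sub_const k)).aestronglyMeasurable
  have hf : AEStronglyMeasurable (fun p => flux (v p)) (volume.restrict (slab T)) :=
    (measurable_flux.comp_aemeasurable hv.aemeasurable).aestronglyMeasurable
  have hva : ∀ w : ℝ, M ≤ w → w ≤ m → |w| ≤ |M| + |m| := fun w h1 h2 => by
    refine abs_le.2 ⟨?_, ?_⟩
    · linarith [neg_abs_le M, abs_nonneg m]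
    · linarith [le_abs_self m, abs_nonneg M]
  have i1 : IntegrableOn (dt ζ) (slab T) :=
    (hζ.continuous_dt.integrable_of_hasCompactSupport hζ.compact_dt).integrableOn
  have i2 : IntegrableOn (dx1 ζ) (slab T) :=
    (hζ.continuous_dx1.integrable_of_hasCompactSupport hζ.compact_dx1).integrableOn
  have i3 : IntegrableOn ζ (slab T) :=
    (hζ.continuous.integrable_of_hasCompactSupport hζ.compact).integrableOn
  refine Integrable.add (Integrable.add ?_ ?_) ?_
  · refine i1.bdd_mul (c := |M| + |m| + |k|) (hv.sub aestronglyMeasurable_const).norm ?_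
    filter_upwards [hb] with p hp
    rw [Real.norm_eq_abs, abs_abs]
    exact (abs_sub _ _).trans (add_le_add (hva _ hp.1 hp.2) le_rfl)
  · refine i2.bdd_mul (c := 1 * D) (hs.mul (hf.sub aestronglyMeasurable_const)) ?_
    filter_upwards [hb] with p hp
    rw [norm_mul]
    exact mul_le_mul (abs_sign_le _) (hD _ hp) (norm_nonneg _) zero_le_one
  · refine i3.bdd_mul (c := |c| * 1 * (|M| + |m|)) ((hs.const_mul c).mul hv) ?_
    filter_upwards [hb] with p hp
    rw [norm_mul, norm_mul]
    have h1 := abs_sign_le (v p - k)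
    have h2 := hva _ hp.1 hp.2
    simp only [Real.norm_eq_abs]
    gcongr

theorem IsDatum.planeWave_mem {c K T : ℝ} {χ : Plane → ℝ} (hχ : IsDatum K χ) {p : ℝ × Plane}
    (hp : 0 ≤ p.1) (hpT : p.1 ≤ T) :
    planeWave c K χ p ∈ Icc (-(K * Real.exp (|c| * T))) 0 := by
  obtain ⟨C, hC⟩ := hχ.profile (p.2 1)
  exact hC.wave_mem hp hpT _

/-- The wave solves the conservation law in the sense of Kruzhkov. -/
theorem IsDatum.isEntropySolution {c K : ℝ} {χ : Plane → ℝ} (hχ : IsDatum K χ) (T : ℝ)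
    (hT : 0 < T) : IsEntropySolution c T χ (planeWave c K χ) := by
  have hb : ∀ᵐ p ∂(volume.restrict (slab T)),
      -(K * Real.exp (|c| * T)) ≤ planeWave c K χ p ∧ planeWave c K χ p ≤ 0 := by
    rw [ae_restrict_iff' (measurableSet_slab T)]
    exact Eventually.of_forall fun p hp => hχ.planeWave_mem hp.1.1.le hp.1.2.le
  refine ⟨hχ.aestronglyMeasurable_planeWave T, ⟨_, 0, one_pos, hb⟩, fun k hk ζ hζ hζ0 => ?_⟩
  have hint := integrableOn_kruzhkovIntegrand (c := c) (k := k) (hχ.aestronglyMeasurable_planeWave T)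
    one_pos hb hζ
  have hint2 : Integrable fun x : Plane => |χ x - k| * ζ (0, x) := by
    have hc := hχ.cont
    have hz := hζ.continuous
    refine Continuous.integrable_of_hasCompactSupport (by fun_prop) ?_
    refine HasCompactSupport.mul_left ?_
    exact HasCompactSupport.intro (hζ.compact.isCompact.image continuous_snd) fun x hx =>
      image_eq_zero_of_notMem_tsupport fun h => hx ⟨_, h, rfl⟩
  obtain ⟨R, hR, hcube⟩ := hζ.exists_cube
  have hF := (integrable_indicator_iff (measurableSet_slab T)).2 hint
  -- The test function and its derivatives vanish from time `T` on and outside the cube, so the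
  -- slice of the slab may be replaced by a half-open rectangle.
  have hA : ∀ b, ∫ z : ℝ × ℝ, (slab T).indicator (kruzhkovIntegrand c k (planeWave c K χ) ζ)
      (z.1, !₂[z.2, b]) = ∫ z in Ioc 0 T ×ˢ Ioc (-R) R,
        kruzhkovIntegrand c k (planeWave c K χ) ζ (z.1, !₂[z.2, b]) := by
    intro b
    rw [← integral_indicator (measurableSet_Ioc.prod measurableSet_Ioc)]
    refine integral_congr_ae (Eventually.of_forall fun z => ?_)
    simp only [indicator, slab, mem_prod, mem_univ, and_true, mem_Ioo, mem_Ioc]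
    by_cases hz : -R < z.2 ∧ z.2 ≤ R
    · by_cases ht : z.1 < T
      · simp [ht, ht.le, hz]
      · have h3 := hζ.eq_zero (p := (z.1, !₂[z.2, b])) (not_lt.1 ht)
        simp [kruzhkovIntegrand, h3]
    · have : R ≤ |z.2| := by
        by_contra h
        exact hz ⟨(abs_lt.1 (not_le.1 h)).1, (abs_lt.1 (not_le.1 h)).2.le⟩
      have h3 := hcube z.1 z.2 b (Or.inr (Or.inl this))
      simp [hz, kruzhkovIntegrand, h3]
  have hB : ∀ b, ∫ x : ℝ, |χ !₂[x, b] - k| * ζ (0, !₂[x, b]) =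
      ∫ x in Ioc (-R) R, |slice χ b x - k| * ζ (0, !₂[x, b]) := by
    intro b
    rw [← integral_indicator measurableSet_Ioc]
    refine integral_congr_ae (Eventually.of_forall fun x => ?_)
    by_cases hz : x ∈ Ioc (-R) R
    · simp [hz, slice]
    · have : R ≤ |x| := by
        by_contra h
        exact hz ⟨(abs_lt.1 (not_le.1 h)).1, (abs_lt.1 (not_le.1 h)).2.le⟩
      have h3 := hcube 0 x b (Or.inr (Or.inl this))
      simp [hz, h3]
  have e1 := integral_spacetime_slices hF
  rw [integral_indicator (measurableSet_slab T)] at e1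
  have e2 := integral_plane_slices hint2
  have iA := (integrable_spacetime.2 hF).integral_prod_left
  have iB := (integrable_plane.2 hint2).integral_prod_right
  simp only [hA] at e1 iA
  simp only [hB] at e2 iB
  change 0 ≤ (∫ p in slab T, kruzhkovIntegrand c k (planeWave c K χ) ζ p) + _
  rw [e1, e2, ← integral_add iA iB]
  refine integral_nonneg fun b => ?_
  obtain ⟨C, hC⟩ := hχ.profile b
  have hmk : Continuous fun p : ℝ × ℝ => ((p.1, !₂[p.2, b]) : ℝ × Plane) :=
    continuous_fst.prodMk (continuous_plane_mk.comp (continuous_snd.prodMk continuous_const))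
  exact hC.kruzhkov_inequality (c := c) hk hT hR (g := fun z => ζ (z.1, !₂[z.2, b]))
    (gt := fun z => dt ζ (z.1, !₂[z.2, b])) (gx := fun z => dx1 ζ (z.1, !₂[z.2, b]))
    (fun t x => hζ.hasDerivAt_time t !₂[x, b]) (fun t x => hζ.hasDerivAt_space t x b)
    (hζ.continuous.comp hmk) (hζ.continuous_dt.comp hmk) (hζ.continuous_dx1.comp hmk)
    (fun z => hζ0 _) (fun x => (hζ.eq_zero le_rfl).1)
    (fun t => (hcube t R b (Or.inr (Or.inl (le_abs_self R)))).1)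
    (fun t => (hcube t (-R) b (Or.inr (Or.inl (by rw [abs_neg]; exact le_abs_self R)))).1)


/-! ### The solution of the second-order problem -/

/-- The points of continuity of the wave at positive times. -/
def contSet (c K : ℝ) (χ : Plane → ℝ) : Set (ℝ × Plane) :=
  {p | 0 < p.1 ∧ ContinuousAt (planeWave c K χ) p}

/-- The wave at its points of continuity, extended by zero. -/
noncomputable def regWave (c K : ℝ) (χ : Plane → ℝ) : ℝ × Plane → ℝ :=
  (contSet c K χ).indicator (planeWave c K χ)

/-- The solution of `(∂_{x₁} - ∂_t) u = v` with `u(0) = 0` for the wave `v`. -/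
noncomputable def travel (c K : ℝ) (χ : Plane → ℝ) (t : ℝ) (x : Plane) : ℝ :=
  -∫ s in (0)..t, planeWave c K χ (s, x + (t - s) • e1)

theorem e1_apply_zero : e1 0 = 1 := by simp [e1]

theorem e1_apply_one : e1 1 = 0 := by simp [e1]

/-- Interchange of the integration variables in a triple product. -/
theorem measurePreserving_triple {α β γ : Type*} [MeasureSpace α] [MeasureSpace β] [MeasureSpace γ]
    [SFinite (volume : Measure α)] [SFinite (volume : Measure β)] [SFinite (volume : Measure γ)] :
    MeasurePreserving (fun z : (α × γ) × β => ((z.1.1, z.2), z.1.2)) := by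
  have h1 : MeasurePreserving (fun z : (α × γ) × β => (z.1.1, (z.1.2, z.2))) :=
    volume_preserving_prodAssoc
  have h2 : MeasurePreserving (fun z : α × (γ × β) => (z.1, (z.2.2, z.2.1))) :=
    (MeasurePreserving.id volume).prod (Measure.measurePreserving_swap (μ := (volume : Measure γ))
        (ν := (volume : Measure β)))
  have h3 : MeasurePreserving (fun z : α × (β × γ) => ((z.1, z.2.1), z.2.2)) :=
    (volume_preserving_prodAssoc (α₁ := α) (β₁ := β) (γ₁ := γ)).symm
  exact h3.comp (h2.comp h1)

theorem integral_triple {α β γ : Type*} [MeasureSpace α] [MeasureSpace β] [MeasureSpace γ]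
    [SFinite (volume : Measure α)] [SFinite (volume : Measure β)] [SFinite (volume : Measure γ)]
    {f : (α × β) × γ → ℝ} (hf : Integrable f) :
    ∫ z, f z = ∫ p : α × γ, ∫ b : β, f ((p.1, b), p.2) := by
  have hm := measurePreserving_triple (α := α) (β := β) (γ := γ)
  rw [← hm.map_eq, integral_map hm.measurable.aemeasurable (by rw [hm.map_eq]; exact hf.1)]
  exact integral_prod _ (hm.integrable_comp_of_integrable hf)

/-- The shear along the transversal direction. -/
theorem measurePreserving_shear :
    MeasurePreserving (fun z : (ℝ × ℝ) × Plane => (z.1, z.2 - (z.1.1 - z.1.2) • e1)) := by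
  refine MeasurePreserving.skew_product (f := id)
    (g := fun (p : ℝ × ℝ) (x : Plane) => x - (p.1 - p.2) • e1) (MeasurePreserving.id volume) ?_ ?_
  · exact Continuous.measurable (by fun_prop)
  · exact Eventually.of_forall fun p => (measurePreserving_sub_right volume _).map_eq

namespace IsDatum

variable {c K : ℝ} {χ : Plane → ℝ} (hχ : IsDatum K χ)
include hχ

theorem ae_regWave_eq : ∀ᵐ p, 0 < p.1 → regWave c K χ p = planeWave c K χ p := by
  filter_upwards [hχ.ae_continuousAt_planeWave (c := c)] with p hp h0
  exact indicator_of_mem (show p ∈ contSet c K χ from ⟨h0, hp h0⟩) _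

omit hχ in
theorem measurable_regWave : Measurable (regWave c K χ) := by
  have hG : MeasurableSet (contSet c K χ) :=
    (measurableSet_lt measurable_const measurable_fst).inter
      (IsGδ.setOfPred_continuousAt (planeWave c K χ)).measurableSet
  have hc : ContinuousOn (planeWave c K χ) (contSet c K χ) := fun p hp => hp.2.continuousWithinAt
  unfold regWave
  classical
  rw [← piecewise_eq_indicator]
  exact hc.measurable_piecewise continuousOn_const hG

theorem abs_planeWave_le {T : ℝ} {p : ℝ × Plane} (h0 : 0 ≤ p.1) (hT : p.1 ≤ T) :
    |planeWave c K χ p| ≤ K * Real.exp (|c| * T) := by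
  have := hχ.planeWave_mem (c := c) h0 hT
  exact abs_le.2 ⟨this.1, by linarith [this.1, this.2]⟩

theorem abs_regWave_le {T : ℝ} {p : ℝ × Plane} (hT : p.1 ≤ T) :
    |regWave c K χ p| ≤ K * Real.exp (|c| * T) := by
  unfold regWave
  by_cases h : p ∈ contSet c K χ
  · rw [indicator_of_mem h]
    exact hχ.abs_planeWave_le h.1.le hT
  · rw [indicator_of_notMem h, abs_zero]
    have := hχ.K_pos
    positivity

/-- The wave is continuous at almost all points of a transversal line. -/
theorem ae_continuousAt_transversal (t : ℝ) (x : Plane) :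
    ∀ᵐ s, 0 < s → ContinuousAt (planeWave c K χ) (s, x + (t - s) • e1) := by
  obtain ⟨C, hC⟩ := hχ.profile (x 1)
  filter_upwards [hC.ae_unique_transversal (c := c) (x 0 + t)] with s hs h0
  refine hχ.continuousAt_planeWave h0 ?_
  have h1 : (x + (t - s) • e1) 0 = x 0 + t - s := by simp [e1_apply_zero]; ring
  have h2 : (x + (t - s) • e1) 1 = x 1 := by simp [e1_apply_one]
  simp only [h1, h2]
  exact hs h0

theorem ae_regWave_transversal (t : ℝ) (x : Plane) :
    ∀ᵐ s, 0 < s → regWave c K χ (s, x + (t - s) • e1) = planeWave c K χ (s, x + (t - s) • e1) := by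
  filter_upwards [hχ.ae_continuousAt_transversal (c := c) t x] with s hs h0
  exact indicator_of_mem (show _ ∈ contSet c K χ from ⟨h0, hs h0⟩) _

/-- A transversal line meets the discontinuities of the wave in a null set, so the integrand may be
replaced by the Borel function `regWave`. -/
theorem travel_eq {t : ℝ} (ht : 0 ≤ t) (x : Plane) :
    travel c K χ t x = -∫ s in Ioc 0 t, regWave c K χ (s, x + (t - s) • e1) := by
  rw [travel, intervalIntegral.integral_of_le ht]
  congr 1
  refine integral_congr_ae ?_
  rw [Filter.EventuallyEq, ae_restrict_iff' measurableSet_Ioc]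
  filter_upwards [hχ.ae_regWave_transversal (c := c) t x] with s hs h0
  exact (hs h0.1).symm

/-- Dominated convergence: the wave is locally bounded in time, and continuous at almost every point
of the line through the limit point. The endpoint `s = p₀.1` is a null set. So `u` is continuous
although the wave is not. -/
theorem continuousOn_travel :
    ContinuousOn (fun p : ℝ × Plane => travel c K χ p.1 p.2) {p | 0 ≤ p.1} := by
  intro p₀ hp₀
  have hp0 : 0 ≤ p₀.1 := hp₀
  have hmM : Measurable (regWave c K χ) := measurable_regWave
  have hmeas : ∀ p : ℝ × Plane, AEStronglyMeasurable
      ((Ioc 0 p.1).indicator fun s => planeWave c K χ (s, p.2 + (p.1 - s) • e1)) := by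
    intro p
    have h1 : Measurable fun s => regWave c K χ (s, p.2 + (p.1 - s) • e1) :=
      hmM.comp (by fun_prop : Continuous fun s : ℝ => (s, p.2 + (p.1 - s) • e1)).measurable
    refine (h1.indicator (measurableSet_Ioc (a := 0) (b := p.1))).aestronglyMeasurable.congr ?_
    · filter_upwards [hχ.ae_regWave_transversal (c := c) p.1 p.2] with s hs
      by_cases h : s ∈ Ioc 0 p.1
      · simp only [indicator_of_mem h, hs h.1]
      · simp only [indicator_of_notMem h]
  have key : Tendsto (fun p : ℝ × Plane => ∫ s, (Ioc 0 p.1).indicator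
      (fun s => planeWave c K χ (s, p.2 + (p.1 - s) • e1)) s) (𝓝[{p | 0 ≤ p.1}] p₀)
      (𝓝 (∫ s, (Ioc 0 p₀.1).indicator
      (fun s => planeWave c K χ (s, p₀.2 + (p₀.1 - s) • e1)) s)) := by
    refine tendsto_integral_filter_of_dominated_convergence
      ((Ioc 0 (p₀.1 + 1)).indicator fun _ => K * Real.exp (|c| * (p₀.1 + 1)))
      (Eventually.of_forall hmeas) ?_ ?_ ?_
    · have h1 : ∀ᶠ p : ℝ × Plane in 𝓝[{p | 0 ≤ p.1}] p₀, p.1 < p₀.1 + 1 :=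
        eventually_nhdsWithin_of_eventually_nhds
          (continuous_fst.continuousAt.eventually_lt continuousAt_const (by simp))
      filter_upwards [h1] with p hp
      refine Eventually.of_forall fun s => ?_
      by_cases h : s ∈ Ioc 0 p.1
      · rw [indicator_of_mem h, indicator_of_mem (show s ∈ Ioc 0 (p₀.1 + 1) from ⟨h.1, by linarith [h.2]⟩)]
        exact hχ.abs_planeWave_le h.1.le (by linarith [h.2])
      · rw [indicator_of_notMem h, norm_zero]
        have := hχ.K_pos
        exact indicator_nonneg (fun _ _ => by positivity) _
    · exact (integrable_indicator_iff measurableSet_Ioc).2 (integrable_const _)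
    · have hne : ∀ᵐ s : ℝ, s ≠ p₀.1 := compl_mem_ae_iff.2 (measure_singleton _)
      filter_upwards [hne, hχ.ae_continuousAt_transversal (c := c) p₀.1 p₀.2] with s hs hcont
      rcases le_or_gt s 0 with h0 | h0
      · have : ∀ p : ℝ × Plane, s ∉ Ioc 0 p.1 := fun p h => absurd h.1 (not_lt.2 h0)
        simp only [indicator_of_notMem (this _)]
        exact tendsto_const_nhds
      rcases lt_or_gt_of_ne hs with hlt | hgt
      · have h1 : ∀ᶠ p : ℝ × Plane in 𝓝[{p | 0 ≤ p.1}] p₀, s < p.1 :=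
          eventually_nhdsWithin_of_eventually_nhds
            (continuousAt_const.eventually_lt continuous_fst.continuousAt hlt)
        rw [indicator_of_mem (show s ∈ Ioc 0 p₀.1 from ⟨h0, hlt.le⟩)]
        have h2 : Tendsto (fun p : ℝ × Plane => (s, p.2 + (p.1 - s) • e1)) (𝓝[{p | 0 ≤ p.1}] p₀)
            (𝓝 (s, p₀.2 + (p₀.1 - s) • e1)) :=
          ((by fun_prop : Continuous fun p : ℝ × Plane => (s, p.2 + (p.1 - s) • e1)).tendsto
            p₀).mono_left nhdsWithin_le_nhds
        refine ((hcont h0).tendsto.comp h2).congr' ?_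
        filter_upwards [h1] with p hp
        rw [indicator_of_mem (show s ∈ Ioc 0 p.1 from ⟨h0, hp.le⟩)]
        rfl
      · have h1 : ∀ᶠ p : ℝ × Plane in 𝓝[{p | 0 ≤ p.1}] p₀, p.1 < s :=
          eventually_nhdsWithin_of_eventually_nhds
            (continuous_fst.continuousAt.eventually_lt continuousAt_const hgt)
        rw [indicator_of_notMem (fun h => absurd h.2 (not_le.2 hgt))]
        refine tendsto_const_nhds.congr' ?_
        filter_upwards [h1] with p hp
        rw [indicator_of_notMem (fun h => absurd h.2 (not_le.2 hp))]
  refine (key.neg.congr' ?_).mono_right (le_of_eq ?_)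
  · filter_upwards [self_mem_nhdsWithin] with p hp
    change -(∫ s, (Ioc 0 p.1).indicator _ s) = -∫ s in (0)..p.1, _
    rw [integral_indicator measurableSet_Ioc,
      intervalIntegral.integral_of_le (show (0 : ℝ) ≤ p.1 from hp)]
  · change 𝓝 (-(∫ s, (Ioc 0 p₀.1).indicator _ s)) = 𝓝 (-∫ s in (0)..p₀.1, _)
    rw [integral_indicator measurableSet_Ioc, intervalIntegral.integral_of_le hp0]

theorem continuous_travel {t : ℝ} (ht : 0 ≤ t) : Continuous (travel c K χ t) := by
  have := (hχ.continuousOn_travel (c := c)).comp_continuous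
    (by fun_prop : Continuous fun x : Plane => (t, x)) fun x => ht
  exact this

omit hχ in
theorem travel_zero (x : Plane) : travel c K χ 0 x = 0 := by simp [travel]

/-- Finite speed of propagation. -/
theorem planeWave_eq_zero {ρ : ℝ} (hρ : ∀ y b, ρ ≤ |y| ∨ ρ ≤ |b| → χ !₂[y, b] = 0)
    {p : ℝ × Plane} (h0 : 0 ≤ p.1) (hp : ρ + p.1 ≤ |p.2 0| ∨ ρ ≤ |p.2 1|) :
    planeWave c K χ p = 0 := by
  obtain ⟨C, hC⟩ := hχ.profile (p.2 1)
  have h1 := hC.abs_sub_foot_le (c := c) (x := p.2 0) h0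
  have h2 : slice χ (p.2 1) (foot c K (slice χ (p.2 1)) p.1 (p.2 0)) = 0 := hρ _ _ ?_
  · rw [planeWave, wave, h2, mul_zero]
  rcases hp with hp | hp
  · left
    have := abs_sub_abs_le_abs_sub (p.2 0) (foot c K (slice χ (p.2 1)) p.1 (p.2 0))
    linarith
  · exact Or.inr hp

theorem travel_eq_zero {ρ : ℝ} (hρ : ∀ y b, ρ ≤ |y| ∨ ρ ≤ |b| → χ !₂[y, b] = 0)
    {t : ℝ} (h0 : 0 ≤ t) {x : Plane} (hp : ρ + t ≤ |x 0| ∨ ρ ≤ |x 1|) :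
    travel c K χ t x = 0 := by
  rw [travel, intervalIntegral.integral_of_le h0, setIntegral_congr_fun (g := fun _ => 0)
    measurableSet_Ioc]
  · simp
  intro s hs
  refine hχ.planeWave_eq_zero hρ hs.1.le ?_
  have h1 : (x + (t - s) • e1) 0 = x 0 + (t - s) := by simp [e1_apply_zero]
  have h2 : (x + (t - s) • e1) 1 = x 1 := by simp [e1_apply_one]
  simp only [h1, h2]
  refine hp.imp_left fun hp => ?_
  have := abs_sub_abs_le_abs_sub (x 0) (-(t - s))
  rw [abs_neg, abs_of_nonneg (by linarith [hs.2] : 0 ≤ t - s), sub_neg_eq_add] at this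
  linarith

omit hχ in
theorem isCompact_box (r : ℝ) : IsCompact {x : Plane | |x 0| ≤ r ∧ |x 1| ≤ r} := by
  refine Metric.isCompact_of_isClosed_isBounded ?_ ?_
  · exact (isClosed_le (by fun_prop : Continuous fun x : Plane => |x 0|) continuous_const).inter
      (isClosed_le (by fun_prop : Continuous fun x : Plane => |x 1|) continuous_const)
  · refine isBounded_iff_forall_norm_le.2 ⟨√(r ^ 2 + r ^ 2), fun x hx => ?_⟩
    rw [EuclideanSpace.norm_eq, Fin.sum_univ_two]
    refine Real.sqrt_le_sqrt (add_le_add ?_ ?_)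
    · exact pow_le_pow_left₀ (abs_nonneg _) hx.1 2
    · exact pow_le_pow_left₀ (abs_nonneg _) hx.2 2

theorem support_travel_subset {ρ : ℝ} (hρ : ∀ y b, ρ ≤ |y| ∨ ρ ≤ |b| → χ !₂[y, b] = 0)
    {t T : ℝ} (h0 : 0 ≤ t) (hT : t ≤ T) :
    Function.support (travel c K χ t) ⊆ {x : Plane | |x 0| ≤ ρ + T ∧ |x 1| ≤ ρ + T} := by
  intro x hx
  by_contra hn
  refine hx (hχ.travel_eq_zero hρ h0 ?_)
  rw [mem_ofPred_eq, not_and_or, not_le, not_le] at hn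
  rcases hn with hn | hn
  · left; linarith
  · right; linarith

theorem memLp_travel {ρ : ℝ} (hρ : ∀ y b, ρ ≤ |y| ∨ ρ ≤ |b| → χ !₂[y, b] = 0)
    {t : ℝ} (h0 : 0 ≤ t) : MemLp (travel c K χ t) 2 volume := by
  refine (hχ.continuous_travel h0).memLp_of_hasCompactSupport ?_
  refine HasCompactSupport.intro (isCompact_box (ρ + t)) fun x hx => ?_
  by_contra h
  exact hx (hχ.support_travel_subset hρ h0 le_rfl h)

/-- For times up to `t + 1` all supports lie in one box, on which the potential solution is
uniformly continuous; the `L²` norm is then bounded by the supremum. -/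
theorem tendsto_travel {ρ : ℝ} (hρ : ∀ y b, ρ ≤ |y| ∨ ρ ≤ |b| → χ !₂[y, b] = 0)
    {t : ℝ} (h0 : 0 ≤ t) :
    Tendsto (fun s => eLpNorm (travel c K χ s - travel c K χ t) 2 volume) (𝓝[Ici 0] t) (𝓝 0) := by
  set B := {x : Plane | |x 0| ≤ ρ + (t + 1) ∧ |x 1| ≤ ρ + (t + 1)} with hB
  have hBc : IsCompact B := isCompact_box _
  have huc := (isCompact_Icc (a := (0 : ℝ)) (b := t + 1)).prod hBc
    |>.uniformContinuousOn_of_continuous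
      ((hχ.continuousOn_travel (c := c)).mono fun p hp => hp.1.1)
  rw [ENNReal.tendsto_nhds_zero]
  intro ε hε
  have hfin : volume B ^ (2 : ℝ≥0∞).toReal⁻¹ ≠ ⊤ :=
    ENNReal.rpow_ne_top_of_nonneg (by simp) hBc.measure_lt_top.ne
  obtain ⟨d, hd, hde⟩ : ∃ d : ℝ, 0 < d ∧ volume B ^ (2 : ℝ≥0∞).toReal⁻¹ * ENNReal.ofReal d ≤ ε := by
    have h1 : Tendsto (fun d : ℝ => volume B ^ (2 : ℝ≥0∞).toReal⁻¹ * ENNReal.ofReal d) (𝓝[>] 0)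
        (𝓝 (volume B ^ (2 : ℝ≥0∞).toReal⁻¹ * ENNReal.ofReal 0)) :=
      (ENNReal.Tendsto.const_mul (ENNReal.continuous_ofReal.tendsto 0)
        (Or.inr hfin)).mono_left nhdsWithin_le_nhds
    rw [ENNReal.ofReal_zero, mul_zero] at h1
    obtain ⟨d, hd1, hd2⟩ := ((ENNReal.tendsto_nhds_zero.1 h1 ε hε).and self_mem_nhdsWithin).exists
    exact ⟨d, hd2, hd1⟩
  obtain ⟨δ, hδ, hδd⟩ := Metric.uniformContinuousOn_iff.1 huc d hd
  have h2 : ∀ᶠ s in 𝓝[Ici 0] t, dist s t < min δ 1 :=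
    eventually_nhdsWithin_of_eventually_nhds (Metric.ball_mem_nhds _ (by positivity))
  filter_upwards [h2, self_mem_nhdsWithin] with s hs hs0
  have hs0' : 0 ≤ s := hs0
  have hs1 : s ≤ t + 1 := by
    have := (abs_lt.1 (hs.trans_le (min_le_right _ _))).2
    linarith
  have hsub : Function.support (travel c K χ s - travel c K χ t) ⊆ B := by
    refine (Function.support_sub _ _).trans (union_subset ?_ ?_)
    · exact hχ.support_travel_subset hρ hs0' hs1
    · exact hχ.support_travel_subset hρ h0 (by linarith)
  rw [← eLpNorm_restrict_eq_of_support_subset hsub]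
  refine (eLpNorm_le_of_ae_bound (C := d) ?_).trans ?_
  · rw [ae_restrict_iff' hBc.measurableSet]
    refine Eventually.of_forall fun x hx => ?_
    have := hδd (s, x) ⟨⟨hs0', hs1⟩, hx⟩ (t, x) ⟨⟨h0, by linarith⟩, hx⟩ (by
      rw [Prod.dist_eq, dist_self, max_eq_left dist_nonneg]
      exact hs.trans_le (min_le_left _ _))
    exact this.le
  · rw [Measure.restrict_apply MeasurableSet.univ, univ_inter]
    exact hde

end IsDatum


/-! ### The transport equation in the sense of distributions -/

theorem IsTest.hasDerivAt_transversal {T : ℝ} {ζ : ℝ × Plane → ℝ} (hζ : IsTest T ζ) (s t : ℝ)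
    (x : Plane) : HasDerivAt (fun t => ζ (t, x - (t - s) • e1))
      (dt ζ (t, x - (t - s) • e1) - dx1 ζ (t, x - (t - s) • e1)) t := by
  have h := (hζ.differentiable (t, x - (t - s) • e1)).hasFDerivAt
  have h2 : HasDerivAt (fun t : ℝ => (t, x - (t - s) • e1)) ((1 : ℝ), -e1) t := by
    refine (hasDerivAt_id t).prodMk ?_
    have h3 := (((hasDerivAt_id t).sub_const s).smul_const e1).const_sub x
    simpa using h3
  refine (h.comp_hasDerivAt t h2).congr_deriv ?_
  have h3 : (((1 : ℝ), -e1) : ℝ × Plane) = (1, 0) - (0, e1) := by simp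
  rw [h3, map_sub]
  rfl

namespace IsDatum

variable {c K : ℝ} {χ : Plane → ℝ} (hχ : IsDatum K χ)
include hχ

/-- The equation `(∂_{x₁} - ∂_t) u = v` in the sense of distributions. -/
theorem integral_travel {T : ℝ} {ζ : ℝ × Plane → ℝ} (hζ : IsTest T ζ) :
    ∫ p in slab T, travel c K χ p.1 p.2 * (dt ζ p - dx1 ζ p) =
      ∫ p in slab T, planeWave c K χ p * ζ p := by
  set M := K * Real.exp (|c| * T) with hM
  set D : ℝ × Plane → ℝ := fun p => dt ζ p - dx1 ζ p with hD
  have hDc : Continuous D := hζ.continuous_dt.sub hζ.continuous_dx1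
  have hDi : Integrable D :=
    hDc.integrable_of_hasCompactSupport (hζ.compact_dt.sub hζ.compact_dx1)
  have hr : Measurable (regWave c K χ) := measurable_regWave
  set A : Set (ℝ × ℝ) := {q | 0 < q.2 ∧ q.2 ≤ q.1 ∧ q.1 < T} with hA
  have hAm : MeasurableSet A :=
    (measurableSet_lt measurable_const measurable_snd).inter
      ((measurableSet_le measurable_snd measurable_fst).inter
        (measurableSet_lt measurable_fst measurable_const))
  -- The variables are `((t, s), x)`: the time at which `u` is evaluated, an earlier time on the
  -- transversal line, and the position at time `t`.
  set F : (ℝ × ℝ) × Plane → ℝ := fun z =>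
    A.indicator (fun q => regWave c K χ (q.2, z.2 + (q.1 - q.2) • e1)) z.1 * D (z.1.1, z.2) with hF
  have hFm : Measurable F := by
    have h1 : Measurable fun z : (ℝ × ℝ) × Plane =>
        regWave c K χ (z.1.2, z.2 + (z.1.1 - z.1.2) • e1) :=
      hr.comp (by fun_prop : Continuous fun z : (ℝ × ℝ) × Plane =>
        (z.1.2, z.2 + (z.1.1 - z.1.2) • e1)).measurable
    have h2 := h1.indicator (measurable_fst hAm : MeasurableSet (Prod.fst ⁻¹' A))
    have h3 : Measurable fun z : (ℝ × ℝ) × Plane => D (z.1.1, z.2) :=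
      (hDc.comp (by fun_prop : Continuous fun z : (ℝ × ℝ) × Plane => (z.1.1, z.2))).measurable
    exact h2.mul h3
  have hH : Integrable fun z : (ℝ × ℝ) × Plane => (Ioc 0 T).indicator (fun _ => M) z.1.2 *
      D (z.1.1, z.2) := by
    have hm := measurePreserving_triple (α := ℝ) (β := ℝ) (γ := Plane)
    refine (hm.integrable_comp ?_).1 ?_
    · have h3 : Measurable fun z : (ℝ × ℝ) × Plane => D (z.1.1, z.2) :=
        (hDc.comp (by fun_prop : Continuous fun z : (ℝ × ℝ) × Plane => (z.1.1, z.2))).measurable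
      have h2 : Measurable fun z : (ℝ × ℝ) × Plane => (Ioc 0 T).indicator (fun _ => M) z.1.2 :=
        (measurable_const.indicator measurableSet_Ioc).comp (measurable_snd.comp measurable_fst)
      exact (h2.mul h3).aestronglyMeasurable
    · have h1 : Integrable ((Ioc 0 T).indicator fun _ : ℝ => M) :=
        (integrable_indicator_iff measurableSet_Ioc).2 (integrable_const _)
      exact (hDi.mul_prod h1).congr (Eventually.of_forall fun z => mul_comm _ _)
  have hFi : Integrable F := by
    refine hH.mono hFm.aestronglyMeasurable (Eventually.of_forall fun z => ?_)
    rw [hF, norm_mul, norm_mul]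
    refine mul_le_mul_of_nonneg_right ?_ (norm_nonneg _)
    by_cases h : z.1 ∈ A
    · rw [indicator_of_mem h, indicator_of_mem (show z.1.2 ∈ Ioc 0 T from
        ⟨h.1, h.2.1.trans h.2.2.le⟩)]
      exact (hχ.abs_regWave_le (h.2.1.trans h.2.2.le)).trans (le_abs_self _)
    · rw [indicator_of_notMem h, norm_zero]
      exact norm_nonneg _
  have e1' : ∫ p in slab T, travel c K χ p.1 p.2 * D p = -∫ z, F z := by
    rw [integral_triple hFi, ← integral_neg, ← integral_indicator (measurableSet_slab T)]
    refine integral_congr_ae (Eventually.of_forall fun p => ?_)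
    simp only [hF, integral_mul_const]
    by_cases hp : p ∈ slab T
    · rw [indicator_of_mem hp, hχ.travel_eq hp.1.1.le, ← integral_indicator measurableSet_Ioc,
        ← neg_mul]
      congr 3
      funext s
      by_cases hs : s ∈ Ioc 0 p.1
      · rw [indicator_of_mem hs, indicator_of_mem (show (p.1, s) ∈ A from ⟨hs.1, hs.2, hp.1.2⟩)]
      · rw [indicator_of_notMem hs, indicator_of_notMem (fun h => hs ⟨h.1, h.2.1⟩)]
    · rw [indicator_of_notMem hp]
      have : ∀ s, (p.1, s) ∉ A := fun s h => hp ⟨⟨h.1.trans_le h.2.1, h.2.2⟩, mem_univ _⟩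
      simp [indicator_of_notMem (this _)]
  -- After the swap and the shear the wave sits at a fixed point `(s, x)` and the test function runs
  -- along the transversal line issuing from it.
  set F2 : (ℝ × ℝ) × Plane → ℝ := fun z =>
    F ((z.1.2, z.1.1), z.2 - (z.1.2 - z.1.1) • e1) with hF2
  have hsw : MeasurePreserving (fun z : (ℝ × ℝ) × Plane => ((z.1.2, z.1.1), z.2)) :=
    (Measure.measurePreserving_swap (μ := (volume : Measure ℝ)) (ν := (volume : Measure ℝ))).prod
      (MeasurePreserving.id (volume : Measure Plane))
  have hcomp : MeasurePreserving (fun z : (ℝ × ℝ) × Plane =>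
      ((z.1.2, z.1.1), z.2 - (z.1.2 - z.1.1) • e1)) := measurePreserving_shear.comp hsw
  have hF2i : Integrable F2 := hcomp.integrable_comp_of_integrable hFi
  have e2 : ∫ z, F z = ∫ z, F2 z := by
    conv_lhs => rw [← hcomp.map_eq]
    rw [integral_map hcomp.measurable.aemeasurable (by rw [hcomp.map_eq]; exact hFi.1)]
  -- The inner integral is that of the derivative of `ζ` along the transversal line from time `s` to
  -- `T`. It equals `-ζ (s, x)`, because `ζ` vanishes at `T`.
  have e3 : ∫ z, F2 z = -∫ p in slab T, regWave c K χ p * ζ p := by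
    rw [integral_triple hF2i, ← integral_neg, ← integral_indicator (measurableSet_slab T)]
    refine integral_congr_ae (Eventually.of_forall fun p => ?_)
    have h1 : ∀ t, F2 ((p.1, t), p.2) = (if 0 < p.1 then regWave c K χ p else 0) *
        (Ico p.1 T).indicator (fun t => D (t, p.2 - (t - p.1) • e1)) t := by
      intro t
      simp only [hF2, hF]
      by_cases h0 : 0 < p.1
      · by_cases h : t ∈ Ico p.1 T
        · rw [indicator_of_mem h, indicator_of_mem (show (t, p.1) ∈ A from ⟨h0, h.1, h.2⟩), if_pos h0]
          simp
        · rw [indicator_of_notMem h, indicator_of_notMem (fun h' => h ⟨h'.2.1, h'.2.2⟩)]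
          simp
      · rw [indicator_of_notMem (fun h' => h0 h'.1), if_neg h0, zero_mul, zero_mul]
    simp only [h1, integral_const_mul]
    by_cases hp : p ∈ slab T
    · rw [indicator_of_mem hp, if_pos hp.1.1, integral_indicator measurableSet_Ico,
        integral_Ico_eq_integral_Ioo, ← integral_Ioc_eq_integral_Ioo,
        ← intervalIntegral.integral_of_le hp.1.2.le,
        intervalIntegral.integral_eq_sub_of_hasDerivAt
          (fun t _ => hζ.hasDerivAt_transversal p.1 t p.2)]
      · rw [(hζ.eq_zero (p := (T, _)) le_rfl).1]
        simp
      · exact (hDc.comp (by fun_prop : Continuous fun t : ℝ =>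
          (t, p.2 - (t - p.1) • e1))).intervalIntegrable _ _
    · rw [indicator_of_notMem hp]
      by_cases h0 : 0 < p.1
      · have : Ico p.1 T = ∅ := Ico_eq_empty fun h => hp ⟨⟨h0, h⟩, mem_univ _⟩
        simp [this]
      · simp [h0]
  rw [e1', e2, e3, neg_neg]
  refine integral_congr_ae ?_
  rw [Filter.EventuallyEq, ae_restrict_iff' (measurableSet_slab T)]
  filter_upwards [hχ.ae_regWave_eq (c := c)] with p hp hps
  rw [hp hps.1.1]

theorem isSolution_travel {ρ : ℝ} (hρ : ∀ y b, ρ ≤ |y| ∨ ρ ≤ |b| → χ !₂[y, b] = 0) {T : ℝ}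
    (hT : 0 < T) : IsSolution c T χ (travel c K χ) where
  meas := ((hχ.continuousOn_travel (c := c)).mono fun _ hp => hp.1.1.le).aestronglyMeasurable
    (measurableSet_slab T)
  memLp _ ht := hχ.memLp_travel hρ ht.1
  cont _ ht := (hχ.tendsto_travel hρ ht.1).mono_left (nhdsWithin_mono _ Ico_subset_Ici_self)
  init := Eventually.of_forall travel_zero
  eqn := ⟨planeWave c K χ, hχ.isEntropySolution T hT, fun _ hζ => hχ.integral_travel hζ⟩

end IsDatum


/-! ### Mollifiers that look into the future -/

/-- The radius of the `n`-th mollifier. -/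
noncomputable def mollRadius (n : ℕ) : ℝ := 1 / 4 * (1 / ((n : ℝ) + 1))

theorem mollRadius_pos (n : ℕ) : 0 < mollRadius n := by unfold mollRadius; positivity

theorem mollRadius_le (n : ℕ) : mollRadius n ≤ 1 / 4 := by
  unfold mollRadius
  have : 1 / ((n : ℝ) + 1) ≤ 1 := by
    rw [div_le_one (by positivity)]
    linarith [(Nat.cast_nonneg n : (0 : ℝ) ≤ n)]
  linarith

theorem tendsto_mollRadius : Tendsto mollRadius atTop (𝓝 0) := by
  have := (tendsto_one_div_add_atTop_nhds_zero_nat (𝕜 := ℝ)).const_mul (1 / 4)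
  rw [mul_zero] at this
  exact this

/-- A bump function in space-time. -/
noncomputable def mollBump (n : ℕ) : ContDiffBump (0 : ℝ × Plane) :=
  ⟨mollRadius n / 2, mollRadius n, half_pos (mollRadius_pos n), half_lt_self (mollRadius_pos n)⟩

/-- A mollifier with support in the half space `t > 0`. -/
noncomputable def mollifier (n : ℕ) (z : ℝ × Plane) : ℝ :=
  (mollBump n).normed volume (z - (2 * mollRadius n, 0))

theorem contDiff_mollifier (n : ℕ) : ContDiff ℝ ∞ (mollifier n) :=
  (mollBump n).contDiff_normed.comp (contDiff_id.sub contDiff_const)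

theorem continuous_mollifier (n : ℕ) : Continuous (mollifier n) := (contDiff_mollifier n).continuous

theorem mollifier_nonneg (n : ℕ) (z : ℝ × Plane) : 0 ≤ mollifier n z := (mollBump n).nonneg_normed _

theorem mollifier_eq_zero {n : ℕ} {z : ℝ × Plane} (hz : mollRadius n ≤ ‖z - (2 * mollRadius n, 0)‖) :
    mollifier n z = 0 := by
  have : z - (2 * mollRadius n, 0) ∉ Function.support ((mollBump n).normed volume) := by
    rw [ContDiffBump.support_normed_eq]
    simpa [mollBump] using hz
  exact Function.notMem_support.1 this

theorem mem_of_mollifier_ne_zero {n : ℕ} {z : ℝ × Plane} (hz : mollifier n z ≠ 0) :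
    mollRadius n < z.1 ∧ z.1 < 3 * mollRadius n ∧ ‖z‖ < 3 * mollRadius n := by
  have h : ‖z - (2 * mollRadius n, 0)‖ < mollRadius n := by
    by_contra h
    exact hz (mollifier_eq_zero (not_lt.1 h))
  have h1 := (norm_fst_le _).trans_lt h
  have h2 := (norm_snd_le _).trans_lt h
  simp only [Prod.fst_sub, Prod.snd_sub, sub_zero, Real.norm_eq_abs, abs_lt] at h1 h2
  have h3 := mollRadius_pos n
  refine ⟨by linarith [h1.1], by linarith [h1.2], ?_⟩
  rw [Prod.norm_def]
  refine max_lt ?_ (by linarith)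
  rw [Real.norm_eq_abs, abs_lt]
  constructor <;> linarith [h1.1, h1.2]

theorem hasCompactSupport_mollifier (n : ℕ) : HasCompactSupport (mollifier n) := by
  refine HasCompactSupport.intro (isCompact_closedBall (0 : ℝ × Plane) (3 * mollRadius n))
    fun z hz => ?_
  by_contra h
  exact hz (mem_closedBall_zero_iff.2 (mem_of_mollifier_ne_zero h).2.2.le)

theorem integral_mollifier (n : ℕ) (q : ℝ × Plane) : ∫ p, mollifier n (p - q) = 1 := by
  simp only [mollifier, sub_sub]
  rw [integral_sub_right_eq_self (fun z => (mollBump n).normed volume z)]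
  exact (mollBump n).integral_normed

/-- The mollifier at `q` lives at times between `q.1` and `q.1 + 3/4`, hence inside the slab. -/
theorem setIntegral_mollifier (n : ℕ) {q : ℝ × Plane} {T : ℝ} (h0 : 0 ≤ q.1) (hT : q.1 + 1 ≤ T) :
    ∫ p in slab T, mollifier n (p - q) = 1 := by
  rw [setIntegral_eq_integral_of_forall_compl_eq_zero, integral_mollifier]
  intro p hp
  by_contra h
  have h1 := mem_of_mollifier_ne_zero h
  have h2 := mollRadius_pos n
  have h3 := mollRadius_le n
  simp only [Prod.fst_sub] at h1
  exact hp ⟨⟨by linarith [h1.1], by linarith [h1.2.1]⟩, mem_univ _⟩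

theorem integrable_mollifier (n : ℕ) (q : ℝ × Plane) : Integrable fun p => mollifier n (p - q) :=
  ((continuous_mollifier n).integrable_of_hasCompactSupport
    (hasCompactSupport_mollifier n)).comp_sub_right q

theorem integrableOn_mollifier_mul {n : ℕ} {q : ℝ × Plane} {T B : ℝ} {f : ℝ × Plane → ℝ}
    (hf : AEStronglyMeasurable f (volume.restrict (slab T)))
    (hb : ∀ᵐ p ∂(volume.restrict (slab T)), |f p| ≤ B) :
    IntegrableOn (fun p => mollifier n (p - q) * f p) (slab T) :=
  (integrable_mollifier n q).integrableOn.mul_bdd (c := B) hf hb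

theorem abs_integral_mollifier_mul_le {n : ℕ} {q : ℝ × Plane} {T B : ℝ} {f : ℝ × Plane → ℝ}
    (h0 : 0 ≤ q.1) (hT : q.1 + 1 ≤ T) (hb : ∀ᵐ p ∂(volume.restrict (slab T)), |f p| ≤ B) :
    |∫ p in slab T, mollifier n (p - q) * f p| ≤ B := by
  have h1 : ∫ p in slab T, mollifier n (p - q) * B = B := by
    rw [integral_mul_const, setIntegral_mollifier n h0 hT, one_mul]
  rw [← Real.norm_eq_abs]
  refine (norm_integral_le_of_norm_le ((integrable_mollifier n q).integrableOn.mul_const B)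
    ?_).trans_eq h1
  filter_upwards [hb] with p hp
  rw [norm_mul, Real.norm_eq_abs, abs_of_nonneg (mollifier_nonneg n _)]
  exact mul_le_mul_of_nonneg_left hp (mollifier_nonneg n _)

/-- Only a limit from times `≥ 0` is required, so `q` may lie on the initial plane. -/
theorem tendsto_integral_mollifier {q : ℝ × Plane} {T B L : ℝ} {f : ℝ × Plane → ℝ}
    (h0 : 0 ≤ q.1) (hT : q.1 + 1 ≤ T)
    (hf : AEStronglyMeasurable f (volume.restrict (slab T)))
    (hb : ∀ᵐ p ∂(volume.restrict (slab T)), |f p| ≤ B)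
    (hL : Tendsto f (𝓝[{p | 0 ≤ p.1}] q) (𝓝 L)) :
    Tendsto (fun n => ∫ p in slab T, mollifier n (p - q) * f p) atTop (𝓝 L) := by
  rw [Metric.tendsto_atTop]
  intro ε hε
  obtain ⟨δ, hδ, hδε⟩ := Metric.tendsto_nhdsWithin_nhds.1 hL (ε / 2) (half_pos hε)
  have h3 : ∀ᶠ n in atTop, 3 * mollRadius n < δ := by
    have := tendsto_mollRadius.const_mul 3
    rw [mul_zero] at this
    exact this.eventually_lt_const hδ
  obtain ⟨N, hN⟩ := eventually_atTop.1 h3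
  refine ⟨N, fun n hn => ?_⟩
  have h4 := hN n hn
  have h5 : (∫ p in slab T, mollifier n (p - q) * f p) - L =
      ∫ p in slab T, mollifier n (p - q) * (f p - L) := by
    simp only [mul_sub]
    rw [integral_sub (integrableOn_mollifier_mul hf hb)
      ((integrable_mollifier n q).integrableOn.mul_const L), integral_mul_const,
      setIntegral_mollifier n h0 hT, one_mul]
  have h6 : ∫ p in slab T, mollifier n (p - q) * (ε / 2) = ε / 2 := by
    rw [integral_mul_const, setIntegral_mollifier n h0 hT, one_mul]
  rw [Real.dist_eq, h5, ← Real.norm_eq_abs]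
  refine lt_of_le_of_lt ((norm_integral_le_of_norm_le
    ((integrable_mollifier n q).integrableOn.mul_const (ε / 2)) ?_).trans_eq h6) (half_lt_self hε)
  rw [ae_restrict_iff' (measurableSet_slab T)]
  refine Eventually.of_forall fun p hp => ?_
  rw [norm_mul, Real.norm_eq_abs, abs_of_nonneg (mollifier_nonneg n _)]
  by_cases h : mollifier n (p - q) = 0
  · simp [h]
  refine mul_le_mul_of_nonneg_left ?_ (mollifier_nonneg n _)
  have h7 := (mem_of_mollifier_ne_zero h).2.2
  exact (hδε (show (0 : ℝ) ≤ p.1 from hp.1.1.le) (by rw [dist_eq_norm]; linarith)).le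

/-! ### Doubling of the variables -/

theorem hasCompactSupport_pair {X E : Type*} [TopologicalSpace X] [T2Space X]
    [AddGroup E] [TopologicalSpace E] [T2Space E] [IsTopologicalAddGroup E] {g : X → ℝ} {ρ : E → ℝ}
    {j : X → E} (hj : Continuous j)
    (hg : HasCompactSupport g) (hρ : HasCompactSupport ρ) :
    HasCompactSupport fun z : X × E => g z.1 * ρ (z.2 - j z.1) := by
  have hK : IsCompact ((fun z : X × E => (z.1, z.2 + j z.1)) '' (tsupport g ×ˢ tsupport ρ)) :=
    (hg.isCompact.prod hρ.isCompact).image (by fun_prop)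
  refine HasCompactSupport.intro hK fun z hz => ?_
  by_contra h
  refine hz ⟨(z.1, z.2 - j z.1), ⟨subset_tsupport _ (left_ne_zero_of_mul h),
    subset_tsupport _ (right_ne_zero_of_mul h)⟩, ?_⟩
  simp

theorem dt_mul_sub {ζ ρ : ℝ × Plane → ℝ} (hζ : Differentiable ℝ ζ) (hρ : Differentiable ℝ ρ)
    (p q e : ℝ × Plane) : fderiv ℝ (fun q => ζ q * ρ (p - q)) q e =
      fderiv ℝ ζ q e * ρ (p - q) - ζ q * fderiv ℝ ρ (p - q) e := by
  have h1 : HasFDerivAt (fun q : ℝ × Plane => p - q) (-ContinuousLinearMap.id ℝ (ℝ × Plane)) q :=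
    (hasFDerivAt_id q).const_sub p
  have h2 := ((hζ q).hasFDerivAt.mul ((hρ (p - q)).hasFDerivAt.comp q h1)).fderiv
  change (fderiv ℝ (ζ * (ρ ∘ fun q => p - q)) q) e = _
  rw [h2]
  simp
  ring

theorem dt_const_mul_sub {ρ : ℝ × Plane → ℝ} (hρ : Differentiable ℝ ρ) (a : ℝ)
    (p q e : ℝ × Plane) : fderiv ℝ (fun p => a * ρ (p - q)) p e = a * fderiv ℝ ρ (p - q) e := by
  have h1 : HasFDerivAt (fun p : ℝ × Plane => p - q) (ContinuousLinearMap.id ℝ (ℝ × Plane)) p :=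
    (hasFDerivAt_id p).sub_const q
  have h2 := (((hρ (p - q)).hasFDerivAt.comp p h1).const_mul a).fderiv
  change (fderiv ℝ (fun y => a * (ρ ∘ fun p => p - q) y) p) e = _
  rw [h2]
  simp

theorem IsTest.mul_mollifier {T : ℝ} {ζ : ℝ × Plane → ℝ} (hζ : IsTest T ζ) (n : ℕ)
    (p : ℝ × Plane) : IsTest T fun q => ζ q * mollifier n (p - q) where
  smooth := hζ.smooth.mul ((contDiff_mollifier n).comp (contDiff_const.sub contDiff_id))
  compact := hζ.compact.mul_right
  before := (closure_mono (Function.support_mul_subset_left _ _)).trans hζ.before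

theorem isTest_mollifier {T : ℝ} (n : ℕ) {q : ℝ × Plane} (hT : q.1 + 1 ≤ T) (a : ℝ) :
    IsTest T fun p => a * mollifier n (p - q) where
  smooth := contDiff_const.mul ((contDiff_mollifier n).comp (contDiff_id.sub contDiff_const))
  compact := by
    refine HasCompactSupport.mul_left ?_
    exact (hasCompactSupport_mollifier n).comp_homeomorph (Homeomorph.subRight q)
  before := by
    have h1 : tsupport (fun p => a * mollifier n (p - q)) ⊆ {p | p.1 ≤ q.1 + 3 * mollRadius n} := by
      refine closure_minimal (fun p hp => ?_) (isClosed_le continuous_fst continuous_const)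
      have := (mem_of_mollifier_ne_zero (right_ne_zero_of_mul hp)).2.1
      simp only [Prod.fst_sub] at this
      exact (by linarith : p.1 ≤ q.1 + 3 * mollRadius n)
    intro p hp
    have h2 : p.1 ≤ q.1 + 3 * mollRadius n := h1 hp
    have h3 := mollRadius_le n
    exact ⟨(by linarith : p.1 < T), mem_univ _⟩

/-- The symmetric entropy flux of Kruzhkov. -/
noncomputable def kruzhkovFlux (v w : ℝ) : ℝ := Real.sign (v - w) * (flux v - flux w)

theorem kruzhkovFlux_comm (v w : ℝ) : kruzhkovFlux v w = kruzhkovFlux w v := by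
  unfold kruzhkovFlux
  rw [← neg_sub w v, Real.sign_neg]
  ring

theorem Real.sign_mul_self_eq_abs (x : ℝ) : Real.sign x * x = |x| := by
  rcases lt_trichotomy x 0 with h | h | h
  · rw [Real.sign_of_neg h, abs_of_neg h]; ring
  · simp [h]
  · rw [Real.sign_of_pos h, abs_of_pos h]; ring

theorem abs_kruzhkovFlux_le {v w m : ℝ} (hm : m < 1) (hv : v ≤ m) (hw : w ≤ m) (M : ℝ)
    (hv' : M ≤ v) (hw' : M ≤ w) : |kruzhkovFlux v w| ≤ (1 + |M| + |m|) / (1 - m) * |v - w| := by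
  have h1 : |flux v - flux w| ≤ (1 + |M| + |m|) / (1 - m) * |v - w| := by
    have := Convex.norm_image_sub_le_of_norm_hasDerivWithin_le (f := flux)
      (f' := fun y => (1 + y) / (1 - y)) (C := (1 + |M| + |m|) / (1 - m)) (s := Icc M m)
      (x := w) (y := v)
      (fun y hy => (hasDerivAt_flux (lt_of_le_of_lt hy.2 hm)).hasDerivWithinAt) ?_
      (convex_Icc M m) ⟨hw', hw⟩ ⟨hv', hv⟩
    · simpa using this
    · intro y hy
      have h3 : 0 < 1 - y := by linarith [hy.2]
      rw [norm_div, Real.norm_eq_abs, Real.norm_eq_abs, abs_of_pos h3]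
      have h4 : |1 + y| ≤ 1 + |M| + |m| := abs_le.2
        ⟨by linarith [neg_abs_le M, abs_nonneg m, hy.1], by
          linarith [le_abs_self m, abs_nonneg M, hy.2]⟩
      have h5 := hy.2
      gcongr
  unfold kruzhkovFlux
  rw [abs_mul]
  exact (mul_le_of_le_one_left (abs_nonneg _) (abs_sign_le _)).trans h1

/-- The jump of the sign at `w = v` is compensated by the vanishing of the flux difference. -/
theorem continuousAt_kruzhkovFlux {v w : ℝ} (hw : w < 1) :
    ContinuousAt (fun w => kruzhkovFlux v w) w := by
  have hf : ContinuousAt flux w := (hasDerivAt_flux hw).continuousAt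
  rcases eq_or_ne v w with rfl | h
  · have h0 : kruzhkovFlux v v = 0 := by simp [kruzhkovFlux]
    rw [ContinuousAt, h0]
    have h1 : Tendsto (fun w => |flux v - flux w|) (𝓝 v) (𝓝 0) := by
      simpa using (hf.tendsto.const_sub (flux v)).abs
    refine squeeze_zero_norm (fun w => ?_) h1
    unfold kruzhkovFlux
    rw [norm_mul]
    exact mul_le_of_le_one_left (norm_nonneg _) (abs_sign_le _)
  · have h1 : (fun w' => kruzhkovFlux v w') =ᶠ[𝓝 w]
        fun w' => Real.sign (v - w) * (flux v - flux w') := by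
      rcases lt_or_gt_of_ne h with hl | hl
      · filter_upwards [lt_mem_nhds hl] with w' hw'
        rw [kruzhkovFlux, Real.sign_of_neg (by linarith), Real.sign_of_neg (by linarith)]
      · filter_upwards [gt_mem_nhds hl] with w' hw'
        rw [kruzhkovFlux, Real.sign_of_pos (by linarith), Real.sign_of_pos (by linarith)]
    exact ((continuousAt_const.sub hf).const_mul (Real.sign (v - w)) |>.congr h1.symm)


/-- Every term of the doubled integrals is a bounded measurable function times a continuous function
with compact support in both variables. -/
theorem integrable_pair {X : Type*} [TopologicalSpace X] [T2Space X] [MeasurableSpace X]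
    [OpensMeasurableSpace (X × (ℝ × Plane))]
    {μ : Measure X} {ν : Measure (ℝ × Plane)}
    [IsFiniteMeasureOnCompacts (μ.prod ν)] {g : X → ℝ} {ρ : ℝ × Plane → ℝ}
    {j : X → ℝ × Plane} (hj : Continuous j) (hgc : Continuous g) (hρc : Continuous ρ)
    (hg : HasCompactSupport g) (hρ : HasCompactSupport ρ) {b : X × (ℝ × Plane) → ℝ}
    (hb : AEStronglyMeasurable b (μ.prod ν)) {B : ℝ} (hB : ∀ᵐ z ∂(μ.prod ν), |b z| ≤ B) :
    Integrable (fun z : X × (ℝ × Plane) => b z * (g z.1 * ρ (z.2 - j z.1))) (μ.prod ν) := by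
  have hc : Continuous fun z : X × (ℝ × Plane) => g z.1 * ρ (z.2 - j z.1) := by fun_prop
  exact (hc.integrable_of_hasCompactSupport (hasCompactSupport_pair hj hg hρ)).bdd_mul hb hB

theorem fderiv_mollifier_compact (n : ℕ) (e : ℝ × Plane) :
    HasCompactSupport (fun z => fderiv ℝ (mollifier n) z e) :=
  (hasCompactSupport_mollifier n).fderiv_apply ℝ _

theorem continuous_fderiv_mollifier (n : ℕ) (e : ℝ × Plane) :
    Continuous (fun z => fderiv ℝ (mollifier n) z e) :=
  ((contDiff_mollifier n).continuous_fderiv (by simp)).clm_apply continuous_const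

/-- Kato's inequality for an entropy solution and the wave. -/
theorem IsDatum.kato_inequality {c K T : ℝ} {χ : Plane → ℝ} (hχ : IsDatum K χ) (hT : 0 < T)
    {v : ℝ × Plane → ℝ} (hv : IsEntropySolution c T χ v) {ζ : ℝ × Plane → ℝ} (hζ : IsTest T ζ)
    (hζ0 : ∀ p, 0 ≤ ζ p) :
    0 ≤ ∫ q in slab T, (|v q - planeWave c K χ q| * dt ζ q
      + kruzhkovFlux (v q) (planeWave c K χ q) * dx1 ζ q
      + c * |v q - planeWave c K χ q| * ζ q) := by
  obtain ⟨M, m, hm, hvb⟩ := hv.bounded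
  set V := planeWave c K χ with hV
  set M' := K * Real.exp (|c| * (T + 1)) with hM'
  have hKpos := hχ.K_pos
  have hM'0 : 0 < M' := by positivity
  have hKM' : K ≤ M' := by
    have : 1 ≤ Real.exp (|c| * (T + 1)) := Real.one_le_exp (by positivity)
    nlinarith
  set lo := min M (-M')
  set hi := max m 0
  have hhi : hi < 1 := max_lt hm one_pos
  set μ : Measure (ℝ × Plane) := volume.restrict (slab T) with hμ
  -- The wave exists beyond `T`. Its variable `p` runs over a longer slab, so that a mollifier based
  -- at `q` with `q.1 < T` is not cut off.
  set ν : Measure (ℝ × Plane) := volume.restrict (slab (T + 1)) with hν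
  have hvI : ∀ᵐ q ∂μ, v q ∈ Icc lo hi := by
    filter_upwards [hvb] with q hq
    exact ⟨(min_le_left _ _).trans hq.1, hq.2.trans (le_max_left _ _)⟩
  have hVI : ∀ p ∈ slab (T + 1), V p ∈ Icc lo hi := fun p hp => by
    have := hχ.planeWave_mem (c := c) hp.1.1.le hp.1.2.le
    exact ⟨(min_le_right _ _).trans this.1, this.2.trans (le_max_right _ _)⟩
  have hVI' : ∀ᵐ p ∂ν, V p ∈ Icc lo hi :=
    (ae_restrict_iff' (measurableSet_slab _)).2 (Eventually.of_forall hVI)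
  have hχI : ∀ x, χ x ∈ Icc lo hi := fun x => by
    obtain ⟨C, hC⟩ := hχ.profile (x 1)
    have h1 := hC.mem (x 0)
    have h2 : slice χ (x 1) (x 0) = χ x := by
      unfold slice
      congr 1
      ext i
      fin_cases i <;> rfl
    rw [h2] at h1
    exact ⟨(min_le_right _ _).trans (by linarith [h1.1]), h1.2.trans (le_max_right _ _)⟩
  have hVm : AEStronglyMeasurable V ν := hχ.aestronglyMeasurable_planeWave _
  have hvm : AEStronglyMeasurable v μ := hv.meas
  set N := hi - lo
  have hN : ∀ {x y : ℝ}, x ∈ Icc lo hi → y ∈ Icc lo hi → |x - y| ≤ N := fun hx hy =>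
    abs_le.2 ⟨by linarith [hx.1, hy.2], by linarith [hx.2, hy.1]⟩
  set Λ := (1 + |lo| + |hi|) / (1 - hi)
  have hΛ : 0 ≤ Λ := by
    have : 0 < 1 - hi := by linarith
    positivity
  have hQ : ∀ {x y : ℝ}, x ∈ Icc lo hi → y ∈ Icc lo hi → |kruzhkovFlux x y| ≤ Λ * N :=
    fun hx hy => (abs_kruzhkovFlux_le hhi hx.2 hy.2 lo hx.1 hy.1).trans
      (mul_le_mul_of_nonneg_left (hN hx hy) hΛ)
  have hAb : ∀ {x : ℝ}, x ∈ Icc lo hi → |x| ≤ |lo| + |hi| := fun hx => abs_le.2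
    ⟨by linarith [neg_abs_le lo, abs_nonneg hi, hx.1], by
      linarith [le_abs_self hi, abs_nonneg lo, hx.2]⟩
  -- the functions of two variables
  have m1 : AEStronglyMeasurable (fun z : (ℝ × Plane) × (ℝ × Plane) => v z.1) (μ.prod ν) :=
    hvm.comp_fst
  have m2 : AEStronglyMeasurable (fun z : (ℝ × Plane) × (ℝ × Plane) => V z.2) (μ.prod ν) :=
    hVm.comp_snd
  have hI : ∀ᵐ z ∂(μ.prod ν), v z.1 ∈ Icc lo hi ∧ V z.2 ∈ Icc lo hi :=
    (Measure.quasiMeasurePreserving_fst.ae hvI).and (Measure.quasiMeasurePreserving_snd.ae hVI')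
  have ma : AEStronglyMeasurable (fun z : (ℝ × Plane) × (ℝ × Plane) => |v z.1 - V z.2|)
      (μ.prod ν) := (m1.sub m2).norm
  have ms : AEStronglyMeasurable (fun z : (ℝ × Plane) × (ℝ × Plane) => Real.sign (v z.1 - V z.2))
      (μ.prod ν) :=
    (measurable_sign.comp_aemeasurable (m1.aemeasurable.sub m2.aemeasurable)).aestronglyMeasurable
  have mb : AEStronglyMeasurable (fun z : (ℝ × Plane) × (ℝ × Plane) => kruzhkovFlux (v z.1) (V z.2))
      (μ.prod ν) := ms.mul ((measurable_flux.comp_aemeasurable m1.aemeasurable).sub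
        (measurable_flux.comp_aemeasurable m2.aemeasurable)).aestronglyMeasurable
  have ba : ∀ᵐ z ∂(μ.prod ν), |(|v z.1 - V z.2|)| ≤ N := by
    filter_upwards [hI] with z hz
    rw [abs_abs]; exact hN hz.1 hz.2
  have bb : ∀ᵐ z ∂(μ.prod ν), |kruzhkovFlux (v z.1) (V z.2)| ≤ Λ * N := by
    filter_upwards [hI] with z hz
    exact hQ hz.1 hz.2
  have bs1 : ∀ᵐ z ∂(μ.prod ν), |Real.sign (v z.1 - V z.2) * v z.1| ≤ |lo| + |hi| := by
    filter_upwards [hI] with z hz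
    rw [abs_mul]
    exact (mul_le_of_le_one_left (abs_nonneg _) (abs_sign_le _)).trans (hAb hz.1)
  have bs2 : ∀ᵐ z ∂(μ.prod ν), |Real.sign (v z.1 - V z.2) * V z.2| ≤ |lo| + |hi| := by
    filter_upwards [hI] with z hz
    rw [abs_mul]
    exact (mul_le_of_le_one_left (abs_nonneg _) (abs_sign_le _)).trans (hAb hz.2)
  have : IsFiniteMeasureOnCompacts (μ.prod ν) := by
    rw [hμ, hν, Measure.prod_restrict]; infer_instance
  have : IsFiniteMeasureOnCompacts ((volume : Measure Plane).prod ν) := by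
    rw [hν, ← Measure.restrict_univ (μ := (volume : Measure Plane)), Measure.prod_restrict]
    infer_instance
  have hζd := hζ.differentiable
  let Θ : ℝ × Plane → ℝ × Plane → ℝ := fun q p =>
    |v q - V p| * dt ζ q + kruzhkovFlux (v q) (V p) * dx1 ζ q + c * |v q - V p| * ζ q
  let L : ℕ → ℝ := fun n => ∫ x : Plane, ∫ p, mollifier n (p - (0, x)) *
    (|χ x - V p| * ζ (0, x)) ∂ν
  let J : ℕ → ℝ := fun n => ∫ q, ∫ p, mollifier n (p - q) * Θ q p ∂ν ∂μ
  have hζ0c : HasCompactSupport fun x : Plane => ζ (0, x) :=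
    HasCompactSupport.intro (hζ.compact.isCompact.image continuous_snd) fun x hx =>
      image_eq_zero_of_notMem_tsupport fun h => hx ⟨_, h, rfl⟩
  have hζ0c' : Continuous fun x : Plane => ζ (0, x) :=
    hζ.continuous.comp (by fun_prop : Continuous fun x : Plane => ((0 : ℝ), x))
  have iL : ∀ n, Integrable (fun z : Plane × (ℝ × Plane) => |χ z.1 - V z.2| *
      (ζ (0, z.1) * mollifier n (z.2 - (0, z.1)))) ((volume : Measure Plane).prod ν) := by
    intro n
    refine integrable_pair (g := fun x => ζ (0, x)) (j := fun x => (0, x)) (B := N) (by fun_prop)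
      hζ0c' (continuous_mollifier n) hζ0c (hasCompactSupport_mollifier n) ?_ ?_
    · exact ((hχ.cont.aestronglyMeasurable.comp_fst).sub hVm.comp_snd).norm
    · filter_upwards [Measure.quasiMeasurePreserving_snd.ae hVI'] with z hz
      rw [abs_abs]
      exact hN (hχI _) hz
  have iJ : ∀ n, Integrable (fun z : (ℝ × Plane) × (ℝ × Plane) =>
      mollifier n (z.2 - z.1) * Θ z.1 z.2) (μ.prod ν) := by
    intro n
    have j1 := integrable_pair (μ := μ) (ν := ν) (j := id) continuous_id hζ.continuous_dt
      (continuous_mollifier n) hζ.compact_dt (hasCompactSupport_mollifier n) ma ba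
    have j2 := integrable_pair (μ := μ) (ν := ν) (j := id) continuous_id hζ.continuous_dx1
      (continuous_mollifier n) hζ.compact_dx1 (hasCompactSupport_mollifier n) mb bb
    have j3 := integrable_pair (μ := μ) (ν := ν) (j := id) continuous_id hζ.continuous
      (continuous_mollifier n) hζ.compact (hasCompactSupport_mollifier n) ma ba
    refine ((j1.add j2).add (j3.const_mul c)).congr (Eventually.of_forall fun z => ?_)
    simp only [Pi.add_apply, Θ, id]
    ring
  have key : ∀ n, -L n ≤ J n := by
    intro n
    set ρ := mollifier n
    have hρd : Differentiable ℝ ρ := (contDiff_mollifier n).differentiable (by simp)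
    have hρc := continuous_mollifier n
    have hρs := hasCompactSupport_mollifier n
    let I1 : (ℝ × Plane) × (ℝ × Plane) → ℝ := fun z =>
      |v z.1 - V z.2| * (dt ζ z.1 * ρ (z.2 - z.1) - ζ z.1 * dt ρ (z.2 - z.1))
      + Real.sign (v z.1 - V z.2) * (flux (v z.1) - flux (V z.2)) *
        (dx1 ζ z.1 * ρ (z.2 - z.1) - ζ z.1 * dx1 ρ (z.2 - z.1))
      + c * Real.sign (v z.1 - V z.2) * v z.1 * (ζ z.1 * ρ (z.2 - z.1))
    let I2 : (ℝ × Plane) × (ℝ × Plane) → ℝ := fun z =>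
      |V z.2 - v z.1| * (ζ z.1 * dt ρ (z.2 - z.1))
      + Real.sign (V z.2 - v z.1) * (flux (V z.2) - flux (v z.1)) *
        (ζ z.1 * dx1 ρ (z.2 - z.1))
      + c * Real.sign (V z.2 - v z.1) * V z.2 * (ζ z.1 * ρ (z.2 - z.1))
    have p1 := integrable_pair (μ := μ) (ν := ν) (j := id) continuous_id hζ.continuous_dt
      hρc hζ.compact_dt hρs ma ba
    have p2 := integrable_pair (μ := μ) (ν := ν) (j := id) continuous_id hζ.continuous
      (continuous_fderiv_mollifier n (1, 0)) hζ.compact (fderiv_mollifier_compact n _) ma ba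
    have p3 := integrable_pair (μ := μ) (ν := ν) (j := id) continuous_id hζ.continuous_dx1
      hρc hζ.compact_dx1 hρs mb bb
    have p4 := integrable_pair (μ := μ) (ν := ν) (j := id) continuous_id hζ.continuous
      (continuous_fderiv_mollifier n (0, e1)) hζ.compact (fderiv_mollifier_compact n _) mb bb
    have p5 := integrable_pair (μ := μ) (ν := ν) (j := id) continuous_id hζ.continuous
      hρc hζ.compact hρs (ms.mul m1) bs1
    have p6 := integrable_pair (μ := μ) (ν := ν) (j := id) continuous_id hζ.continuous
      hρc hζ.compact hρs (ms.mul m2) bs2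
    have i1 : Integrable I1 (μ.prod ν) := by
      refine (((p1.sub p2).add (p3.sub p4)).add (p5.const_mul c)).congr
        (Eventually.of_forall fun z => ?_)
      simp only [Pi.add_apply, Pi.sub_apply, Pi.mul_apply, I1, id, kruzhkovFlux, dt, dx1]
      ring
    have i2 : Integrable I2 (μ.prod ν) := by
      refine ((p2.add p4).sub (p6.const_mul c)).congr (Eventually.of_forall fun z => ?_)
      simp only [Pi.add_apply, Pi.sub_apply, Pi.mul_apply, I2, id, dt, dx1]
      rw [kruzhkovFlux_comm, kruzhkovFlux, abs_sub_comm, ← neg_sub (V z.2) (v z.1), Real.sign_neg]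
      ring
    -- The derivatives of the mollifier in `p` and in `q` have opposite signs and cancel, and the
    -- two source terms combine to `c |v - V|`.
    have eJ : J n = ∫ z, I1 z ∂(μ.prod ν) + ∫ z, I2 z ∂(μ.prod ν) := by
      rw [← integral_add i1 i2, show J n = ∫ z, ρ (z.2 - z.1) * Θ z.1 z.2 ∂(μ.prod ν) from
        (integral_prod _ (iJ n)).symm]
      refine integral_congr_ae (Eventually.of_forall fun z => ?_)
      simp only [I1, I2, Θ, kruzhkovFlux]
      rw [abs_sub_comm (V z.2), ← neg_sub (v z.1) (V z.2), Real.sign_neg,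
        ← Real.sign_mul_self_eq_abs (v z.1 - V z.2)]
      ring
    have iLs := (iL n).swap.integral_prod_left
    -- The inequality for `v` with `k = V p`. Its test function `q ↦ ζ q * ρ (p - q)` need not
    -- vanish at time `0`, and the initial term integrates to `L n`.
    have e1 : -L n ≤ ∫ z, I1 z ∂(μ.prod ν) := by
      have eL : L n = ∫ p, (∫ x : Plane, |χ x - V p| * (ζ (0, x) * ρ (p - (0, x)))) ∂ν := by
        rw [← integral_integral_swap (iL n)]
        refine integral_congr_ae (Eventually.of_forall fun x => ?_)
        refine integral_congr_ae (Eventually.of_forall fun p => ?_)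
        simp only
        ring
      rw [integral_prod_symm _ i1, eL, ← integral_neg]
      refine integral_mono_ae iLs.neg i1.integral_prod_right ?_
      rw [EventuallyLE, ae_restrict_iff' (measurableSet_slab _)]
      refine Eventually.of_forall fun p hp => ?_
      have h1 := hv.entropy (V p) (lt_of_le_of_lt (hVI p hp).2 hhi) _ (hζ.mul_mollifier n p)
        fun q => mul_nonneg (hζ0 q) (mollifier_nonneg n _)
      have hρd' : Differentiable ℝ (mollifier n) := hρd
      simp only [dt, dx1, dt_mul_sub hζd hρd'] at h1
      simp only [I1, dt, dx1]
      exact neg_le_iff_add_nonneg.2 h1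
    -- The inequality for the wave with `k = v q`. The mollifier looks into the future of `q`, so
    -- this test function vanishes at time `0` and there is no initial term.
    have e2 : 0 ≤ ∫ z, I2 z ∂(μ.prod ν) := by
      rw [integral_prod _ i2]
      refine integral_nonneg_of_ae ?_
      have hq : ∀ᵐ q ∂μ, q ∈ slab T := ae_restrict_mem (measurableSet_slab _)
      filter_upwards [hvI, hq] with q hq1 hq2
      have h1 := (hχ.isEntropySolution (c := c) (T + 1) (by linarith)).entropy (v q)
        (lt_of_le_of_lt hq1.2 hhi) _ (isTest_mollifier n (by linarith [hq2.1.2]) (ζ q))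
        fun p => mul_nonneg (hζ0 q) (mollifier_nonneg n _)
      have h2 : ∀ x : Plane, mollifier n ((0, x) - q) = 0 := fun x => by
        by_contra h
        have h3 := (mem_of_mollifier_ne_zero h).1
        have h4 := mollRadius_pos n
        simp only [Prod.fst_sub] at h3
        linarith [hq2.1.1]
      have hρd' : Differentiable ℝ (mollifier n) := hρd
      simp only [dt, dx1, dt_const_mul_sub hρd', h2, mul_zero, integral_zero, add_zero] at h1
      exact h1
    rw [eJ]
    linarith
  -- The wave is continuous up to the initial plane with value `χ`.
  have limL : Tendsto L atTop (𝓝 0) := by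
    have h0 : 𝓝 (0 : ℝ) = 𝓝 (∫ _ : Plane, (0 : ℝ)) := by simp
    rw [h0]
    have hb : ∀ x, ∀ᵐ p ∂ν, |(|χ x - V p| * ζ (0, x))| ≤ N * |ζ (0, x)| := fun x => by
      filter_upwards [hVI'] with p hp
      rw [abs_mul, abs_abs]
      exact mul_le_mul_of_nonneg_right (hN (hχI x) hp) (abs_nonneg _)
    refine tendsto_integral_of_dominated_convergence (fun x => N * |ζ (0, x)|) (fun n => ?_)
      ((hζ0c'.integrable_of_hasCompactSupport hζ0c).norm.const_mul N) (fun n => ?_) ?_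
    · refine ((iL n).integral_prod_left).aestronglyMeasurable.congr
        (Eventually.of_forall fun x => ?_)
      refine integral_congr_ae (Eventually.of_forall fun p => ?_)
      simp only
      ring
    · exact Eventually.of_forall fun x =>
        abs_integral_mollifier_mul_le le_rfl (by simp only; linarith) (hb x)
    · refine Eventually.of_forall fun x => ?_
      refine tendsto_integral_mollifier (B := N * |ζ (0, x)|) le_rfl (by simp only; linarith)
        ?_ (hb x) ?_
      · exact ((aestronglyMeasurable_const.sub hVm).norm).mul aestronglyMeasurable_const
      · have h1 := hχ.continuousWithinAt_planeWave_zero (c := c) (p := (0, x)) rfl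
        have h2 : Tendsto V (𝓝[{q | 0 ≤ q.1}] (0, x)) (𝓝 (χ x)) := by
          have := h1.tendsto
          rwa [hχ.planeWave_zero] at this
        simpa using ((h2.const_sub (χ x)).abs).mul_const (ζ (0, x))
  -- For fixed `q` only the wave is mollified. It is continuous at almost every `q`, so no Lebesgue
  -- points of `v` are involved.
  have limJ : Tendsto J atTop (𝓝 (∫ q, Θ q q ∂μ)) := by
    have hb : ∀ q, v q ∈ Icc lo hi → ∀ᵐ p ∂ν, |Θ q p| ≤
        N * |dt ζ q| + Λ * N * |dx1 ζ q| + |c| * N * |ζ q| := fun q hq => by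
      filter_upwards [hVI'] with p hp
      have h1 := hN hq hp
      have h2 := hQ hq hp
      refine (abs_add_three _ _ _).trans ?_
      rw [abs_mul, abs_mul, abs_mul, abs_mul, abs_abs]
      gcongr
    refine tendsto_integral_of_dominated_convergence
      (fun q => N * |dt ζ q| + Λ * N * |dx1 ζ q| + |c| * N * |ζ q|)
      (fun n => (iJ n).integral_prod_left.aestronglyMeasurable) ?_ (fun n => ?_) ?_
    · have h1 := (hζ.continuous_dt.integrable_of_hasCompactSupport hζ.compact_dt (μ := volume)).norm
      have h2 :=
        (hζ.continuous_dx1.integrable_of_hasCompactSupport hζ.compact_dx1 (μ := volume)).norm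
      have h3 := (hζ.continuous.integrable_of_hasCompactSupport hζ.compact (μ := volume)).norm
      exact (((h1.const_mul N).add (h2.const_mul (Λ * N))).add (h3.const_mul (|c| * N))).restrict
    · have hq : ∀ᵐ q ∂μ, q ∈ slab T := ae_restrict_mem (measurableSet_slab _)
      filter_upwards [hvI, hq] with q hq1 hq2
      exact abs_integral_mollifier_mul_le hq2.1.1.le (by linarith [hq2.1.2]) (hb q hq1)
    · have hq : ∀ᵐ q ∂μ, q ∈ slab T := ae_restrict_mem (measurableSet_slab _)
      filter_upwards [hvI, hq, ae_restrict_of_ae (hχ.ae_continuousAt_planeWave (c := c))]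
        with q hq1 hq2 hq3
      refine tendsto_integral_mollifier hq2.1.1.le (by linarith [hq2.1.2]) ?_ (hb q hq1) ?_
      · have h1 : AEStronglyMeasurable (fun p => |v q - V p|) ν :=
          (aestronglyMeasurable_const.sub hVm).norm
        have h2 : AEStronglyMeasurable (fun p => kruzhkovFlux (v q) (V p)) ν :=
          ((measurable_sign.comp_aemeasurable (aemeasurable_const.sub hVm.aemeasurable)).mul
            (aemeasurable_const.sub
              (measurable_flux.comp_aemeasurable hVm.aemeasurable))).aestronglyMeasurable
        exact ((h1.mul_const _).add (h2.mul_const _)).add ((h1.const_mul c).mul_const _)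
      · have h1 : Tendsto V (𝓝[{p | 0 ≤ p.1}] q) (𝓝 (V q)) :=
          (hq3 hq2.1.1).tendsto.mono_left nhdsWithin_le_nhds
        have hVq : V q < 1 := lt_of_le_of_lt (hVI q ⟨⟨hq2.1.1, by linarith [hq2.1.2]⟩,
          mem_univ _⟩).2 hhi
        have h2 := (continuousAt_kruzhkovFlux (v := v q) hVq).tendsto.comp h1
        have h3 := (h1.const_sub (v q)).abs
        exact ((h3.mul_const _).add (h2.mul_const _)).add ((h3.const_mul c).mul_const _)
  have hfin := le_of_tendsto_of_tendsto' limL.neg limJ key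
  rw [neg_zero] at hfin
  exact hfin


/-! ### Uniqueness of the entropy solution -/

theorem contDiff_glue : ContDiff ℝ ∞ expNegInvGlue := expNegInvGlue.contDiff

theorem deriv_glue_nonneg (x : ℝ) : 0 ≤ deriv expNegInvGlue x := expNegInvGlue.monotone.deriv_nonneg

theorem hasDerivAt_glue (x : ℝ) : HasDerivAt expNegInvGlue (deriv expNegInvGlue x) x :=
  ((contDiff_glue.differentiable (by simp)) x).hasDerivAt

/-- The profile of a test function on a backward cone. -/
noncomputable def coneProfile (B T R Λ t x y : ℝ) : ℝ :=
  Real.exp (-(B * t)) * expNegInvGlue (R ^ 2 - y ^ 2) * (expNegInvGlue (T - t) *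
    (expNegInvGlue (R - x - Λ * t) * expNegInvGlue (R + x - Λ * t)))

/-- A test function on a backward cone. -/
noncomputable def coneTest (B T R Λ : ℝ) (p : ℝ × Plane) : ℝ :=
  Real.smoothTransition (p.1 + 1) * coneProfile B T R Λ p.1 (p.2 0) (p.2 1)

theorem coneProfile_nonneg (B T R Λ t x y : ℝ) : 0 ≤ coneProfile B T R Λ t x y := by
  have h := fun z => expNegInvGlue.nonneg z
  unfold coneProfile
  exact mul_nonneg (mul_nonneg (Real.exp_pos _).le (h _)) (mul_nonneg (h _) (mul_nonneg (h _) (h _)))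

theorem coneTest_nonneg (B T R Λ : ℝ) (p : ℝ × Plane) : 0 ≤ coneTest B T R Λ p :=
  mul_nonneg (Real.smoothTransition.nonneg _) (coneProfile_nonneg _ _ _ _ _ _ _)

theorem coneTest_eq {B T R Λ : ℝ} {p : ℝ × Plane} (hp : 0 ≤ p.1) :
    coneTest B T R Λ p = coneProfile B T R Λ p.1 (p.2 0) (p.2 1) := by
  rw [coneTest, Real.smoothTransition.one_of_one_le (by linarith), one_mul]

theorem mem_of_coneTest_ne_zero {B T R Λ : ℝ} {p : ℝ × Plane} (h : coneTest B T R Λ p ≠ 0) :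
    -1 < p.1 ∧ p.1 < T ∧ |p.2 0| < R - Λ * p.1 ∧ p.2 1 ^ 2 < R ^ 2 := by
  have hz : ∀ {z : ℝ}, expNegInvGlue z ≠ 0 → 0 < z := fun {z} hz => by
    by_contra hn
    exact hz (expNegInvGlue.zero_of_nonpos (not_lt.1 hn))
  unfold coneTest coneProfile at h
  have h1 := left_ne_zero_of_mul h
  have h2 := right_ne_zero_of_mul h
  have h3 := hz (right_ne_zero_of_mul (left_ne_zero_of_mul h2))
  have h4 := right_ne_zero_of_mul h2
  have h5 := hz (left_ne_zero_of_mul h4)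
  have h6 := hz (left_ne_zero_of_mul (right_ne_zero_of_mul h4))
  have h7 := hz (right_ne_zero_of_mul (right_ne_zero_of_mul h4))
  refine ⟨?_, by linarith, abs_lt.2 ⟨by linarith, by linarith⟩, by linarith⟩
  by_contra hn
  exact h1 (Real.smoothTransition.zero_of_nonpos (by linarith))

theorem contDiff_coneTest (B T R Λ : ℝ) : ContDiff ℝ ∞ (coneTest B T R Λ) := by
  have h1 : ContDiff ℝ ∞ fun p : ℝ × Plane => p.1 := contDiff_fst
  have h2 : ContDiff ℝ ∞ fun p : ℝ × Plane => p.2 0 :=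
    (EuclideanSpace.proj (0 : Fin 2) : Plane →L[ℝ] ℝ).contDiff.comp contDiff_snd
  have h3 : ContDiff ℝ ∞ fun p : ℝ × Plane => p.2 1 :=
    (EuclideanSpace.proj (1 : Fin 2) : Plane →L[ℝ] ℝ).contDiff.comp contDiff_snd
  have g := fun {f : ℝ × Plane → ℝ} (hf : ContDiff ℝ ∞ f) => contDiff_glue.comp hf
  have ht : ContDiff ℝ ∞ fun p : ℝ × Plane => Real.smoothTransition (p.1 + 1) :=
    Real.smoothTransition.contDiff.comp (h1.add contDiff_const)
  exact ht.mul ((((contDiff_const.mul h1).neg.exp).mul (g (contDiff_const.sub (h3.pow 2)))).mul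
    ((g (contDiff_const.sub h1)).mul
      ((g ((contDiff_const.sub h2).sub (contDiff_const.mul h1))).mul
        (g ((contDiff_const.add h2).sub (contDiff_const.mul h1))))))

theorem isTest_coneTest {B T T' R Λ : ℝ} (hT : T < T') (hΛ : 0 ≤ Λ) :
    IsTest T' (coneTest B T R Λ) where
  smooth := contDiff_coneTest B T R Λ
  compact := by
    refine HasCompactSupport.intro ((isCompact_Icc (a := -1) (b := T)).prod
      -- The cutoff in time admits times down to `-1`, where the cone has grown to half-width `R +
      -- Λ`.
      (IsDatum.isCompact_box (|R| + Λ))) fun p hp => ?_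
    by_contra h
    obtain ⟨h1, h2, h3, h4⟩ := mem_of_coneTest_ne_zero h
    refine hp ⟨⟨h1.le, h2.le⟩, ?_, ?_⟩
    · have := le_abs_self R
      nlinarith
    · have h5 := sq_lt_sq.1 h4
      linarith
  before := by
    have h1 : tsupport (coneTest B T R Λ) ⊆ {p | p.1 ≤ T} := by
      refine closure_minimal (fun p hp => ?_) (isClosed_le continuous_fst continuous_const)
      exact (mem_of_coneTest_ne_zero hp).2.1.le
    exact fun p hp => ⟨lt_of_le_of_lt (h1 hp) hT, mem_univ _⟩

/-- The differential inequality that makes the cone test functions useful. -/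
theorem coneTest_inequality {B T R Λ c : ℝ} (hΛ : 0 ≤ Λ) (hB : c + 1 ≤ B) {T' : ℝ} (hT : T < T')
    {p : ℝ × Plane} (hp : 0 < p.1) :
    dt (coneTest B T R Λ) p + Λ * |dx1 (coneTest B T R Λ) p| + c * coneTest B T R Λ p
      ≤ -coneTest B T R Λ p := by
  obtain ⟨t, x⟩ := p
  have hp' : 0 < t := hp
  have hζ := isTest_coneTest (B := B) (R := R) hT hΛ
  set E := Real.exp (-(B * t))
  set W := expNegInvGlue (R ^ 2 - x 1 ^ 2)
  set P := expNegInvGlue (T - t)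
  set Y := expNegInvGlue (R - x 0 - Λ * t)
  set Z := expNegInvGlue (R + x 0 - Λ * t)
  set P' := deriv expNegInvGlue (T - t)
  set Y' := deriv expNegInvGlue (R - x 0 - Λ * t)
  set Z' := deriv expNegInvGlue (R + x 0 - Λ * t)
  have hE : 0 < E := Real.exp_pos _
  have hW : 0 ≤ W := expNegInvGlue.nonneg _
  have hP : 0 ≤ P := expNegInvGlue.nonneg _
  have hY : 0 ≤ Y := expNegInvGlue.nonneg _
  have hZ : 0 ≤ Z := expNegInvGlue.nonneg _
  have hP' : 0 ≤ P' := deriv_glue_nonneg _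
  have hY' : 0 ≤ Y' := deriv_glue_nonneg _
  have hZ' : 0 ≤ Z' := deriv_glue_nonneg _
  have d1 : dt (coneTest B T R Λ) (t, x) = E * W *
      (-B * (P * (Y * Z)) - P' * (Y * Z) - Λ * (P * (Y' * Z + Y * Z'))) := by
    refine (hζ.hasDerivAt_time t x).unique ?_
    have a1 : HasDerivAt (fun s : ℝ => Real.exp (-(B * s))) (E * -B) t := by
      simpa using ((hasDerivAt_id t).const_mul B).neg.exp
    have a2 : HasDerivAt (fun s => expNegInvGlue (T - s)) (P' * -1) t :=
      (hasDerivAt_glue (T - t)).comp t ((hasDerivAt_id t).const_sub T)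
    have b3 : HasDerivAt (fun s => R - x 0 - Λ * s) (-(Λ * 1)) t :=
      ((hasDerivAt_id t).const_mul Λ).const_sub (R - x 0)
    have b4 : HasDerivAt (fun s => R + x 0 - Λ * s) (-(Λ * 1)) t :=
      ((hasDerivAt_id t).const_mul Λ).const_sub (R + x 0)
    have a3 : HasDerivAt (fun s => expNegInvGlue (R - x 0 - Λ * s)) (Y' * -(Λ * 1)) t :=
      HasDerivAt.comp (h₂ := expNegInvGlue) t (hasDerivAt_glue _) b3
    have a4 : HasDerivAt (fun s => expNegInvGlue (R + x 0 - Λ * s)) (Z' * -(Λ * 1)) t :=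
      HasDerivAt.comp (h₂ := expNegInvGlue) t (hasDerivAt_glue _) b4
    have a5 := ((a1.mul_const W).mul (a2.mul (a3.mul a4)))
    refine (a5.congr_deriv ?_).congr_of_eventuallyEq ?_
    · simp only [Pi.mul_apply]
      ring
    · filter_upwards [lt_mem_nhds hp'] with s hs
      rw [coneTest_eq hs.le]
      rfl
  have d2 : dx1 (coneTest B T R Λ) (t, x) = E * W * (P * (-(Y' * Z) + Y * Z')) := by
    have hx : x = !₂[x 0, x 1] := by ext i; fin_cases i <;> rfl
    have h1 := hζ.hasDerivAt_space t (x 0) (x 1)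
    rw [← hx] at h1
    refine h1.unique ?_
    have b3 : HasDerivAt (fun s => R - s - Λ * t) (-1) (x 0) :=
      ((hasDerivAt_id (x 0)).const_sub R).sub_const _
    have b4 : HasDerivAt (fun s => R + s - Λ * t) 1 (x 0) :=
      ((hasDerivAt_id (x 0)).const_add R).sub_const _
    have a3 : HasDerivAt (fun s => expNegInvGlue (R - s - Λ * t)) (Y' * -1) (x 0) :=
      HasDerivAt.comp (h₂ := expNegInvGlue) (x 0) (hasDerivAt_glue _) b3
    have a4 : HasDerivAt (fun s => expNegInvGlue (R + s - Λ * t)) (Z' * 1) (x 0) :=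
      HasDerivAt.comp (h₂ := expNegInvGlue) (x 0) (hasDerivAt_glue _) b4
    have a5 := ((a3.mul a4).const_mul P).const_mul (E * W)
    refine (a5.congr_deriv ?_).congr_of_eventuallyEq (Eventually.of_forall fun s => ?_)
    · ring
    · simp only
      rw [coneTest_eq hp'.le]
      rfl
  have d3 : coneTest B T R Λ (t, x) = E * W * (P * (Y * Z)) := coneTest_eq hp'.le
  rw [d1, d2, d3, abs_mul, abs_of_nonneg (mul_nonneg hE.le hW), abs_mul, abs_of_nonneg hP]
  -- The sides of the cone move inwards with speed `Λ`, so the time derivative contains `-Λ (Y' Z +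
  -- Y Z')`, which absorbs `Λ` times the space derivative. The factor `exp (-(B t))` with `B ≥ c +
  -- 1` absorbs the source.
  have h1 : |-(Y' * Z) + Y * Z'| ≤ Y' * Z + Y * Z' := by
    have e1 := mul_nonneg hY' hZ
    have e2 := mul_nonneg hY hZ'
    rw [abs_le]; constructor <;> linarith
  have h2 : Λ * (P * |-(Y' * Z) + Y * Z'|) ≤ Λ * (P * (Y' * Z + Y * Z')) := by gcongr
  have h3 : 0 ≤ (B - c - 1) * (P * (Y * Z)) :=
    mul_nonneg (by linarith) (mul_nonneg hP (mul_nonneg hY hZ))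
  have h4 : 0 ≤ P' * (Y * Z) := mul_nonneg hP' (mul_nonneg hY hZ)
  have h5 := mul_le_mul_of_nonneg_left (show (-B * (P * (Y * Z)) - P' * (Y * Z) -
    Λ * (P * (Y' * Z + Y * Z'))) + Λ * (P * |-(Y' * Z) + Y * Z'|) + c * (P * (Y * Z)) ≤
    -(P * (Y * Z)) by linarith) (mul_nonneg hE.le hW)
  linarith

/-- Entropy solutions agree with the wave. -/
theorem IsDatum.ae_eq_planeWave {c K T : ℝ} {χ : Plane → ℝ} (hχ : IsDatum K χ) (hT : 0 < T)
    {v : ℝ × Plane → ℝ} (hv : IsEntropySolution c T χ v) :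
    v =ᵐ[volume.restrict (slab T)] planeWave c K χ := by
  obtain ⟨M, m, hm, hvb⟩ := hv.bounded
  set V := planeWave c K χ with hV
  set lo := min M (-(K * Real.exp (|c| * T)))
  set hi := max m 0
  have hhi : hi < 1 := max_lt hm one_pos
  set μ : Measure (ℝ × Plane) := volume.restrict (slab T) with hμ
  have hI : ∀ᵐ q ∂μ, (lo ≤ v q ∧ v q ≤ hi) ∧ (lo ≤ V q ∧ V q ≤ hi) := by
    filter_upwards [hvb, ae_restrict_mem (measurableSet_slab _)] with q hq hqs
    have := hχ.planeWave_mem (c := c) hqs.1.1.le hqs.1.2.le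
    exact ⟨⟨(min_le_left _ _).trans hq.1, hq.2.trans (le_max_left _ _)⟩,
      (min_le_right _ _).trans this.1, this.2.trans (le_max_right _ _)⟩
  have hVm : AEStronglyMeasurable V μ := hχ.aestronglyMeasurable_planeWave _
  have hvm : AEStronglyMeasurable v μ := hv.meas
  set Λ := (1 + |lo| + |hi|) / (1 - hi)
  have hΛ : 0 ≤ Λ := by
    have : 0 < 1 - hi := by linarith
    positivity
  have hQ : ∀ᵐ q ∂μ, |kruzhkovFlux (v q) (V q)| ≤ Λ * |v q - V q| := by
    filter_upwards [hI] with q hq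
    exact abs_kruzhkovFlux_le hhi hq.1.2 hq.2.2 lo hq.1.1 hq.2.1
  have hN : ∀ᵐ q ∂μ, |v q - V q| ≤ hi - lo := by
    filter_upwards [hI] with q hq
    exact abs_le.2 ⟨by linarith [hq.1.1, hq.2.2], by linarith [hq.1.2, hq.2.1]⟩
  -- The integrand in Kato's inequality is at most `-|v - V| ζ ≤ 0`, while its integral is
  -- nonnegative. Hence it vanishes almost everywhere, and so does `|v - V| ζ`.
  have key : ∀ n : ℕ, ∀ᵐ q ∂μ,
      |v q - V q| * coneTest (c + 1) (T - 1 / ((n : ℝ) + 1)) n Λ q = 0 := by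
    intro n
    have hn : T - 1 / ((n : ℝ) + 1) < T := by
      have : 0 < 1 / ((n : ℝ) + 1) := by positivity
      linarith
    set ζ := coneTest (c + 1) (T - 1 / ((n : ℝ) + 1)) n Λ with hζdef
    have hζ : IsTest T ζ := isTest_coneTest hn hΛ
    have hζ0 : ∀ p, 0 ≤ ζ p := coneTest_nonneg _ _ _ _
    have kato := hχ.kato_inequality hT hv hζ hζ0
    have ma : AEStronglyMeasurable (fun q => |v q - V q|) μ := (hvm.sub hVm).norm
    have mb : AEStronglyMeasurable (fun q => kruzhkovFlux (v q) (V q)) μ :=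
      ((measurable_sign.comp_aemeasurable (hvm.aemeasurable.sub hVm.aemeasurable)).mul
        ((measurable_flux.comp_aemeasurable hvm.aemeasurable).sub
          (measurable_flux.comp_aemeasurable hVm.aemeasurable))).aestronglyMeasurable
    have ba : ∀ᵐ q ∂μ, ‖(|v q - V q|)‖ ≤ hi - lo := by
      filter_upwards [hN] with q hq
      rwa [Real.norm_eq_abs, abs_abs]
    have bb : ∀ᵐ q ∂μ, ‖kruzhkovFlux (v q) (V q)‖ ≤ Λ * (hi - lo) := by
      filter_upwards [hN, hQ] with q hq hq'
      exact hq'.trans (mul_le_mul_of_nonneg_left hq hΛ)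
    have i1 : Integrable (dt ζ) μ :=
      (hζ.continuous_dt.integrable_of_hasCompactSupport hζ.compact_dt).restrict
    have i2 : Integrable (dx1 ζ) μ :=
      (hζ.continuous_dx1.integrable_of_hasCompactSupport hζ.compact_dx1).restrict
    have i3 : Integrable ζ μ :=
      (hζ.continuous.integrable_of_hasCompactSupport hζ.compact).restrict
    have hint : Integrable (fun q => |v q - V q| * dt ζ q + kruzhkovFlux (v q) (V q) * dx1 ζ q
        + c * |v q - V q| * ζ q) μ := by
      refine ((i1.bdd_mul ma ba).add (i2.bdd_mul mb bb)).add ?_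
      refine ((i3.bdd_mul ma ba).const_mul c).congr (Eventually.of_forall fun q => ?_)
      simp only
      ring
    have hle : ∀ᵐ q ∂μ, |v q - V q| * dt ζ q + kruzhkovFlux (v q) (V q) * dx1 ζ q
        + c * |v q - V q| * ζ q ≤ -(|v q - V q| * ζ q) := by
      filter_upwards [hQ, ae_restrict_mem (measurableSet_slab _)] with q hq hqs
      have h1 := mul_le_mul_of_nonneg_left
        (coneTest_inequality (R := n) hΛ (le_refl (c + 1)) hn hqs.1.1) (abs_nonneg (v q - V q))
      rw [← hζdef] at h1
      have h2 : kruzhkovFlux (v q) (V q) * dx1 ζ q ≤ Λ * |v q - V q| * |dx1 ζ q| := by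
        refine (le_abs_self _).trans ?_
        rw [abs_mul]
        exact mul_le_mul_of_nonneg_right hq (abs_nonneg _)
      linarith
    have hz := (integral_eq_zero_iff_of_nonneg_ae (μ := μ)
      (f := fun q => -(|v q - V q| * dt ζ q + kruzhkovFlux (v q) (V q) * dx1 ζ q
        + c * |v q - V q| * ζ q)) ?_ hint.neg).1 ?_
    · filter_upwards [hz, hle] with q h1 h2
      have h3 : 0 ≤ |v q - V q| * ζ q := mul_nonneg (abs_nonneg _) (hζ0 q)
      simp only [Pi.zero_apply] at h1
      linarith
    · filter_upwards [hle] with q h2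
      have h3 : 0 ≤ |v q - V q| * ζ q := mul_nonneg (abs_nonneg _) (hζ0 q)
      simp only [Pi.zero_apply]
      linarith
    · have h4 : 0 ≤ ∫ q, -(|v q - V q| * dt ζ q + kruzhkovFlux (v q) (V q) * dx1 ζ q
        + c * |v q - V q| * ζ q) ∂μ := by
        refine integral_nonneg_of_ae ?_
        filter_upwards [hle] with q h2
        have h3 : 0 ≤ |v q - V q| * ζ q := mul_nonneg (abs_nonneg _) (hζ0 q)
        simp only [Pi.zero_apply]
        linarith
      rw [integral_neg] at h4 ⊢
      linarith
  filter_upwards [ae_all_iff.2 key, ae_restrict_mem (measurableSet_slab _)] with q hq hqs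
  -- Every point of the slab lies in the interior of the `n`-th cone for large `n`.
  obtain ⟨n1, hn1⟩ := exists_nat_one_div_lt (sub_pos.2 hqs.1.2)
  obtain ⟨n2, hn2⟩ := exists_nat_gt (|q.2 0| + |q.2 1| + Λ * q.1)
  set n := max n1 n2
  have h1 : (n2 : ℝ) ≤ n := by exact_mod_cast le_max_right n1 n2
  have h2 : 1 / ((n : ℝ) + 1) ≤ 1 / ((n1 : ℝ) + 1) := by
    have : (n1 : ℝ) ≤ n := by exact_mod_cast le_max_left n1 n2
    gcongr
  have h3 : 0 < coneTest (c + 1) (T - 1 / ((n : ℝ) + 1)) n Λ q := by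
    rw [coneTest_eq hqs.1.1.le]
    have hpos := fun {z : ℝ} (hz : 0 < z) => expNegInvGlue.pos_of_pos hz
    have hΛt : 0 ≤ Λ * q.1 := mul_nonneg hΛ hqs.1.1.le
    have a0 := abs_nonneg (q.2 0)
    have a1 := abs_nonneg (q.2 1)
    have b1 : 0 < (n : ℝ) ^ 2 - q.2 1 ^ 2 := by
      have : q.2 1 ^ 2 < (n : ℝ) ^ 2 := sq_lt_sq.2 (by
        rw [abs_of_nonneg (show (0 : ℝ) ≤ (n : ℝ) from Nat.cast_nonneg n)]; linarith)
      linarith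
    unfold coneProfile
    exact mul_pos (mul_pos (Real.exp_pos _) (hpos b1)) (mul_pos (hpos (by linarith))
      (mul_pos (hpos (by linarith [le_abs_self (q.2 0)]))
        (hpos (by linarith [neg_abs_le (q.2 0)]))))
  have h4 := (mul_eq_zero.1 (hq n)).resolve_right h3.ne'
  exact sub_eq_zero.1 (abs_eq_zero.1 h4)


/-! ### Uniqueness for the second-order problem -/

/-- A test function that is constant along the transversal direction up to a factor in time. -/
noncomputable def transportTest (T : ℝ) (β : ℝ → ℝ) (θ : Plane → ℝ) (p : ℝ × Plane) : ℝ :=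
  Real.smoothTransition (p.1 + 1) * (∫ s in T..p.1, β s) * θ (p.2 + p.1 • e1)

theorem contDiff_integral {β : ℝ → ℝ} (hβ : ContDiff ℝ ∞ β) (T : ℝ) :
    ContDiff ℝ ∞ fun t => ∫ s in T..t, β s := by
  have h : ∀ t, HasDerivAt (fun t => ∫ s in T..t, β s) (β t) t := fun t =>
    hβ.continuous.integral_hasStrictDerivAt T t |>.hasDerivAt
  rw [contDiff_infty_iff_deriv]
  refine ⟨fun t => (h t).differentiableAt, ?_⟩
  rwa [show deriv (fun t => ∫ s in T..t, β s) = β from funext fun t => (h t).deriv]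

theorem isTest_transportTest {T : ℝ} {β : ℝ → ℝ} {θ : Plane → ℝ} (hβ : ContDiff ℝ ∞ β)
    (hβc : HasCompactSupport β) (hβT : tsupport β ⊆ Ioo 0 T) (hθ : ContDiff ℝ ∞ θ)
    (hθc : HasCompactSupport θ) : IsTest T (transportTest T β θ) := by
  -- The support of `β` ends strictly before `T`, so the primitive based at `T` vanishes on a whole
  -- interval before `T`.
  obtain ⟨b, hbT, hb⟩ : ∃ b < T, ∀ t, b < t → β t = 0 := by
    rcases (tsupport β).eq_empty_or_nonempty with h | h
    · refine ⟨T - 1, by linarith, fun t _ => image_eq_zero_of_notMem_tsupport (by simp [h])⟩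
    · obtain ⟨b, hb1, hb2⟩ := hβc.isCompact.exists_isGreatest h
      exact ⟨b, (hβT hb1).2, fun t ht => image_eq_zero_of_notMem_tsupport fun h =>
        absurd (hb2 h) (not_le.2 ht)⟩
  have hint : ∀ t, b ≤ t → ∫ s in T..t, β s = 0 := by
    intro t ht
    rw [intervalIntegral.integral_congr_ae (g := fun _ => 0)]
    · simp
    · refine Eventually.of_forall fun s hs => hb s ?_
      exact lt_of_le_of_lt (le_min hbT.le ht) hs.1
  have hmem : ∀ p, transportTest T β θ p ≠ 0 → -1 < p.1 ∧ p.1 < b ∧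
      p.2 + p.1 • e1 ∈ tsupport θ := by
    intro p hp
    have h1 := left_ne_zero_of_mul (left_ne_zero_of_mul hp)
    have h2 := right_ne_zero_of_mul (left_ne_zero_of_mul hp)
    have h3 := right_ne_zero_of_mul hp
    refine ⟨?_, ?_, subset_tsupport _ h3⟩
    · by_contra hn
      exact h1 (Real.smoothTransition.zero_of_nonpos (by linarith))
    · by_contra hn
      exact h2 (hint _ (not_lt.1 hn))
  constructor
  · have h1 : ContDiff ℝ ∞ fun p : ℝ × Plane => p.1 := contDiff_fst
    exact ((Real.smoothTransition.contDiff.comp (h1.add contDiff_const)).mul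
      ((contDiff_integral hβ T).comp h1)).mul
      (hθ.comp (contDiff_snd.add (h1.smul contDiff_const)))
  · have hK : IsCompact ((fun z : ℝ × Plane => (z.1, z.2 - z.1 • e1)) ''
        (Icc (-1) b ×ˢ tsupport θ)) := (isCompact_Icc.prod hθc.isCompact).image (by fun_prop)
    refine HasCompactSupport.intro hK fun p hp => ?_
    by_contra h
    obtain ⟨h1, h2, h3⟩ := hmem p h
    exact hp ⟨(p.1, p.2 + p.1 • e1), ⟨⟨h1.le, h2.le⟩, h3⟩, by simp⟩
  · have h1 : tsupport (transportTest T β θ) ⊆ {p | p.1 ≤ b} :=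
      closure_minimal (fun p hp => (hmem p hp).2.1.le) (isClosed_le continuous_fst continuous_const)
    exact fun p hp => ⟨lt_of_le_of_lt (h1 hp) hbT, mem_univ _⟩

/-- Along a transversal line the argument of `θ` is constant, so only the primitive of `β` is
differentiated; the cutoff equals `1` at positive times. -/
theorem transportTest_derivs {T : ℝ} {β : ℝ → ℝ} {θ : Plane → ℝ} (hβ : ContDiff ℝ ∞ β)
    (hζ : IsTest T (transportTest T β θ)) {p : ℝ × Plane} (hp : 0 < p.1) :
    dt (transportTest T β θ) p - dx1 (transportTest T β θ) p = β p.1 * θ (p.2 + p.1 • e1) := by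
  have h1 := hζ.hasDerivAt_transversal p.1 p.1 p.2
  simp only [sub_self, zero_smul, sub_zero] at h1
  refine h1.unique ?_
  have h2 : HasDerivAt (fun t => ∫ s in T..t, β s) (β p.1) p.1 :=
    hβ.continuous.integral_hasStrictDerivAt T p.1 |>.hasDerivAt
  refine (h2.mul_const (θ (p.2 + p.1 • e1))).congr_of_eventuallyEq ?_
  filter_upwards [lt_mem_nhds hp] with t ht
  rw [transportTest, Real.smoothTransition.one_of_one_le (by simp only; linarith), one_mul]
  congr 2
  simp only
  module

/-! ### Continuous curves in `L²` -/

theorem lintegral_enorm_mul_le {f g : Plane → ℝ} (hf : AEStronglyMeasurable f)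
    (hg : AEStronglyMeasurable g) :
    ∫⁻ x, ‖f x * g x‖ₑ ≤ eLpNorm f 2 volume * eLpNorm g 2 volume := by
  have h := eLpNorm_smul_le_mul_eLpNorm (p := 2) (q := 2) (r := 1) hg hf
  rw [eLpNorm_one_eq_lintegral_enorm] at h
  exact h

/-- A continuous curve in `L²` with a jointly measurable representative. -/
structure IsCurve (T : ℝ) (w : ℝ → Plane → ℝ) : Prop where
  meas : AEStronglyMeasurable (fun p : ℝ × Plane => w p.1 p.2) (volume.restrict (slab T))
  memLp : ∀ t ∈ Ico 0 T, MemLp (w t) 2 volume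
  cont : ∀ t ∈ Ico 0 T,
    Tendsto (fun s => eLpNorm (w s - w t) 2 volume) (𝓝[Ico 0 T] t) (𝓝 0)

theorem IsSolution.isCurve {c T : ℝ} {χ : Plane → ℝ} {u : ℝ → Plane → ℝ}
    (hu : IsSolution c T χ u) : IsCurve T u := ⟨hu.meas, hu.memLp, hu.cont⟩

namespace IsCurve

variable {T : ℝ} {w : ℝ → Plane → ℝ} (hw : IsCurve T w)
include hw

/-- Continuity bounds the norm near each time, and compactness makes the bound uniform. -/
theorem exists_bound {K : Set ℝ} (hK : IsCompact K) (hKT : K ⊆ Ico 0 T) :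
    ∃ C : ℝ≥0∞, C < ⊤ ∧ ∀ t ∈ K, eLpNorm (w t) 2 volume ≤ C := by
  suffices h : ∃ C : ℝ≥0∞, C < ⊤ ∧ ∀ t ∈ K, t ∈ K → eLpNorm (w t) 2 volume ≤ C by
    obtain ⟨C, hC, h⟩ := h
    exact ⟨C, hC, fun t ht => h t ht ht⟩
  refine hK.induction_on (p := fun S => ∃ C : ℝ≥0∞, C < ⊤ ∧
    ∀ t ∈ S, t ∈ K → eLpNorm (w t) 2 volume ≤ C) ?_ ?_ ?_ ?_
  · exact ⟨0, by simp, by simp⟩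
  · rintro s t hst ⟨C, hC, h⟩
    exact ⟨C, hC, fun x hx => h x (hst hx)⟩
  · rintro s t ⟨C, hC, h⟩ ⟨C', hC', h'⟩
    refine ⟨max C C', max_lt hC hC', fun x hx hxK => ?_⟩
    rcases hx with hx | hx
    · exact (h x hx hxK).trans (le_max_left _ _)
    · exact (h' x hx hxK).trans (le_max_right _ _)
  · intro t ht
    have h1 := (hw.cont t (hKT ht)).eventually_lt_const (show (0 : ℝ≥0∞) < 1 by simp)
    refine ⟨{s | s ∈ K → eLpNorm (w s - w t) 2 volume < 1}, ?_, 1 + eLpNorm (w t) 2 volume, ?_, ?_⟩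
    · have h2 := h1.filter_mono (nhdsWithin_mono t hKT)
      filter_upwards [h2] with s hs _ using hs
    · exact ENNReal.add_lt_top.2 ⟨by simp, (hw.memLp t (hKT ht)).2⟩
    · intro s hs hsK
      have h3 : w s = (w s - w t) + w t := by simp
      have h4 := hw.memLp s (hKT hsK)
      have h5 := hw.memLp t (hKT ht)
      rw [h3]
      exact (eLpNorm_add_le (h4.sub h5).1 h5.1 (by norm_num)).trans
        (add_le_add (hs hsK).le le_rfl)

theorem integrable_mul {β : ℝ → ℝ} {θ : Plane → ℝ} (hβ : Continuous β)
    (hβc : HasCompactSupport β) (hβT : tsupport β ⊆ Ioo 0 T) (hθ : Continuous θ)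
    (hθc : HasCompactSupport θ) :
    Integrable (fun p : ℝ × Plane => w p.1 p.2 * (β p.1 * θ (p.2 + p.1 • e1)))
      (volume.restrict (slab T)) := by
  have hc : Continuous fun p : ℝ × Plane => β p.1 * θ (p.2 + p.1 • e1) := by fun_prop
  have hm : AEStronglyMeasurable (fun p : ℝ × Plane => w p.1 p.2 * (β p.1 * θ (p.2 + p.1 • e1)))
      (volume.restrict (slab T)) := hw.meas.mul hc.aestronglyMeasurable
  refine ⟨hm, ?_⟩
  obtain ⟨C, hC, hCw⟩ := hw.exists_bound hβc.isCompact (hβT.trans Ioo_subset_Ico_self)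
  obtain ⟨D, hD⟩ := hβc.exists_bound_of_continuous hβ
  have hslab : (volume.restrict (slab T) : Measure (ℝ × Plane)) =
      (volume.restrict (Ioo 0 T)).prod (volume : Measure Plane) := by
    rw [slab, Measure.volume_eq_prod, ← Measure.prod_restrict, Measure.restrict_univ]
  have hθL : MemLp θ 2 volume := hθ.memLp_of_hasCompactSupport hθc
  rw [HasFiniteIntegral]
  rw [hslab] at hm ⊢
  rw [lintegral_prod _ hm.enorm]
  have hb : ∀ t ∈ Ioo 0 T, ∫⁻ x, ‖w t x * (β t * θ (x + t • e1))‖ₑ ≤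
      C * (ENNReal.ofReal D * eLpNorm θ 2 volume) := by
    intro t ht
    by_cases h : t ∈ tsupport β
    · have h1 := (lintegral_enorm_mul_le (f := w t) (g := fun x => β t * θ (x + t • e1))
        (hw.memLp t (Ioo_subset_Ico_self ht)).1
        (by fun_prop : Continuous fun x => β t * θ (x + t • e1)).aestronglyMeasurable)
      refine h1.trans (mul_le_mul' (hCw t h) ?_)
      have h2 : eLpNorm (fun x => θ (x + t • e1)) 2 volume = eLpNorm θ 2 volume :=
        eLpNorm_comp_measurePreserving hθ.aestronglyMeasurable
          (measurePreserving_add_right volume (t • e1))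
      have h3 := eLpNorm_const_smul_le (c := β t) (f := fun x => θ (x + t • e1)) (p := 2)
        (μ := (volume : Measure Plane))
      rw [h2] at h3
      refine le_trans h3 (mul_le_mul' ?_ le_rfl)
      rw [← ofReal_norm]
      exact ENNReal.ofReal_le_ofReal (hD t)
    · simp [image_eq_zero_of_notMem_tsupport h]
  refine lt_of_le_of_lt (setLIntegral_mono' measurableSet_Ioo hb) ?_
  rw [setLIntegral_const]
  refine ENNReal.mul_lt_top (ENNReal.mul_lt_top hC (ENNReal.mul_lt_top (by simp) hθL.2)) (by simp)

/-- Split off `w s - w t`. That part is small by Cauchy-Schwarz, because translations preserve the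
`L²` norm of `θ`. The rest is dominated convergence for the fixed function `w t`. -/
theorem continuousOn_pairing {θ : Plane → ℝ} (hθ : Continuous θ) (hθc : HasCompactSupport θ) :
    ContinuousOn (fun t => ∫ x, w t x * θ (x + t • e1)) (Ioo 0 T) := by
  intro t ht
  have htI := Ioo_subset_Ico_self ht
  have hθL : MemLp θ 2 volume := hθ.memLp_of_hasCompactSupport hθc
  have hθs : ∀ s : ℝ, MemLp (fun x => θ (x + s • e1)) 2 volume := fun s =>
    hθL.comp_measurePreserving (measurePreserving_add_right volume (s • e1))
  have hA : Tendsto (fun s => ∫ x, (w s - w t) x * θ (x + s • e1)) (𝓝[Ioo 0 T] t) (𝓝 0) := by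
    rw [tendsto_zero_iff_enorm_tendsto_zero]
    have h1 : Tendsto (fun s => eLpNorm (w s - w t) 2 volume * eLpNorm θ 2 volume)
        (𝓝[Ioo 0 T] t) (𝓝 0) := by
      have := ENNReal.Tendsto.mul_const ((hw.cont t htI).mono_left
        (nhdsWithin_mono t Ioo_subset_Ico_self)) (b := eLpNorm θ 2 volume) (Or.inr hθL.2.ne)
      rwa [zero_mul] at this
    refine tendsto_of_tendsto_of_tendsto_of_le_of_le' tendsto_const_nhds h1
      (Eventually.of_forall fun _ => zero_le) ?_
    filter_upwards [self_mem_nhdsWithin] with s hs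
    refine (enorm_integral_le_lintegral_enorm _).trans ?_
    refine (lintegral_enorm_mul_le
      ((hw.memLp s (Ioo_subset_Ico_self hs)).sub (hw.memLp t htI)).1 (hθs s).1).trans ?_
    rw [show eLpNorm (fun x => θ (x + s • e1)) 2 volume = eLpNorm θ 2 volume from
      eLpNorm_comp_measurePreserving hθ.aestronglyMeasurable
        (measurePreserving_add_right volume (s • e1))]
  have hB : Tendsto (fun s => ∫ x, w t x * θ (x + s • e1)) (𝓝[Ioo 0 T] t)
      (𝓝 (∫ x, w t x * θ (x + t • e1))) := by
    refine Tendsto.mono_left ?_ nhdsWithin_le_nhds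
    obtain ⟨D, hD⟩ := hθc.exists_bound_of_continuous hθ
    have hK : IsCompact ((fun z : ℝ × Plane => z.2 - z.1 • e1) ''
        (Icc (t - 1) (t + 1) ×ˢ tsupport θ)) :=
      (isCompact_Icc.prod hθc.isCompact).image (by fun_prop)
    set S := (fun z : ℝ × Plane => z.2 - z.1 • e1) '' (Icc (t - 1) (t + 1) ×ˢ tsupport θ)
    have hi : IntegrableOn (w t) S :=
      ((hw.memLp t htI).locallyIntegrable (by norm_num)).integrableOn_isCompact hK
    refine tendsto_integral_filter_of_dominated_convergence
      (S.indicator fun x => ‖w t x‖ * D) (Eventually.of_forall fun s => ?_) ?_ ?_ ?_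
    · exact (hw.memLp t htI).1.mul (hθs s).1
    · filter_upwards [Icc_mem_nhds (show t - 1 < t by linarith) (show t < t + 1 by linarith)]
        with s hs
      refine Eventually.of_forall fun x => ?_
      by_cases hx : x ∈ S
      · rw [indicator_of_mem hx, norm_mul]
        exact mul_le_mul_of_nonneg_left (hD _) (norm_nonneg _)
      · rw [indicator_of_notMem hx]
        have : θ (x + s • e1) = 0 := image_eq_zero_of_notMem_tsupport fun h =>
          hx ⟨(s, x + s • e1), ⟨hs, h⟩, by simp⟩
        simp [this]
    · exact (integrable_indicator_iff hK.measurableSet).2 (hi.norm.mul_const D)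
    · refine Eventually.of_forall fun x => ?_
      exact ((by fun_prop : Continuous fun s : ℝ => w t x * θ (x + s • e1)).tendsto t)
  have hAB := hA.add hB
  rw [zero_add] at hAB
  refine hAB.congr' ?_
  filter_upwards [self_mem_nhdsWithin] with s hs
  have h1 := (hw.memLp s (Ioo_subset_Ico_self hs))
  have h2 := (hw.memLp t htI)
  refine (integral_add ((h1.sub h2).integrable_mul (hθs s))
    (h2.integrable_mul (hθs s))).symm.trans ?_
  refine integral_congr_ae (Eventually.of_forall fun x => ?_)
  simp only [Pi.sub_apply, Pi.mul_apply]
  ring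

end IsCurve

/-- A curve is determined by its derivative in the transversal direction. -/
theorem IsCurve.ae_eq {T : ℝ} {w w' : ℝ → Plane → ℝ} (hw : IsCurve T w) (hw' : IsCurve T w')
    (h : ∀ ζ, IsTest T ζ → ∫ p in slab T, w p.1 p.2 * (dt ζ p - dx1 ζ p) =
      ∫ p in slab T, w' p.1 p.2 * (dt ζ p - dx1 ζ p)) {t : ℝ} (ht : t ∈ Ioo 0 T) :
    w t =ᵐ[volume] w' t := by
  have hslab : (volume.restrict (slab T) : Measure (ℝ × Plane)) =
      (volume.restrict (Ioo 0 T)).prod (volume : Measure Plane) := by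
    rw [slab, Measure.volume_eq_prod, ← Measure.prod_restrict, Measure.restrict_univ]
  have key : ∀ θ : Plane → ℝ, ContDiff ℝ ∞ θ → HasCompactSupport θ → ∀ t ∈ Ioo 0 T,
      ∫ x, w t x * θ (x + t • e1) = ∫ x, w' t x * θ (x + t • e1) := by
    intro θ hθ hθc
    have c1 := hw.continuousOn_pairing hθ.continuous hθc
    have c2 := hw'.continuousOn_pairing hθ.continuous hθc
    -- The pairings of the two curves with the moving test function agree as distributions in time,
    -- and continuity upgrades this to every time.
    have hz := (isOpen_Ioo (a := (0 : ℝ)) (b := T)).ae_eq_zero_of_integral_contDiff_smul_eq_zero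
      (μ := volume) ((c1.sub c2).locallyIntegrableOn measurableSet_Ioo) ?_
    · refine Measure.eqOn_open_of_ae_eq (μ := volume) ?_ isOpen_Ioo c1 c2
      rw [Filter.EventuallyEq, ae_restrict_iff' measurableSet_Ioo]
      filter_upwards [hz] with s hs hsI
      exact sub_eq_zero.1 (hs hsI)
    intro β hβ hβc hβT
    have hζ := isTest_transportTest hβ hβc hβT hθ hθc
    have e : ∀ {y : ℝ → Plane → ℝ}, IsCurve T y → ∫ p in slab T, y p.1 p.2 *
        (dt (transportTest T β θ) p - dx1 (transportTest T β θ) p) =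
        ∫ s in Ioo 0 T, β s * ∫ x, y s x * θ (x + s • e1) := by
      intro y hy
      have h1 : ∫ p in slab T, y p.1 p.2 *
          (dt (transportTest T β θ) p - dx1 (transportTest T β θ) p) =
          ∫ p in slab T, y p.1 p.2 * (β p.1 * θ (p.2 + p.1 • e1)) :=
        setIntegral_congr_fun (measurableSet_slab T) fun p hp => by
          rw [transportTest_derivs hβ hζ hp.1.1]
      have h2 := hy.integrable_mul hβ.continuous hβc hβT hθ.continuous hθc
      rw [h1]
      rw [hslab] at h2 ⊢
      rw [integral_prod _ h2]
      refine integral_congr_ae (Eventually.of_forall fun s => ?_)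
      dsimp only
      rw [← integral_const_mul]
      refine integral_congr_ae (Eventually.of_forall fun x => ?_)
      simp only
      ring
    have h3 := h _ hζ
    rw [e hw, e hw'] at h3
    have hsupp : ∀ s, s ∉ Ioo 0 T → β s = 0 := fun s hs =>
      image_eq_zero_of_notMem_tsupport fun h => hs (hβT h)
    rw [setIntegral_eq_integral_of_forall_compl_eq_zero (fun s hs => by simp [hsupp s hs]),
      setIntegral_eq_integral_of_forall_compl_eq_zero (fun s hs => by simp [hsupp s hs])] at h3
    have hi : ∀ {y : ℝ → Plane → ℝ}, ContinuousOn (fun t => ∫ x, y t x * θ (x + t • e1)) (Ioo 0 T) →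
        Integrable fun s => β s * ∫ x, y s x * θ (x + s • e1) := by
      intro y hy
      have : Continuous fun s => β s * ∫ x, y s x * θ (x + s • e1) := by
        refine continuous_iff_continuousAt.2 fun s => ?_
        by_cases hs : s ∈ tsupport β
        · exact hβ.continuous.continuousAt.mul
            (hy.continuousAt (isOpen_Ioo.mem_nhds (hβT hs)))
        · have : (fun s => β s * ∫ x, y s x * θ (x + s • e1)) =ᶠ[𝓝 s] fun _ => 0 := by
            filter_upwards [(isClosed_tsupport β).isOpen_compl.mem_nhds hs] with r hr
            rw [image_eq_zero_of_notMem_tsupport hr, zero_mul]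
          exact continuousAt_const.congr this.symm
      exact this.integrable_of_hasCompactSupport hβc.mul_right
    simp only [smul_eq_mul, Pi.sub_apply, mul_sub]
    rw [integral_sub (hi c1) (hi c2), h3, sub_self]
  have hL := hw.memLp t (Ioo_subset_Ico_self ht)
  have hL' := hw'.memLp t (Ioo_subset_Ico_self ht)
  have h0 := ae_eq_zero_of_integral_contDiff_smul_eq_zero (μ := (volume : Measure Plane))
    (f := w t - w' t) ((hL.sub hL').locallyIntegrable (by norm_num)) ?_
  · filter_upwards [h0] with x hx
    exact sub_eq_zero.1 hx
  intro g hg hgc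
  -- Translating the test function beforehand makes the pairing at time `t` a pairing with `g`
  -- itself.
  have h1 := key (fun y => g (y - t • e1)) (hg.comp (contDiff_id.sub contDiff_const))
    (hgc.comp_homeomorph (Homeomorph.subRight (t • e1))) t ht
  simp only [add_sub_cancel_right] at h1
  have hgL : MemLp g 2 volume := hg.continuous.memLp_of_hasCompactSupport hgc
  have h2 := integral_sub (hL.integrable_mul hgL) (hL'.integrable_mul hgL)
  simp only [Pi.mul_apply] at h2
  rw [h1, sub_self] at h2
  rw [← h2]
  refine integral_congr_ae (Eventually.of_forall fun x => ?_)
  simp only [smul_eq_mul, Pi.sub_apply]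
  ring

/-- The solution of the second-order problem is unique. -/
theorem IsDatum.ae_eq_travel {c K T ρ : ℝ} {χ : Plane → ℝ} (hχ : IsDatum K χ)
    (hρ : ∀ y b, ρ ≤ |y| ∨ ρ ≤ |b| → χ !₂[y, b] = 0) {u : ℝ → Plane → ℝ}
    (hu : IsSolution c T χ u) {t : ℝ} (ht : t ∈ Ioo 0 T) : u t =ᵐ[volume] travel c K χ t := by
  have hT : 0 < T := ht.1.trans ht.2
  refine hu.isCurve.ae_eq (hχ.isSolution_travel (c := c) hρ hT).isCurve (fun ζ hζ => ?_) ht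
  obtain ⟨v, hv, hvu⟩ := hu.eqn
  rw [hvu ζ hζ, hχ.integral_travel hζ]
  refine integral_congr_ae ?_
  filter_upwards [hχ.ae_eq_planeWave hT hv] with p hp
  rw [hp]


/-! ### Regularity in the logarithmic Sobolev scale -/

/-- The bound `log r ≤ r ^ ε / ε` with `ε = 1 / (4 β)`, raised to the power `β`, costs exactly `r ^
(1/4)`. -/
theorem one_add_log_rpow_le {β r : ℝ} (hβ : 0 < β) (hr : 1 ≤ r) :
    (1 + |Real.log r|) ^ β ≤ (1 + 4 * β) ^ β * r ^ (1 / 4 : ℝ) := by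
  have hr0 : 0 ≤ r := by linarith
  have hε : 0 < 1 / (4 * β) := by positivity
  rw [abs_of_nonneg (Real.log_nonneg hr)]
  have h1 : Real.log r ≤ 4 * β * r ^ (1 / (4 * β)) := by
    have := Real.log_le_rpow_div hr0 hε
    rwa [div_div_eq_mul_div, div_one, mul_comm] at this
  have h2 : 1 ≤ r ^ (1 / (4 * β)) := Real.one_le_rpow hr hε.le
  have h3 : 1 + Real.log r ≤ (1 + 4 * β) * r ^ (1 / (4 * β)) := by linarith
  have h4 := Real.log_nonneg hr
  calc (1 + Real.log r) ^ β ≤ ((1 + 4 * β) * r ^ (1 / (4 * β))) ^ β :=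
        Real.rpow_le_rpow (by linarith) h3 hβ.le
    _ = _ := by
        rw [Real.mul_rpow (by linarith) (by positivity), ← Real.rpow_mul hr0]
        congr 2
        field_simp

/-- For large `‖ξ‖` the logarithm costs at most a power `1/4`, so the weight dominates `‖ξ‖ ^
(5/2)`, and `5/2 - 3/2 = 1`. The exponent `-3/2` is split off because that power is square
integrable in the plane. -/
theorem one_add_norm_le_logSobolevWeight {β : ℝ} (hβ : 0 < β) :
    ∃ C, 0 ≤ C ∧ ∀ ξ : Plane, 1 + ‖ξ‖ ≤
      C * (1 + ‖ξ‖) ^ (-(3 / 2) : ℝ) * (1 + logSobolevWeight (11 / 4) β ξ) := by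
  have hB : (1 : ℝ) ≤ (1 + 4 * β) ^ β := Real.one_le_rpow (by linarith) hβ.le
  refine ⟨2 ^ (5 / 2 : ℝ) * (1 + 4 * β) ^ β, by positivity, fun ξ => ?_⟩
  set r := ‖ξ‖ with hr
  have hr0 : 0 ≤ r := norm_nonneg ξ
  have hW : 0 ≤ logSobolevWeight (11 / 4) β ξ := by unfold logSobolevWeight; positivity
  suffices h : (1 + r) ^ (5 / 2 : ℝ) ≤ 2 ^ (5 / 2 : ℝ) * (1 + 4 * β) ^ β *
      (1 + logSobolevWeight (11 / 4) β ξ) by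
    have h1 : (1 + r) ^ (-(3 / 2) : ℝ) * (1 + r) ^ (5 / 2 : ℝ) = 1 + r := by
      rw [← Real.rpow_add (by linarith)]
      norm_num
    calc 1 + r = (1 + r) ^ (-(3 / 2) : ℝ) * (1 + r) ^ (5 / 2 : ℝ) := h1.symm
      _ ≤ (1 + r) ^ (-(3 / 2) : ℝ) * (2 ^ (5 / 2 : ℝ) * (1 + 4 * β) ^ β *
          (1 + logSobolevWeight (11 / 4) β ξ)) := by gcongr
      _ = _ := by ring
  rcases le_total r 1 with h | h
  · calc (1 + r) ^ (5 / 2 : ℝ) ≤ 2 ^ (5 / 2 : ℝ) :=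
          Real.rpow_le_rpow (by linarith) (by linarith) (by norm_num)
      _ = 2 ^ (5 / 2 : ℝ) * 1 * (1 + 0) := by ring
      _ ≤ _ := by gcongr
  · have h1 : (1 + r) ^ (5 / 2 : ℝ) ≤ 2 ^ (5 / 2 : ℝ) * r ^ (5 / 2 : ℝ) := by
      rw [← Real.mul_rpow (by norm_num) hr0]
      exact Real.rpow_le_rpow (by linarith) (by linarith) (by norm_num)
    have h2 := one_add_log_rpow_le hβ h
    have hl : 0 < 1 + |Real.log r| := by positivity
    have h3 : r ^ (5 / 2 : ℝ) ≤ (1 + 4 * β) ^ β * logSobolevWeight (11 / 4) β ξ := by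
      unfold logSobolevWeight
      rw [← hr]
      have e : r ^ (11 / 4 : ℝ) = r ^ (5 / 2 : ℝ) * r ^ (1 / 4 : ℝ) := by
        rw [← Real.rpow_add (by linarith)]; norm_num
      rw [e, Real.rpow_neg hl.le]
      calc r ^ (5 / 2 : ℝ) = r ^ (5 / 2 : ℝ) * ((1 + |Real.log r|) ^ β *
            ((1 + |Real.log r|) ^ β)⁻¹) := by
            rw [mul_inv_cancel₀ (Real.rpow_pos_of_pos hl _).ne', mul_one]
        _ ≤ r ^ (5 / 2 : ℝ) * ((1 + 4 * β) ^ β * r ^ (1 / 4 : ℝ) *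
            ((1 + |Real.log r|) ^ β)⁻¹) := by gcongr
        _ = _ := by ring
    calc (1 + r) ^ (5 / 2 : ℝ) ≤ 2 ^ (5 / 2 : ℝ) * r ^ (5 / 2 : ℝ) := h1
      _ ≤ 2 ^ (5 / 2 : ℝ) * ((1 + 4 * β) ^ β * logSobolevWeight (11 / 4) β ξ) := by gcongr
      _ ≤ 2 ^ (5 / 2 : ℝ) * ((1 + 4 * β) ^ β * (1 + logSobolevWeight (11 / 4) β ξ)) := by
          gcongr; linarith
      _ = _ := by ring

theorem memLp_one_add_norm_rpow :
    MemLp (fun ξ : Plane => (1 + ‖ξ‖) ^ (-(3 / 2) : ℝ)) 2 volume := by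
  rw [memLp_two_iff_integrable_sq (Measurable.aestronglyMeasurable (by fun_prop))]
  have h := integrable_one_add_norm (E := Plane) (μ := volume) (r := 3) (by simp; norm_num)
  refine h.congr (Eventually.of_forall fun ξ => ?_)
  have : 0 ≤ 1 + ‖ξ‖ := by positivity
  simp only
  rw [← Real.rpow_natCast, ← Real.rpow_mul this]
  norm_num

/-- The inversion formula for a square integrable function with integrable transform. -/
theorem lp_ae_eq_fourierInv (g : Lp ℂ 2 (volume : Measure Plane))
    (hg : Integrable (𝓕 g : Lp ℂ 2 (volume : Measure Plane)) volume) :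
    g =ᵐ[volume] (𝓕⁻ ((𝓕 g : Lp ℂ 2 (volume : Measure Plane)) : Plane → ℂ) : Plane → ℂ) := by
  set G : Lp ℂ 2 (volume : Measure Plane) := 𝓕 g with hG
  have hcont : Continuous (𝓕⁻ (G : Plane → ℂ) : Plane → ℂ) := by
    have : (𝓕⁻ (G : Plane → ℂ) : Plane → ℂ) = fun x => 𝓕 (G : Plane → ℂ) (-x) :=
      funext fun x => Real.fourierInv_eq_fourier_neg _ _
    rw [this]
    exact (VectorFourier.fourierIntegral_continuous Real.continuous_fourierChar
      (innerSL ℝ).continuous₂ hg).comp continuous_neg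
  have h0 := ae_eq_zero_of_integral_contDiff_smul_eq_zero (μ := (volume : Measure Plane))
    (f := fun x => g x - (𝓕⁻ (G : Plane → ℂ) : Plane → ℂ) x)
    (((Lp.memLp g).locallyIntegrable (by norm_num)).sub hcont.locallyIntegrable) ?_
  · filter_upwards [h0] with x hx
    exact sub_eq_zero.1 hx
  intro θ hθ hθc
  have hs : HasCompactSupport fun x => (θ x : ℂ) :=
    hθc.comp_left (g := fun r : ℝ => (r : ℂ)) Complex.ofReal_zero
  have hd : ContDiff ℝ ∞ fun x => (θ x : ℂ) := Complex.ofRealCLM.contDiff.comp hθ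
  set ψ : SchwartzMap Plane ℂ := hs.toSchwartzMap hd with hψ
  have hψx : ∀ x, ψ x = (θ x : ℂ) := fun x => rfl
  have h1 := Lp.fourierInv_toTemperedDistribution_eq G
  have h2 : (𝓕⁻ G : Lp ℂ 2 (volume : Measure Plane)) = g := by
    rw [hG]; exact FourierTransform.fourierInv_fourier_eq g
  rw [h2] at h1
  have h3 := congrArg (fun F => F ψ) h1
  rw [TemperedDistribution.fourierInv_apply, Lp.toTemperedDistribution_apply,
    Lp.toTemperedDistribution_apply] at h3
  -- The integral kernel is symmetric, so the inverse transform passes from the Schwartz function to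
  -- the integrable function `G`. The distributional inverse transform of `G` is therefore given by
  -- the integral.
  have h4 : ∫ x, (𝓕⁻ ψ) x • G x = ∫ x, ψ x • (𝓕⁻ (G : Plane → ℂ) : Plane → ℂ) x := by
    have := VectorFourier.integral_fourierIntegral_smul_eq_flip (μ := (volume : Measure Plane))
      (ν := (volume : Measure Plane)) (L := -innerₗ Plane) (f := ψ) (g := G)
      Real.continuous_fourierChar (((continuous_inner (𝕜 := ℝ) (E := Plane)).neg).congr
        fun p => by simp) ψ.integrable hg
    rw [SchwartzMap.fourierInv_coe]
    refine this.trans ?_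
    congr 1
    ext x
    congr 1
    rw [Real.fourierInv_eq]
    simp [VectorFourier.fourierIntegral, real_inner_comm]
  have h5 : ∫ x, ψ x • g x = ∫ x, ψ x • (𝓕⁻ (G : Plane → ℂ) : Plane → ℂ) x := by
    rw [← h4, h3]
  have i1 : Integrable fun x => ψ x • g x := by
    have := ((Lp.memLp g).locallyIntegrable (by norm_num : (1 : ℝ≥0∞) ≤ 2)).integrable_smul_left_of_hasCompactSupport
      ψ.continuous (by exact hs)
    exact this
  have i2 : Integrable fun x => ψ x • (𝓕⁻ (G : Plane → ℂ) : Plane → ℂ) x :=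
    (ψ.continuous.smul hcont).integrable_of_hasCompactSupport (HasCompactSupport.smul_right hs)
  have h6 := integral_sub i1 i2
  rw [h5, sub_self] at h6
  rw [← h6]
  refine integral_congr_ae (Eventually.of_forall fun x => ?_)
  simp [hψx, mul_sub]

/-- Functions in `H^{11/4} (ln H)^{-β}` have a differentiable representative. -/
theorem MemLogSobolev.exists_differentiable {β : ℝ} (hβ : 0 < β) {f : Plane → ℝ}
    (hf : MemLogSobolev (11 / 4) β f) :
    ∃ g : Plane → ℝ, Differentiable ℝ g ∧ f =ᵐ[volume] g := by
  obtain ⟨hL, hw⟩ := hf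
  set G : Lp ℂ 2 (volume : Measure Plane) := 𝓕 hL.toLp with hG
  obtain ⟨C, hC0, hC⟩ := one_add_norm_le_logSobolevWeight hβ
  have hsum : MemLp (fun ξ : Plane => ‖G ξ‖ + ‖(logSobolevWeight (11 / 4) β ξ : ℂ) * G ξ‖) 2
      volume := (Lp.memLp G).norm.add hw.norm
  have hdom := (memLp_one_add_norm_rpow.integrable_mul hsum).const_mul C
  -- By Cauchy-Schwarz, with a square integrable power against `G` and the weighted `G`, the first
  -- moment of the transform is integrable. This permits differentiation under the Fourier integral.
  have hmain : Integrable (fun ξ : Plane => (1 + ‖ξ‖) * ‖G ξ‖) := by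
    refine hdom.mono' (((by fun_prop : Continuous fun ξ : Plane =>
      1 + ‖ξ‖).aestronglyMeasurable).mul (Lp.memLp G).1.norm) (Eventually.of_forall fun ξ => ?_)
    rw [Real.norm_of_nonneg (by positivity)]
    have hW : 0 ≤ logSobolevWeight (11 / 4) β ξ := by unfold logSobolevWeight; positivity
    simp only [Pi.mul_apply]
    rw [norm_mul, Complex.norm_real, Real.norm_of_nonneg hW]
    calc (1 + ‖ξ‖) * ‖G ξ‖ ≤ (C * (1 + ‖ξ‖) ^ (-(3 / 2) : ℝ) *
          (1 + logSobolevWeight (11 / 4) β ξ)) * ‖G ξ‖ :=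
          mul_le_mul_of_nonneg_right (hC ξ) (norm_nonneg _)
      _ = _ := by ring
  have i1 : Integrable G := by
    refine hmain.mono (Lp.memLp G).1 (Eventually.of_forall fun ξ => ?_)
    rw [Real.norm_of_nonneg (by positivity)]
    nlinarith [norm_nonneg ξ, norm_nonneg (G ξ)]
  have i2 : Integrable fun ξ : Plane => ‖ξ‖ * ‖G ξ‖ := by
    refine hmain.mono (continuous_norm.aestronglyMeasurable.mul (Lp.memLp G).1.norm)
      (Eventually.of_forall fun ξ => ?_)
    rw [Real.norm_of_nonneg (by positivity), Real.norm_of_nonneg (by positivity)]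
    nlinarith [norm_nonneg ξ, norm_nonneg (G ξ)]
  have hd : Differentiable ℝ (𝓕⁻ (G : Plane → ℂ) : Plane → ℂ) := by
    have e : (𝓕⁻ (G : Plane → ℂ) : Plane → ℂ) = fun x => 𝓕 (G : Plane → ℂ) (-x) :=
      funext fun x => Real.fourierInv_eq_fourier_neg _ _
    rw [e]
    exact (VectorFourier.differentiable_fourierIntegral (innerSL ℝ) i1 i2).comp
      differentiable_id.neg
  refine ⟨fun x => ((𝓕⁻ (G : Plane → ℂ) : Plane → ℂ) x).re,
    fun x => (Complex.reCLM.differentiableAt).comp x (hd x), ?_⟩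
  filter_upwards [hL.coeFn_toLp, lp_ae_eq_fourierInv _ i1] with x h1 h2
  rw [← h2, h1, Complex.ofReal_re]


/-! ### Closure under limits, dilations, and the norm of the datum -/

theorem measurable_logSobolevWeight (s β : ℝ) : Measurable (logSobolevWeight s β) := by
  unfold logSobolevWeight
  exact (measurable_norm.pow_const s).mul
    ((measurable_const.add (measurable_norm.log.norm)).pow_const (-β))

theorem logSobolevWeight_nonneg (s β : ℝ) (ξ : Plane) : 0 ≤ logSobolevWeight s β ξ := by
  unfold logSobolevWeight; positivity

theorem logSobolevWeight_le {β : ℝ} (hβ : 0 ≤ β) (s : ℝ) (ξ : Plane) :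
    logSobolevWeight s β ξ ≤ ‖ξ‖ ^ s := by
  unfold logSobolevWeight
  refine mul_le_of_le_one_right (by positivity) ?_
  exact Real.rpow_le_one_of_one_le_of_nonpos (by linarith [abs_nonneg (Real.log ‖ξ‖)]) (by linarith)

/-- The logarithmic Sobolev spaces are closed under bounded limits. -/
theorem memLogSobolev_of_tendsto {s β : ℝ} {f : Plane → ℝ}
    (hf : MemLp (fun x => (f x : ℂ)) 2 (volume : Measure Plane))
    (S : ℕ → SchwartzMap Plane ℂ)
    (hS : Tendsto (fun n => eLpNorm ((S n : Plane → ℂ) - fun x => (f x : ℂ)) 2 volume) atTop (𝓝 0))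
    {B : ℝ≥0∞} (hB : B ≠ ⊤)
    (hbound : ∀ n, eLpNorm (fun ξ => (logSobolevWeight s β ξ : ℂ) *
      (𝓕 (S n : Plane → ℂ) : Plane → ℂ) ξ) 2 volume ≤ B) : MemLogSobolev s β f := by
  refine ⟨hf, ?_⟩
  have h1 : Tendsto (fun n => (S n).toLp 2 volume) atTop (𝓝 hf.toLp) :=
    (Lp.tendsto_Lp_iff_tendsto_eLpNorm'' _ (fun n => (S n).memLp 2 volume) _ hf).2 hS
  have h2 : Tendsto (fun n => (𝓕 ((S n).toLp 2 volume) : Lp ℂ 2 (volume : Measure Plane))) atTop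
      (𝓝 (𝓕 hf.toLp)) :=
    ((FourierTransform.fourierCLM ℂ (Lp ℂ 2 (volume : Measure Plane))).continuous.tendsto _).comp h1
  obtain ⟨ns, -, hns⟩ := (tendstoInMeasure_of_tendsto_Lp h2).exists_seq_tendsto_ae
  have hm := measurable_logSobolevWeight s β
  have hmeas : ∀ n, AEStronglyMeasurable (fun ξ : Plane => (logSobolevWeight s β ξ : ℂ) *
      (𝓕 ((S n).toLp 2 volume) : Lp ℂ 2 (volume : Measure Plane)) ξ) volume := fun n =>
    (Complex.measurable_ofReal.comp hm).aestronglyMeasurable.mul (Lp.memLp _).1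
  refine ⟨(Complex.measurable_ofReal.comp hm).aestronglyMeasurable.mul (Lp.memLp _).1, ?_⟩
  -- Fatou's lemma along a subsequence on which the transforms converge almost everywhere.
  have h3 := Lp.eLpNorm_lim_le_liminf_eLpNorm (p := 2) (μ := (volume : Measure Plane))
    (fun k => hmeas (ns k)) (fun ξ : Plane => (logSobolevWeight s β ξ : ℂ) *
      (𝓕 hf.toLp : Lp ℂ 2 (volume : Measure Plane)) ξ)
    (by filter_upwards [hns] with ξ hξ using hξ.const_mul _)
  refine lt_of_le_of_lt (h3.trans ?_) hB.lt_top
  refine liminf_le_of_le (by isBoundedDefault) fun b hb => ?_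
  obtain ⟨k, hk⟩ := hb.exists
  refine hk.trans ((le_of_eq (eLpNorm_congr_ae ?_)).trans (hbound (ns k)))
  rw [SchwartzMap.toLp_fourier_eq]
  filter_upwards [(𝓕 (S (ns k))).coeFn_toLp 2 volume] with ξ hξ
  rw [hξ, SchwartzMap.fourier_coe]

theorem norm_fourier_comp_smul_sub (f : Plane → ℂ) {R : ℝ} (hR : 0 < R) (e w : Plane) :
    ‖(𝓕 (fun v => f (R • v - e)) : Plane → ℂ) w‖ =
      (R ^ 2)⁻¹ * ‖(𝓕 f : Plane → ℂ) (R⁻¹ • w)‖ := by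
  have h1 : (𝓕 (fun v => f (R • v - e)) : Plane → ℂ) w =
      ∫ v, (fun y : Plane => (fun z : Plane => Real.fourierChar (-inner ℝ (R⁻¹ • (z + e)) w) • f z)
        (y - e)) (R • v) := by
    rw [Real.fourier_eq]
    refine integral_congr_ae (Eventually.of_forall fun v => ?_)
    simp [smul_smul, hR.ne']
  rw [h1, Measure.integral_comp_smul volume (fun y : Plane => (fun z : Plane =>
    Real.fourierChar (-inner ℝ (R⁻¹ • (z + e)) w) • f z) (y - e)) R, integral_sub_right_eq_self
    (fun z : Plane => Real.fourierChar (-inner ℝ (R⁻¹ • (z + e)) w) • f z) e, norm_smul]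
  have h2 : ∀ z : Plane, Real.fourierChar (-inner ℝ (R⁻¹ • (z + e)) w) • f z =
      (Real.fourierChar (-inner ℝ (R⁻¹ • e) w) : ℂ) *
        (Real.fourierChar (-inner ℝ z (R⁻¹ • w)) • f z) := by
    intro z
    have : -inner ℝ (R⁻¹ • (z + e)) w = -inner ℝ (R⁻¹ • e) w + -inner ℝ z (R⁻¹ • w) := by
      rw [smul_add, inner_add_left, real_inner_smul_left z, real_inner_smul_right]
      ring
    rw [this, AddChar.map_add_eq_mul, Circle.smul_def, Circle.smul_def]
    push_cast
    simp only [smul_eq_mul]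
    ring
  simp_rw [h2]
  rw [integral_const_mul, norm_mul, Circle.norm_coe, one_mul, ← Real.fourier_eq]
  simp [abs_of_pos hR]

/-- In dimension two the measure scales by `R ^ 2`, so the `L²` norm scales by `R`. -/
theorem eLpNorm_comp_inv_smul (f : Plane → ℝ) {R : ℝ} (hR : 0 < R)
    (hf : AEStronglyMeasurable f (volume : Measure Plane)) :
    eLpNorm (fun ξ => f (R⁻¹ • ξ)) 2 (volume : Measure Plane) =
      ENNReal.ofReal R * eLpNorm f 2 volume := by
  have hmap : Measure.map (fun ξ : Plane => R⁻¹ • ξ) volume = ENNReal.ofReal (R ^ 2) • volume := by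
    rw [Measure.map_addHaar_smul _ (inv_ne_zero hR.ne')]
    congr 1
    simp [abs_of_pos hR]
  have h1 := eLpNorm_map_measure (p := 2) (μ := (volume : Measure Plane)) (g := f)
    (f := fun ξ : Plane => R⁻¹ • ξ) (by rw [hmap]; exact hf.smul_measure _)
    (by fun_prop)
  change eLpNorm (f ∘ fun ξ : Plane => R⁻¹ • ξ) 2 volume = _
  rw [← h1, hmap, eLpNorm_smul_measure_of_ne_top (by norm_num), smul_eq_mul]
  congr 1
  rw [ENNReal.ofReal_rpow_of_nonneg (by positivity) (by simp), ← Real.rpow_natCast,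
    ← Real.rpow_mul hR.le]
  norm_num

/-- A smooth bump supported in the unit interval. -/
noncomputable def bump (y : ℝ) : ℝ := expNegInvGlue (y * (1 - y))

theorem contDiff_bump : ContDiff ℝ ∞ bump :=
  expNegInvGlue.contDiff.comp (contDiff_id.mul (contDiff_const.sub contDiff_id))

theorem bump_nonneg (y : ℝ) : 0 ≤ bump y := expNegInvGlue.nonneg _

theorem bump_le_one (y : ℝ) : bump y ≤ 1 := by
  unfold bump expNegInvGlue
  split_ifs with h
  · exact zero_le_one
  · push Not at h
    exact Real.exp_le_one_iff.2 (neg_nonpos.2 (inv_nonneg.2 h.le))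

theorem bump_eq_zero {y : ℝ} (h : y ≤ 0 ∨ 1 ≤ y) : bump y = 0 := by
  refine expNegInvGlue.zero_of_nonpos ?_
  rcases h with h | h <;> nlinarith

theorem bump_pos {y : ℝ} (h0 : 0 < y) (h1 : y < 1) : 0 < bump y :=
  expNegInvGlue.pos_of_pos (mul_pos h0 (by linarith))

theorem bump_mono {y y' : ℝ} (h : y ≤ y') (h' : y' ≤ 1 / 2) : bump y ≤ bump y' :=
  expNegInvGlue.monotone (by nlinarith)

theorem bump_anti {y y' : ℝ} (h : y ≤ y') (h' : 1 / 2 ≤ y) : bump y' ≤ bump y :=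
  expNegInvGlue.monotone (by nlinarith)

theorem mem_Ioo_of_bump_ne_zero {y : ℝ} (h : bump y ≠ 0) : 0 < y ∧ y < 1 := by
  by_contra hc
  exact h (bump_eq_zero (by by_contra h'; push Not at h'; exact hc h'))

theorem exists_bump_lipschitz : ∃ L, 0 ≤ L ∧ ∀ y y', |bump y - bump y'| ≤ L * |y - y'| := by
  have hc : HasCompactSupport bump := by
    refine HasCompactSupport.intro (isCompact_Icc (a := (0 : ℝ)) (b := 1)) fun y hy => ?_
    refine bump_eq_zero ?_
    by_contra h
    push Not at h
    exact hy ⟨h.1.le, h.2.le⟩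
  obtain ⟨L, hL⟩ := (contDiff_bump.of_le (by exact_mod_cast le_top) :
    ContDiff ℝ 1 bump).lipschitzWith_of_hasCompactSupport hc one_ne_zero
  refine ⟨L, L.2, fun y y' => ?_⟩
  have := hL.dist_le_mul y y'
  rwa [Real.dist_eq, Real.dist_eq] at this

/-- The ratio of the amplitudes of consecutive bumps of the datum. -/
noncomputable def ratio : ℝ := (2 : ℝ) ^ (-(7 / 8) : ℝ)

theorem ratio_pos : 0 < ratio := by unfold ratio; positivity

theorem ratio_lt_one : ratio < 1 := Real.rpow_lt_one_of_one_lt_of_neg (by norm_num) (by norm_num)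

/-- The bumps of the datum: the `j`-th one has diameter `2⁻ʲ` and amplitude `2^{-7j/8}`. -/
noncomputable def bumpPiece (j : ℕ) (x : Plane) : ℝ :=
  ratio ^ j * (bump (2 ^ j * x 0) * bump (2 ^ j * x 1 - 1))

/-- The initial datum. -/
noncomputable def datum (x : Plane) : ℝ := -∑' j, bumpPiece j x

theorem bumpPiece_nonneg (j : ℕ) (x : Plane) : 0 ≤ bumpPiece j x :=
  mul_nonneg (pow_nonneg ratio_pos.le _) (mul_nonneg (bump_nonneg _) (bump_nonneg _))

theorem bumpPiece_le (j : ℕ) (x : Plane) : bumpPiece j x ≤ ratio ^ j := by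
  refine mul_le_of_le_one_right (pow_nonneg ratio_pos.le _) ?_
  exact mul_le_one₀ (bump_le_one _) (bump_nonneg _) (bump_le_one _)

/-- The strips `2⁻ʲ < b < 2 · 2⁻ʲ` are pairwise disjoint. -/
theorem eq_of_bump_ne_zero {j k : ℕ} {b : ℝ} (hj : bump (2 ^ j * b - 1) ≠ 0)
    (hk : bump (2 ^ k * b - 1) ≠ 0) : j = k := by
  have aux : ∀ {j k : ℕ}, j < k → bump (2 ^ j * b - 1) ≠ 0 → bump (2 ^ k * b - 1) ≠ 0 → False := by
    intro j k hjk hj hk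
    have h1 := mem_Ioo_of_bump_ne_zero hj
    have h2 := mem_Ioo_of_bump_ne_zero hk
    obtain ⟨m, rfl⟩ := Nat.exists_eq_add_of_lt hjk
    have h3 : (1 : ℝ) ≤ 2 ^ m := one_le_pow₀ (by norm_num)
    have h4 : (2 : ℝ) ^ (j + m + 1) * b = 2 * 2 ^ m * (2 ^ j * b) := by ring
    rw [h4] at h2
    nlinarith
  rcases lt_trichotomy j k with h | h | h
  · exact (aux h hj hk).elim
  · exact h
  · exact (aux h hk hj).elim

theorem datum_eq {j : ℕ} {x : Plane} (h : bump (2 ^ j * x 1 - 1) ≠ 0) :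
    datum x = -bumpPiece j x := by
  unfold datum
  rw [tsum_eq_single j]
  intro k hk
  have : bump (2 ^ k * x 1 - 1) = 0 := by
    by_contra h'
    exact hk (eq_of_bump_ne_zero h' h)
  simp [bumpPiece, this]

theorem datum_eq_zero {x : Plane} (h : ∀ j, bump (2 ^ j * x 1 - 1) = 0) : datum x = 0 := by
  simp [datum, bumpPiece, h]

/-- At each point at most one bump is nonzero, so the tail of the series is bounded by its first
amplitude. -/
theorem abs_datum_add_sum_le (n : ℕ) (x : Plane) :
    |datum x + ∑ j ∈ Finset.range n, bumpPiece j x| ≤ ratio ^ n := by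
  by_cases h : ∃ j, bump (2 ^ j * x 1 - 1) ≠ 0
  · obtain ⟨j, hj⟩ := h
    have h0 : ∀ k, k ≠ j → bumpPiece k x = 0 := by
      intro k hk
      have : bump (2 ^ k * x 1 - 1) = 0 := by
        by_contra h'
        exact hk (eq_of_bump_ne_zero h' hj)
      simp [bumpPiece, this]
    rw [datum_eq hj]
    by_cases hn : j < n
    · rw [Finset.sum_eq_single j (fun k _ hk => h0 k hk)
        (fun h => absurd (Finset.mem_range.2 hn) h), neg_add_cancel, abs_zero]
      exact pow_nonneg ratio_pos.le _
    · rw [Finset.sum_eq_zero fun k hk => h0 k fun e => hn (e ▸ Finset.mem_range.1 hk), add_zero,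
        abs_neg, abs_of_nonneg (bumpPiece_nonneg _ _)]
      exact (bumpPiece_le j x).trans
        (pow_le_pow_of_le_one ratio_pos.le ratio_lt_one.le (not_lt.1 hn))
  · push Not at h
    rw [datum_eq_zero h, Finset.sum_eq_zero fun k _ => by simp [bumpPiece, h k]]
    simpa using pow_nonneg ratio_pos.le n

theorem bumpPiece_eq_zero {j : ℕ} {x : Plane} (h : 2 ≤ |x 0| ∨ 2 ≤ |x 1|) : bumpPiece j x = 0 := by
  have h1 : (1 : ℝ) ≤ 2 ^ j := one_le_pow₀ (by norm_num)
  unfold bumpPiece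
  rcases h with h | h
  · rw [bump_eq_zero (y := 2 ^ j * x 0), zero_mul, mul_zero]
    rcases le_abs'.1 h with h | h
    · left; nlinarith
    · right; nlinarith
  · rw [bump_eq_zero (y := 2 ^ j * x 1 - 1), mul_zero, mul_zero]
    rcases le_abs'.1 h with h | h
    · left; nlinarith
    · right; nlinarith

theorem datum_eq_zero_of_le {x : Plane} (h : 2 ≤ |x 0| ∨ 2 ≤ |x 1|) : datum x = 0 := by
  simp [datum, bumpPiece_eq_zero h]

theorem contDiff_bumpPiece (j : ℕ) : ContDiff ℝ ∞ (bumpPiece j) := by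
  have h0 : ContDiff ℝ ∞ fun x : Plane => x 0 := (EuclideanSpace.proj (𝕜 := ℝ) 0 : Plane →L[ℝ] ℝ).contDiff
  have h1 : ContDiff ℝ ∞ fun x : Plane => x 1 := (EuclideanSpace.proj (𝕜 := ℝ) 1 : Plane →L[ℝ] ℝ).contDiff
  unfold bumpPiece
  exact contDiff_const.mul ((contDiff_bump.comp (contDiff_const.mul h0)).mul
    (contDiff_bump.comp ((contDiff_const.mul h1).sub contDiff_const)))

theorem continuous_datum : Continuous datum := by
  have h : TendstoUniformly (fun n x => -∑ j ∈ Finset.range n, bumpPiece j x) datum atTop := by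
    rw [Metric.tendstoUniformly_iff]
    intro ε hε
    have := tendsto_pow_atTop_nhds_zero_of_lt_one ratio_pos.le ratio_lt_one
    filter_upwards [this.eventually_lt_const hε] with n hn x
    rw [Real.dist_eq, sub_neg_eq_add]
    exact (abs_datum_add_sum_le n x).trans_lt hn
  refine h.continuous (Frequently.of_forall fun n => ?_)
  exact (continuous_finsetSum _ fun j _ => (contDiff_bumpPiece j).continuous).neg

theorem hasCompactSupport_of_eq_zero {E : Type*} [Zero E] {f : Plane → E} {r : ℝ}
    (h : ∀ x : Plane, r ≤ |x 0| ∨ r ≤ |x 1| → f x = 0) : HasCompactSupport f := by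
  refine HasCompactSupport.intro (isCompact_closedBall (0 : Plane) (2 * |r|)) fun x hx => h x ?_
  by_contra hc
  push Not at hc
  refine hx ?_
  rw [mem_closedBall_zero_iff, EuclideanSpace.norm_eq, Fin.sum_univ_two]
  refine Real.sqrt_le_iff.2 ⟨by positivity, ?_⟩
  simp only [Real.norm_eq_abs]
  have hr := le_abs_self r
  nlinarith [hc.1, hc.2, abs_nonneg (x 0), abs_nonneg (x 1)]

theorem hasCompactSupport_datum : HasCompactSupport datum :=
  hasCompactSupport_of_eq_zero fun _ => datum_eq_zero_of_le

/-- Each horizontal line meets at most one bump. Its Lipschitz constant there is of order `2^{j/8}`,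
unbounded over the lines, which is why `IsDatum` lets the constant depend on `b`. The amplitudes are
at most `1`, hence strictly below `2`. -/
theorem isDatum_datum : IsDatum 2 datum := by
  refine ⟨continuous_datum, fun b => ?_⟩
  obtain ⟨L, hL0, hL⟩ := exists_bump_lipschitz
  by_cases h : ∃ j, bump (2 ^ j * b - 1) ≠ 0
  · obtain ⟨j, hj⟩ := h
    have e : ∀ y, slice datum b y = -(ratio ^ j * (bump (2 ^ j * y) * bump (2 ^ j * b - 1))) := by
      intro y
      have := datum_eq (j := j) (x := !₂[y, b]) (by simpa using hj)
      simpa [slice, bumpPiece] using this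
    refine ⟨ratio ^ j * bump (2 ^ j * b - 1) * (L * 2 ^ j), fun y => ?_, fun y => ?_,
      fun y hy => ?_, fun y y' => ?_⟩
    · have := datum_eq (j := j) (x := !₂[y, b]) (by simpa using hj)
      have h2 := bumpPiece_le j !₂[y, b]
      have h3 := pow_le_one₀ (n := j) ratio_pos.le ratio_lt_one.le
      unfold slice
      linarith
    · have := datum_eq (j := j) (x := !₂[y, b]) (by simpa using hj)
      have h2 := bumpPiece_nonneg j !₂[y, b]
      unfold slice
      linarith
    · rw [e, bump_eq_zero (Or.inl (mul_nonpos_of_nonneg_of_nonpos (by positivity) hy))]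
      simp
    · rw [e, e]
      have h1 := hL (2 ^ j * y) (2 ^ j * y')
      rw [← mul_sub, abs_mul, abs_of_pos (by positivity : (0 : ℝ) < 2 ^ j)] at h1
      have h2 : 0 ≤ ratio ^ j * bump (2 ^ j * b - 1) :=
        mul_nonneg (pow_nonneg ratio_pos.le _) (bump_nonneg _)
      have : -(ratio ^ j * (bump (2 ^ j * y) * bump (2 ^ j * b - 1))) -
          -(ratio ^ j * (bump (2 ^ j * y') * bump (2 ^ j * b - 1))) =
          -(ratio ^ j * bump (2 ^ j * b - 1)) * (bump (2 ^ j * y) - bump (2 ^ j * y')) := by ring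
      rw [this, abs_mul, abs_neg, abs_of_nonneg h2]
      calc _ ≤ ratio ^ j * bump (2 ^ j * b - 1) * (L * (2 ^ j * |y - y'|)) := by gcongr
        _ = _ := by ring
  · push Not at h
    have e : ∀ y, slice datum b y = 0 := fun y => datum_eq_zero (by simpa using h)
    exact ⟨0, fun y => by rw [e]; norm_num, fun y => (e y).le, fun y _ => e y,
      fun y y' => by rw [e, e]; simp⟩

/-- The shape of the bumps, as a Schwartz function. -/
noncomputable def bumpShape (x : Plane) : ℂ := ((bump (x 0) * bump (x 1) : ℝ) : ℂ)

theorem contDiff_bumpShape : ContDiff ℝ ∞ bumpShape := by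
  have h0 : ContDiff ℝ ∞ fun x : Plane => x 0 := (EuclideanSpace.proj (𝕜 := ℝ) 0 : Plane →L[ℝ] ℝ).contDiff
  have h1 : ContDiff ℝ ∞ fun x : Plane => x 1 := (EuclideanSpace.proj (𝕜 := ℝ) 1 : Plane →L[ℝ] ℝ).contDiff
  exact Complex.ofRealCLM.contDiff.comp ((contDiff_bump.comp h0).mul (contDiff_bump.comp h1))

theorem hasCompactSupport_bumpShape : HasCompactSupport bumpShape :=
  hasCompactSupport_of_eq_zero (r := 1) fun x h => by
    have aux : ∀ y : ℝ, 1 ≤ |y| → bump y = 0 := fun y hy => bump_eq_zero (by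
      rcases le_abs'.1 hy with h | h
      · left; linarith
      · right; exact h)
    unfold bumpShape
    rcases h with h | h <;> simp [aux _ h]

theorem memLp_weight_fourier (g : SchwartzMap Plane ℂ) :
    MemLp (fun ξ : Plane => ‖ξ‖ ^ (7 / 4 : ℝ) * ‖(𝓕 (g : Plane → ℂ) : Plane → ℂ) ξ‖) 2 volume := by
  rw [← SchwartzMap.fourier_coe]
  set h : SchwartzMap Plane ℂ := 𝓕 g
  obtain ⟨M, hM0, hM⟩ := h.decay 0 0
  have hM' : ∀ ξ, ‖h ξ‖ ≤ M := fun ξ => by simpa using hM ξ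
  have hm : AEStronglyMeasurable (fun ξ : Plane => ‖ξ‖ ^ (7 / 4 : ℝ) * ‖h ξ‖) volume := by
    have := h.continuous
    exact (Continuous.mul (continuous_norm.rpow_const fun _ => Or.inr (by norm_num))
      this.norm).aestronglyMeasurable
  rw [memLp_two_iff_integrable_sq hm]
  have i0 := (h.integrable_pow_mul volume 0).const_mul M
  have i4 := (h.integrable_pow_mul volume 4).const_mul M
  refine (i0.add i4).mono' (hm.pow 2) (Eventually.of_forall fun ξ => ?_)
  rw [Real.norm_of_nonneg (by positivity), mul_pow]
  have e : (‖ξ‖ ^ (7 / 4 : ℝ)) ^ 2 ≤ 1 + ‖ξ‖ ^ 4 := by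
    rw [← Real.rpow_natCast, ← Real.rpow_mul (norm_nonneg _)]
    rcases le_total ‖ξ‖ 1 with h1 | h1
    · have := Real.rpow_le_one (norm_nonneg ξ) h1 (by norm_num : (0 : ℝ) ≤ 7 / 4 * (2 : ℕ))
      have : 0 ≤ ‖ξ‖ ^ 4 := by positivity
      linarith
    · have := Real.rpow_le_rpow_of_exponent_le h1 (by norm_num : (7 / 4 : ℝ) * (2 : ℕ) ≤ (4 : ℕ))
      rw [Real.rpow_natCast] at this
      linarith
  have h2 := hM' ξ
  have h3 := norm_nonneg (h ξ)
  calc (‖ξ‖ ^ (7 / 4 : ℝ)) ^ 2 * ‖h ξ‖ ^ 2 ≤ (1 + ‖ξ‖ ^ 4) * (M * ‖h ξ‖) := by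
        gcongr; nlinarith
    _ = _ := by simp only [Pi.add_apply]; ring

theorem bumpPiece_eq_bumpShape (j : ℕ) (x : Plane) : ((bumpPiece j x : ℝ) : ℂ) =
    (ratio ^ j : ℝ) * bumpShape ((2 : ℝ) ^ j • x - EuclideanSpace.single 1 1) := by
  simp [bumpPiece, bumpShape]

/-- The `j`-th bump as a complex Schwartz function. -/
noncomputable def bumpSchwartz (j : ℕ) : SchwartzMap Plane ℂ :=
  HasCompactSupport.toSchwartzMap (f := fun x => ((bumpPiece j x : ℝ) : ℂ))
    (hasCompactSupport_of_eq_zero fun x h => by rw [bumpPiece_eq_zero h, Complex.ofReal_zero])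
    (Complex.ofRealCLM.contDiff.comp (contDiff_bumpPiece j))

theorem bumpSchwartz_apply (j : ℕ) (x : Plane) : bumpSchwartz j x = (bumpPiece j x : ℝ) := rfl

/-- Dilation by `R = 2ʲ` gives the factors `2^{-7j/8}` from the amplitude, `R⁻²` from the transform,
`R^{7/4}` from the weight and `R` from the `L²` norm. Their product is `2^{-j/8}`. The logarithmic
factor is simply bounded by `1`. -/
theorem exists_eLpNorm_bumpSchwartz_le {β : ℝ} (hβ : 0 ≤ β) :
    ∃ N : ℝ, 0 ≤ N ∧ ∀ j, eLpNorm (fun ξ => (logSobolevWeight (7 / 4) β ξ : ℂ) *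
      (𝓕 (bumpSchwartz j : Plane → ℂ) : Plane → ℂ) ξ) 2 volume ≤
        ENNReal.ofReal (N * ((2 : ℝ) ^ (-(1 / 8) : ℝ)) ^ j) := by
  set g : SchwartzMap Plane ℂ := hasCompactSupport_bumpShape.toSchwartzMap contDiff_bumpShape
  have hg : (g : Plane → ℂ) = bumpShape := rfl
  have hH := memLp_weight_fourier g
  rw [hg] at hH
  set H : Plane → ℝ := fun ξ => ‖ξ‖ ^ (7 / 4 : ℝ) * ‖(𝓕 bumpShape : Plane → ℂ) ξ‖ with hHdef
  refine ⟨(eLpNorm H 2 volume).toReal, ENNReal.toReal_nonneg, fun j => ?_⟩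
  set R : ℝ := 2 ^ j with hR
  have hR0 : 0 < R := by positivity
  have h1 : ∀ ξ, ‖(𝓕 (bumpSchwartz j : Plane → ℂ) : Plane → ℂ) ξ‖ =
      ratio ^ j * ((R ^ 2)⁻¹ * ‖(𝓕 bumpShape : Plane → ℂ) (R⁻¹ • ξ)‖) := by
    intro ξ
    rw [← norm_fourier_comp_smul_sub bumpShape hR0 (EuclideanSpace.single 1 1) ξ]
    have e : (bumpSchwartz j : Plane → ℂ) = fun x => ((ratio ^ j : ℝ) : ℂ) *
        bumpShape (R • x - EuclideanSpace.single 1 1) := funext fun x => by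
      rw [bumpSchwartz_apply, bumpPiece_eq_bumpShape]
    rw [e, Real.fourier_eq, Real.fourier_eq]
    have : ∀ v : Plane, Real.fourierChar (-inner ℝ v ξ) • (((ratio ^ j : ℝ) : ℂ) *
        bumpShape (R • v - EuclideanSpace.single 1 1)) = ((ratio ^ j : ℝ) : ℂ) *
        (Real.fourierChar (-inner ℝ v ξ) • bumpShape (R • v - EuclideanSpace.single 1 1)) :=
      fun v => by rw [Circle.smul_def, Circle.smul_def]; simp only [smul_eq_mul]; ring
    simp_rw [this]
    rw [integral_const_mul, norm_mul, Complex.norm_real,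
      Real.norm_of_nonneg (pow_nonneg ratio_pos.le _)]
  have h2 : ∀ ξ, ‖(logSobolevWeight (7 / 4) β ξ : ℂ) *
      (𝓕 (bumpSchwartz j : Plane → ℂ) : Plane → ℂ) ξ‖ ≤
      ratio ^ j * (R ^ 2)⁻¹ * R ^ (7 / 4 : ℝ) * ‖H (R⁻¹ • ξ)‖ := by
    intro ξ
    rw [norm_mul, h1, Complex.norm_real, Real.norm_of_nonneg (logSobolevWeight_nonneg _ _ _),
      Real.norm_of_nonneg (by positivity)]
    simp only [hHdef]
    have e : R ^ (7 / 4 : ℝ) * ‖R⁻¹ • ξ‖ ^ (7 / 4 : ℝ) = ‖ξ‖ ^ (7 / 4 : ℝ) := by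
      rw [← Real.mul_rpow hR0.le (norm_nonneg _), norm_smul, norm_inv, Real.norm_of_nonneg hR0.le,
        mul_inv_cancel_left₀ hR0.ne']
    have hr := pow_pos ratio_pos j
    calc _ ≤ ‖ξ‖ ^ (7 / 4 : ℝ) *
          (ratio ^ j * ((R ^ 2)⁻¹ * ‖(𝓕 bumpShape : Plane → ℂ) (R⁻¹ • ξ)‖)) := by
          gcongr; exact logSobolevWeight_le hβ _ _
      _ = _ := by rw [← e]; ring
  have h3 := eLpNorm_le_mul_eLpNorm_of_ae_le_mul (p := 2) (μ := (volume : Measure Plane))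
    (Eventually.of_forall h2)
  refine h3.trans (le_of_eq ?_)
  rw [eLpNorm_comp_inv_smul H hR0 hH.1]
  have hr := pow_pos ratio_pos j
  rw [← ENNReal.ofReal_toReal hH.2.ne, ENNReal.toReal_ofReal ENNReal.toReal_nonneg, ← mul_assoc,
    ← ENNReal.ofReal_mul (by positivity), ← ENNReal.ofReal_mul (by positivity)]
  congr 1
  rw [mul_comm]
  congr 1
  have e1' : R = (2 : ℝ) ^ (j : ℝ) := by rw [Real.rpow_natCast]
  rw [e1', ratio, ← Real.rpow_natCast, ← Real.rpow_natCast, ← Real.rpow_natCast,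
    ← Real.rpow_mul (by norm_num), ← Real.rpow_mul (by norm_num), ← Real.rpow_mul (by norm_num),
    ← Real.rpow_mul (by norm_num), ← Real.rpow_neg (by norm_num), ← Real.rpow_add (by norm_num),
    ← Real.rpow_add (by norm_num), ← Real.rpow_add (by norm_num)]
  congr 1
  push_cast
  ring

/-- The partial sums converge uniformly with supports in a fixed ball, hence in `L²`, and their
weighted norms are bounded by a geometric series. -/
theorem memLogSobolev_datum {β : ℝ} (hβ : 0 ≤ β) : MemLogSobolev (7 / 4) β datum := by
  obtain ⟨N, hN0, hN⟩ := exists_eLpNorm_bumpSchwartz_le hβ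
  have hc : Continuous fun x : Plane => (datum x : ℂ) :=
    Complex.continuous_ofReal.comp continuous_datum
  have hs : HasCompactSupport fun x : Plane => (datum x : ℂ) :=
    hasCompactSupport_datum.comp_left (g := fun r : ℝ => (r : ℂ)) Complex.ofReal_zero
  set q : ℝ := (2 : ℝ) ^ (-(1 / 8) : ℝ) with hq
  have hq0 : 0 ≤ q := by positivity
  have hq1 : q < 1 := Real.rpow_lt_one_of_one_lt_of_neg (by norm_num) (by norm_num)
  have hsum : Summable fun j : ℕ => N * q ^ j := (summable_geometric_of_lt_one hq0 hq1).mul_left N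
  refine memLogSobolev_of_tendsto (hc.memLp_of_hasCompactSupport hs)
    (fun n => -∑ j ∈ Finset.range n, bumpSchwartz j) ?_
    (B := ENNReal.ofReal (∑' j, N * q ^ j)) ENNReal.ofReal_ne_top fun n => ?_
  · set A : Set Plane := Metric.closedBall 0 4 with hA
    have hbd : ∀ n : ℕ, eLpNorm (((-∑ j ∈ Finset.range n, bumpSchwartz j :
        SchwartzMap Plane ℂ) : Plane → ℂ) - fun x => (datum x : ℂ)) 2 volume ≤
        ENNReal.ofReal (ratio ^ n) * volume A ^ (1 / (2 : ℝ≥0∞).toReal) := by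
      intro n
      have h1 : ∀ x, (((-∑ j ∈ Finset.range n, bumpSchwartz j : SchwartzMap Plane ℂ) :
          Plane → ℂ) - fun x => (datum x : ℂ)) x =
          ((-(datum x + ∑ j ∈ Finset.range n, bumpPiece j x) : ℝ) : ℂ) := by
        intro x
        simp only [Pi.sub_apply, neg_apply, sum_apply, bumpSchwartz_apply]
        push_cast
        ring
      have h2 : ∀ x, ‖(((-∑ j ∈ Finset.range n, bumpSchwartz j : SchwartzMap Plane ℂ) :
          Plane → ℂ) - fun x => (datum x : ℂ)) x‖ ≤ ‖A.indicator (fun _ => ratio ^ n) x‖ := by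
        intro x
        rw [h1, Complex.norm_real, norm_neg, Real.norm_eq_abs]
        by_cases hx : x ∈ A
        · rw [indicator_of_mem hx, Real.norm_of_nonneg (pow_nonneg ratio_pos.le _)]
          exact abs_datum_add_sum_le n x
        · have h3 : 2 ≤ |x 0| ∨ 2 ≤ |x 1| := by
            by_contra hc'
            push Not at hc'
            refine hx ?_
            rw [hA, mem_closedBall_zero_iff, EuclideanSpace.norm_eq, Fin.sum_univ_two]
            refine Real.sqrt_le_iff.2 ⟨by positivity, ?_⟩
            simp only [Real.norm_eq_abs]
            nlinarith [hc'.1, hc'.2, abs_nonneg (x 0), abs_nonneg (x 1)]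
          simp [datum_eq_zero_of_le h3, bumpPiece_eq_zero h3]
      refine (eLpNorm_mono h2).trans ?_
      refine (eLpNorm_indicator_const_le _ _).trans (le_of_eq ?_)
      rw [Real.enorm_of_nonneg (pow_nonneg ratio_pos.le _)]
    have hfin : volume A ^ (1 / (2 : ℝ≥0∞).toReal) ≠ ⊤ :=
      (ENNReal.rpow_lt_top_of_nonneg (by simp) (isCompact_closedBall _ _).measure_lt_top.ne).ne
    have hlim : Tendsto (fun n : ℕ => ENNReal.ofReal (ratio ^ n) *
        volume A ^ (1 / (2 : ℝ≥0∞).toReal)) atTop (𝓝 0) := by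
      have h4 := ENNReal.tendsto_ofReal
        (tendsto_pow_atTop_nhds_zero_of_lt_one ratio_pos.le ratio_lt_one)
      have := ENNReal.Tendsto.mul_const h4 (b := volume A ^ (1 / (2 : ℝ≥0∞).toReal))
        (Or.inr hfin)
      simpa using this
    exact tendsto_of_tendsto_of_tendsto_of_le_of_le tendsto_const_nhds hlim
      (fun _ => zero_le) hbd
  · have e : ∀ ξ, (logSobolevWeight (7 / 4) β ξ : ℂ) * (𝓕 ((-∑ j ∈ Finset.range n, bumpSchwartz j :
        SchwartzMap Plane ℂ) : Plane → ℂ) : Plane → ℂ) ξ =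
        -(∑ j ∈ Finset.range n, fun ξ => (logSobolevWeight (7 / 4) β ξ : ℂ) *
          (𝓕 (bumpSchwartz j : Plane → ℂ) : Plane → ℂ) ξ) ξ := by
      intro ξ
      rw [← SchwartzMap.fourier_coe, FourierTransform.fourier_neg, FourierTransform.fourier_sum,
        neg_apply, sum_apply, Finset.sum_apply, mul_neg, Finset.mul_sum]
      simp only [SchwartzMap.fourier_coe]
    rw [funext e]
    refine (eLpNorm_neg _ _ _).le.trans ?_
    have hm := measurable_logSobolevWeight (7 / 4) β
    refine (eLpNorm_sum_le (fun j _ => ?_) (by norm_num)).trans ?_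
    · refine (Complex.measurable_ofReal.comp hm).aestronglyMeasurable.mul ?_
      rw [← SchwartzMap.fourier_coe]
      exact (SchwartzMap.continuous _).aestronglyMeasurable
    · refine (Finset.sum_le_sum fun j _ => hN j).trans ?_
      rw [← ENNReal.ofReal_sum_of_nonneg fun j _ => by positivity]
      exact ENNReal.ofReal_le_ofReal (hsum.sum_le_tsum _ fun j _ => by positivity)


/-! ### Waves issuing from an increasing profile -/

theorem differentiableAt_displacement {c t w : ℝ} (ht : 0 ≤ t) (hw : w ≤ 0) :
    DifferentiableAt ℝ (displacement c t) w := by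
  set M := Real.exp (|c| * t) with hM
  have hM0 : 0 < M := Real.exp_pos _
  -- Slightly positive amplitudes are admitted, so that `w = 0` is an interior point. The threshold
  -- `1 / (2 M)` keeps the denominators above `1/2`.
  have hden : ∀ s ∈ uIoc 0 t, ∀ z ∈ Iio (1 / (2 * M)), 1 / 2 ≤ 1 - Real.exp (c * s) * z := by
    intro s hs z hz
    rw [uIoc_of_le ht] at hs
    have h1 : Real.exp (c * s) ≤ M := exp_mul_le hs.1.le hs.2
    have h2 := Real.exp_pos (c * s)
    rcases le_total z 0 with h | h
    · nlinarith
    · have h3 : z < 1 / (2 * M) := hz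
      have h4 : M * z ≤ 1 / 2 := by
        rw [lt_div_iff₀ (by positivity)] at h3
        linarith
      nlinarith
  have hz : w ∈ Iio (1 / (2 * M)) := lt_of_le_of_lt hw (by positivity)
  have key := intervalIntegral.hasDerivAt_integral_of_dominated_loc_of_deriv_le
    (μ := volume) (a := 0) (b := t) (F := fun z s => scaledSpeed c s z)
    (F' := fun z s => 2 * Real.exp (c * s) / (1 - Real.exp (c * s) * z) ^ 2)
    (bound := fun _ => 2 * M / (1 / 2) ^ 2) (x₀ := w) (isOpen_Iio.mem_nhds hz) ?_ ?_ ?_ ?_ ?_ ?_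
  · exact key.2.differentiableAt
  · refine Eventually.of_forall fun z => Measurable.aestronglyMeasurable ?_
    unfold scaledSpeed
    fun_prop
  · exact (continuous_scaledSpeed hw).intervalIntegrable _ _
  · exact Measurable.aestronglyMeasurable (by fun_prop)
  · refine Eventually.of_forall fun s hs z hz => ?_
    have h1 := hden s hs z hz
    rw [uIoc_of_le ht] at hs
    have h2 : Real.exp (c * s) ≤ M := exp_mul_le hs.1.le hs.2
    rw [Real.norm_of_nonneg (by positivity)]
    gcongr
  · exact intervalIntegrable_const
  · refine Eventually.of_forall fun s hs z hz => ?_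
    have h1 := hden s hs z hz
    have h2 : (1 - Real.exp (c * s) * z) ≠ 0 := by linarith
    have hm : HasDerivAt (fun z : ℝ => Real.exp (c * s) * z) (Real.exp (c * s)) z := by
      simpa using (hasDerivAt_id z).const_mul (Real.exp (c * s))
    have h3 := (hm.const_add 1).div (hm.const_sub 1) h2
    refine (h3.congr_deriv ?_)
    congr 1
    ring

theorem nonneg_of_abs_sub_le {C : ℝ} {f : ℝ → ℝ} (h : ∀ y y', |f y - f y'| ≤ C * |y - y'|) :
    0 ≤ C := by
  have := h 1 0
  simp only [sub_zero, abs_one, mul_one] at this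
  exact (abs_nonneg _).trans this

theorem continuous_of_abs_sub_le {C : ℝ} {f : ℝ → ℝ} (h : ∀ y y', |f y - f y'| ≤ C * |y - y'|) :
    Continuous f :=
  (LipschitzWith.of_dist_le_mul (K := ⟨C, nonneg_of_abs_sub_le h⟩) fun y y' => by
    rw [Real.dist_eq, Real.dist_eq]; exact h y y').continuous

/-- The foot of the characteristic through `(s, x)` for an increasing profile `ψ`. -/
noncomputable def rarefactionFoot (c : ℝ) (ψ : ℝ → ℝ) (s x : ℝ) : ℝ :=
  Function.invFun (fun y => y + displacement c (max s 0) (ψ y)) x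

/-- The continuous wave issuing from an increasing profile `ψ`. -/
noncomputable def rarefaction (c : ℝ) (ψ : ℝ → ℝ) (s x : ℝ) : ℝ :=
  Real.exp (c * s) * ψ (rarefactionFoot c ψ s x)

section Rarefaction

variable {c K C : ℝ} {ψ : ℝ → ℝ} (hK : ∀ y, ψ y ∈ Icc (-K) 0) (hmono : Monotone ψ)
  (hlip : ∀ y y', |ψ y - ψ y'| ≤ C * |y - y'|)
include hK hmono

/-- An increasing profile has increasing speeds, so its characteristics spread. Hence each point
lies on exactly one of them and no shock forms. -/
theorem sub_le_rarefaction_sub {s y y' : ℝ} (hs : 0 ≤ s) (h : y ≤ y') :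
    y' - y ≤ (y' + displacement c s (ψ y')) - (y + displacement c s (ψ y)) := by
  have h1 := displacement_strictMono (c := c) hs le_rfl (hK y) (hK y') (hmono h)
  have h2 := convexityModulus_pos (c := c) (T := s) (K := K)
    (by have := (hK 0).1.trans (hK 0).2; linarith)
  have h3 : 0 ≤ ψ y' - ψ y := sub_nonneg.2 (hmono h)
  have : 0 ≤ 2 * convexityModulus c s K * s * (ψ y' - ψ y) := by positivity
  linarith

include hlip

omit hmono in
theorem rarefactionFoot_spec (s x : ℝ) :
    rarefactionFoot c ψ s x + displacement c (max s 0) (ψ (rarefactionFoot c ψ s x)) = x := by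
  set r := max s 0 with hr
  have hr0 : 0 ≤ r := le_max_right _ _
  have hψ := continuous_of_abs_sub_le hlip
  have hS : Continuous fun y => displacement c r (ψ y) := by
    refine continuous_iff_continuousAt.2 fun y => ?_
    exact (differentiableAt_displacement hr0 (hK y).2).continuousAt.comp hψ.continuousAt
  have hc : Continuous fun y => y + displacement c r (ψ y) := continuous_id.add hS
  have hsurj : ∃ y, y + displacement c r (ψ y) = x := by
    have h1 := abs_le.1 (abs_displacement_le (c := c) hr0 (hK (x - r)).2)
    have h2 := abs_le.1 (abs_displacement_le (c := c) hr0 (hK (x + r)).2)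
    have := intermediate_value_Icc (a := x - r) (b := x + r) (by linarith) hc.continuousOn
    obtain ⟨y, -, hy⟩ := this (show x ∈ _ from ⟨by linarith [h1.2], by linarith [h2.1]⟩)
    exact ⟨y, hy⟩
  exact Function.invFun_eq hsurj

/-- The map from foot to position expands distances, and positions move with speed at most `1`. -/
theorem rarefactionFoot_lipschitz (s s' x x' : ℝ) :
    |rarefactionFoot c ψ s x - rarefactionFoot c ψ s' x'| ≤ |x - x'| + |s - s'| := by
  wlog h : rarefactionFoot c ψ s' x' ≤ rarefactionFoot c ψ s x generalizing s s' x x'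
  · rw [abs_sub_comm, abs_sub_comm x, abs_sub_comm s]
    exact this _ _ _ _ (le_of_not_ge h)
  have h1 := rarefactionFoot_spec (c := c) hK hlip s x
  have h2 := rarefactionFoot_spec (c := c) hK hlip s' x'
  set y := rarefactionFoot c ψ s x
  set y' := rarefactionFoot c ψ s' x'
  have h3 := sub_le_rarefaction_sub (c := c) hK hmono (le_max_right s 0) h
  have h4 := abs_le.1 (displacement_time_lipschitz (c := c) (t := max s 0) (t' := max s' 0)
    (hK y').2)
  have h5 : |max s 0 - max s' 0| ≤ |s - s'| := abs_max_sub_max_le_abs _ _ _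
  rw [abs_of_nonneg (sub_nonneg.2 h)]
  have := le_abs_self (x - x')
  linarith [h4.1]

theorem rarefactionFoot_eq {s x y : ℝ} (hs : 0 ≤ s) (h : y + displacement c s (ψ y) = x) :
    rarefactionFoot c ψ s x = y := by
  have h1 := rarefactionFoot_spec (c := c) hK hlip s x
  rw [max_eq_left hs] at h1
  set z := rarefactionFoot c ψ s x
  rcases le_total z y with h2 | h2
  · have := sub_le_rarefaction_sub (c := c) hK hmono hs h2; linarith
  · have := sub_le_rarefaction_sub (c := c) hK hmono hs h2; linarith

theorem rarefactionFoot_le {s x y : ℝ} (hs : 0 ≤ s) (h : x ≤ y + displacement c s (ψ y)) :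
    rarefactionFoot c ψ s x ≤ y := by
  have h1 := rarefactionFoot_spec (c := c) hK hlip s x
  rw [max_eq_left hs] at h1
  by_contra h2
  push Not at h2
  have := sub_le_rarefaction_sub (c := c) hK hmono hs h2.le
  linarith

theorem continuous_rarefaction : Continuous fun p : ℝ × ℝ => rarefaction c ψ p.1 p.2 := by
  have hψ := continuous_of_abs_sub_le hlip
  have hY : Continuous fun p : ℝ × ℝ => rarefactionFoot c ψ p.1 p.2 := by
    refine continuous_iff_continuousAt.2 fun p => ?_
    rw [ContinuousAt, tendsto_iff_dist_tendsto_zero]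
    have hlim : Tendsto (fun q : ℝ × ℝ => |q.2 - p.2| + |q.1 - p.1|) (𝓝 p) (𝓝 0) := by
      have : Continuous fun q : ℝ × ℝ => |q.2 - p.2| + |q.1 - p.1| := by fun_prop
      simpa using this.tendsto p
    refine squeeze_zero (fun _ => dist_nonneg) (fun q => ?_) hlim
    rw [Real.dist_eq]
    exact rarefactionFoot_lipschitz hK hmono hlip _ _ _ _
  unfold rarefaction
  fun_prop

theorem rarefaction_lipschitz (s x x' : ℝ) :
    |rarefaction c ψ s x - rarefaction c ψ s x'| ≤ Real.exp (c * s) * C * |x - x'| := by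
  have hC := nonneg_of_abs_sub_le hlip
  unfold rarefaction
  rw [← mul_sub, abs_mul, abs_of_pos (Real.exp_pos _), mul_assoc]
  refine mul_le_mul_of_nonneg_left ((hlip _ _).trans ?_) (Real.exp_pos _).le
  refine mul_le_mul_of_nonneg_left ?_ hC
  simpa using rarefactionFoot_lipschitz (c := c) hK hmono hlip s s x x'

variable (hd : Differentiable ℝ ψ)
include hd

/-- The foot is a continuous right inverse of a differentiable map with derivative at least `1`. -/
theorem differentiableAt_rarefaction (s x : ℝ) : DifferentiableAt ℝ (rarefaction c ψ s) x := by
  set r := max s 0 with hr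
  have hr0 : 0 ≤ r := le_max_right _ _
  set f : ℝ → ℝ := fun y => y + displacement c r (ψ y) with hf
  set y := rarefactionFoot c ψ s x with hy
  have h1 : DifferentiableAt ℝ f y :=
    differentiableAt_id.add ((differentiableAt_displacement hr0 (hK y).2).comp y (hd y))
  have h2 : 1 ≤ deriv f y := by
    have h3 := (hasDerivAt_iff_tendsto_slope.1 h1.hasDerivAt).mono_left
      (nhdsWithin_mono (s := Ioi y) _ fun a ha => ne_of_gt ha)
    refine ge_of_tendsto h3 ?_
    filter_upwards [self_mem_nhdsWithin] with z hz
    have hz : y < z := hz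
    rw [slope_def_field, le_div_iff₀ (by linarith), one_mul]
    exact sub_le_rarefaction_sub hK hmono hr0 hz.le
  have h4 : ContinuousAt (rarefactionFoot c ψ s) x := by
    rw [ContinuousAt, tendsto_iff_dist_tendsto_zero]
    have hlim : Tendsto (fun q : ℝ => |q - x|) (𝓝 x) (𝓝 0) := by
      have : Continuous fun q : ℝ => |q - x| := by fun_prop
      simpa using this.tendsto x
    refine squeeze_zero (fun _ => dist_nonneg) (fun q => ?_) hlim
    rw [Real.dist_eq]
    simpa using rarefactionFoot_lipschitz (c := c) hK hmono hlip s s q x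
  have h5 : HasDerivAt (rarefactionFoot c ψ s) (deriv f y)⁻¹ x :=
    HasDerivAt.of_local_left_inverse h4 h1.hasDerivAt (by linarith)
      (Eventually.of_forall fun z => rarefactionFoot_spec (c := c) hK hlip s z)
  exact ((hd y).comp x h5.differentiableAt).const_mul _

/-- Differentiation under the integral, dominated by the Lipschitz constant of the rarefaction in
space. This is the smooth comparison function at the corner. -/
theorem differentiableAt_integral_rarefaction (r t x : ℝ) :
    DifferentiableAt ℝ (fun x => ∫ s in r..t, rarefaction c ψ s (x + t - s)) x := by
  have hcont := continuous_rarefaction (c := c) hK hmono hlip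
  have hcont' : Continuous (Function.uncurry fun s x : ℝ => rarefaction c ψ s (x + t - s)) :=
    hcont.comp (continuous_fst.prodMk ((continuous_snd.add continuous_const).sub continuous_fst))
  have key := intervalIntegral.hasDerivAt_integral_of_dominated_loc_of_lip
    (μ := volume) (a := r) (b := t) (F := fun x s => rarefaction c ψ s (x + t - s))
    (F' := fun s => deriv (fun x => rarefaction c ψ s (x + t - s)) x)
    (bound := fun s => Real.exp (c * s) * C) (x₀ := x) (s := univ) univ_mem ?_ ?_ ?_ ?_ ?_ ?_
  · exact key.2.differentiableAt
  · refine Eventually.of_forall fun z => ?_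
    exact (hcont'.comp (continuous_id.prodMk continuous_const)).aestronglyMeasurable
  · exact (hcont'.comp (continuous_id.prodMk continuous_const)).intervalIntegrable _ _
  · exact ((measurable_deriv_with_param hcont').comp
      (measurable_id.prodMk measurable_const)).aestronglyMeasurable
  · refine Eventually.of_forall fun s _ => ?_
    refine LipschitzOnWith.of_dist_le_mul fun z _ z' _ => ?_
    rw [Real.dist_eq, Real.dist_eq]
    refine (rarefaction_lipschitz hK hmono hlip _ _ _).trans ?_
    rw [show z + t - s - (z' + t - s) = z - z' by ring]
    refine mul_le_mul_of_nonneg_right ?_ (abs_nonneg _)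
    exact le_abs_self _
  · exact (by fun_prop : Continuous fun s => Real.exp (c * s) * C).intervalIntegrable _ _
  · refine Eventually.of_forall fun s _ => ?_
    have h1 := differentiableAt_rarefaction (c := c) hK hmono hlip hd s (x + t - s)
    have h2 : DifferentiableAt ℝ (fun x : ℝ => x + t - s) x := by fun_prop
    exact (DifferentiableAt.comp x h1 h2).hasDerivAt

end Rarefaction


/-! ### The corner at the tip of the wave -/

/-- A well-shaped profile on `[0, δ]`: decreasing up to `δ / 2`, increasing afterwards. -/
structure IsWell (K C δ : ℝ) (φ : ℝ → ℝ) : Prop where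
  profile : IsProfile K C φ
  pos : 0 < δ
  anti : AntitoneOn φ (Icc 0 (δ / 2))
  mono : MonotoneOn φ (Ici (δ / 2))
  right : ∀ y, δ ≤ y → φ y = 0
  neg : ∀ y, 0 < y → y < δ → φ y < 0
  diff : Differentiable ℝ φ
  bottom : deriv φ (δ / 2) = 0

/-- The increasing part of a well, extended by a constant. -/
noncomputable def rightPart (δ : ℝ) (φ : ℝ → ℝ) (y : ℝ) : ℝ := φ (max y (δ / 2))

namespace IsProfile

variable {c K C : ℝ} {φ : ℝ → ℝ} (hφ : IsProfile K C φ)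
include hφ

/-- The potential decreases along the directions `(τ, z)` with `|τ| ≤ z`. -/
theorem potential_le_of_abs_le {t t' x x' : ℝ} (ht : 0 ≤ t) (ht' : 0 ≤ t')
    (h : |t' - t| ≤ x' - x) : potential c K φ t' x' ≤ potential c K φ t x := by
  have h1 := hφ.potential_sub_le (c := c) (x' := x') ht ht' (hφ.isFoot_foot (c := c) (x := x) ht)
  set w := optSlope c K t' (x' - foot c K φ t x) with hw
  have hw0 : w ≤ 0 := (optSlope_mem hφ.K_pos.le).2
  have h2 := (abs_le.1 (fluxPrimitive_time_lipschitz (c := c) (t := t') (t' := t) hw0)).1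
  rw [abs_of_nonpos hw0] at h2
  nlinarith

theorem wave_eq_zero_of_potential {t x : ℝ} (ht : 0 < t)
    (h : ∀ᶠ z in 𝓝 x, potential c K φ t z = 0) : wave c K φ t x = 0 := by
  have h1 : HasDerivAt (fun z => potential c K φ t z) 0 x :=
    (hasDerivAt_const x (0 : ℝ)).congr_of_eventuallyEq h
  have h2 := hφ.deriv_potential_space ht (hφ.isFoot_foot (c := c) (x := x) ht.le) h1
  rw [wave, ← h2, mul_zero]

theorem wave_eq_zero_of_le {δ t x : ℝ} (hr : ∀ y, δ ≤ y → φ y = 0) (ht : 0 ≤ t)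
    (h : t + δ ≤ x) : wave c K φ t x = 0 := by
  have h1 := (abs_le.1 (hφ.abs_sub_foot_le (c := c) (x := x) ht)).2
  rw [wave, hr _ (by linarith), mul_zero]

theorem wave_nonpos (t x : ℝ) : wave c K φ t x ≤ 0 :=
  mul_nonpos_of_nonneg_of_nonpos (Real.exp_pos _).le (hφ.nonpos _)

end IsProfile

namespace IsWell

variable {c K C δ : ℝ} {φ : ℝ → ℝ} (hφ : IsWell K C δ φ)
include hφ

theorem rightPart_mem (y : ℝ) : rightPart δ φ y ∈ Icc (-K) 0 := hφ.profile.mem _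

theorem rightPart_mono : Monotone (rightPart δ φ) := fun _ _ h =>
  hφ.mono (mem_Ici.2 (le_max_right _ _)) (mem_Ici.2 (le_max_right _ _)) (max_le_max_right _ h)

theorem rightPart_lipschitz (y y' : ℝ) :
    |rightPart δ φ y - rightPart δ φ y'| ≤ C * |y - y'| :=
  (hφ.profile.lip _ _).trans
    (mul_le_mul_of_nonneg_left (abs_max_sub_max_le_abs _ _ _) hφ.profile.C_nonneg)

/-- The constant extension is glued at the bottom of the well, where the derivative is zero. -/
theorem differentiable_rightPart : Differentiable ℝ (rightPart δ φ) := by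
  intro y
  rcases lt_trichotomy y (δ / 2) with h | rfl | h
  · have : rightPart δ φ =ᶠ[𝓝 y] fun _ => φ (δ / 2) := by
      filter_upwards [Iio_mem_nhds h] with z hz
      rw [rightPart, max_eq_right (le_of_lt hz)]
    exact (differentiableAt_const _).congr_of_eventuallyEq this
  · have h1 : HasDerivAt φ 0 (δ / 2) := hφ.bottom ▸ (hφ.diff (δ / 2)).hasDerivAt
    have h2 : HasDerivWithinAt (rightPart δ φ) 0 (Ici (δ / 2)) (δ / 2) :=
      h1.hasDerivWithinAt.congr (fun z hz => by rw [rightPart, max_eq_left hz])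
        (by rw [rightPart, max_self])
    have h3 : HasDerivWithinAt (rightPart δ φ) 0 (Iic (δ / 2)) (δ / 2) :=
      (hasDerivWithinAt_const (δ / 2) _ (φ (δ / 2))).congr
        (fun z hz => by rw [rightPart, max_eq_right hz]) (by rw [rightPart, max_self])
    have := h3.union h2
    rw [Iic_union_Ici, hasDerivWithinAt_univ] at this
    exact this.differentiableAt
  · have : rightPart δ φ =ᶠ[𝓝 y] φ := by
      filter_upwards [Ioi_mem_nhds h] with z hz
      rw [rightPart, max_eq_left (le_of_lt hz)]
    exact (hφ.diff y).congr_of_eventuallyEq this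

/-- Late characteristics do not start in the left half of a well that is deep enough. -/
theorem foot_notMem {t s x : ℝ} (hs : 0 < s) (hst : s ≤ t)
    (hdeep : ((2 * Real.exp (|c| * t) / convexityModulus c t K + 1) * δ) ^ 2 <
      4 * (convexityModulus c t K * s) * (mass φ (δ / 2) - mass φ δ)) :
    foot c K φ s x ≤ 0 ∨ δ / 2 ≤ foot c K φ s x := by
  by_contra hcon
  push Not at hcon
  obtain ⟨hy0, hy1⟩ := hcon
  have hp := hφ.profile
  have hK := hp.K_pos.le
  have hδ := hφ.pos
  have hfoot := hp.isFoot_foot (c := c) (x := x) hs.le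
  have hsub := hp.sub_foot (c := c) (x := x) hs.le
  have hpot := hp.potential_nonpos (c := c) hs.le x
  have hle := hp.potential_le (c := c) (x := x) hs.le δ
  have hopt := hp.optSlope_eq hs hfoot
  rw [hp.potential_eq hs.le hfoot] at hpot hle
  set y := foot c K φ s x with hy
  set κ := convexityModulus c t K with hκ
  have hκ0 : 0 < κ := convexityModulus_pos hK
  set w := φ y with hw
  have hw0 : w < 0 := hφ.neg y hy0 (by linarith)
  set M := Real.exp (|c| * t) with hM
  have hM0 : 0 < M := Real.exp_pos _
  -- Competing with slope `0`, the Legendre transform at `x - y` is at least `κ s w² / 2`.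
  have h1 := legendre_strong (c := c) (K := K) (z := x - y) hs.le hst
    (w := 0) ⟨by linarith, le_rfl⟩
  rw [fluxPrimitive_zero_right, hopt, ← hκ] at h1
  have h2 : -mass φ y ≤ y * -w := by
    have e : -mass φ y = ∫ r in (0 : ℝ)..y, -φ r := by
      rw [mass, intervalIntegral.integral_neg]
    rw [e]
    have := intervalIntegral.integral_mono_on (μ := volume) hy0.le (hp.continuous.neg.intervalIntegrable 0 y)
      (intervalIntegrable_const (c := -w)) fun r hr => neg_le_neg
        (hφ.anti ⟨hr.1, by linarith [hr.2]⟩ ⟨hy0.le, hy1.le⟩ hr.2)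
    refine this.trans (le_of_eq ?_)
    rw [intervalIntegral.integral_const, smul_eq_mul, sub_zero]
  -- The potential is nonpositive, so the cost `κ s w² / 2` is covered by the mass collected up to
  -- `y`, at most `y |w|` because the profile decreases there. Such a characteristic has a small
  -- amplitude and nearly maximal speed.
  have h3 : κ * s * -w ≤ δ := by
    have : κ * s / 2 * w ^ 2 ≤ y * -w := by nlinarith
    have h4 : (κ * s * -w) * -w ≤ 2 * y * -w := by nlinarith
    have h5 := le_of_mul_le_mul_right h4 (by linarith)
    linarith
  have h4 := (abs_le.1 (displacement_lipschitz (c := c) (w := 0) hs.le hst le_rfl hw0.le)).2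
  have h4' := (abs_le.1 (abs_displacement_le (c := c) hs.le hw0.le)).2
  rw [displacement_zero_right, ← hsub, zero_sub, abs_neg, abs_of_neg hw0, ← hM] at h4
  rw [← hsub] at h4'
  have h5 : 2 * M * s * -w ≤ 2 * M / κ * δ := by
    have : 2 * M * s * -w = 2 * M / κ * (κ * s * -w) := by field_simp
    rw [this]
    gcongr
  -- Hence `x` is so far to the right that the foot `δ` is cheap: it costs less than the mass of the
  -- right half of the well, which contradicts minimality of `y`.
  have h6 := legendre_le_sq (c := c) (K := K) (z := x - δ) hK hs hst
  rw [← hκ] at h6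
  have h7 : (s - (x - δ)) ^ 2 ≤ ((2 * M / κ + 1) * δ) ^ 2 :=
    pow_le_pow_left₀ (by linarith) (by linarith) 2
  have h8 : legendre c K s (x - δ) < mass φ (δ / 2) - mass φ δ := by
    refine h6.trans_lt ?_
    rw [div_lt_iff₀ (by positivity)]
    calc _ ≤ _ := h7
      _ < _ := hdeep
      _ = _ := by ring
  have h9 := hp.mass_antitone hy1.le
  have h10 := legendre_nonneg (c := c) (t := s) (z := x - y) hK
  linarith

theorem wave_eq_rarefaction {s x : ℝ} (hs : 0 ≤ s) (h : δ / 2 ≤ foot c K φ s x) :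
    wave c K φ s x = rarefaction c (rightPart δ φ) s x := by
  have h1 := hφ.profile.sub_foot (c := c) (x := x) hs
  have h2 : rightPart δ φ (foot c K φ s x) = φ (foot c K φ s x) := by
    rw [rightPart, max_eq_left h]
  rw [rarefaction, rarefactionFoot_eq (c := c) hφ.rightPart_mem hφ.rightPart_mono
    hφ.rightPart_lipschitz hs (y := foot c K φ s x) (by rw [h2]; linarith), h2, wave]

/-- A foot at `y ≤ 0` carries amplitude zero and no mass, so the potential would vanish. -/
theorem foot_pos {s x : ℝ} (hs : 0 ≤ s) (h : potential c K φ s x < 0) : 0 < foot c K φ s x := by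
  by_contra hy
  push Not at hy
  have hp := hφ.profile
  have h1 := hp.sub_foot (c := c) (x := x) hs
  rw [hp.left _ hy, displacement_zero_right] at h1
  have h2 := hp.potential_eq hs (hp.isFoot_foot (c := c) (x := x) hs)
  rw [hp.mass_of_nonpos hy, h1, legendre_eq_zero hp.K_pos.le hs le_rfl] at h2
  linarith

/-- The wave of a deep and thin well makes its integral along the characteristics of the
transversal direction nondifferentiable. -/
theorem exists_not_differentiableAt {t : ℝ} (ht : 0 < t) (hδt : δ ≤ t / 4)
    (hsmall : ∀ y, 2 * Real.exp (|c| * t) * -φ y ≤ 1 / 2)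
    (hdeep : ((2 * Real.exp (|c| * t) / convexityModulus c t K + 1) * δ) ^ 2 <
      4 * (convexityModulus c t K * (t / 8)) * (mass φ (δ / 2) - mass φ δ)) :
    ∃ X, ¬ DifferentiableAt ℝ (fun x => ∫ s in (0)..t, wave c K φ s (x + t - s)) X := by
  have hp := hφ.profile
  have hK := hp.K_pos.le
  have hδ := hφ.pos
  have hκ0 : 0 < convexityModulus c t K := convexityModulus_pos hK
  have hμ : 0 < mass φ (δ / 2) - mass φ δ := by
    by_contra h
    push Not at h
    have : 4 * (convexityModulus c t K * (t / 8)) * (mass φ (δ / 2) - mass φ δ) ≤ 0 :=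
      mul_nonpos_of_nonneg_of_nonpos (by positivity) h
    have := sq_nonneg ((2 * Real.exp (|c| * t) / convexityModulus c t K + 1) * δ)
    linarith
  have hmass : mass φ δ < 0 := by
    have := hp.mass_nonpos (δ / 2)
    linarith
  set U := potential c K φ t with hU
  have hUc : Continuous U := continuous_of_abs_sub_le (C := K) fun x x' => by
    simpa using hp.potential_lipschitz (c := c) (x := x') (x' := x) ht.le ht.le
  have hdich : ∀ s, t / 8 ≤ s → s ≤ t → ∀ x, foot c K φ s x ≤ 0 ∨ δ / 2 ≤ foot c K φ s x := by
    intro s hs hst x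
    refine hφ.foot_notMem (by linarith) hst (hdeep.trans_le ?_)
    gcongr
  -- Small amplitudes keep every displacement above `t / 2`. Consequently lines that end near the
  -- shock are still ahead of the wave during `[0, t / 8]`, where `hdich` is not available.
  have hlow : ∀ x, U x < 0 → t / 2 ≤ x := by
    intro x hx
    have h1 := hφ.foot_pos ht.le hx
    have h2 := hp.sub_foot (c := c) (x := x) ht.le
    have h3 := hp.nonpos (foot c K φ t x)
    have h4 := (abs_le.1 (displacement_lipschitz (c := c) (w := 0) ht.le le_rfl le_rfl h3)).2
    rw [displacement_zero_right, ← h2, zero_sub, abs_neg, abs_of_nonpos h3] at h4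
    have h5 := mul_le_mul_of_nonneg_left (hsmall (foot c K φ t x)) ht.le
    nlinarith
  have hUδ : U (t + δ) < 0 := by
    have h1 := hp.potential_le (c := c) (x := t + δ) ht.le δ
    rw [legendre_eq_zero hK ht.le (by linarith)] at h1
    simp only [hU]
    linarith
  set A : Set ℝ := {x | U x < 0} with hA
  have hAbdd : BddBelow A := ⟨t / 2, fun x hx => hlow x hx⟩
  have hAne : A.Nonempty := ⟨t + δ, hUδ⟩
  -- The position of the shock: the potential vanishes to its left and is negative to its right.
  set X := sInf A with hX
  have hXlow : t / 2 ≤ X := le_csInf hAne fun x hx => hlow x hx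
  have hXright : ∀ x, X < x → U x < 0 := by
    intro x hx
    obtain ⟨z, hz, hzx⟩ := exists_lt_of_csInf_lt hAne hx
    exact (hp.potential_antitone ht.le hzx.le).trans_lt hz
  have hXleft : ∀ x, x < X → U x = 0 := fun x hx => le_antisymm (hp.potential_nonpos ht.le x)
    (not_lt.1 fun h => not_lt.2 (csInf_le hAbdd h) hx)
  have hXlt : X < t + δ := by
    obtain ⟨x, hx, hxA⟩ := ((hUc.tendsto (t + δ)).eventually_lt_const hUδ).exists_lt
    exact (csInf_le hAbdd hxA).trans_lt hx
  set ψ := rightPart δ φ with hψ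
  have hψc : Continuous ψ := continuous_of_abs_sub_le hφ.rightPart_lipschitz
  have hRcont := continuous_rarefaction (c := c) hφ.rightPart_mem hφ.rightPart_mono
    hφ.rightPart_lipschitz
  have hRline : ∀ x, Continuous fun s => rarefaction c ψ s (x + t - s) := fun x =>
    hRcont.comp (continuous_id.prodMk (continuous_const.sub continuous_id))
  have hRnonpos : ∀ s x, rarefaction c ψ s x ≤ 0 := fun s x =>
    mul_nonpos_of_nonneg_of_nonpos (Real.exp_pos _).le (hφ.rightPart_mem _).2
  set P : ℝ → ℝ := fun x => ∫ s in (0)..t, wave c K φ s (x + t - s) with hP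
  set R : ℝ → ℝ := fun x => ∫ s in (t / 8)..t, rarefaction c ψ s (x + t - s) with hR
  have hearly : ∀ x, 0 ≤ x → ∀ s, 0 ≤ s → s ≤ t / 8 → wave c K φ s (x + t - s) = 0 :=
    fun x hx s hs0 hs => hp.wave_eq_zero_of_le hφ.right hs0 (by linarith)
  -- Going back along a transversal line the potential can only decrease, so it stays negative. The
  -- foot is then positive, hence in the right half of the well.
  have hPR : ∀ x, X < x → P x = R x := by
    intro x hx
    have e : ∀ s ∈ Ioc 0 t, wave c K φ s (x + t - s) =
        (Ioc (t / 8) t).indicator (fun s => rarefaction c ψ s (x + t - s)) s := by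
      intro s hs
      by_cases h8 : t / 8 < s
      · rw [indicator_of_mem (show s ∈ Ioc (t / 8) t from ⟨h8, hs.2⟩)]
        refine hφ.wave_eq_rarefaction hs.1.le ?_
        refine (hdich s h8.le hs.2 _).resolve_left (not_le.2 (hφ.foot_pos hs.1.le ?_))
        refine lt_of_le_of_lt (hp.potential_le_of_abs_le ht.le hs.1.le ?_) (hXright x hx)
        rw [abs_of_nonpos (by linarith [hs.2])]
        linarith
      · rw [indicator_of_notMem fun h => h8 h.1]
        exact hearly x (by linarith) s hs.1.le (not_lt.1 h8)
    simp only [hP, hR]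
    rw [intervalIntegral.integral_of_le ht.le, intervalIntegral.integral_of_le (by linarith),
      setIntegral_congr_fun measurableSet_Ioc e, setIntegral_indicator measurableSet_Ioc,
      inter_eq_right.2 (Ioc_subset_Ioc_left (by linarith))]
  have hPleft : ∀ h, 0 < h → h ≤ t / 2 →
      ∫ s in (t / 8)..(t - h / 2), rarefaction c ψ s (X - h + t - s) ≤ P (X - h) := by
    intro h hh hht
    have hle : t / 8 ≤ t - h / 2 := by linarith
    set J : Set ℝ := Ioc (t / 8) (t - h / 2) with hJ
    have e : ∀ s ∈ Ioc 0 t, J.indicator (fun s => rarefaction c ψ s (X - h + t - s)) s ≤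
        wave c K φ s (X - h + t - s) := by
      intro s hs
      by_cases h8 : t / 8 < s
      · by_cases h9 : s ≤ t - h / 2
        · rw [indicator_of_mem (show s ∈ J from ⟨h8, h9⟩)]
          rcases hdich s h8.le hs.2 (X - h + t - s) with hy | hy
          · rw [wave, hp.left _ hy, mul_zero]
            exact hRnonpos _ _
          · rw [hφ.wave_eq_rarefaction hs.1.le hy]
        · push Not at h9
          rw [indicator_of_notMem fun h => not_le.2 h9 h.2]
          refine (hp.wave_eq_zero_of_potential hs.1 ?_).ge
          -- For `s > t - h / 2` the point lies so far left that going on in the direction of speed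
          -- `1` it reaches time `t` to the left of `X`, where the potential is zero. The potential
          -- decreases along this direction, so it is already zero near the point.
          have hlt : X - h + t - s < X - (t - s) := by linarith
          filter_upwards [Iio_mem_nhds hlt] with z hz
          have hz : z < X - (t - s) := hz
          refine le_antisymm (hp.potential_nonpos hs.1.le z) ?_
          rw [← hXleft (z + (t - s)) (by linarith)]
          refine hp.potential_le_of_abs_le hs.1.le ht.le ?_
          rw [abs_of_nonneg (by linarith [hs.2])]
          linarith
      · rw [indicator_of_notMem fun h => h8 h.1]
        exact (hearly (X - h) (by linarith) s hs.1.le (not_lt.1 h8)).ge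
    have hint : Integrable (J.indicator fun s => rarefaction c ψ s (X - h + t - s))
        (volume.restrict (Ioc 0 t)) := by
      refine (((hRline (X - h)).integrableOn_Ioc).integrable_indicator measurableSet_Ioc).restrict
    have h1 := integral_mono_of_nonneg (μ := volume.restrict (Ioc 0 t))
      (f := fun s => -wave c K φ s (X - h + t - s))
      (g := fun s => -J.indicator (fun s => rarefaction c ψ s (X - h + t - s)) s)
      (Eventually.of_forall fun s => neg_nonneg.2 (hp.wave_nonpos _ _)) hint.neg
      ((ae_restrict_mem measurableSet_Ioc).mono fun s hs => neg_le_neg (e s hs))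
    rw [integral_neg, integral_neg, setIntegral_indicator measurableSet_Ioc,
      inter_eq_right.2 (Ioc_subset_Ioc (by linarith) (by linarith)), neg_le_neg_iff] at h1
    simp only [hP]
    rw [intervalIntegral.integral_of_le ht.le, intervalIntegral.integral_of_le hle]
    exact h1
  -- Since `X < t + δ`, some characteristic of the right half with nonzero amplitude passes to the
  -- right of `X` at time `t`. By monotonicity the rarefaction is uniformly negative to the left of
  -- it, also shortly before `t`.
  obtain ⟨J, hJ0, η, hη0, hJ⟩ : ∃ J > 0, ∃ η > 0, ∀ s, 0 ≤ s → s ≤ t → t - s < η → ∀ x ≤ X,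
      rarefaction c ψ s x ≤ -J := by
    have hEc : Continuous fun y => y + displacement c t (ψ y) :=
      continuous_iff_continuousAt.2 fun y => continuousAt_id.add
        ((differentiableAt_displacement ht.le (hφ.rightPart_mem y).2).continuousAt.comp
          hψc.continuousAt)
    have hEδ : X < δ + displacement c t (ψ δ) := by
      have : ψ δ = 0 := hφ.right _ (le_max_left _ _)
      rw [this, displacement_zero_right]
      linarith
    have hmem : ∀ᶠ y in 𝓝[<] δ, y ∈ Ioo (δ / 2) δ := Ioo_mem_nhdsLT (by linarith)
    obtain ⟨y, hyE, hy1, hy2⟩ := ((((hEc.tendsto δ).eventually_const_lt hEδ).filter_mono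
      nhdsWithin_le_nhds).and hmem).exists
    have hψy : ψ y < 0 := hφ.neg _ (lt_max_of_lt_right (by linarith)) (max_lt hy2 (by linarith))
    refine ⟨Real.exp (-(|c| * t)) * -ψ y, mul_pos (Real.exp_pos _) (by linarith),
      y + displacement c t (ψ y) - X, by linarith, fun s hs0 hst hsη x hx => ?_⟩
    have h1 := (abs_le.1 (displacement_time_lipschitz (c := c) (t := t) (t' := s) hψy.le)).2
    rw [abs_of_nonneg (by linarith)] at h1
    have h2 := rarefactionFoot_le (c := c) hφ.rightPart_mem hφ.rightPart_mono
      hφ.rightPart_lipschitz hs0 (x := x) (y := y) (by linarith)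
    have h3 := hφ.rightPart_mono h2
    have h4 := le_exp_mul (c := c) hs0 hst
    have h5 := Real.exp_pos (c * s)
    have h6 : Real.exp (-(|c| * t)) * -ψ y ≤ Real.exp (c * s) * -ψ y :=
      mul_le_mul_of_nonneg_right h4 (by linarith)
    have h7 := mul_le_mul_of_nonneg_left h3 h5.le
    unfold rarefaction
    linarith
  refine ⟨X, fun hdP => ?_⟩
  have hdR : DifferentiableAt ℝ R X := differentiableAt_integral_rarefaction hφ.rightPart_mem
    hφ.rightPart_mono hφ.rightPart_lipschitz hφ.differentiable_rightPart (t / 8) t X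
  have hdG := (hdP.sub hdR).hasDerivAt
  set G : ℝ → ℝ := P - R with hG
  have hG0 : G X = 0 := by
    have h1 : Tendsto G (𝓝[>] X) (𝓝 (G X)) := hdG.continuousAt.mono_left nhdsWithin_le_nhds
    refine tendsto_nhds_unique h1 (tendsto_const_nhds.congr' ?_)
    filter_upwards [self_mem_nhdsWithin] with x hx
    simp [hG, hPR x hx]
  have hslope := hasDerivAt_iff_tendsto_slope.1 hdG
  have hright : deriv G X = 0 := by
    refine tendsto_nhds_unique (hslope.mono_left
      (nhdsWithin_mono (s := Ioi X) _ fun a ha => ne_of_gt ha)) (tendsto_const_nhds.congr' ?_)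
    filter_upwards [self_mem_nhdsWithin] with x hx
    rw [slope_def_field, hG0]
    simp [hG, hPR x hx]
  -- At `X - h` the integral `P` lacks the contribution of the last `h / 2` units of time, which is
  -- at most `-J h / 2` in `R`. On the right `P = R`, so a derivative of `P - R` would have to
  -- vanish.
  have hleft : deriv G X ≤ -(J / 2) := by
    refine le_of_tendsto (hslope.mono_left
      (nhdsWithin_mono (s := Iio X) _ fun a ha => ne_of_lt ha)) ?_
    have hmem : Ioo (X - min (t / 2) η) X ∈ 𝓝[<] X :=
      Ioo_mem_nhdsLT (by have : 0 < min (t / 2) η := lt_min (by linarith) hη0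
                         linarith)
    filter_upwards [hmem] with x hx
    have hx0 : 0 < X - x := by linarith [hx.2]
    have hx1 : X - x ≤ t / 2 := by linarith [hx.1, min_le_left (t / 2) η]
    have hx2 : X - x ≤ η := by linarith [hx.1, min_le_right (t / 2) η]
    have h1 := hPleft (X - x) hx0 hx1
    rw [sub_sub_cancel] at h1
    have h2 : R x = (∫ s in (t / 8)..(t - (X - x) / 2), rarefaction c ψ s (x + t - s)) +
        ∫ s in (t - (X - x) / 2)..t, rarefaction c ψ s (x + t - s) :=
      (intervalIntegral.integral_add_adjacent_intervals
        ((hRline x).intervalIntegrable _ _) ((hRline x).intervalIntegrable _ _)).symm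
    have h3 : ∫ s in (t - (X - x) / 2)..t, rarefaction c ψ s (x + t - s) ≤ -J * ((X - x) / 2) := by
      have := intervalIntegral.integral_mono_on (μ := volume) (by linarith : t - (X - x) / 2 ≤ t)
        ((hRline x).intervalIntegrable _ _) (intervalIntegrable_const (c := -J)) fun s hs =>
          hJ s (by linarith [hs.1]) hs.2 (by linarith [hs.1]) (x + t - s) (by linarith [hs.1])
      refine this.trans (le_of_eq ?_)
      rw [intervalIntegral.integral_const, smul_eq_mul]
      ring
    have h4 : J * ((X - x) / 2) ≤ G x := by
      simp only [hG, Pi.sub_apply]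
      linarith
    rw [slope_def_field, hG0, sub_zero, div_le_iff_of_neg (by linarith)]
    linarith
  linarith

end IsWell


/-! ### The loss of regularity -/

/-- The height `3 / 2 / 2 ^ j` is the middle of the `j`-th strip, where the factor in `x₂` equals
`bump (1 / 2)`. -/
theorem slice_datum (j : ℕ) (y : ℝ) : slice datum (3 / 2 / 2 ^ j) y =
    -(ratio ^ j * bump (1 / 2)) * bump (2 ^ j * y) := by
  have hb : (2 : ℝ) ^ j * (3 / 2 / 2 ^ j) - 1 = 1 / 2 := by
    rw [mul_div_cancel₀ _ (by positivity)]; norm_num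
  have h := datum_eq (j := j) (x := !₂[y, 3 / 2 / 2 ^ j]) (by
    simp only [Matrix.cons_val_one, Matrix.cons_val_fin_one]
    rw [hb]
    exact (bump_pos (by norm_num) (by norm_num)).ne')
  rw [slice, h, bumpPiece]
  simp only [Matrix.cons_val_zero, Matrix.cons_val_one, Matrix.cons_val_fin_one]
  rw [hb]
  ring

theorem exists_isWell_slice (j : ℕ) :
    ∃ C, IsWell 2 C (1 / 2 ^ j) (slice datum (3 / 2 / 2 ^ j)) := by
  obtain ⟨C, hC⟩ := isDatum_datum.profile (3 / 2 / 2 ^ j)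
  have h2 : (0 : ℝ) < 2 ^ j := by positivity
  have hα : 0 < ratio ^ j * bump (1 / 2) :=
    mul_pos (pow_pos ratio_pos _) (bump_pos (by norm_num) (by norm_num))
  have hhalf : (2 : ℝ) ^ j * (1 / 2 ^ j / 2) = 1 / 2 := by field_simp
  have hdiff : Differentiable ℝ (slice datum (3 / 2 / 2 ^ j)) := by
    rw [funext (slice_datum j)]
    exact ((contDiff_bump.differentiable (by simp)).comp
      (differentiable_id.const_mul _)).const_mul _
  refine ⟨C, hC, by positivity, fun y hy y' hy' h => ?_, fun y hy y' hy' h => ?_, fun y hy => ?_,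
    fun y h0 h1 => ?_, hdiff, ?_⟩
  · rw [slice_datum, slice_datum]
    have := bump_mono (mul_le_mul_of_nonneg_left h h2.le)
      ((mul_le_mul_of_nonneg_left hy'.2 h2.le).trans hhalf.le)
    nlinarith
  · rw [slice_datum, slice_datum]
    have := bump_anti (mul_le_mul_of_nonneg_left h h2.le)
      (hhalf.ge.trans (mul_le_mul_of_nonneg_left (mem_Ici.1 hy) h2.le))
    nlinarith
  · rw [div_le_iff₀' h2] at hy
    rw [slice_datum, bump_eq_zero (y := 2 ^ j * y) (Or.inr hy), mul_zero]
  · rw [slice_datum]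
    have := bump_pos (mul_pos h2 h0) (by rwa [lt_div_iff₀' h2] at h1)
    nlinarith
  · refine IsLocalMin.deriv_eq_zero (Eventually.of_forall fun y => ?_)
    rw [slice_datum, slice_datum, hhalf]
    have : bump (2 ^ j * y) ≤ bump (1 / 2) := by
      rcases le_total (2 ^ j * y) (1 / 2) with h | h
      · exact bump_mono h le_rfl
      · exact bump_anti h le_rfl
    nlinarith

theorem mass_slice_datum (j : ℕ) :
    mass (slice datum (3 / 2 / 2 ^ j)) (1 / 2 ^ j / 2) - mass (slice datum (3 / 2 / 2 ^ j)) (1 / 2 ^ j)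
      = ratio ^ j * bump (1 / 2) * (1 / 2 ^ j) * ∫ y in (1 / 2 : ℝ)..1, bump y := by
  obtain ⟨C, hC⟩ := isDatum_datum.profile (3 / 2 / 2 ^ j)
  rw [hC.mass_sub, funext (slice_datum j), intervalIntegral.integral_const_mul,
    intervalIntegral.integral_comp_mul_left _ (by positivity),
    show (2 : ℝ) ^ j * (1 / 2 ^ j) = 1 by field_simp,
    show (2 : ℝ) ^ j * (1 / 2 ^ j / 2) = 1 / 2 by field_simp, intervalIntegral.integral_symm]
  simp only [smul_eq_mul]
  ring

theorem integral_bump_pos : 0 < ∫ y in (1 / 2 : ℝ)..1, bump y :=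
  intervalIntegral.intervalIntegral_pos_of_pos_on
    (contDiff_bump.continuous.intervalIntegrable _ _)
    (fun y hy => bump_pos (by linarith [hy.1]) hy.2) (by norm_num)

/-- At any positive time some slice of the solution has a corner. -/
theorem exists_slice_not_differentiableAt (c : ℝ) {t : ℝ} (ht : 0 < t) :
    ∃ b X, ¬ DifferentiableAt ℝ
      (fun x => ∫ s in (0)..t, wave c 2 (slice datum b) s (x + t - s)) X := by
  set M := Real.exp (|c| * t) with hM
  have hM0 : 0 < M := Real.exp_pos _
  set κ := convexityModulus c t 2 with hκ
  have hκ0 : 0 < κ := convexityModulus_pos (by norm_num)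
  have hb : 0 < bump (1 / 2) := bump_pos (by norm_num) (by norm_num)
  have hI := integral_bump_pos
  set I := ∫ y in (1 / 2 : ℝ)..1, bump y with hIdef
  have l1 : Tendsto (fun j : ℕ => (1 / 2 : ℝ) ^ j) atTop (𝓝 0) :=
    tendsto_pow_atTop_nhds_zero_of_lt_one (by norm_num) (by norm_num)
  have l2 : Tendsto (fun j : ℕ => 2 * M * (ratio ^ j * bump (1 / 2))) atTop (𝓝 0) := by
    simpa using ((tendsto_pow_atTop_nhds_zero_of_lt_one ratio_pos.le ratio_lt_one).mul_const
      (bump (1 / 2))).const_mul (2 * M)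
  -- The quotient is `2^{-1/8}`: the time needed to absorb the left half of the `j`-th well is of
  -- order width over amplitude and tends to zero.
  have hq : 1 / 2 / ratio < 1 := by
    rw [div_lt_one ratio_pos, ratio, show (1 / 2 : ℝ) = 2 ^ (-1 : ℝ) by
      rw [Real.rpow_neg_one]; norm_num]
    exact Real.rpow_lt_rpow_of_exponent_lt (by norm_num) (by norm_num)
  have l3 : Tendsto (fun j : ℕ => (2 * M / κ + 1) ^ 2 * (1 / 2 / ratio) ^ j) atTop (𝓝 0) := by
    simpa using (tendsto_pow_atTop_nhds_zero_of_lt_one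
      (div_nonneg (by norm_num) ratio_pos.le) hq).const_mul ((2 * M / κ + 1) ^ 2)
  obtain ⟨j, h1, h2, h3⟩ := ((l1.eventually_le_const (by linarith : 0 < t / 4)).and
    ((l2.eventually_le_const (by norm_num : (0 : ℝ) < 1 / 2)).and
      (l3.eventually_lt_const (by positivity : 0 < 4 * (κ * (t / 8)) * bump (1 / 2) * I)))).exists
  obtain ⟨C, hC⟩ := exists_isWell_slice j
  rw [one_div_pow] at h1
  have hr := pow_pos ratio_pos j
  refine ⟨3 / 2 / 2 ^ j, hC.exists_not_differentiableAt (c := c) ht h1 (fun y => ?_) ?_⟩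
  · rw [slice_datum, ← hM, neg_mul, neg_neg]
    have := mul_le_of_le_one_right
      (by positivity : 0 ≤ 2 * M * (ratio ^ j * bump (1 / 2))) (bump_le_one (2 ^ j * y))
    linarith
  · rw [mass_slice_datum, ← hM, ← hκ, ← hIdef]
    rw [div_pow, one_div_pow, mul_div_assoc', div_lt_iff₀ hr] at h3
    set d : ℝ := 1 / 2 ^ j with hd
    have hd0 : 0 < d := by positivity
    calc ((2 * M / κ + 1) * d) ^ 2 = ((2 * M / κ + 1) ^ 2 * d) * d := by ring
      _ < (4 * (κ * (t / 8)) * bump (1 / 2) * I * ratio ^ j) * d := by gcongr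
      _ = _ := by ring

/-- Both `travel` and the differentiable representative are continuous, so they agree everywhere and
not only almost everywhere. The corner of a single slice, a null set, is then a contradiction. -/
theorem not_memLogSobolev_of_ae_eq_travel {β c t : ℝ} (hβ : 0 < β) (ht : 0 < t) {f : Plane → ℝ}
    (h : f =ᵐ[volume] travel c 2 datum t) : ¬ MemLogSobolev (11 / 4) β f := by
  intro hf
  obtain ⟨g, hg, hfg⟩ := hf.exists_differentiable hβ
  have hc : Continuous (travel c 2 datum t) := isDatum_datum.continuous_travel ht.le
  have heq : travel c 2 datum t = g :=
    Measure.eq_of_ae_eq (h.symm.trans hfg) hc hg.continuous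
  obtain ⟨b, X, hX⟩ := exists_slice_not_differentiableAt c ht
  refine hX ?_
  have hline : ∀ x : ℝ, ∫ s in (0)..t, wave c 2 (slice datum b) s (x + t - s) =
      -g (x • e1 + EuclideanSpace.single 1 b) := by
    intro x
    rw [← heq, travel, neg_neg]
    refine intervalIntegral.integral_congr fun s _ => ?_
    simp [planeWave, e1, add_sub_assoc]
  rw [funext hline]
  exact (hg.comp ((differentiable_id.smul_const e1).add_const _)).neg X

theorem memLogSobolev_of_ae_eq_zero {s β : ℝ} {f : Plane → ℝ} (hf : f =ᵐ[volume] 0) :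
    MemLogSobolev s β f := by
  have h0 : (fun x => (f x : ℂ)) =ᵐ[volume] (0 : Plane → ℂ) := by
    filter_upwards [hf] with x hx
    simp [hx]
  have hL : MemLp (fun x => (f x : ℂ)) 2 (volume : Measure Plane) := (memLp_congr_ae h0).2 MemLp.zero
  refine ⟨hL, (memLp_congr_ae ?_).2 (MemLp.zero : MemLp (0 : Plane → ℂ) 2 volume)⟩
  have e : hL.toLp = 0 := (Lp.eq_zero_iff_ae_eq_zero).2 (hL.coeFn_toLp.trans h0)
  have e' : (𝓕 hL.toLp : Lp ℂ 2 (volume : Measure Plane)) = 0 := by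
    rw [e]; exact (FourierTransform.fourierCLM ℂ (Lp ℂ 2 (volume : Measure Plane))).map_zero
  rw [e']
  filter_upwards [Lp.coeFn_zero ℂ 2 (volume : Measure Plane)] with ξ hξ
  rw [hξ]
  simp

/-- One datum serves all `β` and `c`. The index `j` of the slice that carries the corner depends on
`t` and `c`. -/
theorem theorem3p1 (β : ℝ) (hβ : 1 / 2 < β) (c : ℝ) :
    ∃ χ : Plane → ℝ, HasCompactSupport χ ∧ MemLogSobolev (7 / 4) β χ ∧
      (∃ u : ℝ → Plane → ℝ, ∀ T : ℝ, 0 < T → IsSolution c T χ u) ∧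
      ∀ T : ℝ, 0 < T → ∀ u : ℝ → Plane → ℝ, IsSolution c T χ u →
        MemLogSobolev (11 / 4) β (u 0) ∧
        ∀ t : ℝ, 0 < t → t < T → ¬ MemLogSobolev (11 / 4) β (u t) := by
  have hχ : ∀ y b : ℝ, (2 : ℝ) ≤ |y| ∨ 2 ≤ |b| → datum !₂[y, b] = 0 := fun y b h =>
    datum_eq_zero_of_le (by simpa using h)
  exact ⟨datum, hasCompactSupport_datum, memLogSobolev_datum (by linarith),
    ⟨travel c 2 datum, fun T hT => isDatum_datum.isSolution_travel hχ hT⟩,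
    fun T _ u hu => ⟨memLogSobolev_of_ae_eq_zero hu.init, fun t ht htT =>
      not_memLogSobolev_of_ae_eq_travel (by linarith) ht
        (isDatum_datum.ae_eq_travel hχ hu ⟨ht, htT⟩)⟩⟩
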